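/- Let $V=\mathbb C^7$ with the symmetric bilinear form $b(v,w)=\sum_{j=1}^7 v_jw_{8-j}$ and the Hermitian form $h(v,w)=b(v,\overline w)$. Let $L=\mathrm{SO}(7,\mathbb C)$ be the group of isometries of $b$ of determinant $1$, $\mathrm{SO}(3,4)=L\cap\mathbb R^{7\times7}$ its group of real points, and $G=\mathrm{SO}(3,4)^\circ$ the identity component of the latter. Let $\mathfrak l=\mathfrak{so}(7,\mathbb C)$ be the Lie algebra of $L$, with conjugation $\sigma(X)=\overline X$. Let $Z$ be the set of all $b$-isotropic $2$-planes in $V$, and let $\mathcal H\subset Z$ be the set of planes $E$ such that $h|_E$ is degenerate. The smooth part of $\mathcal H$ is the set of points near which $\mathcal H$ is a (smooth, real-analytic) real hypersurface of $Z$. For a real hypersurface $M$ of a complex manifold put $F_{(0)}=H^{0,1}M$, and let $F_{(k+1)}\subset F_{(k)}$ be the left kernel of the tensor induced by the Lie bracket of sections of $F_{(k)}$ with sections of $H^{1,0}M$, taken modulo $F_{(k)}\oplus H^{1,0}M$; thus $F_{(1)}$ is the Levi kernel and $F_{(2)}$ the second order kernel. $M$ is $k$-nondegenerate at $p$ if,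 for a local defining function $\rho$, $k$ is the least integer such that the vectors $L_1\cdots L_j(\partial\rho/\partial z)(p)$, $0\le j\le k$, $L_i$ local sections of $H^{0,1}M$, span the whole space. For $z\in Z$ let $\mathfrak q=\mathfrak q_z\subset\mathfrak l$ be the isotropy algebra of $z$ and put $\mathfrak q^{(0)}=\mathfrak q$, $\mathfrak q^{(k+1)}=\{w\in\mathfrak q^{(k)}:[w,\sigma\mathfrak q]\subset\mathfrak q^{(k)}+\sigma\mathfrak q\}$, $\mathfrak q^{(\infty)}=\mathfrak q\cap\sigma\mathfrak q$. Then: 1. $Z$ is a $7$-dimensional complex manifold on which $L$ acts holomorphically and transitively. 2. The smooth part of $\mathcal H$ is non-empty and is a single orbit of $\mathrm{SO}(3,4)$. 3. Let $z$ be a point of the smooth part of $\mathcal H$ and $M=G\cdot z$. Then $M$ is contained in the smooth part of $\mathcal H$, is open in $\mathcal H$, and is a real-analytic real hypersurface of $Z$. $M$ is $3$-nondegenerate at each of its points, and $F_{(0)},F_{(1)},F_{(2)}$ are real-analytic subbundles of rank $6,3,1$, while $F_{(k)}=0$ for $k\ge3$. 4. For every such $z$ there are a $\sigma$-stable Cartan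 subalgebra $\mathfrak t$ of $\mathfrak l$ and simple roots $\alpha_1,\alpha_2,\alpha_3$ of $\Phi(\mathfrak l,\mathfrak t)$ (of type $B_3$, numbered along the Dynkin diagram, $\alpha_3$ short) such that $\mathfrak q$ contains $\mathfrak t$ and all root spaces of negative roots, $\alpha_1$ and $\alpha_3$, but not $\alpha_2$, are roots of $\mathfrak q$ (so $Z=\mathrm{SO}(7,\mathbb C)/Q_{\alpha_1,\alpha_3}$), and $\sigma$ acts on the roots by $\alpha_1\mapsto-\alpha_1-\alpha_2-2\alpha_3$, $\alpha_2\mapsto-\alpha_2$, $\alpha_3\mapsto\alpha_2+\alpha_3$. Writing $\mathfrak l^{\pm abc}$ for the root space of $\pm(a\alpha_1+b\alpha_2+c\alpha_3)$, one has $\mathfrak q=\mathfrak q^{(0)}\supsetneq\mathfrak q^{(1)}\supsetneq\mathfrak q^{(2)}\supsetneq\mathfrak q^{(3)}=\mathfrak q^{(\infty)}$ and $$\begin{aligned} \mathfrak q^{(3)}&=\mathfrak t\oplus\mathfrak l^{100}\oplus\mathfrak l^{-112}\oplus\mathfrak l^{-001}\oplus\mathfrak l^{-011}\oplus\mathfrak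 l^{-012},\\ \mathfrak q^{(2)}&=\mathfrak q^{(3)}\oplus\mathfrak l^{-122},\\ \mathfrak q^{(1)}&=\mathfrak q^{(2)}\oplus\mathfrak l^{-010}\oplus\mathfrak l^{-111},\\ \mathfrak q^{(0)}&=\mathfrak q^{(1)}\oplus\mathfrak l^{-100}\oplus\mathfrak l^{-110}\oplus\mathfrak l^{001}. \end{aligned}$$ -/

import Mathlib

open Set Filter Topology
open scoped Manifold ContDiff

noncomputable section

/-! ## Real hypersurfaces in complex manifolds, Levi kernels and finite nondegeneracy -/

namespace CR

/-- The coordinate space `ℂⁿ`. -/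
abbrev Cn (n : ℕ) : Type := Fin n → ℂ

/-- The complexified tangent space `ℂ ⊗ T_x ℂⁿ`: the pair `(a, b)` stands for the complex tangent
vector `∑ aⱼ ∂/∂zⱼ + ∑ bⱼ ∂/∂z̄ⱼ`. The real tangent vector `v ∈ ℂⁿ` is the pair `(v, v̄)`. -/
abbrev CT (n : ℕ) : Type := Cn n × Cn n

variable {n : ℕ} {F : Type*} [NormedAddCommGroup F] [NormedSpace ℂ F]

/-- The derivative `∑ aⱼ ∂f/∂zⱼ + ∑ bⱼ ∂f/∂z̄ⱼ` of a (real-differentiable) function `f` at `x` in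
the direction of the complex tangent vector `ξ = (a, b)`. -/
def cderiv (f : Cn n → F) (x : Cn n) (ξ : CT n) : F :=
  (1 / 2 : ℂ) • ((fderiv ℝ f x ξ.1 - Complex.I • fderiv ℝ f x (Complex.I • ξ.1)) +
    (fderiv ℝ f x (star ξ.2) + Complex.I • fderiv ℝ f x (Complex.I • star ξ.2)))

/-- The Lie bracket of two complex vector fields on (an open subset of) `ℂⁿ`. -/
def cbracket (ξ η : Cn n → CT n) (x : Cn n) : CT n :=
  cderiv η x (ξ x) - cderiv ξ x (η x)

/-- The (real) tangent space of `S ⊆ ℂⁿ` at `p`: the vectors annihilated by the differentials of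
all smooth real functions near `p` that vanish on `S`. -/
def tangent (S : Set (Cn n)) (p : Cn n) : Set (Cn n) :=
  {v | ∀ f : Cn n → ℝ, (∀ᶠ x in 𝓝 p, ContDiffAt ℝ ∞ f x) → (∀ᶠ x in 𝓝[S] p, f x = 0) →
    fderiv ℝ f p v = 0}

/-- The complexified tangent space of `S` at `p`. -/
def ctangent (S : Set (Cn n)) (p : Cn n) : Submodule ℂ (CT n) :=
  Submodule.span ℂ ((fun v : Cn n => (v, star v)) '' tangent S p)

/-- The fibre at `p` of the bundle `H^{1,0}` of `S`. -/
def H10 (S : Set (Cn n)) (p : Cn n) : Submodule ℂ (CT n) :=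
  ctangent S p ⊓ LinearMap.ker (LinearMap.snd ℂ (Cn n) (Cn n))

/-- The fibre at `p` of the bundle `H^{0,1}` of `S`. -/
def H01 (S : Set (Cn n)) (p : Cn n) : Submodule ℂ (CT n) :=
  ctangent S p ⊓ LinearMap.ker (LinearMap.fst ℂ (Cn n) (Cn n))

/-- `ξ` is (a smooth extension to a neighbourhood of `p` in `ℂⁿ` of) a smooth section near `p` of
the family `B` of subspaces of the complexified tangent spaces at the points of `S`. -/
def IsLocalSection (S : Set (Cn n)) (B : Cn n → Submodule ℂ (CT n)) (p : Cn n)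
    (ξ : Cn n → CT n) : Prop :=
  (∀ᶠ x in 𝓝 p, ContDiffAt ℝ ∞ ξ x) ∧ ∀ᶠ x in 𝓝[S] p, ξ x ∈ B x

theorem IsLocalSection.differentiableAt {S : Set (Cn n)} {B : Cn n → Submodule ℂ (CT n)}
    {p : Cn n} {ξ : Cn n → CT n} (h : IsLocalSection S B p ξ) : DifferentiableAt ℝ ξ p :=
  h.1.self_of_nhds.differentiableAt (by simp)

theorem IsLocalSection.add {S : Set (Cn n)} {B : Cn n → Submodule ℂ (CT n)} {p : Cn n}
    {ξ η : Cn n → CT n} (h : IsLocalSection S B p ξ) (k : IsLocalSection S B p η) :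
    IsLocalSection S B p (fun x => ξ x + η x) := by
  refine ⟨?_, ?_⟩
  · filter_upwards [h.1, k.1] with x hx kx using hx.add kx
  · filter_upwards [h.2, k.2] with x hx kx using (B x).add_mem hx kx

theorem IsLocalSection.smul {S : Set (Cn n)} {B : Cn n → Submodule ℂ (CT n)} {p : Cn n}
    {ξ : Cn n → CT n} (c : ℂ) (h : IsLocalSection S B p ξ) :
    IsLocalSection S B p (fun x => c • ξ x) := by
  refine ⟨?_, ?_⟩
  · filter_upwards [h.1] with x hx using hx.const_smul c
  · filter_upwards [h.2] with x hx using (B x).smul_mem c hx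

theorem IsLocalSection.zero (S : Set (Cn n)) (B : Cn n → Submodule ℂ (CT n)) (p : Cn n) :
    IsLocalSection S B p (fun _ => 0) :=
  ⟨Eventually.of_forall fun _ => contDiffAt_const, Eventually.of_forall fun x => (B x).zero_mem⟩

theorem cderiv_add_right (f : Cn n → F) (x : Cn n) (ξ η : CT n) :
    cderiv f x (ξ + η) = cderiv f x ξ + cderiv f x η := by
  simp only [cderiv, Prod.fst_add, Prod.snd_add, star_add, smul_add, map_add, smul_sub]
  abel

theorem cderiv_smul_right (f : Cn n → F) (x : Cn n) (c : ℂ) (ξ : CT n) :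
    cderiv f x (c • ξ) = c • cderiv f x ξ := by
  have key : ∀ v : Cn n, fderiv ℝ f x (c • v) =
      (c.re : ℂ) • fderiv ℝ f x v + (c.im : ℂ) • fderiv ℝ f x (Complex.I • v) := by
    intro v
    have : c • v = c.re • v + c.im • (Complex.I • v) := by
      ext i
      simp only [Pi.smul_apply, Pi.add_apply, smul_eq_mul, Complex.real_smul]
      linear_combination (v i) * (-(Complex.re_add_im c))
    rw [this, map_add, map_smul, map_smul]
    simp
  have key' : ∀ v : Cn n, fderiv ℝ f x (star c • v) =
      (c.re : ℂ) • fderiv ℝ f x v - (c.im : ℂ) • fderiv ℝ f x (Complex.I • v) := by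
    intro v
    have : star c • v = c.re • v - c.im • (Complex.I • v) := by
      ext i
      simp only [Pi.smul_apply, Pi.sub_apply, smul_eq_mul, Complex.real_smul]
      have h : star c = c.re - c.im * Complex.I := by
        apply Complex.ext <;> simp
      rw [h]; ring
    rw [this, map_sub, map_smul, map_smul]
    simp
  have hI : ∀ v : Cn n, fderiv ℝ f x (Complex.I • Complex.I • v) = -fderiv ℝ f x v := by
    intro v
    rw [smul_smul, Complex.I_mul_I, neg_one_smul, map_neg]
  simp only [cderiv, Prod.smul_fst, Prod.smul_snd, star_smul, smul_comm Complex.I c,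
    smul_comm Complex.I (star c), key, key', hI]
  conv_rhs => rw [← Complex.re_add_im c]
  have hII := Complex.I_mul_I
  match_scalars
  · ring
  · linear_combination ((c.im : ℂ) / 2) * hII
  · ring
  · linear_combination (-(c.im : ℂ) / 2) * hII

theorem cderiv_add_left {f g : Cn n → F} {x : Cn n} (hf : DifferentiableAt ℝ f x)
    (hg : DifferentiableAt ℝ g x) (ξ : CT n) :
    cderiv (fun y => f y + g y) x ξ = cderiv f x ξ + cderiv g x ξ := by
  simp only [cderiv, fderiv_fun_add hf hg, add_apply, smul_add, smul_sub]
  abel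

theorem cderiv_smul_left {f : Cn n → F} {x : Cn n} (c : ℂ) (hf : DifferentiableAt ℝ f x)
    (ξ : CT n) : cderiv (fun y => c • f y) x ξ = c • cderiv f x ξ := by
  simp only [cderiv, fderiv_fun_const_smul hf c, smul_apply]
  module

theorem cbracket_add_left {ξ ξ' η : Cn n → CT n} {x : Cn n} (h : DifferentiableAt ℝ ξ x)
    (h' : DifferentiableAt ℝ ξ' x) :
    cbracket (fun y => ξ y + ξ' y) η x = cbracket ξ η x + cbracket ξ' η x := by
  simp only [cbracket, cderiv_add_right, cderiv_add_left h h']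
  abel

theorem cbracket_smul_left {ξ η : Cn n → CT n} {x : Cn n} (c : ℂ) (h : DifferentiableAt ℝ ξ x) :
    cbracket (fun y => c • ξ y) η x = c • cbracket ξ η x := by
  simp only [cbracket, cderiv_smul_right, cderiv_smul_left c h, smul_sub]

theorem cbracket_zero_left (η : Cn n → CT n) (x : Cn n) : cbracket (fun _ => 0) η x = 0 := by
  simp [cbracket, cderiv]

/-- One step of the recursion for the Levi kernels: the fibre at `p` of the left kernel of the
tensor induced by the Lie bracket of sections of `B` with sections of `H^{1,0}`, modulo
`B ⊕ H^{1,0}`. (If `B` is a subbundle of `H^{0,1}`, the class of the bracket at `p` does not depend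
on the chosen section `Ξ` through `ξ`.) -/
def leviStep (S : Set (Cn n)) (B : Cn n → Submodule ℂ (CT n)) (p : Cn n) :
    Submodule ℂ (CT n) where
  carrier := {ξ | ξ ∈ B p ∧ ∃ Ξ : Cn n → CT n, IsLocalSection S B p Ξ ∧ Ξ p = ξ ∧
    ∀ Y : Cn n → CT n, IsLocalSection S (H10 S) p Y → cbracket Ξ Y p ∈ B p ⊔ H10 S p}
  zero_mem' := ⟨Submodule.zero_mem _, fun _ => 0, IsLocalSection.zero _ _ _, rfl, fun Y _ => by
    rw [cbracket_zero_left]; exact Submodule.zero_mem _⟩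
  add_mem' := by
    rintro ξ η ⟨hξ, Ξ, h1, rfl, h2⟩ ⟨hη, Θ, k1, rfl, k2⟩
    refine ⟨Submodule.add_mem _ hξ hη, _, h1.add k1, rfl, fun Y hY => ?_⟩
    rw [cbracket_add_left h1.differentiableAt k1.differentiableAt]
    exact Submodule.add_mem _ (h2 Y hY) (k2 Y hY)
  smul_mem' := by
    rintro c ξ ⟨hξ, Ξ, h1, rfl, h2⟩
    refine ⟨Submodule.smul_mem _ c hξ, _, h1.smul c, rfl, fun Y hY => ?_⟩
    rw [cbracket_smul_left c h1.differentiableAt]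
    exact Submodule.smul_mem _ c (h2 Y hY)

/-- The fibre at `p` of the Levi kernel of order `k` of `S`: order `0` is `H^{0,1}`, order `1` is
the kernel of the Levi form, and so on. -/
def leviKernel (S : Set (Cn n)) : ℕ → Cn n → Submodule ℂ (CT n)
  | 0 => H01 S
  | k + 1 => leviStep S (leviKernel S k)

/-- The family `B` is a real-analytic complex vector subbundle of rank `r` of the complexified
tangent bundle along `S`: near every point of `S` it has a real-analytic frame. -/
def IsSubbundle (S : Set (Cn n)) (B : Cn n → Submodule ℂ (CT n)) (r : ℕ) : Prop :=
  ∀ p ∈ S, ∃ e : Fin r → Cn n → CT n, (∀ i, AnalyticAt ℝ (e i) p) ∧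
    ∀ᶠ x in 𝓝[S] p, LinearIndependent ℂ (fun i => e i x) ∧
      Submodule.span ℂ (Set.range fun i => e i x) = B x

/-- `ρ` is a real-analytic local defining function of the real hypersurface `S` near `p ∈ S`. -/
structure IsDefiningFunction (S : Set (Cn n)) (p : Cn n) (ρ : Cn n → ℝ) : Prop where
  mem : p ∈ S
  analyticAt : AnalyticAt ℝ ρ p
  fderiv_ne_zero : fderiv ℝ ρ p ≠ 0
  mem_iff : ∀ᶠ x in 𝓝 p, x ∈ S ↔ ρ x = 0

/-- The complex gradient `(∂ρ/∂z₁, …, ∂ρ/∂zₙ)`. -/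
def cgrad (ρ : Cn n → ℝ) (x : Cn n) : Cn n :=
  fun j => cderiv (fun y => (ρ y : ℂ)) x (Pi.single j 1, 0)

/-- `IteratedCR S p ρ k f` says that `f = L₁ ⋯ Lₖ (∂ρ/∂z)` for smooth local sections
`L₁, …, Lₖ` of `H^{0,1}` near `p`. -/
inductive IteratedCR (S : Set (Cn n)) (p : Cn n) (ρ : Cn n → ℝ) : ℕ → (Cn n → Cn n) → Prop
  | zero : IteratedCR S p ρ 0 (cgrad ρ)
  | step {k : ℕ} {f : Cn n → Cn n} {L : Cn n → CT n} (hf : IteratedCR S p ρ k f)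
      (hL : IsLocalSection S (H01 S) p L) : IteratedCR S p ρ (k + 1) (fun x => cderiv f x (L x))

/-- The span at `p` of all `L₁ ⋯ Lⱼ (∂ρ/∂z)` with `j ≤ k`. -/
def nondegSpan (S : Set (Cn n)) (p : Cn n) (ρ : Cn n → ℝ) (k : ℕ) : Submodule ℂ (Cn n) :=
  Submodule.span ℂ {v | ∃ j ≤ k, ∃ f, IteratedCR S p ρ j f ∧ f p = v}

/-- The real hypersurface `S` is `k`-nondegenerate at `p` (in the sense of Baouendi, Huang and
Rothschild): `k` is the least order for which the vectors `L₁ ⋯ Lⱼ (∂ρ/∂z)(p)`, `j ≤ k`, span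
`ℂⁿ`. -/
def IsNondegenerateAt (S : Set (Cn n)) (k : ℕ) (p : Cn n) : Prop :=
  (∃ ρ, IsDefiningFunction S p ρ) ∧ ∀ ρ, IsDefiningFunction S p ρ →
    nondegSpan S p ρ k = ⊤ ∧ ∀ j < k, nondegSpan S p ρ j ≠ ⊤

/-! The same notions for subsets of a complex manifold `Z`, read in all charts of its atlas. -/

variable {Z : Type*} [TopologicalSpace Z]

/-- The image of `S ⊆ Z` in the coordinates given by a chart. -/
def coordImage (e : OpenPartialHomeomorph Z (Cn n)) (S : Set Z) : Set (Cn n) :=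
  e.target ∩ e.symm ⁻¹' S

variable [ChartedSpace (Cn n) Z]

variable (n) in
/-- The points of `S` near which `S` is a (smooth, real-analytic) real hypersurface of `Z`. -/
def smoothPart (S : Set Z) : Set Z :=
  {z | z ∈ S ∧ ∀ e ∈ atlas (Cn n) Z, z ∈ e.source → ∃ ρ, IsDefiningFunction (coordImage e S) (e z) ρ}

variable (n) in
/-- `S` is a (locally closed) real-analytic real hypersurface of `Z`. -/
def IsRealHypersurface (S : Set Z) : Prop :=
  ∀ e ∈ atlas (Cn n) Z, ∀ p ∈ coordImage e S, ∃ ρ, IsDefiningFunction (coordImage e S) p ρ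

variable (n) in
/-- The real hypersurface `S` of `Z` is `k`-nondegenerate at each of its points. -/
def IsUniformlyNondegenerate (S : Set Z) (k : ℕ) : Prop :=
  ∀ e ∈ atlas (Cn n) Z, ∀ p ∈ coordImage e S, IsNondegenerateAt (coordImage e S) k p

variable (n) in
/-- The Levi kernel of order `k` of `S` is a subbundle of rank `r`. -/
def LeviKernelHasRank (S : Set Z) (k r : ℕ) : Prop :=
  ∀ e ∈ atlas (Cn n) Z, IsSubbundle (coordImage e S) (leviKernel (coordImage e S) k) r

end CR

/-! ## The Grassmannian of isotropic planes in `ℂ⁷` -/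

namespace SevenDim

open CR

/-- The symmetric bilinear form `b(v, w) = ∑ vⱼ w₈₋ⱼ` on `ℂ⁷`. -/
def bform (v w : Cn 7) : ℂ := ∑ i, v i * w (Fin.rev i)

/-- The Hermitian form `h(v, w) = b(v, w̄)`. -/
def hform (v w : Cn 7) : ℂ := bform v (star w)

theorem bform_add_left (u v w : Cn 7) : bform (u + v) w = bform u w + bform v w := by
  simp [bform, add_mul, Finset.sum_add_distrib]

theorem bform_add_right (u v w : Cn 7) : bform u (v + w) = bform u v + bform u w := by
  simp [bform, mul_add, Finset.sum_add_distrib]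

theorem bform_smul_left (c : ℂ) (v w : Cn 7) : bform (c • v) w = c * bform v w := by
  simp [bform, Finset.mul_sum, mul_assoc]

theorem bform_smul_right (c : ℂ) (v w : Cn 7) : bform v (c • w) = c * bform v w := by
  simp [bform, Finset.mul_sum, mul_left_comm]

/-- The group `L = SO(7, ℂ)` of isometries of `b` with determinant `1`. -/
def SO7C : Subgroup (GL (Fin 7) ℂ) where
  carrier := {g | (∀ v w, bform (g.val.mulVec v) (g.val.mulVec w) = bform v w) ∧ g.val.det = 1}
  one_mem' := by simp
  mul_mem' := by
    rintro g k ⟨hg, dg⟩ ⟨hk, dk⟩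
    refine ⟨fun v w => ?_, ?_⟩
    · rw [Units.val_mul, ← Matrix.mulVec_mulVec, ← Matrix.mulVec_mulVec, hg, hk]
    · rw [Units.val_mul, Matrix.det_mul, dg, dk, one_mul]
  inv_mem' := by
    rintro g ⟨hg, dg⟩
    have hgi : ∀ v, g.val.mulVec ((g⁻¹).val.mulVec v) = v := fun v => by
      rw [Matrix.mulVec_mulVec, ← Units.val_mul, mul_inv_cancel, Units.val_one, Matrix.one_mulVec]
    refine ⟨fun v w => ?_, ?_⟩
    · rw [← hg, hgi, hgi]
    · have : (g.val * (g⁻¹).val).det = 1 := by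
        rw [← Units.val_mul, mul_inv_cancel, Units.val_one, Matrix.det_one]
      rwa [Matrix.det_mul, dg, one_mul] at this

/-- The group of real points of `SO(7, ℂ)`; as `b` has signature `(4, 3)` on `ℝ⁷`, this is the
(non-connected) group `SO(3, 4)`. -/
def SO34 : Subgroup SO7C where
  carrier := {g | g.val.val.map (starRingEnd ℂ) = g.val.val}
  one_mem' := by
    simp [Matrix.map_one]
  mul_mem' := by
    intro g k hg hk
    simp only [mem_ofPred_eq, Subgroup.coe_mul, Units.val_mul, Matrix.map_mul] at *
    rw [hg, hk]
  inv_mem' := by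
    intro g hg
    simp only [mem_ofPred_eq, Subgroup.coe_inv] at *
    have h1 : ((g.val⁻¹).val.map (starRingEnd ℂ)) * g.val.val = 1 := by
      have h2 : ((g.val⁻¹).val * g.val.val).map (starRingEnd ℂ) = 1 := by
        rw [← Units.val_mul, inv_mul_cancel, Units.val_one]
        simp
      rwa [Matrix.map_mul, hg] at h2
    calc _ = ((g.val⁻¹).val.map (starRingEnd ℂ)) * (g.val.val * (g.val⁻¹).val) := by
            rw [← Units.val_mul, mul_inv_cancel, Units.val_one, mul_one]
      _ = _ := by rw [← mul_assoc, h1, one_mul]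

/-- The group `G = SO(3, 4)°`, the connected component of the identity of `SO(3, 4)`. -/
def SO34o : Subgroup SO7C :=
  (Subgroup.connectedComponentOfOne SO34).map SO34.subtype

/-- The set `Z` of `b`-isotropic planes in `ℂ⁷`. -/
@[ext]
structure IsoGrass where
  plane : Submodule ℂ (Cn 7)
  finrank_eq : Module.finrank ℂ plane = 2
  isotropic : ∀ v ∈ plane, ∀ w ∈ plane, bform v w = 0

theorem mulVec_mem_map {g : SO7C} {E : Submodule ℂ (Cn 7)} {v : Cn 7} :
    v ∈ E.map (Matrix.mulVecLin g.val.val) ↔ ∃ w ∈ E, g.val.val.mulVec w = v := Iff.rfl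

theorem mulVecLin_injective (g : SO7C) : Function.Injective (Matrix.mulVecLin g.val.val) := by
  intro v w h
  have h' : (g.val⁻¹).val.mulVec (g.val.val.mulVec v) =
      (g.val⁻¹).val.mulVec (g.val.val.mulVec w) := congrArg _ h
  simpa only [Matrix.mulVec_mulVec, ← Units.val_mul, inv_mul_cancel, Units.val_one,
    Matrix.one_mulVec] using h'

/-- `SO(7, ℂ)` acts on the isotropic planes by `E ↦ g E`. -/
instance : MulAction SO7C IsoGrass where
  smul g E :=
    { plane := E.plane.map (Matrix.mulVecLin g.val.val)
      finrank_eq := by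
        rw [← E.finrank_eq]
        exact (Submodule.equivMapOfInjective _ (mulVecLin_injective g) E.plane).finrank_eq.symm
      isotropic := by
        rintro _ ⟨v, hv, rfl⟩ _ ⟨w, hw, rfl⟩
        exact (g.2.1 v w).trans (E.isotropic v hv w hw) }
  one_smul E := by
    ext1
    change E.plane.map (Matrix.mulVecLin (1 : Matrix (Fin 7) (Fin 7) ℂ)) = E.plane
    rw [Matrix.mulVecLin_one, Submodule.map_id]
  mul_smul g k E := by
    ext1
    change E.plane.map (Matrix.mulVecLin (g.val.val * k.val.val)) =
      (E.plane.map (Matrix.mulVecLin k.val.val)).map (Matrix.mulVecLin g.val.val)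
    rw [Matrix.mulVecLin_mul, Submodule.map_comp]

theorem smul_plane (g : SO7C) (E : IsoGrass) :
    (g • E).plane = E.plane.map (Matrix.mulVecLin g.val.val) := rfl

/-- The first vector of the normalized basis of an isotropic plane with coordinates `x`. -/
def vecA (x : Cn 7) : Cn 7 :=
  ![1, 0, x 0, x 1, x 2, x 6, -(x 0 * x 2 + x 1 ^ 2 / 2)]

/-- The second vector of the normalized basis of an isotropic plane with coordinates `x`. -/
def vecB (x : Cn 7) : Cn 7 :=
  ![0, 1, x 3, x 4, x 5, -(x 3 * x 5 + x 4 ^ 2 / 2), -x 6 - (x 0 * x 5 + x 1 * x 4 + x 2 * x 3)]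

theorem bform_apply (v w : Cn 7) : bform v w = v 0 * w 6 + v 1 * w 5 + v 2 * w 4 + v 3 * w 3 +
    v 4 * w 2 + v 5 * w 1 + v 6 * w 0 := by
  simp only [bform, Fin.sum_univ_seven]
  rfl

theorem linearIndependent_of_minor {u v : Cn 7} (h : u 0 * v 1 - u 1 * v 0 ≠ 0) :
    LinearIndependent ℂ ![u, v] := by
  rw [LinearIndependent.pair_iff]
  intro s t hst
  have h0 := congrFun hst 0
  have h1 := congrFun hst 1
  simp only [Pi.add_apply, Pi.smul_apply, smul_eq_mul, Pi.zero_apply] at h0 h1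
  constructor
  · have : s * (u 0 * v 1 - u 1 * v 0) = 0 := by linear_combination v 1 * h0 - v 0 * h1
    exact (mul_eq_zero.1 this).resolve_right h
  · have : t * (u 0 * v 1 - u 1 * v 0) = 0 := by linear_combination u 0 * h1 - u 1 * h0
    exact (mul_eq_zero.1 this).resolve_right h

theorem finrank_span_pair {u v : Cn 7} (h : LinearIndependent ℂ ![u, v]) :
    Module.finrank ℂ (Submodule.span ℂ {u, v}) = 2 := by
  have := finrank_span_eq_card h
  rwa [Matrix.range_cons_cons_empty, Fintype.card_fin] at this

theorem isotropic_span_pair {u v : Cn 7} (huu : bform u u = 0) (huv : bform u v = 0)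
    (hvu : bform v u = 0) (hvv : bform v v = 0) :
    ∀ a ∈ Submodule.span ℂ {u, v}, ∀ b ∈ Submodule.span ℂ {u, v}, bform a b = 0 := by
  intro a ha b hb
  obtain ⟨s, t, rfl⟩ := Submodule.mem_span_pair.1 ha
  obtain ⟨s', t', rfl⟩ := Submodule.mem_span_pair.1 hb
  simp [bform_add_left, bform_add_right, bform_smul_left, bform_smul_right, huu, huv, hvu, hvv]

theorem minor_vecA_vecB (x : Cn 7) : vecA x 0 * vecB x 1 - vecA x 1 * vecB x 0 ≠ 0 := by
  simp [vecA, vecB]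

/-- The standard holomorphic parametrization of the planes near `⟨e₁, e₂⟩`. -/
def param (x : Cn 7) : IsoGrass where
  plane := Submodule.span ℂ {vecA x, vecB x}
  finrank_eq := finrank_span_pair (linearIndependent_of_minor (minor_vecA_vecB x))
  isotropic := by
    apply isotropic_span_pair <;> rw [bform_apply] <;> simp [vecA, vecB] <;> ring

/-- The coordinates of the plane with normalized basis `a`, `b`. -/
def readCoord (a b : Cn 7) : Cn 7 := ![a 2, a 3, a 4, b 2, b 3, b 4, a 5]

theorem vecA_readCoord {a b : Cn 7} (a0 : a 0 = 1) (a1 : a 1 = 0) (haa : bform a a = 0) :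
    vecA (readCoord a b) = a := by
  rw [bform_apply] at haa
  have h6 : a 6 = -(a 2 * a 4 + a 3 ^ 2 / 2) := by
    rw [a0, a1] at haa; linear_combination haa / 2
  ext i
  fin_cases i <;> simp [vecA, readCoord, a0, a1, h6]

theorem vecB_readCoord {a b : Cn 7} (a0 : a 0 = 1) (a1 : a 1 = 0) (b0 : b 0 = 0) (b1 : b 1 = 1)
    (hab : bform a b = 0) (hbb : bform b b = 0) : vecB (readCoord a b) = b := by
  rw [bform_apply] at hab hbb
  have h5 : b 5 = -(b 2 * b 4 + b 3 ^ 2 / 2) := by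
    rw [b0, b1] at hbb; linear_combination hbb / 2
  have h6 : b 6 = -a 5 - (a 2 * b 4 + a 3 * b 3 + a 4 * b 2) := by
    rw [a0, a1, b0, b1] at hab; linear_combination hab
  ext i
  fin_cases i <;> simp [vecB, readCoord, b0, b1, h5, h6]

theorem readCoord_vec (x : Cn 7) : readCoord (vecA x) (vecB x) = x := by
  ext i
  fin_cases i <;> simp [vecA, vecB, readCoord]

theorem eq_param {E : IsoGrass} {a b : Cn 7} (ha : a ∈ E.plane) (hb : b ∈ E.plane) (a0 : a 0 = 1)
    (a1 : a 1 = 0) (b0 : b 0 = 0) (b1 : b 1 = 1) : E = param (readCoord a b) := by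
  ext1
  have hA := vecA_readCoord (b := b) a0 a1 (E.isotropic a ha a ha)
  have hB := vecB_readCoord a0 a1 b0 b1 (E.isotropic a ha b hb) (E.isotropic b hb b hb)
  symm
  apply Submodule.eq_of_le_of_finrank_eq
  · change Submodule.span ℂ _ ≤ _
    rw [hA, hB, Submodule.span_le]
    rintro v (rfl | rfl)
    · exact ha
    · exact hb
  · rw [(param _).finrank_eq, E.finrank_eq]

theorem mem_param_unique {x : Cn 7} {v : Cn 7} (hv : v ∈ (param x).plane) :
    v = v 0 • vecA x + v 1 • vecB x := by
  obtain ⟨s, t, rfl⟩ := Submodule.mem_span_pair.1 hv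
  simp [vecA, vecB]

theorem param_injective : Function.Injective param := by
  intro x y h
  have hA : vecA y ∈ (param x).plane := h ▸ Submodule.subset_span (by simp)
  have hB : vecB y ∈ (param x).plane := h ▸ Submodule.subset_span (by simp)
  have hA' := mem_param_unique hA
  have hB' := mem_param_unique hB
  have a0 : vecA y 0 = 1 := rfl
  have a1 : vecA y 1 = 0 := rfl
  have b0 : vecB y 0 = 0 := rfl
  have b1 : vecB y 1 = 1 := rfl
  rw [a0, a1, one_smul, zero_smul, add_zero] at hA'
  rw [b0, b1, one_smul, zero_smul, zero_add] at hB'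
  rw [← readCoord_vec x, ← readCoord_vec y, hA', hB']

theorem smul_param_injective (g : SO7C) : Function.Injective fun x => g • param x :=
  (MulAction.injective g).comp param_injective

/-- The chart of `Z` whose inverse is `x ↦ g • param x`. -/
def chart (g : SO7C) : PartialEquiv IsoGrass (Cn 7) :=
  (Set.InjOn.toPartialEquiv (fun x => g • param x) univ (smul_param_injective g).injOn).symm

theorem chart_target (g : SO7C) : (chart g).target = univ := rfl

theorem chart_source (g : SO7C) : (chart g).source = Set.range fun x => g • param x :=
  Set.image_univ

theorem chart_symm_apply (g : SO7C) (x : Cn 7) : (chart g).symm x = g • param x := rfl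

theorem chart_apply (g : SO7C) (x : Cn 7) : chart g (g • param x) = x :=
  (chart g).right_inv (mem_univ x)

/-- The basis of `g • param x` obtained from the normalized basis of `param x`. -/
def moveA (g : SO7C) (x : Cn 7) : Cn 7 := g.val.val.mulVec (vecA x)

/-- The basis of `g • param x` obtained from the normalized basis of `param x`. -/
def moveB (g : SO7C) (x : Cn 7) : Cn 7 := g.val.val.mulVec (vecB x)

/-- The leading minor of the basis `moveA g x`, `moveB g x`. -/
def minor (g : SO7C) (x : Cn 7) : ℂ :=
  moveA g x 0 * moveB g x 1 - moveA g x 1 * moveB g x 0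

/-- The coordinate change between the charts of `1` and `g⁻¹`, as an explicit rational map. -/
def transition (g : SO7C) (x : Cn 7) : Cn 7 :=
  readCoord ((minor g x)⁻¹ • (moveB g x 1 • moveA g x - moveA g x 1 • moveB g x))
    ((minor g x)⁻¹ • (moveA g x 0 • moveB g x - moveB g x 0 • moveA g x))

theorem moveA_mem (g : SO7C) (x : Cn 7) : moveA g x ∈ (g • param x).plane :=
  ⟨vecA x, Submodule.subset_span (by simp), rfl⟩

theorem moveB_mem (g : SO7C) (x : Cn 7) : moveB g x ∈ (g • param x).plane :=
  ⟨vecB x, Submodule.subset_span (by simp), rfl⟩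

theorem smul_param_eq (g : SO7C) (x : Cn 7) (h : minor g x ≠ 0) :
    g • param x = param (transition g x) := by
  have hA := moveA_mem g x
  have hB := moveB_mem g x
  apply eq_param
  · exact Submodule.smul_mem _ _ (Submodule.sub_mem _ (Submodule.smul_mem _ _ hA)
      (Submodule.smul_mem _ _ hB))
  · exact Submodule.smul_mem _ _ (Submodule.sub_mem _ (Submodule.smul_mem _ _ hB)
      (Submodule.smul_mem _ _ hA))
  all_goals simp only [Pi.smul_apply, Pi.sub_apply, smul_eq_mul]
  · rw [inv_mul_eq_one₀ h, minor]; ring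
  · ring
  · ring
  · rw [inv_mul_eq_one₀ h, minor]; ring

theorem minor_ne_zero {g : SO7C} {x y : Cn 7} (h : g • param x = param y) : minor g x ≠ 0 := by
  have hplane : (param y).plane = Submodule.span ℂ {moveA g x, moveB g x} := by
    rw [← h, smul_plane]
    change Submodule.map _ (Submodule.span ℂ _) = _
    rw [Submodule.map_span, Set.image_pair]
    rfl
  have hA : vecA y ∈ Submodule.span ℂ {moveA g x, moveB g x} :=
    hplane ▸ Submodule.subset_span (by simp)
  have hB : vecB y ∈ Submodule.span ℂ {moveA g x, moveB g x} :=
    hplane ▸ Submodule.subset_span (by simp)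
  obtain ⟨s, t, hst⟩ := Submodule.mem_span_pair.1 hA
  obtain ⟨s', t', hst'⟩ := Submodule.mem_span_pair.1 hB
  have e0 : s * moveA g x 0 + t * moveB g x 0 = 1 := congrFun hst 0
  have e1 : s * moveA g x 1 + t * moveB g x 1 = 0 := congrFun hst 1
  have e2 : s' * moveA g x 0 + t' * moveB g x 0 = 0 := congrFun hst' 0
  have e3 : s' * moveA g x 1 + t' * moveB g x 1 = 1 := congrFun hst' 1
  intro h0
  rw [minor] at h0
  have : (1 : ℂ) = 0 := by
    calc (1 : ℂ) = (s * moveA g x 0 + t * moveB g x 0) * (s' * moveA g x 1 + t' * moveB g x 1) -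
          (s * moveA g x 1 + t * moveB g x 1) * (s' * moveA g x 0 + t' * moveB g x 0) := by
            rw [e0, e1, e2, e3]; ring
      _ = 0 := by linear_combination (s * t' - t * s') * h0
  exact one_ne_zero this

theorem trans_source (g k : SO7C) :
    ((chart g).symm.trans (chart k)).source = {x | minor (k⁻¹ * g) x ≠ 0} := by
  ext x
  rw [PartialEquiv.trans_source, PartialEquiv.symm_source, chart_target, univ_inter, mem_preimage,
    chart_symm_apply, chart_source]
  constructor
  · rintro ⟨y, hy⟩
    refine minor_ne_zero (y := y) ?_
    rw [mul_smul, ← hy, inv_smul_smul]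
  · intro h
    refine ⟨transition (k⁻¹ * g) x, ?_⟩
    change k • param (transition (k⁻¹ * g) x) = g • param x
    rw [← smul_param_eq _ _ h, mul_smul, smul_inv_smul]

theorem trans_apply (g k : SO7C) {x : Cn 7} (h : minor (k⁻¹ * g) x ≠ 0) :
    ((chart g).symm.trans (chart k)) x = transition (k⁻¹ * g) x := by
  change chart k (g • param x) = _
  rw [← chart_apply k (transition (k⁻¹ * g) x), ← smul_param_eq _ _ h, mul_smul, smul_inv_smul]

theorem continuous_vecA : Continuous vecA := by
  refine continuous_pi fun i => ?_
  fin_cases i <;> simp only [vecA] <;> dsimp <;> fun_prop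

theorem continuous_vecB : Continuous vecB := by
  refine continuous_pi fun i => ?_
  fin_cases i <;> simp only [vecB] <;> dsimp <;> fun_prop

theorem continuous_moveA (g : SO7C) : Continuous (moveA g) :=
  continuous_const.matrix_mulVec continuous_vecA

theorem continuous_moveB (g : SO7C) : Continuous (moveB g) :=
  continuous_const.matrix_mulVec continuous_vecB

theorem continuous_minor (g : SO7C) : Continuous (minor g) := by
  have hA := continuous_moveA g
  have hB := continuous_moveB g
  unfold minor
  fun_prop

theorem continuousOn_transition (g : SO7C) : ContinuousOn (transition g) {x | minor g x ≠ 0} := by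
  have hA := continuous_moveA g
  have hB := continuous_moveB g
  have hm : ContinuousOn (fun x => (minor g x)⁻¹) {x | minor g x ≠ 0} :=
    (continuous_minor g).continuousOn.inv₀ fun x hx => hx
  have h1 : ContinuousOn (fun x => (minor g x)⁻¹ •
      (moveB g x 1 • moveA g x - moveA g x 1 • moveB g x)) {x | minor g x ≠ 0} :=
    hm.smul (Continuous.continuousOn (by fun_prop))
  have h2 : ContinuousOn (fun x => (minor g x)⁻¹ •
      (moveA g x 0 • moveB g x - moveB g x 0 • moveA g x)) {x | minor g x ≠ 0} :=
    hm.smul (Continuous.continuousOn (by fun_prop))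
  rw [continuousOn_pi] at h1 h2 ⊢
  intro i
  fin_cases i
  · exact h1 2
  · exact h1 3
  · exact h1 4
  · exact h2 2
  · exact h2 3
  · exact h2 4
  · exact h1 5

/-- A permutation that commutes with `Fin.rev` and maps `0`, `1` to `i`, `j`. -/
def permFor (i j : Fin 7) : Equiv.Perm (Fin 7) :=
  let τ : Equiv.Perm (Fin 7) :=
    if i = 6 then Equiv.swap 0 6 else Equiv.swap 0 i * Equiv.swap 6 (Fin.rev i)
  let j' := τ⁻¹ j
  τ * (if j' = 5 then Equiv.swap 1 5 else Equiv.swap 1 j' * Equiv.swap 5 (Fin.rev j'))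

theorem permFor_spec : ∀ i j : Fin 7, i ≠ 3 → j ≠ 3 → i ≠ j → j ≠ Fin.rev i →
    (∀ k, permFor i j (Fin.rev k) = Fin.rev (permFor i j k)) ∧ permFor i j 0 = i ∧
      permFor i j 1 = j := by
  decide

theorem exists_SO7C_perm (π : Equiv.Perm (Fin 7)) (hπ : ∀ k, π (Fin.rev k) = Fin.rev (π k)) :
    ∃ (g : SO7C) (c : ℂ), c ≠ 0 ∧ ∀ v k, g.val.val.mulVec v k = c * v (π k) := by
  set c : ℂ := (π.permMatrix ℂ).det with hc
  have hcc : c * c = 1 := by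
    rw [hc, Matrix.det_permutation]
    rcases Int.units_eq_one_or (Equiv.Perm.sign π) with h | h <;> simp [h]
  have hdet : (c • π.permMatrix ℂ).det = 1 := by
    rw [Matrix.det_smul, ← hc, Fintype.card_fin]
    linear_combination (c ^ 6 + c ^ 4 + c ^ 2 + 1) * hcc
  have hact : ∀ v k, (c • π.permMatrix ℂ).mulVec v k = c * v (π k) := by
    intro v k
    rw [Matrix.smul_mulVec, Matrix.permMatrix_mulVec]
    rfl
  refine ⟨⟨Matrix.GeneralLinearGroup.mkOfDetNeZero _ (by rw [hdet]; exact one_ne_zero),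
    fun v w => ?_, hdet⟩, c, ?_, hact⟩
  · change bform ((c • π.permMatrix ℂ).mulVec v) ((c • π.permMatrix ℂ).mulVec w) = _
    have : ∀ k, (c • π.permMatrix ℂ).mulVec v k * (c • π.permMatrix ℂ).mulVec w (Fin.rev k) =
        v (π k) * w (Fin.rev (π k)) := by
      intro k
      rw [hact, hact, hπ]
      linear_combination v (π k) * w (Fin.rev (π k)) * hcc
    simp only [bform, this]
    exact Equiv.sum_comp π fun k => v k * w (Fin.rev k)
  · rintro h
    simp [h] at hcc

theorem exists_minor (E : IsoGrass) : ∃ u ∈ E.plane, ∃ v ∈ E.plane, ∃ i j : Fin 7,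
    i ≠ 3 ∧ j ≠ 3 ∧ i ≠ j ∧ j ≠ Fin.rev i ∧ u i * v j - u j * v i ≠ 0 := by
  obtain ⟨u, v, hu, hv, huv⟩ : ∃ u v, u ∈ E.plane ∧ v ∈ E.plane ∧
      LinearIndependent ℂ ![u, v] := by
    let B := Module.finBasisOfFinrankEq ℂ E.plane E.finrank_eq
    refine ⟨B 0, B 1, (B 0).2, (B 1).2, ?_⟩
    have := B.linearIndependent.map' E.plane.subtype (Submodule.ker_subtype _)
    convert! this using 1
    ext k : 1
    fin_cases k <;> rfl
  by_contra! H
  have H' := fun i j => H u hu v hv i j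
  set w : Fin 7 → Cn 7 := fun i => u i • v - v i • u with hw
  have hwE : ∀ i, w i ∈ E.plane := fun i =>
    Submodule.sub_mem _ (Submodule.smul_mem _ _ hv) (Submodule.smul_mem _ _ hu)
  have hwij : ∀ i j, w i j = u i * v j - u j * v i := by
    intro i j; simp [hw]; ring
  have hz : ∀ i j, i ≠ 3 → j ≠ 3 → j ≠ Fin.rev i → w i j = 0 := by
    intro i j hi hj hij
    rw [hwij]
    by_cases h : i = j
    · subst h; ring
    · exact H' i j hi hj h hij
  have hsum : ∀ i k, i ≠ 3 → k ≠ 3 → bform (w i) (w k) = 0 := fun i k _ _ =>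
    E.isotropic _ (hwE i) _ (hwE k)
  have hself : ∀ i : Fin 7, i ≠ 3 → i ≠ Fin.rev i := by decide
  have hrev : ∀ i : Fin 7, i ≠ 3 → Fin.rev i ≠ 3 := by decide
  have h3 : ∀ i, i ≠ 3 → w i 3 = 0 := by
    intro i hi
    have := hsum i i hi hi
    rw [bform, Finset.sum_eq_single 3] at this
    · exact mul_self_eq_zero.1 this
    · intro j _ hj
      by_cases h : j = Fin.rev i
      · subst h
        rw [Fin.rev_rev, hz i i hi hi (hself i hi), mul_zero]
      · rw [hz i j hi hj h, zero_mul]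
    · simp
  have hr : ∀ i, i ≠ 3 → w i (Fin.rev i) = 0 := by
    intro i hi
    have := hsum i (Fin.rev i) hi (hrev i hi)
    rw [bform, Finset.sum_eq_single (Fin.rev i)] at this
    · rw [Fin.rev_rev, hwij (Fin.rev i) i] at this
      rw [hwij] at this ⊢
      have h2 : (u i * v (Fin.rev i) - u (Fin.rev i) * v i) ^ 2 = 0 := by
        linear_combination -this
      exact pow_eq_zero_iff (two_ne_zero) |>.1 h2
    · intro j _ hj
      by_cases h : j = 3
      · subst h; rw [h3 i hi, zero_mul]
      · rw [hz i j hi h hj, zero_mul]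
    · simp
  have hall : ∀ i j, w i j = 0 := by
    have key : ∀ i, i ≠ 3 → ∀ j, w i j = 0 := by
      intro i hi j
      by_cases h : j = 3
      · subst h; exact h3 i hi
      by_cases h' : j = Fin.rev i
      · subst h'; exact hr i hi
      · exact hz i j hi h h'
    intro i j
    by_cases h : i = 3
    · by_cases h' : j = 3
      · subst h; subst h'; rw [hwij]; ring
      · have := key j h' i
        rw [hwij] at this ⊢
        linear_combination -this
    · exact key i h j
  rw [LinearIndependent.pair_iff] at huv
  have hu0 : ∀ i, u i = 0 := by
    intro i
    refine (huv (-(v i)) (u i) ?_).2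
    have : w i = 0 := funext (hall i)
    rw [hw] at this
    simp only at this
    rw [← this, neg_smul]; abel
  have := (huv 1 0 (by ext i; simp [hu0 i])).1
  exact one_ne_zero this

theorem exists_mem_chart_source (E : IsoGrass) : ∃ g : SO7C, E ∈ (chart g).source := by
  obtain ⟨u, hu, v, hv, i, j, hi, hj, hij, hji, hne⟩ := exists_minor E
  obtain ⟨hπ, h0, h1⟩ := permFor_spec i j hi hj hij hji
  obtain ⟨g, c, hc, hg⟩ := exists_SO7C_perm _ hπ
  refine ⟨g⁻¹, ?_⟩
  rw [chart_source]
  set D := u i * v j - u j * v i with hD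
  have hgu : g.val.val.mulVec u ∈ (g • E).plane := ⟨u, hu, rfl⟩
  have hgv : g.val.val.mulVec v ∈ (g • E).plane := ⟨v, hv, rfl⟩
  have key : g • E = param (readCoord
      ((c * D)⁻¹ • (v j • g.val.val.mulVec u - u j • g.val.val.mulVec v))
      ((c * D)⁻¹ • (u i • g.val.val.mulVec v - v i • g.val.val.mulVec u))) := by
    have hcD : c * D ≠ 0 := mul_ne_zero hc hne
    apply eq_param
    · exact Submodule.smul_mem _ _ (Submodule.sub_mem _ (Submodule.smul_mem _ _ hgu)
        (Submodule.smul_mem _ _ hgv))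
    · exact Submodule.smul_mem _ _ (Submodule.sub_mem _ (Submodule.smul_mem _ _ hgv)
        (Submodule.smul_mem _ _ hgu))
    all_goals simp only [Pi.smul_apply, Pi.sub_apply, smul_eq_mul, hg, h0, h1]
    · rw [inv_mul_eq_one₀ hcD, hD]; ring
    · ring
    · ring
    · rw [inv_mul_eq_one₀ hcD, hD]; ring
  refine ⟨readCoord
      ((c * D)⁻¹ • (v j • g.val.val.mulVec u - u j • g.val.val.mulVec v))
      ((c * D)⁻¹ • (u i • g.val.val.mulVec v - v i • g.val.val.mulVec u)), ?_⟩
  change g⁻¹ • param _ = E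
  rw [← key, inv_smul_smul]

/-- The atlas of `Z` that consists of the charts `chart g`, `g ∈ SO(7, ℂ)`. -/
def chartCore : ChartedSpaceCore (Cn 7) IsoGrass where
  atlas := Set.range chart
  chartAt E := chart (exists_mem_chart_source E).choose
  mem_chart_source E := (exists_mem_chart_source E).choose_spec
  chart_mem_atlas _ := mem_range_self _
  open_source := by
    rintro _ _ ⟨g, rfl⟩ ⟨k, rfl⟩
    rw [trans_source]
    exact isOpen_ne_fun (continuous_minor _) continuous_const
  continuousOn_toFun := by
    rintro _ _ ⟨g, rfl⟩ ⟨k, rfl⟩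
    rw [trans_source]
    exact (continuousOn_transition _).congr fun x hx => trans_apply g k hx

instance : TopologicalSpace IsoGrass := chartCore.toTopologicalSpace

instance : ChartedSpace (Cn 7) IsoGrass := chartCore.toChartedSpace

/-- The set of isotropic planes on which the Hermitian form `h` is degenerate. -/
def degeneratePlanes : Set IsoGrass :=
  {E | ∃ v ∈ E.plane, v ≠ 0 ∧ ∀ w ∈ E.plane, hform v w = 0}

/-! ## The CR-algebra and its filtration -/

/-- The matrix of the bilinear form `b`. -/
def bmatrix : Matrix (Fin 7) (Fin 7) ℂ := Matrix.of fun i j => if j = Fin.rev i then 1 else 0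

/-- The Lie algebra `𝔩 = 𝔰𝔬(7, ℂ)` of the group `SO(7, ℂ)`. -/
abbrev so7 := skewAdjointMatricesLieSubalgebra bmatrix

/-- The conjugation `σ` of `𝔩` with fixed set the real form `𝔤 = 𝔰𝔬(3, 4)`. -/
def conj7 : so7 →ₛₗ[starRingEnd ℂ] so7 where
  toFun X := ⟨X.val.map (starRingEnd ℂ), by
    have hX := X.2
    rw [mem_skewAdjointMatricesLieSubalgebra, mem_skewAdjointMatricesSubmodule] at hX ⊢
    have hJ : bmatrix.map (starRingEnd ℂ) = bmatrix := by
      ext i j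
      simp only [bmatrix, Matrix.map_apply, Matrix.of_apply]
      split_ifs <;> simp
    have hX' : X.val.transpose * bmatrix = bmatrix * -X.val := hX
    have h := congrArg (fun A => Matrix.map A (starRingEnd ℂ)) hX'
    simp only [Matrix.map_mul, hJ] at h
    change (X.val.map (starRingEnd ℂ)).transpose * bmatrix = bmatrix * -(X.val.map (starRingEnd ℂ))
    rw [← Matrix.transpose_map, h]
    congr 1⟩
  map_add' X Y := by
    ext i j; simp
  map_smul' c X := by
    ext i j; simp

/-- The complex isotropy algebra `𝔮` at `z`: the Lie algebra of the stabilizer of the plane `z`. -/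
def isotropyAlg (z : IsoGrass) : Submodule ℂ so7 where
  carrier := {X | ∀ v ∈ z.plane, X.val.mulVec v ∈ z.plane}
  zero_mem' v _ := by simp
  add_mem' hX hY v hv := by
    simpa [Matrix.add_mulVec] using z.plane.add_mem (hX v hv) (hY v hv)
  smul_mem' c X hX v hv := by
    simpa [Matrix.smul_mulVec] using z.plane.smul_mem c (hX v hv)

/-- The filtration `𝔮⁽⁰⁾ = 𝔮`, `𝔮⁽ᵏ⁺¹⁾ = {w ∈ 𝔮⁽ᵏ⁾ : [w, σ𝔮] ⊆ 𝔮⁽ᵏ⁾ + σ𝔮}` of a complex subspace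
`𝔮` of `𝔩`. -/
def crFiltration (q : Submodule ℂ so7) : ℕ → Submodule ℂ so7
  | 0 => q
  | k + 1 =>
    { carrier := {w | w ∈ crFiltration q k ∧
        ∀ v ∈ q, ⁅w, conj7 v⁆ ∈ crFiltration q k ⊔ q.map conj7}
      zero_mem' := ⟨Submodule.zero_mem _, fun v _ => by
        rw [zero_lie]; exact Submodule.zero_mem _⟩
      add_mem' := fun hx hy => ⟨Submodule.add_mem _ hx.1 hy.1, fun v hv => by
        rw [add_lie]; exact Submodule.add_mem _ (hx.2 v hv) (hy.2 v hv)⟩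
      smul_mem' := fun c x hx => ⟨Submodule.smul_mem _ c hx.1, fun v hv => by
        rw [smul_lie]; exact Submodule.smul_mem _ c (hx.2 v hv)⟩ }

/-- The root space `{v ∈ 𝔩 : [d, v] = β(d) v for all d ∈ 𝔱}`. -/
def rootSp (t : LieSubalgebra ℂ so7) (β : Module.Dual ℂ t) : Submodule ℂ so7 where
  carrier := {v | ∀ d : t, ⁅(d : so7), v⁆ = β d • v}
  zero_mem' d := by simp
  add_mem' hx hy d := by rw [lie_add, hx d, hy d, smul_add]
  smul_mem' c x hx d := by rw [lie_smul, hx d, smul_comm]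

/-- The functional `a α₁ + b α₂ + c α₃`. -/
def comb {t : LieSubalgebra ℂ so7} (α : Fin 3 → Module.Dual ℂ t) (a b c : ℤ) : Module.Dual ℂ t :=
  a • α 0 + b • α 1 + c • α 2

/-- The coefficients of the positive roots of a root system of type `B₃` with respect to its simple
roots `α₁, α₂, α₃` (in the order of the Dynkin diagram, `α₃` short). -/
def posB3 : Set (ℤ × ℤ × ℤ) :=
  {(1, 0, 0), (0, 1, 0), (0, 0, 1), (1, 1, 0), (0, 1, 1), (1, 1, 1), (0, 1, 2), (1, 1, 2), (1, 2, 2)}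

/-- `𝔱` is a Cartan subalgebra of `𝔩` and `α₁, α₂, α₃` are simple roots of the root system
`Φ(𝔩, 𝔱)`, which is of type `B₃`, with `α₃` short. -/
structure IsCartanWithSimpleRoots (t : LieSubalgebra ℂ so7) (α : Fin 3 → Module.Dual ℂ t) :
    Prop where
  cartan : t.IsCartanSubalgebra
  linearIndependent : LinearIndependent ℂ α
  roots : ∀ β : Module.Dual ℂ t, (β ≠ 0 ∧ rootSp t β ≠ ⊥) ↔
    ∃ r ∈ posB3, β = comb α r.1 r.2.1 r.2.2 ∨ β = -comb α r.1 r.2.1 r.2.2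

/-- `𝔮` is the parabolic subalgebra that corresponds to the set `{α₁, α₃}` of simple roots: it
contains the Borel subalgebra of `𝔱` and the negative roots, and `α₁`, `α₃`, but not `α₂`, are
roots of `𝔮`. -/
structure IsParabolicOneThree (t : LieSubalgebra ℂ so7) (α : Fin 3 → Module.Dual ℂ t)
    (q : Submodule ℂ so7) : Prop where
  cartan_le : t.toSubmodule ≤ q
  neg_le : ∀ r ∈ posB3, rootSp t (-comb α r.1 r.2.1 r.2.2) ≤ q
  one_le : rootSp t (α 0) ≤ q
  three_le : rootSp t (α 2) ≤ q
  two_not_le : ¬ rootSp t (α 1) ≤ q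

end SevenDim
end

noncomputable section

/-! ## Curves in real hypersurfaces -/

/-! The proof separates degenerate planes according to whether they contain a nonzero real vector.
Suppose that E contains none. If h vanished on E, the conjugate of E would lie in E^⊥, and its image
in the three-dimensional nondegenerate space E^⊥/E would be totally isotropic, hence at most a line;
some nonzero vector of E would then have its conjugate in E and produce a real vector
(`hasRealVector_of_hermF_eq_zero`). So at a degenerate E without real vectors the kernel of h on E
is a line. Let v span it, let c be the conjugate of v, and let W in E satisfy h(W,W) ≠ 0. Then c
lies in E^⊥ but not in E, and its image m in E^⊥/E is a nonzero isotropic vector. Choose s with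
(m,s) ≠ 0 and a vector U of E^⊥ over a multiple of the cross product m × s, corrected by a multiple
of W; U is orthogonal to c, and b(U,U) ≠ 0.

The CR geometry is read off from how v and W move. A holomorphic tangent vector of Z is a pair
(dv,dW) modulo E, subject to the differentiated isotropy relations, and H^{1,0} of the hypersurface
is the kernel of b(dv,c). Differentiating this covector in CR directions, where c moves, produces
b(dW,c), b(dv,W) and b(dv,U). Next come b(dW,U) and the c-component of dv, and finally the
c-component of dW. The last two arise because b(U,c) = 0 along the hypersurface gives b(c,dU) =
-b(U,dc), which is nonzero when c moves towards U. The covectors found up to order k therefore span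
spaces of dimension 1, 4, 6, 7 (`PlaneFrame.exists_adaptedCoframe`).

The passage from such a coframe to the definitions is independent of the example. In an
`AdaptedCoframe`, the Levi kernel of order k is conjugate to the annihilator of the first r k
covectors (`AdaptedCoframe.leviKernel_eq`), because the tensor in its definition is, up to sign and
conjugation, the CR derivative of these covectors. The iterated CR derivatives of the gradient span
the same covectors (`AdaptedCoframe.iteratedCR` and `AdaptedCoframe.coframeKer_eq_of_nondegSpan`).
Hence the ranks 6, 3, 1, 0 and 3-nondegeneracy.

For the orbits, v and W are completed to a basis of ℂ⁷ in which b has its standard form and on which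
conjugation acts by one fixed signed permutation (`IsSeed.isAdaptedBasis`). The signature of h
forces h(W,W) > 0 (`hform_pos`), so there is a single normal form and two such bases differ by an
element of SO(3,4). Since the basis can be chosen continuously, and SO(3,4) is connected near 1 by
Cayley paths, nearby degenerate planes lie in the same orbit of the identity component
(`exists_isOpen_subset_orbit`).

At a degenerate plane with a real vector the hypersurface is not smooth
(`not_hasRealVector_of_mem_smoothPart`). In a real chart its equation equates the Gram determinant
of two real 3-vectors with the square of a further coordinate. There the 3-vectors are dependent, so
the Gram determinant vanishes to second order and also takes negative values nearby, and neither
position of a hypothetical tangent hyperplane is compatible with this.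

Finally, in an adapted basis the diagonal matrices form a σ-stable Cartan subalgebra, root spaces
are matrix positions, and σ permutes positions. The filtration then becomes finite combinatorics of
weights (`crFiltration_succ_eq`), which is checked by evaluation. -/

/-- An intermediate value argument along the transversal direction e replaces the implicit function
theorem: it yields points of ρ = 0 whose deviation from the tangent direction ξ is small compared
with s, which is all that first-order arguments need. -/
theorem eventually_exists_zero {E : Type*} [NormedAddCommGroup E] [NormedSpace ℝ E] {ρ : E → ℝ}
    {p : E} (hρ : AnalyticAt ℝ ρ p) (hp : ρ p = 0) {ξ e : E} (hξ : fderiv ℝ ρ p ξ = 0)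
    (he : fderiv ℝ ρ p e ≠ 0) {ε : ℝ} (hε : 0 < ε) :
    ∀ᶠ s : ℝ in 𝓝[>] 0, ∃ τ : ℝ, |τ| ≤ ε * s ∧ ρ (p + s • ξ + τ • e) = 0 := by
  set D := fderiv ℝ ρ p e with hD
  set R := ‖ξ‖ + ε * ‖e‖ + 1 with hR
  have hRpos : 0 < R := by positivity
  -- With this constant the first-order error is at most half of ε·s·|D|, the change of the linear
  -- part at τ = ±ε·s, so ρ has opposite signs at the two ends.
  have hc : 0 < ε * |D| / (2 * R) := by have := abs_pos.2 he; positivity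
  have hd := hρ.differentiableAt.hasFDerivAt.isLittleO.def hc
  have hcont : ∀ᶠ y in 𝓝 p, ContinuousAt ρ y :=
    hρ.eventually_analyticAt.mono fun y hy => hy.continuousAt
  obtain ⟨δ, hδ, hball⟩ := Metric.eventually_nhds_iff_ball.1 (hd.and hcont)
  have hsmall : ∀ᶠ s : ℝ in 𝓝[>] 0, s * R < δ := by
    have : Tendsto (fun s : ℝ => s * R) (𝓝[>] 0) (𝓝 0) := by
      have h0 : Tendsto (fun s : ℝ => s * R) (𝓝 0) (𝓝 (0 * R)) := (continuous_mul_const R).tendsto 0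
      rw [zero_mul] at h0
      exact h0.mono_left nhdsWithin_le_nhds
    exact this.eventually (gt_mem_nhds hδ)
  filter_upwards [hsmall, self_mem_nhdsWithin] with s hs hs0
  have hs0 : 0 < s := hs0
  have hnorm : ∀ τ : ℝ, |τ| ≤ ε * s → ‖s • ξ + τ • e‖ ≤ s * R := by
    intro τ hτ
    calc ‖s • ξ + τ • e‖ ≤ ‖s • ξ‖ + ‖τ • e‖ := norm_add_le _ _
      _ = s * ‖ξ‖ + |τ| * ‖e‖ := by
        rw [norm_smul, norm_smul, Real.norm_eq_abs, Real.norm_eq_abs, abs_of_pos hs0]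
      _ ≤ s * ‖ξ‖ + ε * s * ‖e‖ := by gcongr
      _ ≤ s * R := by rw [hR]; nlinarith
  have hmem : ∀ τ : ℝ, |τ| ≤ ε * s → p + s • ξ + τ • e ∈ Metric.ball p δ := by
    intro τ hτ
    rw [Metric.mem_ball, dist_eq_norm, add_assoc, add_sub_cancel_left]
    exact (hnorm τ hτ).trans_lt hs
  have happ : ∀ τ : ℝ, |τ| ≤ ε * s →
      |ρ (p + s • ξ + τ • e) - τ * D| ≤ ε * |D| / 2 * s := by
    intro τ hτ
    have h := (hball _ (hmem τ hτ)).1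
    rw [hp, sub_zero, add_assoc, add_sub_cancel_left, map_add, map_smul, map_smul, hξ, smul_zero,
      zero_add, smul_eq_mul, Real.norm_eq_abs] at h
    rw [add_assoc]
    refine h.trans ?_
    calc _ ≤ ε * |D| / (2 * R) * (s * R) := by gcongr; exact hnorm τ hτ
      _ = _ := by field_simp
  have hcontOn : ContinuousOn (fun τ : ℝ => ρ (p + s • ξ + τ • e)) (Icc (-(ε * s)) (ε * s)) := by
    intro τ hτ
    have h1 : ContinuousAt ρ (p + s • ξ + τ • e) := (hball _ (hmem τ (abs_le.2 hτ))).2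
    have h2 : ContinuousAt (fun τ : ℝ => p + s • ξ + τ • e) τ := by fun_prop
    exact (ContinuousAt.comp (f := fun τ : ℝ => p + s • ξ + τ • e) h1 h2).continuousWithinAt
  have hεs : 0 < ε * s := by positivity
  have hr := abs_le.1 (happ (ε * s) (by rw [abs_of_pos hεs]))
  have hl := abs_le.1 (happ (-(ε * s)) (by rw [abs_neg, abs_of_pos hεs]))
  have hle : -(ε * s) ≤ ε * s := by linarith
  rcases lt_or_gt_of_ne he with hneg | hpos
  · rw [abs_of_neg hneg] at hr hl
    have hm : 0 < ε * s * (-D) := mul_pos hεs (by linarith)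
    obtain ⟨τ, hτ, h0⟩ := intermediate_value_Icc' hle hcontOn
      (show (0 : ℝ) ∈ Icc _ _ from ⟨by nlinarith [hr.2], by nlinarith [hl.1]⟩)
    exact ⟨τ, abs_le.2 hτ, h0⟩
  · rw [abs_of_pos hpos] at hr hl
    have hm : 0 < ε * s * D := mul_pos hεs hpos
    obtain ⟨τ, hτ, h0⟩ := intermediate_value_Icc hle hcontOn
      (show (0 : ℝ) ∈ Icc _ _ from ⟨by nlinarith [hl.2], by nlinarith [hr.1]⟩)
    exact ⟨τ, abs_le.2 hτ, h0⟩

/-- The differential of a function that vanishes on the hypersurface `ρ = 0` annihilates the kernel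
of `dρ`. -/
theorem fderiv_apply_eq_zero_of_vanishing {E G : Type*} [NormedAddCommGroup E] [NormedSpace ℝ E]
    [NormedAddCommGroup G] [NormedSpace ℝ G] {ρ : E → ℝ} {p : E} (hρ : AnalyticAt ℝ ρ p)
    (hp : ρ p = 0) (hd : fderiv ℝ ρ p ≠ 0) {f : E → G} (hf : DifferentiableAt ℝ f p)
    (h0 : ∀ᶠ x in 𝓝 p, ρ x = 0 → f x = 0) {v : E} (hv : fderiv ℝ ρ p v = 0) :
    fderiv ℝ f p v = 0 := by
  obtain ⟨e, he⟩ : ∃ e, fderiv ℝ ρ p e ≠ 0 := by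
    by_contra! H
    exact hd (ContinuousLinearMap.ext H)
  have hfp : f p = 0 := h0.self_of_nhds hp
  -- At the points p + s·v + τ·e of the hypersurface f vanishes, so s·f'(v) equals minus τ·f'(e) up
  -- to the first-order error, and both of these are of size ε·s. Dividing by s and letting ε tend
  -- to 0 gives the claim.
  have key : ∀ ε : ℝ, 0 < ε → ε ≤ 1 →
      ‖fderiv ℝ f p v‖ ≤ ε * (‖fderiv ℝ f p e‖ + ‖v‖ + ‖e‖) := by
    intro ε hε hε1
    have hcurve := eventually_exists_zero hρ hp hv he hε
    have hlo := hf.hasFDerivAt.isLittleO.def hε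
    obtain ⟨δ, hδ, hball⟩ := Metric.eventually_nhds_iff_ball.1 (hlo.and h0)
    have hsmall : ∀ᶠ s : ℝ in 𝓝[>] 0, s * (‖v‖ + ‖e‖) < δ := by
      have h0 : Tendsto (fun s : ℝ => s * (‖v‖ + ‖e‖)) (𝓝 0) (𝓝 (0 * (‖v‖ + ‖e‖))) :=
        (continuous_mul_const _).tendsto 0
      rw [zero_mul] at h0
      exact (h0.mono_left nhdsWithin_le_nhds).eventually (gt_mem_nhds hδ)
    obtain ⟨s, ⟨τ, hτ, hz⟩, hs, hs0⟩ := (hcurve.and (hsmall.and self_mem_nhdsWithin)).exists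
    have hs0 : 0 < s := hs0
    have hτs : |τ| ≤ s := hτ.trans (by nlinarith)
    have hn : ‖s • v + τ • e‖ ≤ s * (‖v‖ + ‖e‖) := by
      calc ‖s • v + τ • e‖ ≤ ‖s • v‖ + ‖τ • e‖ := norm_add_le _ _
        _ = s * ‖v‖ + |τ| * ‖e‖ := by
          rw [norm_smul, norm_smul, Real.norm_eq_abs, Real.norm_eq_abs, abs_of_pos hs0]
        _ ≤ s * ‖v‖ + s * ‖e‖ := by gcongr
        _ = _ := by ring
    have hmem : p + (s • v + τ • e) ∈ Metric.ball p δ := by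
      rw [Metric.mem_ball, dist_eq_norm, add_sub_cancel_left]
      exact hn.trans_lt hs
    rw [add_assoc] at hz
    obtain ⟨h1, h2⟩ := hball _ hmem
    rw [h2 hz, hfp, sub_zero, zero_sub, norm_neg, add_sub_cancel_left, map_add, map_smul,
      map_smul] at h1
    have h3 : s * ‖fderiv ℝ f p v‖ ≤ s * (ε * (‖fderiv ℝ f p e‖ + ‖v‖ + ‖e‖)) := by
      calc s * ‖fderiv ℝ f p v‖ = ‖s • fderiv ℝ f p v‖ := by
            rw [norm_smul, Real.norm_eq_abs, abs_of_pos hs0]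
        _ = ‖(s • fderiv ℝ f p v + τ • fderiv ℝ f p e) - τ • fderiv ℝ f p e‖ := by
            rw [add_sub_cancel_right]
        _ ≤ ‖s • fderiv ℝ f p v + τ • fderiv ℝ f p e‖ + ‖τ • fderiv ℝ f p e‖ := norm_sub_le _ _
        _ ≤ ε * (s * (‖v‖ + ‖e‖)) + ε * s * ‖fderiv ℝ f p e‖ := by
            rw [norm_smul τ, Real.norm_eq_abs]
            gcongr
            exact h1.trans (by gcongr)
        _ = _ := by ring
    exact le_of_mul_le_mul_left h3 hs0
  rw [← norm_le_zero_iff]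
  have hlim : Tendsto (fun ε : ℝ => ε * (‖fderiv ℝ f p e‖ + ‖v‖ + ‖e‖)) (𝓝[>] 0) (𝓝 0) := by
    have h0 : Tendsto (fun s : ℝ => s * (‖fderiv ℝ f p e‖ + ‖v‖ + ‖e‖)) (𝓝 0)
        (𝓝 (0 * (‖fderiv ℝ f p e‖ + ‖v‖ + ‖e‖))) := (continuous_mul_const _).tendsto 0
    rw [zero_mul] at h0
    exact h0.mono_left nhdsWithin_le_nhds
  refine ge_of_tendsto hlim ?_
  filter_upwards [self_mem_nhdsWithin, mem_nhdsWithin_of_mem_nhds (gt_mem_nhds one_pos)] with ε h1 h2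
  exact key ε h1 h2.le

namespace CR

variable {n : ℕ}

/-! ## Calculus of complex tangent vectors -/

/-- `f` is real-differentiable at `x` and its derivative in the direction of the complex tangent
vector `ξ` is `d`. -/
def HasCDeriv {F : Type*} [NormedAddCommGroup F] [NormedSpace ℂ F] (f : Cn n → F) (x : Cn n)
    (ξ : CT n) (d : F) : Prop :=
  DifferentiableAt ℝ f x ∧ cderiv f x ξ = d

section

variable {F : Type*} [NormedAddCommGroup F] [NormedSpace ℂ F] {f g : Cn n → F} {x : Cn n}
  {ξ : CT n} {d e : F}

theorem hasCDeriv_self (hf : DifferentiableAt ℝ f x) : HasCDeriv f x ξ (cderiv f x ξ) := ⟨hf, rfl⟩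

theorem HasCDeriv.unique (h : HasCDeriv f x ξ d) (h' : HasCDeriv f x ξ e) : d = e :=
  h.2.symm.trans h'.2

theorem HasCDeriv.congr (h : HasCDeriv f x ξ d) (hd : d = e) : HasCDeriv f x ξ e := hd ▸ h

theorem hasCDeriv_const (c : F) : HasCDeriv (fun _ => c) x ξ 0 :=
  ⟨differentiableAt_const c, by simp [cderiv]⟩

theorem HasCDeriv.add (hf : HasCDeriv f x ξ d) (hg : HasCDeriv g x ξ e) :
    HasCDeriv (fun y => f y + g y) x ξ (d + e) :=
  ⟨hf.1.add hg.1, by rw [cderiv_add_left hf.1 hg.1, hf.2, hg.2]⟩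

theorem HasCDeriv.neg (hf : HasCDeriv f x ξ d) : HasCDeriv (fun y => -f y) x ξ (-d) := by
  refine ⟨hf.1.neg, ?_⟩
  rw [← hf.2]
  simp only [cderiv, fderiv_fun_neg, neg_apply]
  module

theorem HasCDeriv.sub (hf : HasCDeriv f x ξ d) (hg : HasCDeriv g x ξ e) :
    HasCDeriv (fun y => f y - g y) x ξ (d - e) := by
  simpa only [sub_eq_add_neg] using hf.add hg.neg

theorem HasCDeriv.sum {ι : Type*} (s : Finset ι) {f : ι → Cn n → F} {d : ι → F}
    (h : ∀ i ∈ s, HasCDeriv (f i) x ξ (d i)) :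
    HasCDeriv (fun y => ∑ i ∈ s, f i y) x ξ (∑ i ∈ s, d i) := by
  classical
  induction s using Finset.induction_on with
  | empty => simpa using hasCDeriv_const (0 : F)
  | insert a s ha ih =>
    simp only [Finset.sum_insert ha]
    exact (h a (Finset.mem_insert_self a s)).add
      (ih fun i hi => h i (Finset.mem_insert_of_mem hi))

/-- A continuous complex linear map commutes with derivatives. -/
theorem HasCDeriv.clm_comp {G : Type*} [NormedAddCommGroup G] [NormedSpace ℂ G] (L : F →L[ℂ] G)
    (hf : HasCDeriv f x ξ d) : HasCDeriv (fun y => L (f y)) x ξ (L d) := by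
  have h := ((L.restrictScalars ℝ).hasFDerivAt (x := f x)).comp x hf.1.hasFDerivAt
  refine ⟨h.differentiableAt, ?_⟩
  have h' : fderiv ℝ (fun y => L (f y)) x = (L.restrictScalars ℝ).comp (fderiv ℝ f x) := h.fderiv
  rw [← hf.2]
  simp only [cderiv, h', ContinuousLinearMap.comp_apply, ContinuousLinearMap.coe_restrictScalars',
    map_smul, map_add, map_sub]

end

theorem HasCDeriv.mul {f g : Cn n → ℂ} {x : Cn n} {ξ : CT n} {d e : ℂ} (hf : HasCDeriv f x ξ d)
    (hg : HasCDeriv g x ξ e) : HasCDeriv (fun y => f y * g y) x ξ (d * g x + f x * e) := by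
  refine ⟨hf.1.mul hg.1, ?_⟩
  rw [← hf.2, ← hg.2]
  simp only [cderiv, fderiv_fun_mul hf.1 hg.1, add_apply, smul_apply, smul_eq_mul]
  ring

theorem HasCDeriv.pi {m : ℕ} {f : Cn n → Cn m} {x : Cn n} {ξ : CT n} {d : Cn m}
    (h : ∀ i, HasCDeriv (fun y => f y i) x ξ (d i)) : HasCDeriv f x ξ d := by
  have hf : DifferentiableAt ℝ f x := differentiableAt_pi.2 fun i => (h i).1
  refine ⟨hf, funext fun i => ?_⟩
  exact ((hasCDeriv_self (ξ := ξ) hf).clm_comp (ContinuousLinearMap.proj i)).unique (h i)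

theorem HasCDeriv.apply {m : ℕ} {f : Cn n → Cn m} {x : Cn n} {ξ : CT n} {d : Cn m}
    (h : HasCDeriv f x ξ d) (i : Fin m) : HasCDeriv (fun y => f y i) x ξ (d i) :=
  h.clm_comp (ContinuousLinearMap.proj i)

theorem HasCDeriv.smul {m : ℕ} {c : Cn n → ℂ} {f : Cn n → Cn m} {x : Cn n} {ξ : CT n} {d : ℂ}
    {e : Cn m} (hc : HasCDeriv c x ξ d) (hf : HasCDeriv f x ξ e) :
    HasCDeriv (fun y => c y • f y) x ξ (d • f x + c x • e) :=
  HasCDeriv.pi fun i => hc.mul (hf.apply i)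

theorem HasCDeriv.fst {m : ℕ} {f : Cn n → CT m} {x : Cn n} {ξ : CT n} {d : CT m}
    (h : HasCDeriv f x ξ d) : HasCDeriv (fun y => (f y).1) x ξ d.1 :=
  h.clm_comp (ContinuousLinearMap.fst ℂ (Cn m) (Cn m))

theorem HasCDeriv.snd {m : ℕ} {f : Cn n → CT m} {x : Cn n} {ξ : CT n} {d : CT m}
    (h : HasCDeriv f x ξ d) : HasCDeriv (fun y => (f y).2) x ξ d.2 :=
  h.clm_comp (ContinuousLinearMap.snd ℂ (Cn m) (Cn m))

theorem HasCDeriv.dotProduct {m : ℕ} {f g : Cn n → Cn m} {x : Cn n} {ξ : CT n} {d e : Cn m}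
    (hf : HasCDeriv f x ξ d) (hg : HasCDeriv g x ξ e) :
    HasCDeriv (fun y => f y ⬝ᵥ g y) x ξ (d ⬝ᵥ g x + f x ⬝ᵥ e) := by
  refine (HasCDeriv.sum Finset.univ fun i _ => (hf.apply i).mul (hg.apply i)).congr ?_
  simp only [Finset.sum_add_distrib, _root_.dotProduct]

/-- Conjugation exchanges the derivatives along conjugate complex tangent vectors. -/
theorem HasCDeriv.star {f : Cn n → ℂ} {x : Cn n} {ξ : CT n} {d : ℂ}
    (h : HasCDeriv f x (star ξ.2, star ξ.1) d) :
    HasCDeriv (fun y => star (f y)) x ξ (star d) := by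
  have hh := (Complex.conjCLE.toContinuousLinearMap.hasFDerivAt (x := f x)).comp x h.1.hasFDerivAt
  have h' : fderiv ℝ (fun y => Star.star (f y)) x =
      Complex.conjCLE.toContinuousLinearMap.comp (fderiv ℝ f x) := hh.fderiv
  refine ⟨hh.differentiableAt, ?_⟩
  rw [← h.2]
  simp only [cderiv, h', ContinuousLinearMap.comp_apply, star_star]
  simp
  ring

theorem HasCDeriv.star_pi {m : ℕ} {f : Cn n → Cn m} {x : Cn n} {ξ : CT n} {d : Cn m}
    (h : HasCDeriv f x (Star.star ξ.2, Star.star ξ.1) d) :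
    HasCDeriv (fun y => Star.star (f y)) x ξ (Star.star d) :=
  HasCDeriv.pi fun i => (h.apply i).star

/-- The derivative of a holomorphic map only sees the `(1,0)` part of the tangent vector. -/
theorem hasCDeriv_of_holomorphic {F : Type*} [NormedAddCommGroup F] [NormedSpace ℂ F]
    {f : Cn n → F} {x : Cn n} {f' : Cn n →L[ℂ] F} (h : HasFDerivAt f f' x)
    (ξ : CT n) : HasCDeriv f x ξ (f' ξ.1) := by
  have h' := h.restrictScalars ℝ
  refine ⟨h'.differentiableAt, ?_⟩
  simp only [cderiv, h'.fderiv, ContinuousLinearMap.coe_restrictScalars', map_smul]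
  have hII := Complex.I_mul_I
  simp only [smul_smul, hII]
  module

theorem cderiv_congr {F : Type*} [NormedAddCommGroup F] [NormedSpace ℂ F]
    {f g : Cn n → F} {x : Cn n} (h : f =ᶠ[𝓝 x] g) (ξ : CT n) : cderiv f x ξ = cderiv g x ξ := by
  simp only [cderiv, h.fderiv_eq]

/-- The derivative of a real function along a complex tangent vector. -/
theorem cderiv_ofReal {ρ : Cn n → ℝ} {x : Cn n} (h : DifferentiableAt ℝ ρ x) (v w : Cn n) :
    cderiv (fun y => (ρ y : ℂ)) x (v + Complex.I • w, star v + Complex.I • star w) =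
      fderiv ℝ ρ x v + Complex.I * fderiv ℝ ρ x w := by
  have hh := (Complex.ofRealCLM.hasFDerivAt (x := ρ x)).comp x h.hasFDerivAt
  have h' : fderiv ℝ (fun y => (ρ y : ℂ)) x = Complex.ofRealCLM.comp (fderiv ℝ ρ x) := hh.fderiv
  have hII := Complex.I_mul_I
  have e1 : (v + Complex.I • w, star v + Complex.I • star w) =
      ((v, star v) : CT n) + Complex.I • (w, star w) := rfl
  rw [e1, cderiv_add_right, cderiv_smul_right]
  simp only [cderiv, h', ContinuousLinearMap.comp_apply, Complex.ofRealCLM_apply, star_star,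
    smul_eq_mul]
  ring

theorem dotProduct_cgrad {ρ : Cn n → ℝ} (x a : Cn n) :
    cgrad ρ x ⬝ᵥ a = cderiv (fun y => (ρ y : ℂ)) x (a, 0) := by
  have ha : ((a, 0) : CT n) = ∑ j, a j • ((Pi.single j 1, 0) : CT n) := by
    apply Prod.ext
    · rw [Prod.fst_sum]
      ext i
      simp [Finset.sum_apply, Pi.single_apply]
    · rw [Prod.snd_sum]; simp
  let D : CT n →ₗ[ℂ] ℂ :=
    { toFun := cderiv (fun y => (ρ y : ℂ)) x
      map_add' := cderiv_add_right _ _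
      map_smul' := cderiv_smul_right _ _ }
  change _ = D (a, 0)
  rw [ha, map_sum]
  simp only [map_smul, dotProduct, cgrad, smul_eq_mul]
  exact Finset.sum_congr rfl fun j _ => mul_comm _ _

/-- Since ρ is real, its (0,1)-derivatives are conjugate to its (1,0)-derivatives. This expresses
membership in H^{0,1} through the same covector `cgrad ρ` as membership in H^{1,0}. -/
theorem star_cgrad_dotProduct {ρ : Cn n → ℝ} {x : Cn n} (h : DifferentiableAt ℝ ρ x) (b : Cn n) :
    star (cgrad ρ x ⬝ᵥ star b) = cderiv (fun y => (ρ y : ℂ)) x (0, b) := by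
  rw [dotProduct_cgrad]
  have hd : DifferentiableAt ℝ (fun y => (ρ y : ℂ)) x :=
    ((Complex.ofRealCLM.hasFDerivAt (x := ρ x)).comp x h.hasFDerivAt).differentiableAt
  have := (HasCDeriv.star (ξ := (0, b)) (hasCDeriv_self (ξ := (star b, star 0)) hd)).2
  simp only [star_zero] at this
  rw [← this]
  congr 1
  ext y
  simp

/-! ## Tangent spaces of real hypersurfaces -/

section Hypersurface

variable {S : Set (Cn n)} {p : Cn n} {ρ : Cn n → ℝ}

theorem IsDefiningFunction.zero (h : IsDefiningFunction S p ρ) : ρ p = 0 :=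
  h.mem_iff.self_of_nhds.1 h.mem

theorem IsDefiningFunction.differentiableAt (h : IsDefiningFunction S p ρ) :
    DifferentiableAt ℝ ρ p := h.analyticAt.differentiableAt

theorem IsDefiningFunction.fderiv_apply_eq_zero {G : Type*} [NormedAddCommGroup G]
    [NormedSpace ℝ G] (h : IsDefiningFunction S p ρ) {f : Cn n → G} (hf : DifferentiableAt ℝ f p)
    (h0 : ∀ᶠ x in 𝓝[S] p, f x = 0) {v : Cn n} (hv : fderiv ℝ ρ p v = 0) :
    fderiv ℝ f p v = 0 := by
  refine fderiv_apply_eq_zero_of_vanishing h.analyticAt h.zero h.fderiv_ne_zero hf ?_ hv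
  filter_upwards [eventually_nhdsWithin_iff.1 h0, h.mem_iff] with x h1 h2 h3
  exact h1 (h2.2 h3)

theorem IsDefiningFunction.eventually (h : IsDefiningFunction S p ρ) :
    ∀ᶠ x in 𝓝[S] p, IsDefiningFunction S x ρ := by
  have h1 : ∀ᶠ x in 𝓝 p, fderiv ℝ ρ x ≠ 0 :=
    h.analyticAt.fderiv.continuousAt.eventually_ne h.fderiv_ne_zero
  filter_upwards [self_mem_nhdsWithin, mem_nhdsWithin_of_mem_nhds h1,
    mem_nhdsWithin_of_mem_nhds h.analyticAt.eventually_analyticAt,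
    mem_nhdsWithin_of_mem_nhds h.mem_iff.eventually_nhds] with x a b c d
  exact ⟨a, c, b, d⟩

/-- One direction tests against ρ itself; the other holds because every function that vanishes on S
has a differential that annihilates the kernel of dρ. -/
theorem IsDefiningFunction.mem_tangent (h : IsDefiningFunction S p ρ) {v : Cn n} :
    v ∈ tangent S p ↔ fderiv ℝ ρ p v = 0 := by
  constructor
  · intro hv
    refine hv ρ ?_ ?_
    · exact h.analyticAt.eventually_analyticAt.mono fun x hx => hx.contDiffAt
    · rw [eventually_nhdsWithin_iff]
      exact h.mem_iff.mono fun x hx => hx.1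
  · intro hv f hf hf0
    exact h.fderiv_apply_eq_zero (hf.self_of_nhds.differentiableAt (by simp)) hf0 hv

theorem IsDefiningFunction.mem_ctangent (h : IsDefiningFunction S p ρ) {ξ : CT n} :
    ξ ∈ ctangent S p ↔ cderiv (fun y => (ρ y : ℂ)) p ξ = 0 := by
  let D : CT n →ₗ[ℂ] ℂ :=
    { toFun := cderiv (fun y => (ρ y : ℂ)) p
      map_add' := cderiv_add_right _ _
      map_smul' := cderiv_smul_right _ _ }
  have hre : ∀ v : Cn n, cderiv (fun y => (ρ y : ℂ)) p (v, star v) = fderiv ℝ ρ p v := by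
    intro v
    simpa using cderiv_ofReal h.differentiableAt v 0
  constructor
  · intro hξ
    have : ctangent S p ≤ LinearMap.ker D := by
      rw [ctangent, Submodule.span_le]
      rintro _ ⟨v, hv, rfl⟩
      change cderiv (fun y => (ρ y : ℂ)) p (v, star v) = 0
      rw [hre, h.mem_tangent.1 hv, Complex.ofReal_zero]
    exact this hξ
  · intro hξ
    -- The decomposition of ξ into two real vectors. As ρ is real, the real and imaginary parts of
    -- the derivative along ξ are the derivatives along v and w, so both are tangent.
    set v : Cn n := (1 / 2 : ℂ) • (ξ.1 + star ξ.2) with hv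
    set w : Cn n := (-Complex.I / 2) • (ξ.1 - star ξ.2) with hw
    have hdec : ξ = (v + Complex.I • w, star v + Complex.I • star w) := by
      have hII := Complex.I_mul_I
      apply Prod.ext
      · simp only [hv, hw, smul_smul]
        rw [show Complex.I * (-Complex.I / 2) = 1 / 2 by linear_combination (-1 / 2 : ℂ) * hII]
        module
      · have e1 : star (1 / 2 : ℂ) = 1 / 2 := by simp
        have e2 : star (-Complex.I / 2 : ℂ) = Complex.I / 2 := by simp
        simp only [hv, hw, star_smul, star_add, star_sub, star_star, smul_smul, e1, e2]
        rw [show Complex.I * (Complex.I / 2) = -1 / 2 by linear_combination (1 / 2 : ℂ) * hII]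
        module
    have h0 := hξ
    rw [hdec, cderiv_ofReal h.differentiableAt] at h0
    have hr := congrArg Complex.re h0
    have hi := congrArg Complex.im h0
    simp at hr hi
    have hdec' : ξ = ((v, star v) : CT n) + Complex.I • (w, star w) := hdec
    rw [hdec']
    exact Submodule.add_mem _ (Submodule.subset_span ⟨v, h.mem_tangent.2 hr, rfl⟩)
      (Submodule.smul_mem _ _ (Submodule.subset_span ⟨w, h.mem_tangent.2 hi, rfl⟩))

theorem IsDefiningFunction.mem_H10 (h : IsDefiningFunction S p ρ) {ξ : CT n} :
    ξ ∈ H10 S p ↔ ξ.2 = 0 ∧ cgrad ρ p ⬝ᵥ ξ.1 = 0 := by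
  rw [H10, Submodule.mem_inf, h.mem_ctangent, LinearMap.mem_ker, LinearMap.snd_apply, and_comm]
  refine and_congr_right fun h2 => ?_
  rw [dotProduct_cgrad, ← h2]

theorem IsDefiningFunction.mem_H01 (h : IsDefiningFunction S p ρ) {ξ : CT n} :
    ξ ∈ H01 S p ↔ ξ.1 = 0 ∧ cgrad ρ p ⬝ᵥ star ξ.2 = 0 := by
  rw [H01, Submodule.mem_inf, h.mem_ctangent, LinearMap.mem_ker, LinearMap.fst_apply, and_comm]
  refine and_congr_right fun h2 => ?_
  rw [← star_eq_zero (x := cgrad ρ p ⬝ᵥ star ξ.2), star_cgrad_dotProduct h.differentiableAt, ← h2]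

/-- Complex tangent vectors of `S` annihilate the functions that vanish on `S`. -/
theorem IsDefiningFunction.cderiv_eq_zero {F : Type*} [NormedAddCommGroup F] [NormedSpace ℂ F]
    (h : IsDefiningFunction S p ρ) {f : Cn n → F} (hf : DifferentiableAt ℝ f p)
    (h0 : ∀ᶠ x in 𝓝[S] p, f x = 0) {ξ : CT n} (hξ : ξ ∈ ctangent S p) : cderiv f p ξ = 0 := by
  let D : CT n →ₗ[ℂ] F :=
    { toFun := cderiv f p
      map_add' := cderiv_add_right _ _
      map_smul' := cderiv_smul_right _ _ }
  have : ctangent S p ≤ LinearMap.ker D := by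
    rw [ctangent, Submodule.span_le]
    rintro _ ⟨v, hv, rfl⟩
    change cderiv f p (v, star v) = 0
    have hv0 := h.fderiv_apply_eq_zero hf h0 (h.mem_tangent.1 hv)
    simp only [cderiv, star_star, hv0]
    module
  exact this hξ

end Hypersurface

end CR

namespace CR

variable {n : ℕ}

/-! ## Regularity of derivatives -/

theorem contDiffAt_cderiv {F : Type*} [NormedAddCommGroup F] [NormedSpace ℂ F] {f : Cn n → F}
    {L : Cn n → CT n} {x : Cn n} (hf : ContDiffAt ℝ ∞ f x) (hL : ContDiffAt ℝ ∞ L x) :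
    ContDiffAt ℝ ∞ (fun y => cderiv f y (L y)) x := by
  have hf' : ContDiffAt ℝ ∞ (fderiv ℝ f) x := hf.fderiv_right (by simp)
  have hst : ContDiffAt ℝ ∞ (fun y => star (L y).2) x :=
    ((starL' ℝ : Cn n ≃L[ℝ] Cn n).contDiff.contDiffAt).comp x hL.snd
  have hI : ∀ {v : Cn n → Cn n}, ContDiffAt ℝ ∞ v x → ContDiffAt ℝ ∞ (fun y => Complex.I • v y) x :=
    fun h => h.const_smul Complex.I
  simp only [cderiv]
  exact (((hf'.clm_apply hL.fst).sub ((hf'.clm_apply (hI hL.fst)).const_smul _)).add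
    ((hf'.clm_apply hst).add ((hf'.clm_apply (hI hst)).const_smul _))).const_smul _

theorem contDiffAt_ofReal_comp {ρ : Cn n → ℝ} {x : Cn n} (h : ContDiffAt ℝ ∞ ρ x) :
    ContDiffAt ℝ ∞ (fun y => (ρ y : ℂ)) x :=
  Complex.ofRealCLM.contDiff.contDiffAt.comp x h

theorem contDiffAt_cgrad {ρ : Cn n → ℝ} {x : Cn n} (h : ContDiffAt ℝ ∞ ρ x) :
    ContDiffAt ℝ ∞ (cgrad ρ) x := by
  rw [contDiffAt_pi]
  exact fun j => contDiffAt_cderiv (contDiffAt_ofReal_comp h) contDiffAt_const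

/-- Derivatives along constant complex vector fields commute. -/
theorem cderiv_cderiv_comm {f : Cn n → ℂ} {x : Cn n} (hf : ContDiffAt ℝ ∞ f x) (ξ η : CT n) :
    cderiv (fun y => cderiv f y ξ) x η = cderiv (fun y => cderiv f y η) x ξ := by
  have hd : DifferentiableAt ℝ (fderiv ℝ f) x :=
    (hf.fderiv_right (m := ∞) (by simp)).differentiableAt (by simp)
  have hsymm : ∀ v w, fderiv ℝ (fderiv ℝ f) x v w = fderiv ℝ (fderiv ℝ f) x w v := fun v w =>
    hf.isSymmSndFDerivAt (by simpa using ENat.LEInfty.out) v w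
  have key : ∀ ξ v, fderiv ℝ (fun y => cderiv f y ξ) x v =
      (1 / 2 : ℂ) • ((fderiv ℝ (fderiv ℝ f) x v ξ.1 -
        Complex.I • fderiv ℝ (fderiv ℝ f) x v (Complex.I • ξ.1)) +
        (fderiv ℝ (fderiv ℝ f) x v (star ξ.2) +
          Complex.I • fderiv ℝ (fderiv ℝ f) x v (Complex.I • star ξ.2))) := by
    intro ξ v
    have h0 : ∀ w : Cn n, HasFDerivAt (fun y => fderiv ℝ f y w)
        ((fderiv ℝ (fderiv ℝ f) x).flip w) x := fun w =>
      ((ContinuousLinearMap.apply ℝ ℂ w).hasFDerivAt.comp x hd.hasFDerivAt)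
    have h := (((h0 ξ.1).sub ((h0 (Complex.I • ξ.1)).const_smul Complex.I)).add
      ((h0 (star ξ.2)).add ((h0 (Complex.I • star ξ.2)).const_smul Complex.I))).const_smul
        (1 / 2 : ℂ)
    have h' : fderiv ℝ (fun y => cderiv f y ξ) x = _ := h.fderiv
    rw [h']
    rfl
  have expand : ∀ ξ η : CT n, cderiv (fun y => cderiv f y ξ) x η = (1 / 2 : ℂ) •
      ((fderiv ℝ (fun y => cderiv f y ξ) x η.1 -
        Complex.I • fderiv ℝ (fun y => cderiv f y ξ) x (Complex.I • η.1)) +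
      (fderiv ℝ (fun y => cderiv f y ξ) x (star η.2) +
        Complex.I • fderiv ℝ (fun y => cderiv f y ξ) x (Complex.I • star η.2))) := fun _ _ => rfl
  rw [expand, expand]
  simp only [key, smul_eq_mul]
  rw [hsymm η.1 ξ.1, hsymm η.1 (Complex.I • ξ.1), hsymm η.1 (star ξ.2),
    hsymm η.1 (Complex.I • star ξ.2), hsymm (Complex.I • η.1) ξ.1,
    hsymm (Complex.I • η.1) (Complex.I • ξ.1), hsymm (Complex.I • η.1) (star ξ.2),
    hsymm (Complex.I • η.1) (Complex.I • star ξ.2), hsymm (star η.2) ξ.1,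
    hsymm (star η.2) (Complex.I • ξ.1), hsymm (star η.2) (star ξ.2),
    hsymm (star η.2) (Complex.I • star ξ.2), hsymm (Complex.I • star η.2) ξ.1,
    hsymm (Complex.I • star η.2) (Complex.I • ξ.1), hsymm (Complex.I • star η.2) (star ξ.2),
    hsymm (Complex.I • star η.2) (Complex.I • star ξ.2)]
  ring

/-- The Levi form of a real function is Hermitian. -/
theorem cderiv_cgrad_dotProduct {ρ : Cn n → ℝ} {x : Cn n} (h : ContDiffAt ℝ ∞ ρ x) (η β : Cn n) :
    cderiv (cgrad ρ) x (0, star β) ⬝ᵥ η = star (cderiv (cgrad ρ) x (0, star η) ⬝ᵥ β) := by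
  have hρ := contDiffAt_ofReal_comp h
  have hg : DifferentiableAt ℝ (cgrad ρ) x := (contDiffAt_cgrad h).differentiableAt (by simp)
  have hdiff : ∀ ξ : CT n, DifferentiableAt ℝ (fun y => cderiv (fun z => (ρ z : ℂ)) y ξ) x :=
    fun ξ => (contDiffAt_cderiv hρ contDiffAt_const).differentiableAt (by simp)
  have key : ∀ η β : Cn n, cderiv (cgrad ρ) x (0, star β) ⬝ᵥ η =
      cderiv (fun y => cderiv (fun z => (ρ z : ℂ)) y (η, 0)) x (0, star β) := by
    intro η β
    have h1 := ((hasCDeriv_self (ξ := (0, star β)) hg).dotProduct (hasCDeriv_const η)).2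
    simp only [dotProduct_zero, add_zero] at h1
    rw [← h1]
    simp only [dotProduct_cgrad]
  rw [key η β, key β η]
  -- Reality of ρ exchanges the inner derivative for its conjugate; commuting the two derivatives
  -- afterwards turns this into Hermitian symmetry.
  have hev : (fun y => star (cderiv (fun z => (ρ z : ℂ)) y (0, star η))) =ᶠ[𝓝 x]
      fun y => cderiv (fun z => (ρ z : ℂ)) y (η, 0) := by
    have hc : ∀ᶠ y in 𝓝 x, ContDiffAt ℝ 1 ρ y :=
      (h.of_le (by simp)).eventually (by simp)
    filter_upwards [hc] with y hy
    rw [← star_cgrad_dotProduct (hy.differentiableAt (by simp)), star_star, star_star,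
      dotProduct_cgrad]
  rw [← cderiv_congr hev]
  have h2 := (HasCDeriv.star (ξ := (0, star β))
    (hasCDeriv_self (ξ := (star (star β), star 0)) (hdiff (0, star η)))).2
  rw [h2, cderiv_cderiv_comm hρ]
  simp

/-! ## Adapted coframes -/

/-- The vectors annihilated by the first `r` members of the coframe `a` at `x`. -/
def coframeKer (a : Fin n → Cn n → Cn n) (r : ℕ) (x : Cn n) : Set (Cn n) :=
  {v | ∀ j : Fin n, j.val < r → a j x ⬝ᵥ v = 0}

/-- An analytic coframe on `U` adapted to the Levi kernels of the real hypersurface `S`: the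
annihilator of the first `r 0` covectors is `H^{1,0}`, and the annihilators of the first `r (k + 1)`
covectors are determined by the derivatives of the first `r k` covectors in CR directions. -/
structure AdaptedCoframe (S U : Set (Cn n)) (ρ : Cn n → ℝ) (a : Fin n → Cn n → Cn n)
    (r : ℕ → ℕ) : Prop where
  isOpen : IsOpen U
  defining : ∀ x ∈ S ∩ U, IsDefiningFunction S x ρ
  analytic : ∀ j, ∀ x ∈ U, AnalyticAt ℝ (a j) x
  indep : ∀ x ∈ U, ∀ v, (∀ j, a j x ⬝ᵥ v = 0) → v = 0
  mono : Monotone r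
  grad : ∀ x ∈ S ∩ U, ∀ v, v ∈ coframeKer a (r 0) x ↔ cgrad ρ x ⬝ᵥ v = 0
  incl : ∀ k, ∀ x ∈ S ∩ U, ∀ v ∈ coframeKer a (r (k + 1)) x, ∀ j : Fin n, j.val < r k →
    ∀ L ∈ H01 S x, cderiv (a j) x L ⬝ᵥ v = 0
  gen : ∀ k, ∀ x ∈ S ∩ U, ∀ v ∈ coframeKer a (r k) x,
    (∀ j : Fin n, j.val < r k → ∀ L ∈ H01 S x, cderiv (a j) x L ⬝ᵥ v = 0) →
      v ∈ coframeKer a (r (k + 1)) x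

/-- The matrix of a coframe. -/
def coframeMatrix (a : Fin n → Cn n → Cn n) (x : Cn n) : Matrix (Fin n) (Fin n) ℂ :=
  Matrix.of fun j => a j x

/-- The frame dual to a coframe. -/
def dualFrame (a : Fin n → Cn n → Cn n) (j : Fin n) (x : Cn n) : Cn n :=
  fun i => (coframeMatrix a x)⁻¹ i j

theorem analyticAt_det {m : Type*} [Fintype m] [DecidableEq m] {M : Cn n → Matrix m m ℂ} {x : Cn n}
    (h : ∀ i j, AnalyticAt ℝ (fun y => M y i j) x) : AnalyticAt ℝ (fun y => (M y).det) x := by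
  simp only [Matrix.det_apply, Units.smul_def, zsmul_eq_mul]
  refine Finset.analyticAt_fun_sum _ fun σ _ => ?_
  exact analyticAt_const.mul (Finset.analyticAt_fun_prod _ fun i _ => h _ _)

namespace AdaptedCoframe

variable {S U : Set (Cn n)} {ρ : Cn n → ℝ} {a : Fin n → Cn n → Cn n} {r : ℕ → ℕ} {x : Cn n}

theorem isUnit_det (h : AdaptedCoframe S U ρ a r) (hx : x ∈ U) :
    IsUnit (coframeMatrix a x).det := by
  rw [isUnit_iff_ne_zero]
  intro h0
  obtain ⟨v, hv, hv0⟩ := Matrix.exists_mulVec_eq_zero_iff.2 h0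
  exact hv (h.indep x hx v fun j => congrFun hv0 j)

theorem dotProduct_dualFrame (h : AdaptedCoframe S U ρ a r) (hx : x ∈ U) (i j : Fin n) :
    a i x ⬝ᵥ dualFrame a j x = if i = j then 1 else 0 := by
  have := congrFun (congrFun (Matrix.mul_nonsing_inv _ (h.isUnit_det hx)) i) j
  rw [Matrix.one_apply] at this
  rw [← this]
  rfl

theorem sum_dualFrame (h : AdaptedCoframe S U ρ a r) (hx : x ∈ U) (v : Cn n) :
    v = ∑ j, (a j x ⬝ᵥ v) • dualFrame a j x := by
  have h1 : (coframeMatrix a x)⁻¹.mulVec ((coframeMatrix a x).mulVec v) = v := by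
    rw [Matrix.mulVec_mulVec, Matrix.nonsing_inv_mul _ (h.isUnit_det hx), Matrix.one_mulVec]
  conv_lhs => rw [← h1]
  ext i
  simp only [Matrix.mulVec, dotProduct, Finset.sum_apply, Pi.smul_apply, smul_eq_mul, dualFrame,
    coframeMatrix, Matrix.of_apply]
  exact Finset.sum_congr rfl fun j _ => mul_comm _ _

theorem sum_coframe (h : AdaptedCoframe S U ρ a r) (hx : x ∈ U) (θ : Cn n) :
    θ = ∑ j, (θ ⬝ᵥ dualFrame a j x) • a j x := by
  have h1 : Matrix.vecMul (Matrix.vecMul θ (coframeMatrix a x)⁻¹) (coframeMatrix a x) = θ := by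
    rw [Matrix.vecMul_vecMul, Matrix.nonsing_inv_mul _ (h.isUnit_det hx), Matrix.vecMul_one]
  conv_lhs => rw [← h1]
  ext i
  simp only [Matrix.vecMul, dotProduct, Finset.sum_apply, Pi.smul_apply, smul_eq_mul, dualFrame,
    coframeMatrix, Matrix.of_apply]

theorem analyticAt_dualFrame (h : AdaptedCoframe S U ρ a r) (hx : x ∈ U) (j : Fin n) :
    AnalyticAt ℝ (dualFrame a j) x := by
  have hentry : ∀ i j, AnalyticAt ℝ (fun y => coframeMatrix a y i j) x := fun i j =>
    (ContinuousLinearMap.proj (R := ℝ) (φ := fun _ : Fin n => ℂ) j).analyticAt _ |>.comp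
      (h.analytic i x hx)
  have hdet := analyticAt_det hentry
  refine analyticAt_pi_iff.2 fun i => ?_
  have : (fun y => dualFrame a j y i) =
      fun y => (coframeMatrix a y).det⁻¹ * (coframeMatrix a y).adjugate i j := by
    ext y
    rw [dualFrame, Matrix.inv_def, Matrix.smul_apply, Ring.inverse_eq_inv', smul_eq_mul]
  rw [this]
  refine (hdet.inv (h.isUnit_det hx).ne_zero).mul ?_
  simp only [Matrix.adjugate_apply]
  refine analyticAt_det fun k l => ?_
  by_cases hk : k = j
  · subst hk
    simp only [Matrix.updateRow_self]
    exact analyticAt_const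
  · simp only [Matrix.updateRow_ne hk]
    exact hentry k l

theorem dualFrame_mem (h : AdaptedCoframe S U ρ a r) (hx : x ∈ U) {k : ℕ} {j : Fin n}
    (hj : k ≤ j.val) : dualFrame a j x ∈ coframeKer a k x := by
  intro i hi
  rw [h.dotProduct_dualFrame hx, if_neg]
  rintro rfl
  omega

theorem smul_mem {k : ℕ} {v : Cn n} (c : ℂ) (hv : v ∈ coframeKer a k x) :
    c • v ∈ coframeKer a k x := fun j hj => by
  rw [dotProduct_smul, hv j hj, smul_zero]

theorem sum_mem {k : ℕ} {ι : Type*} (s : Finset ι) {v : ι → Cn n}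
    (hv : ∀ i ∈ s, v i ∈ coframeKer a k x) : ∑ i ∈ s, v i ∈ coframeKer a k x := fun j hj => by
  rw [dotProduct_sum]
  exact Finset.sum_eq_zero fun i hi => hv i hi j hj

theorem coframeKer_anti {k l : ℕ} (hkl : k ≤ l) : coframeKer a l x ⊆ coframeKer a k x :=
  fun _ hv j hj => hv j (hj.trans_le hkl)

/-- Every vector in the annihilator extends to an analytic field of such vectors. -/
theorem exists_section (h : AdaptedCoframe S U ρ a r) (hx : x ∈ U) {k : ℕ} {v : Cn n}
    (hv : v ∈ coframeKer a k x) : ∃ V : Cn n → Cn n, (∀ y ∈ U, AnalyticAt ℝ V y) ∧ V x = v ∧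
      ∀ y ∈ U, V y ∈ coframeKer a k y := by
  refine ⟨fun y => ∑ j : Fin n, (a j x ⬝ᵥ v) • dualFrame a j y, fun y hy => ?_,
    (h.sum_dualFrame hx v).symm, fun y hy => ?_⟩
  · exact Finset.analyticAt_fun_sum _ fun j _ =>
      (h.analyticAt_dualFrame hy j).const_smul (c := a j x ⬝ᵥ v)
  · refine sum_mem _ fun j _ => ?_
    by_cases hj : j.val < k
    · rw [hv j hj, zero_smul]
      exact fun i _ => dotProduct_zero _
    · exact smul_mem _ (h.dualFrame_mem hy (not_lt.1 hj))

theorem analyticAt_star {m : ℕ} {V : Cn n → Cn m} (h : AnalyticAt ℝ V x) :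
    AnalyticAt ℝ (fun y => star (V y)) x :=
  ((starL' ℝ : Cn m ≃L[ℝ] Cn m).toContinuousLinearMap.analyticAt _).comp h

theorem mem_H01 (h : AdaptedCoframe S U ρ a r) (hx : x ∈ S ∩ U) {ξ : CT n} :
    ξ ∈ H01 S x ↔ ξ.1 = 0 ∧ star ξ.2 ∈ coframeKer a (r 0) x := by
  rw [(h.defining x hx).mem_H01, h.grad x hx]

theorem mem_H10 (h : AdaptedCoframe S U ρ a r) (hx : x ∈ S ∩ U) {ξ : CT n} :
    ξ ∈ H10 S x ↔ ξ.2 = 0 ∧ ξ.1 ∈ coframeKer a (r 0) x := by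
  rw [(h.defining x hx).mem_H10, h.grad x hx]

theorem eventually_mem (h : AdaptedCoframe S U ρ a r) (hx : x ∈ U) :
    ∀ᶠ y in 𝓝[S] x, y ∈ S ∩ U := by
  filter_upwards [self_mem_nhdsWithin, mem_nhdsWithin_of_mem_nhds (h.isOpen.mem_nhds hx)] with y a b
  exact ⟨a, b⟩

theorem differentiableAt (h : AdaptedCoframe S U ρ a r) (hx : x ∈ U) (j : Fin n) :
    DifferentiableAt ℝ (a j) x := (h.analytic j x hx).differentiableAt

theorem cderiv_eq_zero (h : AdaptedCoframe S U ρ a r) (hx : x ∈ S ∩ U) {F : Type*}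
    [NormedAddCommGroup F] [NormedSpace ℂ F] {f : Cn n → F} (hf : DifferentiableAt ℝ f x)
    (h0 : ∀ᶠ y in 𝓝[S] x, f y = 0) {L : CT n} (hL : L ∈ H01 S x ∨ L ∈ H10 S x) :
    cderiv f x L = 0 :=
  (h.defining x hx).cderiv_eq_zero hf h0 (hL.elim (fun h => h.1) fun h => h.1)

/-- The derivative of a section of the span of the first `r k` covectors. -/
theorem cderiv_dotProduct_eq_sum (h : AdaptedCoframe S U ρ a r) (hx : x ∈ S ∩ U) {k : ℕ}
    {f : Cn n → Cn n} (hf : DifferentiableAt ℝ f x)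
    (hfk : ∀ᶠ y in 𝓝[S] x, ∀ j : Fin n, k ≤ j.val → f y ⬝ᵥ dualFrame a j y = 0) {L : CT n}
    (hL : L ∈ H01 S x) {v : Cn n} (hv : v ∈ coframeKer a k x) :
    cderiv f x L ⬝ᵥ v = ∑ j, (f x ⬝ᵥ dualFrame a j x) * (cderiv (a j) x L ⬝ᵥ v) := by
  have hfd := hasCDeriv_self (ξ := L) hf
  have hc : ∀ j, HasCDeriv (fun y => f y ⬝ᵥ dualFrame a j y) x L
      (cderiv (fun y => f y ⬝ᵥ dualFrame a j y) x L) := fun j => hasCDeriv_self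
    (hfd.dotProduct (hasCDeriv_self (ξ := L)
      (h.analyticAt_dualFrame hx.2 j).differentiableAt)).1
  have hsum := HasCDeriv.sum Finset.univ fun j _ =>
    (hc j).smul (hasCDeriv_self (ξ := L) (h.differentiableAt hx.2 j))
  have hev : f =ᶠ[𝓝 x] fun y => ∑ j, (f y ⬝ᵥ dualFrame a j y) • a j y :=
    (h.isOpen.mem_nhds hx.2 |> eventually_of_mem <| fun y hy => h.sum_coframe hy (f y))
  rw [cderiv_congr hev, hsum.2, sum_dotProduct]
  refine Finset.sum_congr rfl fun j _ => ?_
  rw [add_dotProduct, smul_dotProduct, smul_dotProduct, smul_eq_mul, smul_eq_mul]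
  -- In the product rule the derivative of the coefficient of `a j` drops out in either case: for j
  -- < k because it is multiplied by `a j x ⬝ᵥ v = 0`, for j ≥ k because the coefficient vanishes
  -- along S and L is tangent.
  by_cases hj : j.val < k
  · rw [hv j hj, mul_zero, zero_add]
  · rw [h.cderiv_eq_zero hx (hc j).1 (hfk.mono fun y hy => hy j (not_lt.1 hj)) (Or.inl hL),
      zero_mul, zero_add]

/-- One CR derivative raises the order by one: a section of the span of the first `r k` covectors is
differentiated into the span of the first `r (k + 1)`, by `incl`. -/
theorem cderiv_dotProduct_eq_zero (h : AdaptedCoframe S U ρ a r) (hx : x ∈ S ∩ U) {k : ℕ}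
    {f : Cn n → Cn n} (hf : DifferentiableAt ℝ f x)
    (hfk : ∀ᶠ y in 𝓝[S] x, ∀ j : Fin n, r k ≤ j.val → f y ⬝ᵥ dualFrame a j y = 0) {L : CT n}
    (hL : L ∈ H01 S x) {v : Cn n} (hv : v ∈ coframeKer a (r (k + 1)) x) :
    cderiv f x L ⬝ᵥ v = 0 := by
  rw [h.cderiv_dotProduct_eq_sum hx hf hfk hL (coframeKer_anti (h.mono k.le_succ) hv)]
  refine Finset.sum_eq_zero fun j _ => ?_
  by_cases hj : j.val < r k
  · rw [h.incl k x hx v hv j hj L hL, mul_zero]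
  · rw [(hfk.self_of_nhdsWithin hx.1) j (not_lt.1 hj), zero_mul]

/-- H^{1,0} depends on S only, so all defining functions have the same gradient direction along S.
This makes the later statements independent of the defining function. -/
theorem cgrad_eventually (h : AdaptedCoframe S U ρ a r) (hx : x ∈ S ∩ U) {ρ' : Cn n → ℝ}
    (hρ' : IsDefiningFunction S x ρ') :
    ∀ᶠ y in 𝓝[S] x, ∀ j : Fin n, r 0 ≤ j.val → cgrad ρ' y ⬝ᵥ dualFrame a j y = 0 := by
  filter_upwards [h.eventually_mem hx.2, hρ'.eventually] with y hy hy' j hj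
  have h1 : ((dualFrame a j y, 0) : CT n) ∈ H10 S y :=
    (h.mem_H10 hy).2 ⟨rfl, h.dualFrame_mem hy.2 hj⟩
  exact (hy'.mem_H10.1 h1).2

/-! ### The Levi kernels -/

/-- Let V be a section of the annihilator of the first `r k` covectors, so that the conjugate of V
is a section of the kernel of order k, and let Y be a section of H^{1,0}. Differentiating a_j·V = 0
along the conjugate of Y shows that pairing a_j with the conjugate of the (0,1)-part of the bracket
gives, up to sign, the CR derivative of a_j evaluated on V. Thus V lies in the next kernel exactly
when all CR derivatives of a_j, j < r k, annihilate it, which `incl` and `gen` identify with the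
annihilator of the first `r (k + 1)` covectors. -/
theorem leviKernel_eq (h : AdaptedCoframe S U ρ a r) (k : ℕ) : ∀ x ∈ S ∩ U, ∀ ξ : CT n,
    ξ ∈ leviKernel S k x ↔ ξ.1 = 0 ∧ star ξ.2 ∈ coframeKer a (r k) x := by
  induction k with
  | zero => exact fun x hx ξ => h.mem_H01 hx
  | succ k ih =>
    intro x hx ξ
    have hsec : ∀ {Ξ : Cn n → CT n}, IsLocalSection S (leviKernel S k) x Ξ →
        ∀ᶠ y in 𝓝[S] x, (Ξ y).1 = 0 ∧ star (Ξ y).2 ∈ coframeKer a (r k) y := by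
      intro Ξ hΞ
      filter_upwards [hΞ.2, h.eventually_mem hx.2] with y h1 h2
      exact (ih y h2 _).1 h1
    have hsecY : ∀ {Y : Cn n → CT n}, IsLocalSection S (H10 S) x Y →
        ∀ᶠ y in 𝓝[S] x, (Y y).2 = 0 ∧ (Y y).1 ∈ coframeKer a (r 0) y := by
      intro Y hY
      filter_upwards [hY.2, h.eventually_mem hx.2] with y h1 h2
      exact (h.mem_H10 h2).1 h1
    -- the derivative of the conjugate of a section of `F_(k)` against the coframe
    have hder : ∀ {Ξ Y : Cn n → CT n}, IsLocalSection S (leviKernel S k) x Ξ →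
        IsLocalSection S (H10 S) x Y → ∀ j : Fin n, j.val < r k →
          cderiv (a j) x (0, star (Y x).1) ⬝ᵥ star (Ξ x).2 +
            a j x ⬝ᵥ star (cderiv Ξ x (Y x)).2 = 0 := by
      intro Ξ Y hΞ hY j hj
      have hYx : (Y x).2 = 0 := ((hsecY hY).self_of_nhdsWithin hx.1).1
      have hLx : ((0, star (Y x).1) : CT n) ∈ H01 S x := (h.mem_H01 hx).2
        ⟨rfl, by simpa using ((hsecY hY).self_of_nhdsWithin hx.1).2⟩
      have hYe : Y x = (star (star (Y x).1), star 0) := by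
        rw [star_star, star_zero, ← hYx]
      have h1 := (hasCDeriv_self (ξ := (star (star (Y x).1), star (0 : Cn n)))
        hΞ.differentiableAt).snd
      have h2 := (hasCDeriv_self (ξ := (0, star (Y x).1)) (h.differentiableAt hx.2 j)).dotProduct
        (HasCDeriv.star_pi (ξ := (0, star (Y x).1)) h1)
      rw [← hYe] at h2
      rw [← h2.2]
      refine h.cderiv_eq_zero hx h2.1 ?_ (Or.inl hLx)
      exact (hsec hΞ).mono fun y hy => hy.2 j hj
    -- The (0,1)-part of Y vanishes along S, and so does its derivative in the tangent direction Ξ;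
    -- only the derivative of Ξ along Y survives. The (1,0)-part is treated in the same way with the
    -- roles exchanged.
    have hbr2 : ∀ {Ξ Y : Cn n → CT n}, IsLocalSection S (leviKernel S k) x Ξ →
        IsLocalSection S (H10 S) x Y → Ξ x ∈ H01 S x →
          (cbracket Ξ Y x).2 = -(cderiv Ξ x (Y x)).2 := by
      intro Ξ Y hΞ hY hΞx
      have h1 := (hasCDeriv_self (ξ := Ξ x) hY.differentiableAt).snd
      have h2 : (cderiv Y x (Ξ x)).2 = 0 := by
        rw [← h1.2]
        exact h.cderiv_eq_zero hx h1.1 ((hsecY hY).mono fun y hy => hy.1) (Or.inl hΞx)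
      rw [cbracket, Prod.snd_sub, h2, zero_sub]
    have hbr1 : ∀ {Ξ Y : Cn n → CT n}, IsLocalSection S (leviKernel S k) x Ξ →
        IsLocalSection S (H10 S) x Y → (cbracket Ξ Y x).1 = (cderiv Y x (Ξ x)).1 := by
      intro Ξ Y hΞ hY
      have h1 := (hasCDeriv_self (ξ := Y x) hΞ.differentiableAt).fst
      have h2 : (cderiv Ξ x (Y x)).1 = 0 := by
        rw [← h1.2]
        exact h.cderiv_eq_zero hx h1.1 ((hsec hΞ).mono fun y hy => hy.1)
          (Or.inr (hY.2.self_of_nhdsWithin hx.1))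
      rw [cbracket, Prod.fst_sub, h2, sub_zero]
    constructor
    · rintro ⟨hξ, Ξ, hΞ, rfl, hbr⟩
      have hξ' := (ih x hx _).1 hξ
      have hΞx : Ξ x ∈ H01 S x :=
        (h.mem_H01 hx).2 ⟨hξ'.1, coframeKer_anti (h.mono (Nat.zero_le k)) hξ'.2⟩
      refine ⟨hξ'.1, h.gen k x hx _ hξ'.2 fun j hj L hL => ?_⟩
      obtain ⟨hL1, hL2⟩ := (h.mem_H01 hx).1 hL
      -- The given CR vector L is extended to the conjugate of a section of H^{1,0}, so that the
      -- hypothesis on brackets can be applied to it.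
      obtain ⟨V, hVa, hVx, hV⟩ := h.exists_section hx.2 hL2
      have hY : IsLocalSection S (H10 S) x (fun y => (V y, 0)) := by
        refine ⟨?_, ?_⟩
        · filter_upwards [h.isOpen.mem_nhds hx.2] with y hy
          exact (hVa y hy).contDiffAt.prodMk contDiffAt_const
        · filter_upwards [h.eventually_mem hx.2] with y hy
          exact (h.mem_H10 hy).2 ⟨rfl, hV y hy.2⟩
      have hb := hbr _ hY
      obtain ⟨β, hβ, η, hη, hsum⟩ := Submodule.mem_sup.1 hb
      have hβ' := (ih x hx _).1 hβ
      have hη' := (h.mem_H10 hx).1 hη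
      have h2 : β.2 = -(cderiv Ξ x (V x, 0)).2 := by
        rw [← hbr2 hΞ hY hΞx, ← hsum, Prod.snd_add, hη'.1, add_zero]
      have h3 := hder hΞ hY j hj
      have h4 : a j x ⬝ᵥ star (cderiv Ξ x (V x, 0)).2 = 0 := by
        have := hβ'.2 j hj
        rwa [h2, star_neg, dotProduct_neg, neg_eq_zero] at this
      rw [h4, add_zero] at h3
      have hLe : L = (0, star (V x)) := by
        rw [hVx, star_star, ← hL1]
      rw [hLe]
      exact h3
    · rintro ⟨hξ1, hξ2⟩
      have hξk : star ξ.2 ∈ coframeKer a (r k) x := coframeKer_anti (h.mono k.le_succ) hξ2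
      obtain ⟨V, hVa, hVx, hV⟩ := h.exists_section hx.2 hξk
      have hΞ : IsLocalSection S (leviKernel S k) x (fun y => (0, star (V y))) := by
        refine ⟨?_, ?_⟩
        · filter_upwards [h.isOpen.mem_nhds hx.2] with y hy
          exact contDiffAt_const.prodMk (analyticAt_star (hVa y hy)).contDiffAt
        · filter_upwards [h.eventually_mem hx.2] with y hy
          exact (ih y hy _).2 ⟨rfl, by simpa using hV y hy.2⟩
      have hΞx : ((0, star (V x)) : CT n) = ξ := by
        simp only [hVx, star_star, ← hξ1]
      have hξH : ξ ∈ H01 S x :=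
        (h.mem_H01 hx).2 ⟨hξ1, coframeKer_anti (h.mono (Nat.zero_le _)) hξ2⟩
      refine ⟨(ih x hx _).2 ⟨hξ1, hξk⟩, _, hΞ, hΞx, fun Y hY => ?_⟩
      have hYx := (hsecY hY).self_of_nhdsWithin hx.1
      have hLx : ((0, star (Y x).1) : CT n) ∈ H01 S x := (h.mem_H01 hx).2
        ⟨rfl, by simpa using hYx.2⟩
      set X := cbracket (fun y => ((0, star (V y)) : CT n)) Y x with hX
      have hX1 : X.1 = (cderiv Y x ξ).1 := by rw [hX, hbr1 hΞ hY, hΞx]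
      have hX2 : X.2 = -(cderiv (fun y => ((0, star (V y)) : CT n)) x (Y x)).2 := by
        rw [hX, hbr2 hΞ hY (by rw [hΞx]; exact hξH)]
      have hdec : X = ((0, X.2) : CT n) + (X.1, 0) := by simp
      rw [hdec]
      refine Submodule.add_mem_sup ((ih x hx _).2 ⟨rfl, fun j hj => ?_⟩)
        ((h.defining x hx).mem_H10.2 ⟨rfl, ?_⟩)
      · have h3 := hder hΞ hY j hj
        rw [show star ((fun y => ((0, star (V y)) : CT n)) x).2 = star ξ.2 by rw [← hΞx],
          h.incl k x hx _ hξ2 j hj _ hLx, zero_add] at h3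
        change a j x ⬝ᵥ star X.2 = 0
        rw [hX2, star_neg, dotProduct_neg, h3, neg_zero]
      · change cgrad ρ x ⬝ᵥ X.1 = 0
        rw [hX1]
        have hρ := (h.defining x hx).analyticAt.contDiffAt (n := ∞)
        have hg : DifferentiableAt ℝ (cgrad ρ) x :=
          (contDiffAt_cgrad hρ).differentiableAt (by simp)
        have h1 := (hasCDeriv_self (ξ := ξ) hg).dotProduct
          (hasCDeriv_self (ξ := ξ) hY.differentiableAt).fst
        have h0 : cderiv (cgrad ρ) x ξ ⬝ᵥ (Y x).1 + cgrad ρ x ⬝ᵥ (cderiv Y x ξ).1 = 0 := by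
          rw [← h1.2]
          refine h.cderiv_eq_zero hx h1.1 ?_ (Or.inl hξH)
          filter_upwards [hY.2, h.eventually_mem hx.2] with y h1 h2
          exact ((h.defining y h2).mem_H10.1 h1).2
        -- This term is the Levi form of ξ and Y. By Hermitian symmetry ξ may be moved to the other
        -- slot, where it is annihilated because it lies at least in the first-order kernel.
        have h2 : cderiv (cgrad ρ) x ξ ⬝ᵥ (Y x).1 = 0 := by
          have hξe : ξ = (0, star (star ξ.2)) := by rw [star_star, ← hξ1]
          rw [hξe, cderiv_cgrad_dotProduct hρ, h.cderiv_dotProduct_eq_zero (k := 0) hx hg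
            (h.cgrad_eventually hx (h.defining x hx)) hLx, star_zero]
          exact coframeKer_anti (h.mono (by omega)) hξ2
        rwa [h2, zero_add] at h0

/-- The Levi kernel of order `k` has an analytic frame near every point of `U`. -/
theorem exists_frame (h : AdaptedCoframe S U ρ a r) (hx : x ∈ S ∩ U) {k m : ℕ}
    (hm : r k + m = n) : ∃ e : Fin m → Cn n → CT n, (∀ i, AnalyticAt ℝ (e i) x) ∧
      ∀ᶠ y in 𝓝[S] x, LinearIndependent ℂ (fun i => e i y) ∧
        Submodule.span ℂ (Set.range fun i => e i y) = leviKernel S k y := by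
  let ι : Fin m → Fin n := fun i => ⟨r k + i.val, by omega⟩
  refine ⟨fun i y => (0, star (dualFrame a (ι i) y)), fun i => ?_, ?_⟩
  · exact analyticAt_const.prod (analyticAt_star (h.analyticAt_dualFrame hx.2 _))
  · filter_upwards [h.eventually_mem hx.2] with y hy
    constructor
    · rw [Fintype.linearIndependent_iff]
      intro c hc i
      have h1 := congrArg (fun ξ : CT n => a (ι i) y ⬝ᵥ star ξ.2) hc
      simp only [Prod.snd_sum, Prod.smul_snd, star_sum, star_smul, star_star, dotProduct_sum,
        dotProduct_smul, h.dotProduct_dualFrame hy.2, Prod.snd_zero, star_zero, dotProduct_zero] at h1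
      rw [Finset.sum_eq_single i] at h1
      · simpa using h1
      · intro j _ hj
        rw [if_neg, smul_zero]
        intro hij
        apply hj
        have : r k + i.val = r k + j.val := congrArg Fin.val hij
        ext; omega
      · simp
    · apply le_antisymm
      · rw [Submodule.span_le]
        rintro _ ⟨i, rfl⟩
        refine (h.leviKernel_eq k y hy _).2 ⟨rfl, ?_⟩
        simp only [star_star]
        exact h.dualFrame_mem hy.2 (Nat.le_add_right _ _)
      · intro ξ hξ
        obtain ⟨h1, h2⟩ := (h.leviKernel_eq k y hy _).1 hξ
        have h3 := congrArg star (h.sum_dualFrame hy.2 (star ξ.2))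
        rw [star_star, star_sum] at h3
        have h4 : ξ = ∑ j, star (a j y ⬝ᵥ star ξ.2) • ((0, star (dualFrame a j y)) : CT n) := by
          apply Prod.ext
          · rw [h1, Prod.fst_sum]; simp
          · rw [Prod.snd_sum]
            conv_lhs => rw [h3]
            exact Finset.sum_congr rfl fun j _ => star_smul _ _
        rw [h4]
        refine Submodule.sum_mem _ fun j _ => ?_
        by_cases hj : j.val < r k
        · rw [h2 j hj, star_zero, zero_smul]
          exact Submodule.zero_mem _
        · refine Submodule.smul_mem _ _ (Submodule.subset_span ⟨⟨j.val - r k, by omega⟩, ?_⟩)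
          have : ι ⟨j.val - r k, by omega⟩ = j := by
            ext; simp only [ι]; omega
          simp only [this]

/-! ### Finite nondegeneracy -/

/-- Smoothness must be carried along with the algebraic claim, since each further derivative is
taken of a function that is known only near the point; the order then increases by one in each step.
-/
theorem iteratedCR (h : AdaptedCoframe S U ρ a r) (hx : x ∈ S ∩ U) {ρ' : Cn n → ℝ}
    (hρ' : IsDefiningFunction S x ρ') {k : ℕ} {f : Cn n → Cn n} (hf : IteratedCR S x ρ' k f) :
    (∀ᶠ y in 𝓝 x, ContDiffAt ℝ ∞ f y) ∧
      ∀ᶠ y in 𝓝[S] x, ∀ j : Fin n, r k ≤ j.val → f y ⬝ᵥ dualFrame a j y = 0 := by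
  induction hf with
  | zero =>
    refine ⟨?_, h.cgrad_eventually hx hρ'⟩
    filter_upwards [hρ'.analyticAt.eventually_analyticAt] with y hy
    exact contDiffAt_cgrad hy.contDiffAt
  | step hf hL ih =>
    refine ⟨?_, ?_⟩
    · filter_upwards [ih.1, hL.1] with y h1 h2
      exact contDiffAt_cderiv h1 h2
    · filter_upwards [mem_nhdsWithin_of_mem_nhds ih.1, hL.2, h.eventually_mem hx.2,
        eventually_eventually_nhdsWithin.2 ih.2] with y h1 h2 h3 h4 j hj
      exact h.cderiv_dotProduct_eq_zero h3 (h1.differentiableAt (by simp)) h4 h2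
        (h.dualFrame_mem h3.2 hj)

theorem exists_dotProduct_of_notMem {N : Submodule ℂ (Cn n)} {θ : Cn n} (hθ : θ ∉ N) :
    ∃ v, (∀ η ∈ N, η ⬝ᵥ v = 0) ∧ θ ⬝ᵥ v ≠ 0 := by
  obtain ⟨φ, hφ, hN⟩ := Submodule.exists_le_ker_of_notMem hθ
  have hrep : ∀ η : Cn n, η ⬝ᵥ (fun i => φ (Pi.single i 1)) = φ η := by
    intro η
    conv_rhs => rw [← Finset.univ_sum_single η]
    rw [map_sum, dotProduct]
    refine Finset.sum_congr rfl fun i _ => ?_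
    have : Pi.single i (η i) = η i • (Pi.single i 1 : Cn n) := by
      rw [← Pi.single_smul, smul_eq_mul, mul_one]
    rw [this, map_smul, smul_eq_mul]
  refine ⟨fun i => φ (Pi.single i 1), fun η hη => ?_, ?_⟩
  · rw [hrep]; exact hN hη
  · rw [hrep]; exact hφ

theorem nondegSpan_mono {S : Set (Cn n)} {p : Cn n} {ρ' : Cn n → ℝ} {k l : ℕ} (hkl : k ≤ l) :
    nondegSpan S p ρ' k ≤ nondegSpan S p ρ' l :=
  Submodule.span_mono fun _ ⟨j, hj, hf⟩ => ⟨j, hj.trans hkl, hf⟩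

/-- Dually, the first `r k` covectors lie in the span of the iterated derivatives of order at most
k. In the induction step `a j x` is the value at x of a combination f of iterated derivatives. Since
f and `a j` are both sections of the span of the first `r k` covectors, their CR derivatives at x
agree on the annihilator of these covectors, where only the values at x matter. The derivative of f
is in the next span, hence kills v, and `gen` applies. -/
theorem coframeKer_eq_of_nondegSpan (h : AdaptedCoframe S U ρ a r) (hx : x ∈ S ∩ U)
    {ρ' : Cn n → ℝ} (hρ' : IsDefiningFunction S x ρ') (k : ℕ) :
    ∀ v, (∀ θ ∈ nondegSpan S x ρ' k, θ ⬝ᵥ v = 0) → v ∈ coframeKer a (r k) x := by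
  induction k with
  | zero =>
    intro v hv
    have h1 := hv (cgrad ρ' x) (Submodule.subset_span ⟨0, le_rfl, _, IteratedCR.zero, rfl⟩)
    exact ((h.mem_H10 hx (ξ := (v, 0))).1 (hρ'.mem_H10.2 ⟨rfl, h1⟩)).2
  | succ k ih =>
    intro v hv
    have hvk : v ∈ coframeKer a (r k) x :=
      ih v fun θ hθ => hv θ (nondegSpan_mono k.le_succ hθ)
    refine h.gen k x hx v hvk fun j hj L hL => ?_
    have key : ∀ θ ∈ nondegSpan S x ρ' k, ∃ f : Cn n → Cn n, DifferentiableAt ℝ f x ∧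
        (∀ᶠ y in 𝓝[S] x, ∀ j : Fin n, r k ≤ j.val → f y ⬝ᵥ dualFrame a j y = 0) ∧ f x = θ ∧
          cderiv f x L ∈ nondegSpan S x ρ' (k + 1) := by
      intro θ hθ
      induction hθ using Submodule.span_induction with
      | mem θ hθ =>
        obtain ⟨i, hi, f, hf, rfl⟩ := hθ
        obtain ⟨h1, h2⟩ := h.iteratedCR hx hρ' hf
        refine ⟨f, h1.self_of_nhds.differentiableAt (by simp), ?_, rfl, ?_⟩
        · filter_upwards [h2] with y hy l hl using hy l ((h.mono hi).trans hl)
        · obtain ⟨hL1, hL2⟩ := (h.mem_H01 hx).1 hL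
          obtain ⟨V, hVa, hVx, hV⟩ := h.exists_section hx.2 hL2
          have hsec : IsLocalSection S (H01 S) x (fun y => (0, star (V y))) := by
            refine ⟨?_, ?_⟩
            · filter_upwards [h.isOpen.mem_nhds hx.2] with y hy
              exact contDiffAt_const.prodMk (analyticAt_star (hVa y hy)).contDiffAt
            · filter_upwards [h.eventually_mem hx.2] with y hy
              exact (h.mem_H01 hy).2 ⟨rfl, by simpa using hV y hy.2⟩
          refine Submodule.subset_span ⟨i + 1, by omega, _, hf.step hsec, ?_⟩
          simp only [hVx, star_star]
          rw [← hL1]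
      | zero =>
        refine ⟨fun _ => 0, differentiableAt_const _, ?_, rfl, ?_⟩
        · exact Eventually.of_forall fun y j _ => zero_dotProduct _
        · rw [(hasCDeriv_const (0 : Cn n)).2]
          exact Submodule.zero_mem _
      | add θ θ' _ _ ih1 ih2 =>
        obtain ⟨f, f1, f2, f3, f4⟩ := ih1
        obtain ⟨g, g1, g2, g3, g4⟩ := ih2
        refine ⟨fun y => f y + g y, f1.add g1, ?_, by simp only [f3, g3], ?_⟩
        · filter_upwards [f2, g2] with y h1 h2 j hj
          rw [add_dotProduct, h1 j hj, h2 j hj, add_zero]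
        · rw [cderiv_add_left f1 g1]
          exact Submodule.add_mem _ f4 g4
      | smul c θ _ ih1 =>
        obtain ⟨f, f1, f2, f3, f4⟩ := ih1
        refine ⟨fun y => c • f y, f1.const_smul c, ?_, by simp only [f3], ?_⟩
        · filter_upwards [f2] with y h1 j hj
          rw [smul_dotProduct, h1 j hj, smul_zero]
        · rw [cderiv_smul_left c f1]
          exact Submodule.smul_mem _ c f4
    -- The induction hypothesis read backwards: a covector outside the span would be separated from
    -- it by a vector that every covector of the span annihilates.
    have hj' : a j x ∈ nondegSpan S x ρ' k := by
      by_contra hn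
      obtain ⟨w, hw, hne⟩ := exists_dotProduct_of_notMem hn
      exact hne (ih w hw j hj)
    obtain ⟨f, f1, f2, f3, f4⟩ := key _ hj'
    have ha : ∀ᶠ y in 𝓝[S] x, ∀ l : Fin n, r k ≤ l.val → a j y ⬝ᵥ dualFrame a l y = 0 := by
      filter_upwards [h.eventually_mem hx.2] with y hy l hl
      rw [h.dotProduct_dualFrame hy.2, if_neg]
      rintro rfl
      omega
    rw [h.cderiv_dotProduct_eq_sum hx (h.differentiableAt hx.2 j) ha hL hvk, ← f3,
      ← h.cderiv_dotProduct_eq_sum hx f1 f2 hL hvk]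
    exact hv _ f4

theorem dotProduct_eq_zero_of_mem_nondegSpan (h : AdaptedCoframe S U ρ a r) (hx : x ∈ S ∩ U)
    {ρ' : Cn n → ℝ} (hρ' : IsDefiningFunction S x ρ') {k : ℕ} {θ : Cn n}
    (hθ : θ ∈ nondegSpan S x ρ' k) {j : Fin n} (hj : r k ≤ j.val) :
    θ ⬝ᵥ dualFrame a j x = 0 := by
  induction hθ using Submodule.span_induction with
  | mem θ hθ =>
    obtain ⟨i, hi, f, hf, rfl⟩ := hθ
    exact ((h.iteratedCR hx hρ' hf).2.self_of_nhdsWithin hx.1) j ((h.mono hi).trans hj)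
  | zero => exact zero_dotProduct _
  | add θ θ' _ _ ih1 ih2 => rw [add_dotProduct, ih1, ih2, add_zero]
  | smul c θ _ ih => rw [smul_dotProduct, ih, smul_zero]

theorem isNondegenerateAt (h : AdaptedCoframe S U ρ a r) (hx : x ∈ S ∩ U) {k : ℕ}
    (hk : r k = n) (hlt : ∀ j < k, r j < n) : IsNondegenerateAt S k x := by
  refine ⟨⟨ρ, h.defining x hx⟩, fun ρ' hρ' => ⟨?_, fun j hj htop => ?_⟩⟩
  · by_contra hne
    obtain ⟨θ, hθ⟩ : ∃ θ, θ ∉ nondegSpan S x ρ' k := by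
      by_contra! H
      exact hne (Submodule.eq_top_iff'.2 H)
    obtain ⟨v, hv, hne⟩ := exists_dotProduct_of_notMem hθ
    have h0 : v = 0 := h.indep x hx.2 v fun j =>
      h.coframeKer_eq_of_nondegSpan hx hρ' k v hv j (by rw [hk]; exact j.2)
    rw [h0, dotProduct_zero] at hne
    exact hne rfl
  -- The first covector beyond the index r j pairs to 1 with its dual vector, whereas everything of
  -- order at most j pairs to 0 with that vector.
  · have hmem : a ⟨r j, hlt j hj⟩ x ∈ nondegSpan S x ρ' j := htop ▸ Submodule.mem_top
    have := h.dotProduct_eq_zero_of_mem_nondegSpan hx hρ' hmem (j := ⟨r j, hlt j hj⟩) le_rfl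
    rw [h.dotProduct_dualFrame hx.2, if_pos rfl] at this
    exact one_ne_zero this

end AdaptedCoframe

end CR

namespace SevenDim

open CR

/-! ## The manifold of isotropic planes -/

/-- The chart `chart g` as a partial homeomorphism. -/
def chartHomeo (g : SO7C) : OpenPartialHomeomorph IsoGrass (Cn 7) :=
  chartCore.openPartialHomeomorph (chart g) (mem_range_self g)

theorem mem_atlas_iff {e : OpenPartialHomeomorph IsoGrass (Cn 7)} :
    e ∈ atlas (Cn 7) IsoGrass ↔ ∃ g : SO7C, e = chartHomeo g := by
  change e ∈ ⋃ (e : PartialEquiv IsoGrass (Cn 7)) (he : e ∈ chartCore.atlas),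
    {chartCore.openPartialHomeomorph e he} ↔ _
  simp only [mem_iUnion, mem_singleton_iff]
  constructor
  · rintro ⟨_, ⟨g, rfl⟩, rfl⟩
    exact ⟨g, rfl⟩
  · rintro ⟨g, rfl⟩
    exact ⟨chart g, mem_range_self g, rfl⟩

theorem chartHomeo_target (g : SO7C) : (chartHomeo g).target = univ := rfl

theorem mem_chartHomeo_source {g : SO7C} {z : IsoGrass} :
    z ∈ (chartHomeo g).source ↔ ∃ x, g • param x = z := by
  change z ∈ (chart g).source ↔ _
  rw [chart_source]
  rfl

theorem chartHomeo_symm_apply (g : SO7C) (x : Cn 7) : (chartHomeo g).symm x = g • param x := rfl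

theorem chartHomeo_apply (g : SO7C) (x : Cn 7) : chartHomeo g (g • param x) = x := chart_apply g x

theorem mem_coordImage {g : SO7C} {S : Set IsoGrass} {x : Cn 7} :
    x ∈ coordImage (chartHomeo g) S ↔ g • param x ∈ S := by
  rw [coordImage, chartHomeo_target, univ_inter, mem_preimage, chartHomeo_symm_apply]

theorem continuous_smul_param (g : SO7C) : Continuous fun x => g • param x := by
  have := (chartHomeo g).continuousOn_symm
  rw [chartHomeo_target] at this
  exact continuousOn_univ.1 this

theorem isOpen_image_smul_param (g : SO7C) {U : Set (Cn 7)} (hU : IsOpen U) :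
    IsOpen ((fun x => g • param x) '' U) :=
  (chartHomeo g).isOpen_image_symm_of_subset_target hU (subset_univ _)

theorem contDiff_vecA : ContDiff ℂ ω vecA := by
  rw [contDiff_pi]
  intro i
  fin_cases i <;> simp only [vecA] <;> dsimp <;> fun_prop

theorem contDiff_vecB : ContDiff ℂ ω vecB := by
  rw [contDiff_pi]
  intro i
  fin_cases i <;> simp only [vecB] <;> dsimp <;> fun_prop

theorem contDiff_moveA (g : SO7C) : ContDiff ℂ ω (moveA g) :=
  (LinearMap.toContinuousLinearMap (Matrix.mulVecLin g.val.val)).contDiff.comp contDiff_vecA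

theorem contDiff_moveB (g : SO7C) : ContDiff ℂ ω (moveB g) :=
  (LinearMap.toContinuousLinearMap (Matrix.mulVecLin g.val.val)).contDiff.comp contDiff_vecB

theorem contDiffOn_transition (g : SO7C) :
    ContDiffOn ℂ ω (transition g) {x | minor g x ≠ 0} := by
  have hA : ∀ i, ContDiff ℂ ω (fun x => moveA g x i) := contDiff_pi.1 (contDiff_moveA g)
  have hB : ∀ i, ContDiff ℂ ω (fun x => moveB g x i) := contDiff_pi.1 (contDiff_moveB g)
  have hm : ContDiff ℂ ω (minor g) := ((hA 0).mul (hB 1)).sub ((hA 1).mul (hB 0))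
  have hmi : ContDiffOn ℂ ω (fun x => (minor g x)⁻¹) {x | minor g x ≠ 0} :=
    hm.contDiffOn.inv fun x hx => hx
  have h1 : ∀ i, ContDiffOn ℂ ω (fun x => ((minor g x)⁻¹ •
      (moveB g x 1 • moveA g x - moveA g x 1 • moveB g x)) i) {x | minor g x ≠ 0} := fun i =>
    hmi.mul (((hB 1).mul (hA i)).sub ((hA 1).mul (hB i))).contDiffOn
  have h2 : ∀ i, ContDiffOn ℂ ω (fun x => ((minor g x)⁻¹ •
      (moveA g x 0 • moveB g x - moveB g x 0 • moveA g x)) i) {x | minor g x ≠ 0} := fun i =>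
    hmi.mul (((hA 0).mul (hB i)).sub ((hB 0).mul (hA i))).contDiffOn
  rw [contDiffOn_pi]
  intro i
  fin_cases i
  · exact h1 2
  · exact h1 3
  · exact h1 4
  · exact h2 2
  · exact h2 3
  · exact h2 4
  · exact h1 5

instance isManifold_isoGrass : IsManifold 𝓘(ℂ, Cn 7) ω IsoGrass := by
  refine isManifold_of_contDiffOn _ _ _ fun e e' he he' => ?_
  obtain ⟨g, rfl⟩ := mem_atlas_iff.1 he
  obtain ⟨k, rfl⟩ := mem_atlas_iff.1 he'
  have hs : ((chartHomeo g).symm ≫ₕ chartHomeo k).source = {x | minor (k⁻¹ * g) x ≠ 0} :=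
    trans_source g k
  simp only [modelWithCornersSelf_coe, modelWithCornersSelf_coe_symm, range_id, inter_univ,
    Function.id_comp, Function.comp_id, preimage_id, hs]
  exact (contDiffOn_transition _).congr fun x hx => trans_apply g k hx

/-- Read in the charts of g and of k * g, the action of k is the identity of ℂ⁷. -/
theorem contMDiff_smul (k : SO7C) :
    ContMDiff 𝓘(ℂ, Cn 7) 𝓘(ℂ, Cn 7) ω (fun z : IsoGrass => k • z) := by
  intro z
  obtain ⟨g, hg⟩ := exists_mem_chart_source z
  have hmax : ∀ g, chartHomeo g ∈ IsManifold.maximalAtlas 𝓘(ℂ, Cn 7) ω IsoGrass := fun g =>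
    IsManifold.subset_maximalAtlas (mem_atlas_iff.2 ⟨g, rfl⟩)
  have h1 := contMDiffOn_of_mem_maximalAtlas (hmax g)
  have h2 := contMDiffOn_symm_of_mem_maximalAtlas (hmax (k * g))
  have h3 := h2.comp h1 (fun _ _ => mem_univ _)
  have hz : (chartHomeo g).source ∈ 𝓝 z := (chartHomeo g).open_source.mem_nhds hg
  refine (h3.contMDiffAt hz).congr_of_eventuallyEq ?_
  filter_upwards [hz] with y hy
  obtain ⟨x, rfl⟩ := mem_chartHomeo_source.1 hy
  simp only [Function.comp_apply, chartHomeo_apply, chartHomeo_symm_apply, mul_smul]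

/-! ## Adapted bases -/

theorem bform_comm (v w : Cn 7) : bform v w = bform w v := by
  rw [bform_apply, bform_apply]; ring

theorem bform_sum_left {ι : Type*} (s : Finset ι) (v : ι → Cn 7) (w : Cn 7) :
    bform (∑ i ∈ s, v i) w = ∑ i ∈ s, bform (v i) w := by
  simp only [bform, Finset.sum_apply, Finset.sum_mul]
  exact Finset.sum_comm

theorem bform_sum_right {ι : Type*} (s : Finset ι) (v : Cn 7) (w : ι → Cn 7) :
    bform v (∑ i ∈ s, w i) = ∑ i ∈ s, bform v (w i) := by
  simp only [bform_comm v, bform_sum_left]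

theorem bform_star (v w : Cn 7) : bform (star v) (star w) = star (bform v w) := by
  simp [bform]

/-- The element of `SO(7, ℂ)` whose columns form a basis in which `b` has its standard form. -/
def ofColumns (f : Fin 7 → Cn 7)
    (hf : ∀ i j, bform (f i) (f j) = if j = Fin.rev i then 1 else 0)
    (hdet : (Matrix.of f).det = 1) : SO7C :=
  ⟨Matrix.GeneralLinearGroup.mkOfDetNeZero (Matrix.of f).transpose
    (by rw [Matrix.det_transpose, hdet]; exact one_ne_zero), by
    refine ⟨fun v w => ?_, by change (Matrix.of f).transpose.det = 1; rw [Matrix.det_transpose, hdet]⟩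
    have hm : ∀ v : Cn 7, (Matrix.of f).transpose.mulVec v = ∑ i, v i • f i := by
      intro v
      ext k
      simp only [Matrix.mulVec, dotProduct, Matrix.transpose_apply, Matrix.of_apply,
        Finset.sum_apply, Pi.smul_apply, smul_eq_mul]
      exact Finset.sum_congr rfl fun j _ => mul_comm _ _
    change bform ((Matrix.of f).transpose.mulVec v) ((Matrix.of f).transpose.mulVec w) = _
    rw [hm, hm, bform_sum_left]
    simp only [bform_sum_right, bform_smul_left, bform_smul_right, hf]
    simp [bform, mul_comm]⟩

theorem ofColumns_apply (f : Fin 7 → Cn 7) (hf hdet) (i j : Fin 7) :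
    (ofColumns f hf hdet).val.val i j = f j i := rfl

theorem ofColumns_mulVec_single (f : Fin 7 → Cn 7) (hf hdet) (i : Fin 7) :
    (ofColumns f hf hdet).val.val.mulVec (Pi.single i 1) = f i := by
  ext k
  simp [ofColumns_apply]

theorem vecA_zero : vecA 0 = Pi.single 0 1 := by
  ext i; fin_cases i <;> simp [vecA]

theorem vecB_zero : vecB 0 = Pi.single 1 1 := by
  ext i; fin_cases i <;> simp [vecB]

theorem smul_param_plane (g : SO7C) (x : Cn 7) : (g • param x).plane =
    Submodule.span ℂ {moveA g x, moveB g x} := by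
  rw [smul_plane]
  change Submodule.map _ (Submodule.span ℂ _) = _
  rw [Submodule.map_span, Set.image_pair]
  rfl

theorem ofColumns_smul_param_zero (f : Fin 7 → Cn 7) (hf hdet) :
    (ofColumns f hf hdet • param 0).plane = Submodule.span ℂ {f 0, f 1} := by
  rw [smul_param_plane, moveA, moveB, vecA_zero, vecB_zero, ofColumns_mulVec_single,
    ofColumns_mulVec_single]

/-- The holomorphic family of isomorphisms from `ℂ³` onto a complement of `E` in `E^⊥`, where `E` is
the isotropic plane with coordinates `x`. -/
def perp (x : Cn 7) (y : Cn 3) : Cn 7 :=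
  ![0, 0, y 0, y 1, y 2, -(y 0 * x 5 + y 1 * x 4 + y 2 * x 3), -(y 0 * x 2 + y 1 * x 1 + y 2 * x 0)]

/-- The basis of `ℂ⁷` formed by the normalized basis of an isotropic plane `E`, a basis of a
complement of `E` in `E^⊥`, and two constant vectors. -/
def unipotentColumns (x : Cn 7) : Fin 7 → Cn 7 :=
  ![vecA x, vecB x, perp x ![1, 0, 0], perp x ![0, 1, 0], perp x ![0, 0, 1], Pi.single 5 1,
    Pi.single 6 1]

theorem bform_unipotentColumns (x : Cn 7) (i j : Fin 7) :
    bform (unipotentColumns x i) (unipotentColumns x j) = if j = Fin.rev i then 1 else 0 := by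
  rw [bform_apply]
  fin_cases i <;> fin_cases j <;>
    simp [unipotentColumns, vecA, vecB, perp, Fin.rev] <;> ring

theorem det_unipotentColumns (x : Cn 7) : (Matrix.of (unipotentColumns x)).det = 1 := by
  rw [Matrix.det_of_isUpperTriangular]
  · simp [Fin.prod_univ_seven, unipotentColumns, vecA, vecB, perp]
  · intro i j hij
    fin_cases i <;> fin_cases j <;> revert hij <;>
      simp [unipotentColumns, vecA, vecB, perp]

/-- The unipotent matrix with columns `unipotentColumns x` carries the origin of the standard chart
to the point with coordinates x, so charts are needed only at their origin. -/
theorem exists_smul_param_zero (z : IsoGrass) : ∃ g : SO7C, z = g • param 0 := by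
  obtain ⟨g, hg⟩ := exists_mem_chart_source z
  obtain ⟨x, rfl⟩ := mem_chartHomeo_source.1 hg
  refine ⟨g * ofColumns _ (bform_unipotentColumns x) (det_unipotentColumns x), ?_⟩
  rw [mul_smul]
  congr 1
  apply IsoGrass.ext
  rw [ofColumns_smul_param_zero]
  rfl

theorem isPretransitive_isoGrass : MulAction.IsPretransitive SO7C IsoGrass := by
  refine ⟨fun z z' => ?_⟩
  obtain ⟨g, rfl⟩ := exists_smul_param_zero z
  obtain ⟨g', rfl⟩ := exists_smul_param_zero z'
  exact ⟨g' * g⁻¹, by rw [mul_smul, inv_smul_smul]⟩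

end SevenDim

namespace SevenDim

open CR

theorem bform_sub_left (u v w : Cn 7) : bform (u - v) w = bform u w - bform v w := by
  simp [bform, sub_mul, Finset.sum_sub_distrib]

theorem bform_sub_right (u v w : Cn 7) : bform u (v - w) = bform u v - bform u w := by
  simp [bform, mul_sub, Finset.sum_sub_distrib]

theorem bform_zero_left (v : Cn 7) : bform 0 v = 0 := by simp [bform]

theorem bform_zero_right (v : Cn 7) : bform v 0 = 0 := by simp [bform]

theorem _root_.CR.HasCDeriv.bform {f g : Cn 7 → Cn 7} {x : Cn 7} {ξ : CT 7} {d e : Cn 7}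
    (hf : HasCDeriv f x ξ d) (hg : HasCDeriv g x ξ e) :
    HasCDeriv (fun y => bform (f y) (g y)) x ξ (bform d (g x) + bform (f x) e) := by
  refine (HasCDeriv.sum Finset.univ fun i _ => (hf.apply i).mul (hg.apply (Fin.rev i))).congr ?_
  simp only [Finset.sum_add_distrib, SevenDim.bform]

/-! ## The complex conjugation read in a chart -/

/-- The complex conjugation of `ℂ⁷` read in the basis given by `g`. -/
def cj (g : SO7C) (v : Cn 7) : Cn 7 := (g⁻¹).val.val.mulVec (star (g.val.val.mulVec v))

theorem mulVec_inv_mulVec (g : SO7C) (v : Cn 7) :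
    g.val.val.mulVec ((g⁻¹).val.val.mulVec v) = v := by
  rw [Matrix.mulVec_mulVec, ← Units.val_mul, ← Subgroup.coe_mul, mul_inv_cancel]
  simp

theorem inv_mulVec_mulVec (g : SO7C) (v : Cn 7) :
    (g⁻¹).val.val.mulVec (g.val.val.mulVec v) = v := by
  rw [Matrix.mulVec_mulVec, ← Units.val_mul, ← Subgroup.coe_mul, inv_mul_cancel]
  simp

theorem mulVec_cj (g : SO7C) (v : Cn 7) : g.val.val.mulVec (cj g v) = star (g.val.val.mulVec v) :=
  mulVec_inv_mulVec g _

theorem cj_cj (g : SO7C) (v : Cn 7) : cj g (cj g v) = v := by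
  rw [cj, mulVec_cj, star_star, inv_mulVec_mulVec]

theorem cj_add (g : SO7C) (v w : Cn 7) : cj g (v + w) = cj g v + cj g w := by
  simp only [cj, Matrix.mulVec_add, star_add]

theorem cj_sub (g : SO7C) (v w : Cn 7) : cj g (v - w) = cj g v - cj g w := by
  simp only [cj, Matrix.mulVec_sub, star_sub]

theorem cj_smul (g : SO7C) (c : ℂ) (v : Cn 7) : cj g (c • v) = star c • cj g v := by
  simp only [cj, Matrix.mulVec_smul, star_smul]

theorem cj_zero (g : SO7C) : cj g 0 = 0 := by simp [cj]

theorem bform_cj_cj (g : SO7C) (v w : Cn 7) : bform (cj g v) (cj g w) = star (bform v w) := by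
  rw [cj, cj, (g⁻¹).2.1, bform_star, g.2.1]

theorem bform_cj_left (g : SO7C) (v w : Cn 7) : bform (cj g v) w = star (bform v (cj g w)) := by
  rw [← bform_cj_cj, cj_cj]

theorem hform_mulVec (g : SO7C) (v w : Cn 7) :
    hform (g.val.val.mulVec v) (g.val.val.mulVec w) = bform v (cj g w) := by
  rw [hform, ← mulVec_cj, g.2.1]

theorem _root_.CR.HasCDeriv.cj (g : SO7C) {f : Cn 7 → Cn 7} {x : Cn 7} {ξ : CT 7} {d : Cn 7}
    (h : HasCDeriv f x (star ξ.2, star ξ.1) d) :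
    HasCDeriv (fun y => cj g (f y)) x ξ (SevenDim.cj g d) :=
  (HasCDeriv.star_pi (h.clm_comp (LinearMap.toContinuousLinearMap
    (Matrix.mulVecLin g.val.val)))).clm_comp (LinearMap.toContinuousLinearMap
      (Matrix.mulVecLin (g⁻¹).val.val))

/-! ## Isotropic planes and their orthogonal complements in coordinates -/

/-- The derivative of `vecA` at `x` in the direction `l`. -/
def dvecA (x l : Cn 7) : Cn 7 :=
  ![0, 0, l 0, l 1, l 2, l 6, -(l 0 * x 2 + x 0 * l 2 + x 1 * l 1)]

/-- The derivative of `vecB` at `x` in the direction `l`. -/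
def dvecB (x l : Cn 7) : Cn 7 :=
  ![0, 0, l 3, l 4, l 5, -(l 3 * x 5 + x 3 * l 5 + x 4 * l 4),
    -l 6 - (l 0 * x 5 + x 0 * l 5 + (l 1 * x 4 + x 1 * l 4) + (l 2 * x 3 + x 2 * l 3))]

theorem hasCDeriv_coord (x : Cn 7) (ξ : CT 7) (i : Fin 7) :
    HasCDeriv (fun y : Cn 7 => y i) x ξ (ξ.1 i) :=
  hasCDeriv_of_holomorphic (ContinuousLinearMap.proj (R := ℂ) i).hasFDerivAt ξ

theorem hasCDeriv_vecA (x : Cn 7) (ξ : CT 7) : HasCDeriv vecA x ξ (dvecA x ξ.1) := by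
  have h := hasCDeriv_coord x ξ
  refine HasCDeriv.pi fun i => ?_
  fin_cases i
  · exact hasCDeriv_const 1
  · exact hasCDeriv_const 0
  · exact h 0
  · exact h 1
  · exact h 2
  · exact h 6
  · have h2 := (((h 0).mul (h 2)).add (((h 1).mul (h 1)).mul (hasCDeriv_const (1 / 2)))).neg
    have e : (fun y : Cn 7 => vecA y ((fun i => i) ⟨6, by omega⟩)) =
        fun y => -(y 0 * y 2 + y 1 * y 1 * (1 / 2)) := by
      ext y; simp [vecA]; ring
    rw [e]
    refine h2.congr ?_
    simp [dvecA]; ring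

theorem hasCDeriv_vecB (x : Cn 7) (ξ : CT 7) : HasCDeriv vecB x ξ (dvecB x ξ.1) := by
  have h := hasCDeriv_coord x ξ
  refine HasCDeriv.pi fun i => ?_
  fin_cases i
  · exact hasCDeriv_const 0
  · exact hasCDeriv_const 1
  · exact h 3
  · exact h 4
  · exact h 5
  · have h2 := (((h 3).mul (h 5)).add (((h 4).mul (h 4)).mul (hasCDeriv_const (1 / 2)))).neg
    have e : (fun y : Cn 7 => vecB y ((fun i => i) ⟨5, by omega⟩)) =
        fun y => -(y 3 * y 5 + y 4 * y 4 * (1 / 2)) := by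
      ext y; simp [vecB]; ring
    rw [e]
    refine h2.congr ?_
    simp [dvecB]; ring
  · have h2 := (h 6).neg.sub ((((h 0).mul (h 5)).add ((h 1).mul (h 4))).add ((h 2).mul (h 3)))
    exact h2

/-- For fixed l the vector `dvecA y l` is holomorphic in y, so it does not change in
(0,1)-directions. -/
theorem hasCDeriv_dvecA (x l : Cn 7) {ξ : CT 7} (hξ : ξ.1 = 0) :
    HasCDeriv (fun y => dvecA y l) x ξ 0 := by
  have h := fun i => (hasCDeriv_coord x ξ i).congr (show ξ.1 i = 0 by rw [hξ]; rfl)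
  refine HasCDeriv.pi fun i => ?_
  fin_cases i
  on_goal 7 =>
    have h2 := ((((hasCDeriv_const (l 0)).mul (h 2)).add ((h 0).mul (hasCDeriv_const (l 2)))).add
      ((h 1).mul (hasCDeriv_const (l 1)))).neg
    exact h2.congr (by simp)
  all_goals exact hasCDeriv_const _

theorem hasCDeriv_dvecB (x l : Cn 7) {ξ : CT 7} (hξ : ξ.1 = 0) :
    HasCDeriv (fun y => dvecB y l) x ξ 0 := by
  have h := fun i => (hasCDeriv_coord x ξ i).congr (show ξ.1 i = 0 by rw [hξ]; rfl)
  refine HasCDeriv.pi fun i => ?_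
  fin_cases i
  on_goal 6 =>
    have h2 := ((((hasCDeriv_const (l 3)).mul (h 5)).add ((h 3).mul (hasCDeriv_const (l 5)))).add
      ((h 4).mul (hasCDeriv_const (l 4)))).neg
    exact h2.congr (by simp)
  on_goal 6 =>
    have h2 := (hasCDeriv_const (-l 6)).sub
      (((((hasCDeriv_const (l 0)).mul (h 5)).add ((h 0).mul (hasCDeriv_const (l 5)))).add
      (((hasCDeriv_const (l 1)).mul (h 4)).add ((h 1).mul (hasCDeriv_const (l 4))))).add
      (((hasCDeriv_const (l 2)).mul (h 3)).add ((h 2).mul (hasCDeriv_const (l 3)))))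
    exact h2.congr (by simp)
  all_goals exact hasCDeriv_const _

/-- The coordinates of a vector of `E^⊥` modulo `E`. -/
def perpCoord (x y : Cn 7) : Cn 3 :=
  ![y 2 - y 0 * x 0 - y 1 * x 3, y 3 - y 0 * x 1 - y 1 * x 4, y 4 - y 0 * x 2 - y 1 * x 5]

/-- The bilinear form on `ℂ³ ≅ E^⊥ / E`. -/
def form3 (m s : Cn 3) : ℂ := m 0 * s 2 + m 1 * s 1 + m 2 * s 0

/-- The cross product of `ℂ³` with respect to `form3`. -/
def cross3 (m s : Cn 3) : Cn 3 :=
  ![m 0 * s 1 - m 1 * s 0, m 2 * s 0 - m 0 * s 2, m 1 * s 2 - m 2 * s 1]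

/-- Lagrange's identity. For isotropic m it shows that m × s is not isotropic as soon as (m,s) ≠ 0,
the source of the nondegeneracy of `orthU`. -/
theorem form3_cross3_self (m s : Cn 3) :
    form3 (cross3 m s) (cross3 m s) = form3 m s ^ 2 - form3 m m * form3 s s := by
  simp [form3, cross3]; ring

theorem form3_cross3_left (m s : Cn 3) : form3 (cross3 m s) m = 0 := by
  simp [form3, cross3]; ring

theorem form3_comm (m s : Cn 3) : form3 m s = form3 s m := by
  simp [form3]; ring

/-- A vector orthogonal to an isotropic vector `m` and to `m × s` is a multiple of `m`. -/
theorem eq_smul_of_form3_eq_zero {m s y : Cn 3} (hm : form3 m m = 0) (hms : form3 m s ≠ 0)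
    (h1 : form3 y m = 0) (h2 : form3 y (cross3 m s) = 0) :
    y = (form3 y s / form3 m s) • m := by
  have key : ∀ i, form3 m s ^ 2 * y i = form3 y s * form3 m s * m i := by
    intro i
    -- The expansion of y in m, s and m × s, cleared of denominators and sorted so that each
    -- remaining term contains one of the three quantities that vanish.
    have e : form3 m s ^ 2 * y i = form3 y s * form3 m s * m i +
        (form3 s s * y i - form3 y s * s i) * form3 m m +
        (form3 m s * s i - form3 s s * m i) * form3 y m +
        cross3 m s i * form3 y (cross3 m s) := by
      fin_cases i <;> simp [form3, cross3] <;> ring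
    rw [e, hm, h1, h2]
    ring
  ext i
  rw [Pi.smul_apply, smul_eq_mul]
  field_simp
  have := key i
  have h3 : form3 m s * (y i * form3 m s - form3 y s * m i) = 0 := by linear_combination this
  linear_combination (mul_eq_zero.1 h3).resolve_left hms

theorem bform_perp_vecA (x : Cn 7) (m : Cn 3) : bform (perp x m) (vecA x) = 0 := by
  rw [bform_apply]; simp [perp, vecA]

theorem bform_perp_vecB (x : Cn 7) (m : Cn 3) : bform (perp x m) (vecB x) = 0 := by
  rw [bform_apply]; simp [perp, vecB]

theorem bform_perp_perp (x : Cn 7) (m s : Cn 3) : bform (perp x m) (perp x s) = form3 m s := by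
  rw [bform_apply]; simp [perp, form3]

theorem eq_add_perp {x y : Cn 7} (hA : bform y (vecA x) = 0) (hB : bform y (vecB x) = 0) :
    y = y 0 • vecA x + y 1 • vecB x + perp x (perpCoord x y) := by
  rw [bform_apply] at hA hB
  simp [vecA, vecB] at hA hB
  ext i
  fin_cases i <;> simp [vecA, vecB, perp, perpCoord]
  · linear_combination hB
  · linear_combination hA

end SevenDim

/-! ### Plane frames: one set of properties for both orders of the normalized basis -/

namespace SevenDim

open CR

/-- `P`, `W` is the normalized holomorphic basis of the isotropic planes, in one of its two orders,
and `dP`, `dW` are the derivatives of `P`, `W`. -/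
structure PlaneFrame (P W : Cn 7 → Cn 7) (dP dW : Cn 7 → Cn 7 → Cn 7) : Prop where
  derivP : ∀ x ξ, HasCDeriv P x ξ (dP x ξ.1)
  derivW : ∀ x ξ, HasCDeriv W x ξ (dW x ξ.1)
  derivdP : ∀ x l (ξ : CT 7), ξ.1 = 0 → HasCDeriv (fun y => dP y l) x ξ 0
  derivdW : ∀ x l (ξ : CT 7), ξ.1 = 0 → HasCDeriv (fun y => dW y l) x ξ 0
  bPP : ∀ x, bform (P x) (P x) = 0
  bPW : ∀ x, bform (P x) (W x) = 0
  bWW : ∀ x, bform (W x) (W x) = 0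
  surj : ∀ x y₁ y₂, bform y₁ (P x) = 0 → bform y₂ (W x) = 0 →
    bform y₁ (W x) + bform y₂ (P x) = 0 →
    ∃ (l : Cn 7) (a b c d : ℂ), dP x l = y₁ + (a • P x + b • W x) ∧ dW x l = y₂ + (c • P x + d • W x)
  inj : ∀ (x l : Cn 7) (a b c d : ℂ), dP x l = a • P x + b • W x → dW x l = c • P x + d • W x → l = 0
  decomp : ∀ x y, bform y (P x) = 0 → bform y (W x) = 0 →
    ∃ a b : ℂ, y = a • P x + b • W x + perp x (perpCoord x y)
  bperpP : ∀ x m, bform (perp x m) (P x) = 0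
  bperpW : ∀ x m, bform (perp x m) (W x) = 0
  contP : ContDiff ℝ ω P
  contW : ContDiff ℝ ω W
  contdP : ∀ l, ContDiff ℝ ω (fun x => dP x l)
  contdW : ∀ l, ContDiff ℝ ω (fun x => dW x l)
  lindP : ∀ x l, dP x l = ∑ i, l i • dP x (Pi.single i 1)
  lindW : ∀ x l, dW x l = ∑ i, l i • dW x (Pi.single i 1)

theorem bform_vecA_vecA (x : Cn 7) : bform (vecA x) (vecA x) = 0 := by
  rw [bform_apply]; simp [vecA]; ring

theorem bform_vecB_vecB (x : Cn 7) : bform (vecB x) (vecB x) = 0 := by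
  rw [bform_apply]; simp [vecB]; ring

theorem bform_vecA_vecB (x : Cn 7) : bform (vecA x) (vecB x) = 0 := by
  rw [bform_apply]; simp [vecA, vecB]; ring

theorem contDiff_dvecA (l : Cn 7) : ContDiff ℝ ω (fun x => dvecA x l) := by
  rw [contDiff_pi]
  intro i
  fin_cases i <;> simp only [dvecA] <;> dsimp <;> fun_prop

theorem contDiff_dvecB (l : Cn 7) : ContDiff ℝ ω (fun x => dvecB x l) := by
  rw [contDiff_pi]
  intro i
  fin_cases i <;> simp only [dvecB] <;> dsimp <;> fun_prop

theorem dvecA_eq_sum (x l : Cn 7) : dvecA x l = ∑ i, l i • dvecA x (Pi.single i 1) := by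
  ext k
  rw [Finset.sum_apply, Fin.sum_univ_seven]
  fin_cases k <;> (simp [dvecA]; try ring)

theorem dvecB_eq_sum (x l : Cn 7) : dvecB x l = ∑ i, l i • dvecB x (Pi.single i 1) := by
  ext k
  rw [Finset.sum_apply, Fin.sum_univ_seven]
  fin_cases k <;> (simp [dvecB]; try ring)

/-- Every first-order deformation of the basis that preserves isotropy is tangent to Z, up to a
change of basis of the plane. The witnesses subtract from y₁ and y₂ the combination of basis vectors
with the same first two coordinates, since derivatives of the normalized basis have these
coordinates zero. -/
theorem exists_dvec (x y₁ y₂ : Cn 7) (h1 : bform y₁ (vecA x) = 0) (h2 : bform y₂ (vecB x) = 0)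
    (h3 : bform y₁ (vecB x) + bform y₂ (vecA x) = 0) :
    ∃ (l : Cn 7) (a b c d : ℂ), dvecA x l = y₁ + (a • vecA x + b • vecB x) ∧
      dvecB x l = y₂ + (c • vecA x + d • vecB x) := by
  rw [bform_apply] at h1 h2
  rw [bform_apply, bform_apply] at h3
  simp [vecA, vecB] at h1 h2 h3
  refine ⟨![y₁ 2 - y₁ 0 * x 0 - y₁ 1 * x 3, y₁ 3 - y₁ 0 * x 1 - y₁ 1 * x 4,
    y₁ 4 - y₁ 0 * x 2 - y₁ 1 * x 5, y₂ 2 - y₂ 0 * x 0 - y₂ 1 * x 3,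
    y₂ 3 - y₂ 0 * x 1 - y₂ 1 * x 4, y₂ 4 - y₂ 0 * x 2 - y₂ 1 * x 5,
    y₁ 5 - y₁ 0 * x 6 - y₁ 1 * (-(x 3 * x 5 + x 4 ^ 2 / 2))], -y₁ 0, -y₁ 1, -y₂ 0, -y₂ 1, ?_, ?_⟩
  · ext i
    fin_cases i <;> simp [dvecA, vecA, vecB]
    all_goals first | ring1 | linear_combination -h1
  · ext i
    fin_cases i <;> simp [dvecB, vecA, vecB]
    all_goals first | ring1 | linear_combination -h2 | linear_combination -h3

/-- The first two coordinates of the derivatives vanish while those of the basis are the unit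
vectors, so all four coefficients are zero; l is then read off from the entries. -/
theorem dvec_injective (x l : Cn 7) (a b c d : ℂ) (h1 : dvecA x l = a • vecA x + b • vecB x)
    (h2 : dvecB x l = c • vecA x + d • vecB x) : l = 0 := by
  have e0 := congrFun h1 0
  have e1 := congrFun h1 1
  have f0 := congrFun h2 0
  have f1 := congrFun h2 1
  simp [dvecA, dvecB, vecA, vecB] at e0 e1 f0 f1
  subst e0 e1 f0 f1
  simp only [zero_smul, add_zero] at h1 h2
  ext i
  fin_cases i
  · simpa [dvecA] using congrFun h1 2
  · simpa [dvecA] using congrFun h1 3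
  · simpa [dvecA] using congrFun h1 4
  · simpa [dvecB] using congrFun h2 2
  · simpa [dvecB] using congrFun h2 3
  · simpa [dvecB] using congrFun h2 4
  · simpa [dvecA] using congrFun h1 5

theorem planeFrame_AB : PlaneFrame vecA vecB dvecA dvecB where
  derivP := hasCDeriv_vecA
  derivW := hasCDeriv_vecB
  derivdP := fun x l _ h => hasCDeriv_dvecA x l h
  derivdW := fun x l _ h => hasCDeriv_dvecB x l h
  bPP := bform_vecA_vecA
  bPW := bform_vecA_vecB
  bWW := bform_vecB_vecB
  surj := exists_dvec
  inj := dvec_injective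
  decomp := fun _ y hA hB => ⟨y 0, y 1, eq_add_perp hA hB⟩
  bperpP := bform_perp_vecA
  bperpW := bform_perp_vecB
  contP := contDiff_vecA.restrict_scalars ℝ
  contW := contDiff_vecB.restrict_scalars ℝ
  contdP := contDiff_dvecA
  contdW := contDiff_dvecB
  lindP := dvecA_eq_sum
  lindW := dvecB_eq_sum

theorem planeFrame_BA : PlaneFrame vecB vecA dvecB dvecA where
  derivP := hasCDeriv_vecB
  derivW := hasCDeriv_vecA
  derivdP := fun x l _ h => hasCDeriv_dvecB x l h
  derivdW := fun x l _ h => hasCDeriv_dvecA x l h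
  bPP := bform_vecB_vecB
  bPW := fun x => by rw [bform_comm, bform_vecA_vecB]
  bWW := bform_vecA_vecA
  surj := fun x y₁ y₂ h1 h2 h3 => by
    obtain ⟨l, a, b, c, d, e1, e2⟩ := exists_dvec x y₂ y₁ h2 h1 (by rw [add_comm]; exact h3)
    exact ⟨l, d, c, b, a, by rw [e2, add_comm (c • _)], by rw [e1, add_comm (a • _)]⟩
  inj := fun x l a b c d h1 h2 => dvec_injective x l d c b a (by rw [h2, add_comm])
    (by rw [h1, add_comm])
  decomp := fun x y hB hA => ⟨y 1, y 0, by
    rw [add_comm (y 1 • vecB x)]; exact eq_add_perp hA hB⟩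
  bperpP := bform_perp_vecB
  bperpW := bform_perp_vecA
  contP := contDiff_vecB.restrict_scalars ℝ
  contW := contDiff_vecA.restrict_scalars ℝ
  contdP := contDiff_dvecB
  contdW := contDiff_dvecA
  lindP := dvecB_eq_sum
  lindW := dvecA_eq_sum

/-! ## The coframe -/

section Coframe

/-- The Hermitian form `h` on two vector fields, in the chart of `g`. -/
def hermF (g : SO7C) (P Q : Cn 7 → Cn 7) (x : Cn 7) : ℂ := bform (P x) (cj g (Q x))

/-- A vector of the plane spanned by `P x`, `W x` that is `h`-orthogonal to `W x`. -/
def kerV (g : SO7C) (P W : Cn 7 → Cn 7) (x : Cn 7) : Cn 7 :=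
  hermF g W W x • P x - hermF g P W x • W x

/-- The conjugate of `kerV`. -/
def kerC (g : SO7C) (P W : Cn 7 → Cn 7) (x : Cn 7) : Cn 7 := cj g (kerV g P W x)

/-- The coordinates of `kerC` in `E^⊥ / E`. -/
def kerM (g : SO7C) (P W : Cn 7 → Cn 7) (x : Cn 7) : Cn 3 := perpCoord x (kerC g P W x)

/-- A vector of `E^⊥` that is orthogonal to the conjugates of `kerV` and of `W`. -/
def orthU (g : SO7C) (P W : Cn 7 → Cn 7) (s : Cn 3) (x : Cn 7) : Cn 7 :=
  hermF g W W x • perp x (cross3 (kerM g P W x) s) -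
    bform (perp x (cross3 (kerM g P W x) s)) (cj g (W x)) • W x

/-- The determinant of the Gram matrix of `h`. -/
def gram (g : SO7C) (P W : Cn 7 → Cn 7) (x : Cn 7) : ℂ :=
  hermF g P P x * hermF g W W x - hermF g P W x * hermF g W P x

/-- The derivative of `kerV` modulo the plane itself. -/
def dkerV (g : SO7C) (P W : Cn 7 → Cn 7) (dP dW : Cn 7 → Cn 7 → Cn 7) (x l : Cn 7) : Cn 7 :=
  hermF g W W x • dP x l - hermF g P W x • dW x l

theorem star_hermF (g : SO7C) (P Q : Cn 7 → Cn 7) (x : Cn 7) :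
    star (hermF g P Q x) = hermF g Q P x := by
  rw [hermF, hermF, ← bform_cj_cj, cj_cj, bform_comm]

theorem kerC_eq (g : SO7C) (P W : Cn 7 → Cn 7) (x : Cn 7) :
    kerC g P W x = hermF g W W x • cj g (P x) - hermF g W P x • cj g (W x) := by
  rw [kerC, kerV, cj_sub, cj_smul, cj_smul, star_hermF, star_hermF]

variable {g : SO7C} {P W : Cn 7 → Cn 7} {dP dW : Cn 7 → Cn 7 → Cn 7} {s : Cn 3} {x : Cn 7}

namespace PlaneFrame

theorem bWP (h : PlaneFrame P W dP dW) (x : Cn 7) : bform (W x) (P x) = 0 := by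
  rw [bform_comm, h.bPW]

/-- This and the next two lemmas differentiate the isotropy relations of the basis. -/
theorem dPP (h : PlaneFrame P W dP dW) (x l : Cn 7) : bform (dP x l) (P x) = 0 := by
  have h1 := (h.derivP x (l, 0)).bform (h.derivP x (l, 0))
  have h2 : HasCDeriv (fun y => bform (P y) (P y)) x (l, 0) 0 := by
    simp only [h.bPP]; exact hasCDeriv_const 0
  have := h1.unique h2
  rw [bform_comm (P x)] at this
  linear_combination this / 2

theorem dWW (h : PlaneFrame P W dP dW) (x l : Cn 7) : bform (dW x l) (W x) = 0 := by
  have h1 := (h.derivW x (l, 0)).bform (h.derivW x (l, 0))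
  have h2 : HasCDeriv (fun y => bform (W y) (W y)) x (l, 0) 0 := by
    simp only [h.bWW]; exact hasCDeriv_const 0
  have := h1.unique h2
  rw [bform_comm (W x)] at this
  linear_combination this / 2

theorem dPW (h : PlaneFrame P W dP dW) (x l : Cn 7) :
    bform (dP x l) (W x) + bform (dW x l) (P x) = 0 := by
  have h1 := (h.derivP x (l, 0)).bform (h.derivW x (l, 0))
  have h2 : HasCDeriv (fun y => bform (P y) (W y)) x (l, 0) 0 := by
    simp only [h.bPW]; exact hasCDeriv_const 0
  have := h1.unique h2
  rwa [bform_comm (P x)] at this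

theorem bkerV_cW : bform (kerV g P W x) (cj g (W x)) = 0 := by
  rw [kerV, bform_sub_left, bform_smul_left, bform_smul_left, ← hermF, ← hermF]; ring

theorem bkerC_W : bform (kerC g P W x) (W x) = 0 := by
  rw [kerC, bform_cj_left, bkerV_cW, star_zero]

/-- As `kerC` is always orthogonal to W, this says that `kerC` lies in E^⊥ exactly where the Gram
determinant vanishes. -/
theorem bkerC_P : bform (kerC g P W x) (P x) = gram g P W x := by
  rw [kerC_eq, bform_sub_left, bform_smul_left, bform_smul_left, bform_comm, bform_comm (cj g (W x)),
    ← hermF, ← hermF, gram]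
  ring

theorem bkerV_P (h : PlaneFrame P W dP dW) : bform (kerV g P W x) (P x) = 0 := by
  rw [kerV, bform_sub_left, bform_smul_left, bform_smul_left, h.bPP, h.bWP]; ring

theorem bkerV_W (h : PlaneFrame P W dP dW) : bform (kerV g P W x) (W x) = 0 := by
  rw [kerV, bform_sub_left, bform_smul_left, bform_smul_left, h.bPW, h.bWW]; ring

theorem bkerV_kerV (h : PlaneFrame P W dP dW) : bform (kerV g P W x) (kerV g P W x) = 0 := by
  conv_lhs => arg 2; rw [kerV]
  rw [bform_sub_right, bform_smul_right, bform_smul_right, h.bkerV_P, h.bkerV_W]; ring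

theorem bkerC_kerC (h : PlaneFrame P W dP dW) : bform (kerC g P W x) (kerC g P W x) = 0 := by
  rw [kerC, bform_cj_cj, h.bkerV_kerV, star_zero]

theorem bkerC_kerV (hS : gram g P W x = 0) : bform (kerC g P W x) (kerV g P W x) = 0 := by
  rw [kerV, bform_sub_right, bform_smul_right, bform_smul_right, bkerC_P, bkerC_W, hS]; ring

theorem bU_P (h : PlaneFrame P W dP dW) : bform (orthU g P W s x) (P x) = 0 := by
  rw [orthU, bform_sub_left, bform_smul_left, bform_smul_left, h.bperpP, h.bWP]; ring

theorem bU_W (h : PlaneFrame P W dP dW) : bform (orthU g P W s x) (W x) = 0 := by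
  rw [orthU, bform_sub_left, bform_smul_left, bform_smul_left, h.bperpW, h.bWW]; ring

theorem bU_kerV (h : PlaneFrame P W dP dW) : bform (orthU g P W s x) (kerV g P W x) = 0 := by
  rw [kerV, bform_sub_right, bform_smul_right, bform_smul_right, h.bU_P, h.bU_W]; ring

theorem bform_perpCoord (h : PlaneFrame P W dP dW) {y : Cn 7} (hP : bform y (P x) = 0)
    (hW : bform y (W x) = 0) (m : Cn 3) : bform y (perp x m) = form3 (perpCoord x y) m := by
  obtain ⟨a, b, hy⟩ := h.decomp x y hP hW
  conv_lhs => rw [hy]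
  rw [bform_add_left, bform_add_left, bform_smul_left, bform_smul_left, bform_comm (P x),
    bform_comm (W x), h.bperpP, h.bperpW, bform_perp_perp]
  ring

theorem bkerC_perp (h : PlaneFrame P W dP dW) (hS : gram g P W x = 0) (m : Cn 3) :
    bform (kerC g P W x) (perp x m) = form3 (kerM g P W x) m :=
  h.bform_perpCoord (bkerC_P.trans hS) bkerC_W m

theorem kerC_decomp (h : PlaneFrame P W dP dW) (hS : gram g P W x = 0) :
    ∃ a b : ℂ, kerC g P W x = a • P x + b • W x + perp x (kerM g P W x) :=
  h.decomp x _ (bkerC_P.trans hS) bkerC_W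

theorem bform_kerC (h : PlaneFrame P W dP dW) (hS : gram g P W x = 0) {y : Cn 7}
    (hP : bform y (P x) = 0) (hW : bform y (W x) = 0) :
    bform y (kerC g P W x) = form3 (perpCoord x y) (kerM g P W x) := by
  obtain ⟨a, b, hc⟩ := h.kerC_decomp hS
  conv_lhs => rw [hc]
  rw [bform_add_right, bform_add_right, bform_smul_right, bform_smul_right, hP, hW,
    h.bform_perpCoord hP hW]
  ring

theorem form3_kerM (h : PlaneFrame P W dP dW) (hS : gram g P W x = 0) :
    form3 (kerM g P W x) (kerM g P W x) = 0 := by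
  rw [← h.bkerC_kerC (x := x) (g := g)]
  exact (h.bform_kerC hS (bkerC_P.trans hS) bkerC_W).symm

theorem bU_kerC (h : PlaneFrame P W dP dW) (hS : gram g P W x = 0) :
    bform (orthU g P W s x) (kerC g P W x) = 0 := by
  rw [orthU, bform_sub_left, bform_smul_left, bform_smul_left, bform_comm (W x), bkerC_W,
    bform_comm, h.bkerC_perp hS, form3_comm, form3_cross3_left]
  ring

/-- The plane is isotropic and orthogonal to `perp`, so only the norm of m × s contributes; with m
isotropic, Lagrange's identity makes the result a square. It is nonzero at regular points, and the
second and third orders rest on this. -/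
theorem bU_U (h : PlaneFrame P W dP dW) (hS : gram g P W x = 0) :
    bform (orthU g P W s x) (orthU g P W s x) =
      (hermF g W W x * form3 (kerM g P W x) s) ^ 2 := by
  conv_lhs => arg 2; rw [orthU]
  rw [bform_sub_right, bform_smul_right, bform_smul_right, h.bU_W, orthU, bform_sub_left,
    bform_smul_left, bform_smul_left, bform_comm (W x), h.bperpW, bform_perp_perp,
    form3_cross3_self, h.form3_kerM hS]
  ring

theorem bform_U (h : PlaneFrame P W dP dW) {y : Cn 7} (hP : bform y (P x) = 0)
    (hW : bform y (W x) = 0) : bform y (orthU g P W s x) =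
      hermF g W W x * form3 (perpCoord x y) (cross3 (kerM g P W x) s) := by
  rw [orthU, bform_sub_right, bform_smul_right, bform_smul_right, hW, h.bform_perpCoord hP hW]
  ring

theorem perp_smul (x : Cn 7) (c : ℂ) (m : Cn 3) : perp x (c • m) = c • perp x m := by
  ext i
  fin_cases i <;> simp [perp] <;> ring

/-- The orthogonal complement of the span of `E`, `kerC` and `orthU`. -/
theorem mem_of_orth (h : PlaneFrame P W dP dW) (hS : gram g P W x = 0) (hW0 : hermF g W W x ≠ 0)
    (hs : form3 (kerM g P W x) s ≠ 0) {y : Cn 7} (hP : bform y (P x) = 0)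
    (hW : bform y (W x) = 0) (hC : bform y (kerC g P W x) = 0)
    (hU : bform y (orthU g P W s x) = 0) :
    ∃ a b c : ℂ, y = a • P x + b • W x + c • kerC g P W x ∧
      c * form3 (kerM g P W x) s = bform y (perp x s) := by
  rw [h.bform_kerC hS hP hW] at hC
  rw [h.bform_U hP hW] at hU
  have hU' := (mul_eq_zero.1 hU).resolve_left hW0
  -- In E^⊥/E the image of y is orthogonal to m and to m × s, hence a multiple of m.
  have hm := eq_smul_of_form3_eq_zero (h.form3_kerM hS) hs hC hU'
  obtain ⟨a, b, hy⟩ := h.decomp x y hP hW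
  obtain ⟨a', b', hc⟩ := h.kerC_decomp hS
  set t := form3 (perpCoord x y) s / form3 (kerM g P W x) s with ht
  refine ⟨a - t * a', b - t * b', t, ?_, ?_⟩
  · conv_lhs => rw [hy, hm, perp_smul]
    rw [hc]
    module
  · rw [h.bform_perpCoord hP hW, ht, div_mul_cancel₀ _ hs]

/-! ### Derivatives -/

theorem hasCDeriv_hermF {P Q : Cn 7 → Cn 7} {dP dQ : Cn 7 → Cn 7 → Cn 7}
    (hP : ∀ x ξ, HasCDeriv P x ξ (dP x ξ.1)) (hQ : ∀ x ξ, HasCDeriv Q x ξ (dQ x ξ.1)) (x : Cn 7)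
    (ξ : CT 7) : HasCDeriv (hermF g P Q) x ξ
      (bform (dP x ξ.1) (cj g (Q x)) + bform (P x) (cj g (dQ x (star ξ.2)))) :=
  (hP x ξ).bform (HasCDeriv.cj g (hQ x (star ξ.2, star ξ.1)))

theorem dW_zero (h : PlaneFrame P W dP dW) (x : Cn 7) : dW x 0 = 0 := by
  rw [h.lindW]; simp

theorem dP_zero (h : PlaneFrame P W dP dW) (x : Cn 7) : dP x 0 = 0 := by
  rw [h.lindP]; simp

/-- The coefficients of `kerV` also vary, but their derivatives contribute only vectors of the
plane; `dkerV` is the part that matters modulo the plane. -/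
theorem hasCDeriv_kerV (h : PlaneFrame P W dP dW) (x l : Cn 7) :
    HasCDeriv (kerV g P W) x (l, 0) (dkerV g P W dP dW x l + bform (dW x l) (cj g (W x)) • P x -
      bform (dP x l) (cj g (W x)) • W x) := by
  have h1 := hasCDeriv_hermF (g := g) h.derivW h.derivW x (l, 0)
  have h2 := hasCDeriv_hermF (g := g) h.derivP h.derivW x (l, 0)
  have h3 := (h1.smul (h.derivP x (l, 0))).sub (h2.smul (h.derivW x (l, 0)))
  refine h3.congr ?_
  simp only [star_zero, h.dW_zero, cj_zero, bform_zero_right, add_zero, dkerV]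
  module

/-- The derivative of `kerC` along a `(0,1)`-vector. -/
theorem hasCDeriv_kerC (h : PlaneFrame P W dP dW) (x l : Cn 7) :
    HasCDeriv (kerC g P W) x (0, star l) (cj g (dkerV g P W dP dW x l +
      bform (dW x l) (cj g (W x)) • P x - bform (dP x l) (cj g (W x)) • W x)) := by
  have h1 := h.hasCDeriv_kerV (g := g) x l
  refine HasCDeriv.cj g (ξ := (0, star l)) ?_
  simpa using h1

theorem dkerV_kerV (h : PlaneFrame P W dP dW) (x l : Cn 7) :
    bform (dkerV g P W dP dW x l) (kerV g P W x) = 0 := by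
  rw [kerV, dkerV, bform_sub_left, bform_sub_right, bform_sub_right]
  simp only [bform_smul_left, bform_smul_right, h.dPP, h.dWW]
  linear_combination (-(hermF g W W x * hermF g P W x)) * h.dPW x l

/-- `dkerV` and `dW` take all the values allowed by isotropy. -/
theorem exists_dkerV (h : PlaneFrame P W dP dW) (hW0 : hermF g W W x ≠ 0) {y₁ y₂ : Cn 7}
    (h1 : bform y₁ (kerV g P W x) = 0) (h2 : bform y₂ (W x) = 0)
    (h3 : bform y₁ (W x) + bform y₂ (kerV g P W x) = 0) :
    ∃ (l : Cn 7) (a b c d : ℂ), dkerV g P W dP dW x l = y₁ + (a • kerV g P W x + b • W x) ∧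
      dW x l = y₂ + (c • P x + d • W x) := by
  set η := hermF g W W x with hη
  set κ := hermF g P W x with hκ
  -- As h(W,W) ≠ 0, P can be replaced by `kerV` as the first basis vector; prescribing `dkerV`
  -- amounts to prescribing dP, and the surjectivity for (P,W) applies.
  have hP : P x = η⁻¹ • (kerV g P W x + κ • W x) := by
    rw [kerV, ← hη, ← hκ, sub_add_cancel, smul_smul, inv_mul_cancel₀ hW0, one_smul]
  have e1 : bform (η⁻¹ • (y₁ + κ • y₂)) (P x) = 0 := by
    rw [hP]
    simp only [bform_smul_left, bform_smul_right, bform_add_left, bform_add_right, h1, h2]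
    linear_combination η⁻¹ * η⁻¹ * κ * h3
  have e2 : bform (η⁻¹ • (y₁ + κ • y₂)) (W x) + bform y₂ (P x) = 0 := by
    rw [hP]
    simp only [bform_smul_left, bform_smul_right, bform_add_left, bform_add_right, h2]
    linear_combination η⁻¹ * h3
  obtain ⟨l, a, b, c, d, hl1, hl2⟩ := h.surj x _ _ e1 h2 e2
  refine ⟨l, a - κ * c * η⁻¹, η * b + κ * (a - κ * c * η⁻¹) - κ * d, c, d, ?_, hl2⟩
  rw [dkerV, ← hη, ← hκ, hl1, hl2]
  have hPx : η • P x = kerV g P W x + κ • W x := by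
    rw [hP, smul_smul, mul_inv_cancel₀ hW0, one_smul]
  have e3 : η • (η⁻¹ • (y₁ + κ • y₂) + (a • P x + b • W x)) - κ • (y₂ + (c • P x + d • W x)) =
      (η * η⁻¹) • (y₁ + κ • y₂) - κ • y₂ + (a - κ * c * η⁻¹) • (η • P x) +
        (κ * c * (η⁻¹ * η - 1)) • P x + (η * b - κ * d) • W x := by
    module
  rw [e3, hPx, mul_inv_cancel₀ hW0, inv_mul_cancel₀ hW0]
  module

end PlaneFrame

end Coframe

end SevenDim

/-! ### CR derivatives of the kernel vector, of its conjugate and of the covectors -/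

namespace SevenDim

open CR

/-- The derivative of `kerC` along the `(0,1)`-vector conjugate to `l`. -/
def dkerC (g : SO7C) (P W : Cn 7 → Cn 7) (dP dW : Cn 7 → Cn 7 → Cn 7) (x l : Cn 7) : Cn 7 :=
  cj g (dkerV g P W dP dW x l + bform (dW x l) (cj g (W x)) • P x -
    bform (dP x l) (cj g (W x)) • W x)

/-- The derivative of the coefficients of `kerV` along the `(0,1)`-vector conjugate to `l`,
contracted with the derivatives along `l'`. -/
def dcoefV (g : SO7C) (P W : Cn 7 → Cn 7) (dP dW : Cn 7 → Cn 7 → Cn 7) (x l l' : Cn 7) : Cn 7 :=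
  bform (W x) (cj g (dW x l)) • dP x l' - bform (P x) (cj g (dW x l)) • dW x l'

namespace PlaneFrame

variable {g : SO7C} {P W : Cn 7 → Cn 7} {dP dW : Cn 7 → Cn 7 → Cn 7} {s : Cn 3} {x l l' : Cn 7}

theorem bform_dP_eq_zero {Y : Cn 7} (hW0 : hermF g W W x ≠ 0)
    (h1 : bform (dkerV g P W dP dW x l) Y = 0) (h2 : bform (dW x l) Y = 0) :
    bform (dP x l) Y = 0 := by
  rw [dkerV, bform_sub_left, bform_smul_left, bform_smul_left, h2, mul_zero, sub_zero] at h1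
  exact (mul_eq_zero.1 h1).resolve_left hW0

theorem bform_dcoefV_eq_zero {Y : Cn 7} (hW0 : hermF g W W x ≠ 0)
    (h1 : bform (dkerV g P W dP dW x l') Y = 0) (h2 : bform (dW x l') Y = 0) :
    bform (dcoefV g P W dP dW x l l') Y = 0 := by
  rw [dcoefV, bform_sub_left, bform_smul_left, bform_smul_left, h2, bform_dP_eq_zero hW0 h1 h2]
  ring

/-- When l' is tangent, the variation of the coefficients of `kerV` is seen only through the
movement of W. This is the summand of the Levi form that produces the covector b(dW, `kerC`). -/
theorem bform_dcoefV_kerC (h1 : bform (dkerV g P W dP dW x l') (kerC g P W x) = 0) :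
    hermF g W W x * bform (dcoefV g P W dP dW x l l') (kerC g P W x) =
      -(star (bform (kerC g P W x) (dW x l)) * bform (dW x l') (kerC g P W x)) := by
  have e : star (bform (kerC g P W x) (dW x l)) =
      hermF g W W x * bform (P x) (cj g (dW x l)) - hermF g P W x * bform (W x) (cj g (dW x l)) := by
    rw [kerC, bform_cj_left, star_star, kerV, bform_sub_left, bform_smul_left, bform_smul_left]
  rw [e]
  rw [dkerV, bform_sub_left, bform_smul_left, bform_smul_left] at h1
  rw [dcoefV, bform_sub_left, bform_smul_left, bform_smul_left]
  linear_combination bform (W x) (cj g (dW x l)) * h1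

/-- `kerC` is orthogonal to W on the whole chart and W is holomorphic, so every (0,1)-derivative of
`kerC` stays orthogonal to W. -/
theorem bdkerC_W : bform (dkerC g P W dP dW x l) (W x) = 0 := by
  rw [dkerC, bform_cj_left, dkerV, star_eq_zero]
  simp only [bform_sub_left, bform_add_left, bform_smul_left, hermF]
  ring

theorem bdkerC_P (hS : gram g P W x = 0) (hW0 : hermF g W W x ≠ 0)
    (hl : bform (dkerV g P W dP dW x l) (kerC g P W x) = 0) :
    bform (dkerC g P W dP dW x l) (P x) = 0 := by
  have h1 := bdkerC_W (g := g) (P := P) (W := W) (dP := dP) (dW := dW) (x := x) (l := l)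
  rw [dkerC, bform_cj_left, star_eq_zero] at h1 ⊢
  set D := dkerV g P W dP dW x l + bform (dW x l) (cj g (W x)) • P x -
    bform (dP x l) (cj g (W x)) • W x with hD
  have h2 : bform D (kerC g P W x) = 0 := by
    rw [hD, bform_sub_left, bform_add_left, bform_smul_left, bform_smul_left, hl, bform_comm (P x),
      bform_comm (W x), bkerC_P, bkerC_W, hS]
    ring
  rw [kerC_eq, bform_sub_right, bform_smul_right, bform_smul_right, h1, mul_zero, sub_zero] at h2
  exact (mul_eq_zero.1 h2).resolve_left hW0

theorem bdkerC_kerC (h : PlaneFrame P W dP dW) :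
    bform (dkerC g P W dP dW x l) (kerC g P W x) = 0 := by
  rw [dkerC, kerC, bform_cj_cj, star_eq_zero, bform_sub_left, bform_add_left, bform_smul_left,
    bform_smul_left, h.dkerV_kerV, bform_comm (P x), bform_comm (W x), h.bkerV_P, h.bkerV_W]
  ring

/-- The value of `dkerC`, given the value of `dkerV` modulo the plane. -/
theorem dkerC_eq (hW0 : hermF g W W x ≠ 0) {Y : Cn 7} {a b : ℂ}
    (hY : bform Y (W x) = 0)
    (hl : dkerV g P W dP dW x l = cj g Y + (a • kerV g P W x + b • W x)) :
    ∃ c : ℂ, dkerC g P W dP dW x l = Y + c • kerC g P W x := by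
  have h1 := bdkerC_W (g := g) (P := P) (W := W) (dP := dP) (dW := dW) (x := x) (l := l)
  rw [dkerC, bform_cj_left, star_eq_zero, hl] at h1
  simp only [dkerC, hl]
  set τ := bform (dW x l) (cj g (W x))
  set σ := bform (dP x l) (cj g (W x))
  set η := hermF g W W x with hη
  set κ := hermF g P W x with hκ
  have hPx : P x = η⁻¹ • (kerV g P W x + κ • W x) := by
    rw [kerV, ← hη, ← hκ, sub_add_cancel, smul_smul, inv_mul_cancel₀ hW0, one_smul]
  -- The total coefficient of W, after P is expressed through `kerV` and W; it vanishes because the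
  -- derivative of `kerC` is orthogonal to W.
  have h2 : b * η + τ * κ - σ * η = 0 := by
    simp only [bform_sub_left, bform_add_left, bform_smul_left, bkerV_cW, bform_cj_cj, hY,
      star_zero] at h1
    rw [← hermF, ← hermF] at h1
    rw [hη, hκ]
    linear_combination h1
  have h3 : cj g Y + (a • kerV g P W x + b • W x) + τ • P x - σ • W x =
      cj g Y + (a + τ * η⁻¹) • kerV g P W x + (η⁻¹ * (b * η + τ * κ - σ * η)) • W x +
        ((1 - η⁻¹ * η) * (b - σ)) • W x := by
    rw [hPx]; module
  rw [h3, h2, inv_mul_cancel₀ hW0, mul_zero, sub_self, zero_mul, zero_smul, add_zero, add_zero,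
    cj_add, cj_cj, cj_smul]
  exact ⟨_, rfl⟩

/-- There is a CR direction along which `kerC` has the derivative `Y`, modulo `kerC`. -/
theorem exists_dkerC_eq (h : PlaneFrame P W dP dW) (hS : gram g P W x = 0)
    (hW0 : hermF g W W x ≠ 0) (hs : form3 (kerM g P W x) s ≠ 0) {Y : Cn 7}
    (hYW : bform Y (W x) = 0) (hYV : bform Y (kerV g P W x) = 0)
    (hYC : bform Y (kerC g P W x) = 0) :
    ∃ l, bform (dkerV g P W dP dW x l) (kerC g P W x) = 0 ∧
      ∃ c : ℂ, dkerC g P W dP dW x l = Y + c • kerC g P W x := by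
  -- The movement of `kerV` is prescribed as the conjugate of Y, which is a CR direction because Y
  -- is orthogonal to `kerV`. The isotropy relation then needs a compensating movement of W: the
  -- vector z is orthogonal to W and pairs nontrivially with `kerV`, and dW is taken to be the
  -- multiple κ • z.
  set η := hermF g W W x with hη
  set z := cj g (perp x s) - (η⁻¹ * bform (cj g (perp x s)) (W x)) • cj g (W x) with hz
  have hzW : bform z (W x) = 0 := by
    rw [hz, bform_sub_left, bform_smul_left, bform_comm (cj g (W x)), ← hermF, ← hη]
    field_simp
    ring
  have hzV : bform z (kerV g P W x) = star (form3 (kerM g P W x) s) := by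
    rw [hz, bform_sub_left, bform_smul_left, bform_comm (cj g (W x)), bkerV_cW, mul_zero, sub_zero,
      bform_cj_left, ← kerC, bform_comm, h.bkerC_perp hS]
  have hs' : star (form3 (kerM g P W x) s) ≠ 0 := fun h0 => hs (star_eq_zero.1 h0)
  set κ := -(bform (cj g Y) (W x)) / star (form3 (kerM g P W x) s) with hκ
  have e1 : bform (cj g Y) (kerV g P W x) = 0 := by
    rw [bform_cj_left, ← kerC, hYC, star_zero]
  have e2 : bform (κ • z) (W x) = 0 := by rw [bform_smul_left, hzW, mul_zero]
  have e3 : bform (cj g Y) (W x) + bform (κ • z) (kerV g P W x) = 0 := by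
    rw [bform_smul_left, hzV, hκ, div_mul_cancel₀ _ hs']; ring
  obtain ⟨l, a, b, c, d, hl1, hl2⟩ := h.exists_dkerV hW0 e1 e2 e3
  refine ⟨l, ?_, dkerC_eq hW0 hYW hl1⟩
  rw [hl1, bform_add_left, bform_add_left, bform_smul_left, bform_smul_left,
    bform_comm (kerV g P W x), bkerC_kerV hS, bform_comm (W x), bkerC_W]
  conv_lhs => rw [kerC, bform_cj_cj, hYV, star_zero]
  ring

theorem bdkerV_P (h : PlaneFrame P W dP dW) (hW0 : hermF g W W x ≠ 0)
    (h2 : bform (dkerV g P W dP dW x l) (W x) = 0) :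
    bform (dkerV g P W dP dW x l) (P x) = 0 := by
  have h1 := h.dkerV_kerV (g := g) x l
  rw [kerV, bform_sub_right, bform_smul_right, bform_smul_right, h2, mul_zero, sub_zero] at h1
  exact (mul_eq_zero.1 h1).resolve_left hW0

theorem bdW_P (h : PlaneFrame P W dP dW) (hW0 : hermF g W W x ≠ 0)
    (h2 : bform (dkerV g P W dP dW x l) (W x) = 0) : bform (dW x l) (P x) = 0 := by
  have h1 := h.dPW x l
  rwa [bform_dP_eq_zero hW0 h2 (h.dWW x l), zero_add] at h1

/-- The data at a point of the hypersurface that enter the verification of the coframe. -/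
structure RegularAt (g : SO7C) (P W : Cn 7 → Cn 7) (s : Cn 3) (x : Cn 7) : Prop where
  gram_eq : gram g P W x = 0
  herm_ne : hermF g W W x ≠ 0
  form_ne : form3 (kerM g P W x) s ≠ 0

/-- Once four pairings vanish (the one with P follows from the others), the movement of `kerV` is
confined to P, W and `kerC`; its last coefficient is what the pairing with `perp x s` measures. -/
theorem dkerV_mem (h : PlaneFrame P W dP dW) (hx : RegularAt g P W s x)
    (p0 : bform (dkerV g P W dP dW x l) (kerC g P W x) = 0)
    (p2 : bform (dkerV g P W dP dW x l) (W x) = 0)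
    (p3 : bform (dkerV g P W dP dW x l) (orthU g P W s x) = 0) :
    ∃ a b c : ℂ, dkerV g P W dP dW x l = a • P x + b • W x + c • kerC g P W x ∧
      c * form3 (kerM g P W x) s = bform (dkerV g P W dP dW x l) (perp x s) :=
  h.mem_of_orth hx.gram_eq hx.herm_ne hx.form_ne (h.bdkerV_P hx.herm_ne p2) p2 p0 p3

theorem dW_mem (h : PlaneFrame P W dP dW) (hx : RegularAt g P W s x)
    (p1 : bform (dW x l) (kerC g P W x) = 0)
    (p2 : bform (dkerV g P W dP dW x l) (W x) = 0)
    (p4 : bform (dW x l) (orthU g P W s x) = 0) :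
    ∃ a b c : ℂ, dW x l = a • P x + b • W x + c • kerC g P W x ∧
      c * form3 (kerM g P W x) s = bform (dW x l) (perp x s) :=
  h.mem_of_orth hx.gram_eq hx.herm_ne hx.form_ne (h.bdW_P hx.herm_ne p2) (h.dWW x l) p1 p4

/-- In a CR direction `kerC` moves orthogonally to the plane and to itself, so movements confined to
P, W and `kerC` are invisible to it. -/
theorem bform_dkerC (h : PlaneFrame P W dP dW) (hx : RegularAt g P W s x)
    (hl : bform (dkerV g P W dP dW x l) (kerC g P W x) = 0) (a b c : ℂ) :
    bform (a • P x + b • W x + c • kerC g P W x) (dkerC g P W dP dW x l) = 0 := by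
  rw [bform_comm]
  simp only [bform_add_right, bform_smul_right, bdkerC_P hx.gram_eq hx.herm_ne hl, bdkerC_W,
    h.bdkerC_kerC]
  ring

/-- The coframe is independent at regular points. -/
theorem eq_zero_of_pairings (h : PlaneFrame P W dP dW) (hx : RegularAt g P W s x)
    (p0 : bform (dkerV g P W dP dW x l) (kerC g P W x) = 0)
    (p1 : bform (dW x l) (kerC g P W x) = 0)
    (p2 : bform (dkerV g P W dP dW x l) (W x) = 0)
    (p3 : bform (dkerV g P W dP dW x l) (orthU g P W s x) = 0)
    (p4 : bform (dW x l) (orthU g P W s x) = 0)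
    (p5 : bform (dkerV g P W dP dW x l) (perp x s) = 0)
    (p6 : bform (dW x l) (perp x s) = 0) : l = 0 := by
  obtain ⟨a, b, c, e1, e2⟩ := h.dkerV_mem hx p0 p2 p3
  obtain ⟨a', b', c', e1', e2'⟩ := h.dW_mem hx p1 p2 p4
  rw [p5] at e2
  rw [p6] at e2'
  rw [(mul_eq_zero.1 e2).resolve_right hx.form_ne, zero_smul, add_zero] at e1
  rw [(mul_eq_zero.1 e2').resolve_right hx.form_ne, zero_smul, add_zero] at e1'
  have hη := hx.herm_ne
  refine h.inj x l ((hermF g W W x)⁻¹ * (a + hermF g P W x * a'))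
    ((hermF g W W x)⁻¹ * (b + hermF g P W x * b')) a' b' ?_ e1'
  have e3 : dP x l = (hermF g W W x)⁻¹ • (dkerV g P W dP dW x l + hermF g P W x • dW x l) := by
    rw [dkerV, sub_add_cancel, smul_smul, inv_mul_cancel₀ hη, one_smul]
  rw [e3, e1, e1']
  module

/-! ### The covectors -/

/-- The covector `l ↦ b(α dP(l) + β dW(l), Y)`. -/
def covector (dP dW : Cn 7 → Cn 7 → Cn 7) (α β : Cn 7 → ℂ) (Y : Cn 7 → Cn 7) (x : Cn 7) : Cn 7 :=
  fun i => bform (α x • dP x (Pi.single i 1) + β x • dW x (Pi.single i 1)) (Y x)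

theorem covector_dotProduct (h : PlaneFrame P W dP dW) (α β : Cn 7 → ℂ) (Y : Cn 7 → Cn 7)
    (x l : Cn 7) : covector dP dW α β Y x ⬝ᵥ l =
      bform (α x • dP x l + β x • dW x l) (Y x) := by
  rw [h.lindP x l, h.lindW x l, Finset.smul_sum, Finset.smul_sum, ← Finset.sum_add_distrib,
    bform_sum_left, dotProduct]
  refine Finset.sum_congr rfl fun i _ => ?_
  simp only [covector, bform_add_left, bform_smul_left]
  ring

/-- The coframe adapted to the Levi kernels. -/
def coframe (g : SO7C) (P W : Cn 7 → Cn 7) (dP dW : Cn 7 → Cn 7 → Cn 7) (s : Cn 3) :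
    Fin 7 → Cn 7 → Cn 7 :=
  ![covector dP dW (hermF g W W) (fun y => -hermF g P W y) (kerC g P W),
    covector dP dW (fun _ => 0) (fun _ => 1) (kerC g P W),
    covector dP dW (hermF g W W) (fun y => -hermF g P W y) W,
    covector dP dW (hermF g W W) (fun y => -hermF g P W y) (orthU g P W s),
    covector dP dW (fun _ => 0) (fun _ => 1) (orthU g P W s),
    covector dP dW (hermF g W W) (fun y => -hermF g P W y) (fun y => perp y s),
    covector dP dW (fun _ => 0) (fun _ => 1) (fun y => perp y s)]

theorem covectorV_dotProduct (h : PlaneFrame P W dP dW) (Y : Cn 7 → Cn 7) (x l : Cn 7) :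
    covector dP dW (hermF g W W) (fun y => -hermF g P W y) Y x ⬝ᵥ l =
      bform (dkerV g P W dP dW x l) (Y x) := by
  rw [h.covector_dotProduct, dkerV, neg_smul, ← sub_eq_add_neg]

theorem covectorW_dotProduct (h : PlaneFrame P W dP dW) (Y : Cn 7 → Cn 7) (x l : Cn 7) :
    covector dP dW (fun _ => 0) (fun _ => 1) Y x ⬝ᵥ l = bform (dW x l) (Y x) := by
  rw [h.covector_dotProduct, zero_smul, zero_add, one_smul]

/-! ### Regularity -/

theorem contDiff_bform {f f' : Cn 7 → Cn 7} (hf : ContDiff ℝ ω f) (hf' : ContDiff ℝ ω f') :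
    ContDiff ℝ ω (fun y => bform (f y) (f' y)) := by
  simp only [bform]
  exact ContDiff.sum fun i _ => (contDiff_pi.1 hf i).mul (contDiff_pi.1 hf' (Fin.rev i))

theorem contDiff_mulVec (M : Matrix (Fin 7) (Fin 7) ℂ) {f : Cn 7 → Cn 7} (hf : ContDiff ℝ ω f) :
    ContDiff ℝ ω (fun y => M.mulVec (f y)) :=
  ((LinearMap.toContinuousLinearMap (Matrix.mulVecLin M)).restrictScalars ℝ).contDiff.comp hf

theorem contDiff_cj {f : Cn 7 → Cn 7} (hf : ContDiff ℝ ω f) :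
    ContDiff ℝ ω (fun y => cj g (f y)) :=
  contDiff_mulVec _ ((starL' ℝ : Cn 7 ≃L[ℝ] Cn 7).contDiff.comp (contDiff_mulVec _ hf))

theorem contDiff_hermF {f f' : Cn 7 → Cn 7} (hf : ContDiff ℝ ω f) (hf' : ContDiff ℝ ω f') :
    ContDiff ℝ ω (hermF g f f') := contDiff_bform hf (contDiff_cj hf')

theorem contDiff_gram {f f' : Cn 7 → Cn 7} (hf : ContDiff ℝ ω f) (hf' : ContDiff ℝ ω f') :
    ContDiff ℝ ω (gram g f f') :=
  ((contDiff_hermF hf hf).mul (contDiff_hermF hf' hf')).sub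
    ((contDiff_hermF hf hf').mul (contDiff_hermF hf' hf))

theorem contDiff_kerV {f f' : Cn 7 → Cn 7} (hf : ContDiff ℝ ω f) (hf' : ContDiff ℝ ω f') :
    ContDiff ℝ ω (kerV g f f') :=
  ((contDiff_hermF hf' hf').smul hf).sub ((contDiff_hermF hf hf').smul hf')

theorem contDiff_kerC {f f' : Cn 7 → Cn 7} (hf : ContDiff ℝ ω f) (hf' : ContDiff ℝ ω f') :
    ContDiff ℝ ω (kerC g f f') := contDiff_cj (contDiff_kerV hf hf')

theorem contDiff_kerM {f f' : Cn 7 → Cn 7} (hf : ContDiff ℝ ω f) (hf' : ContDiff ℝ ω f') :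
    ContDiff ℝ ω (kerM g f f') := by
  have h := contDiff_pi.1 (contDiff_kerC (g := g) hf hf')
  rw [contDiff_pi]
  intro i
  fin_cases i
  · exact ((h 2).sub ((h 0).mul (contDiff_apply ℝ ℂ 0))).sub ((h 1).mul (contDiff_apply ℝ ℂ 3))
  · exact ((h 3).sub ((h 0).mul (contDiff_apply ℝ ℂ 1))).sub ((h 1).mul (contDiff_apply ℝ ℂ 4))
  · exact ((h 4).sub ((h 0).mul (contDiff_apply ℝ ℂ 2))).sub ((h 1).mul (contDiff_apply ℝ ℂ 5))

theorem contDiff_cross3 {m : Cn 7 → Cn 3} (hm : ContDiff ℝ ω m) (s : Cn 3) :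
    ContDiff ℝ ω (fun y => cross3 (m y) s) := by
  have h := contDiff_pi.1 hm
  rw [contDiff_pi]
  intro i
  fin_cases i
  · exact ((h 0).mul contDiff_const).sub ((h 1).mul contDiff_const)
  · exact ((h 2).mul contDiff_const).sub ((h 0).mul contDiff_const)
  · exact ((h 1).mul contDiff_const).sub ((h 2).mul contDiff_const)

theorem contDiff_perp {m : Cn 7 → Cn 3} (hm : ContDiff ℝ ω m) :
    ContDiff ℝ ω (fun y => perp y (m y)) := by
  have h := contDiff_pi.1 hm
  have hx : ∀ i, ContDiff ℝ ω (fun y : Cn 7 => y i) := fun i => contDiff_apply ℝ ℂ i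
  rw [contDiff_pi]
  intro i
  fin_cases i
  · exact contDiff_const
  · exact contDiff_const
  · exact h 0
  · exact h 1
  · exact h 2
  · exact ((((h 0).mul (hx 5)).add ((h 1).mul (hx 4))).add ((h 2).mul (hx 3))).neg
  · exact ((((h 0).mul (hx 2)).add ((h 1).mul (hx 1))).add ((h 2).mul (hx 0))).neg

theorem contDiff_orthU {f f' : Cn 7 → Cn 7} (hf : ContDiff ℝ ω f) (hf' : ContDiff ℝ ω f') :
    ContDiff ℝ ω (orthU g f f' s) := by
  have h := contDiff_perp (contDiff_cross3 (contDiff_kerM (g := g) hf hf') s)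
  exact ((contDiff_hermF hf' hf').smul h).sub ((contDiff_bform h (contDiff_cj hf')).smul hf')

theorem contDiff_covector (h : PlaneFrame P W dP dW) {α β : Cn 7 → ℂ} {Y : Cn 7 → Cn 7}
    (hα : ContDiff ℝ ω α) (hβ : ContDiff ℝ ω β) (hY : ContDiff ℝ ω Y) :
    ContDiff ℝ ω (covector dP dW α β Y) := by
  rw [contDiff_pi]
  intro i
  exact contDiff_bform ((hα.smul (h.contdP _)).add (hβ.smul (h.contdW _))) hY

theorem contDiff_coframe (h : PlaneFrame P W dP dW) (j : Fin 7) :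
    ContDiff ℝ ω (coframe g P W dP dW s j) := by
  have h1 := contDiff_hermF (g := g) h.contW h.contW
  have h2 := (contDiff_hermF (g := g) h.contP h.contW).neg
  have h3 := contDiff_kerC (g := g) h.contP h.contW
  have h4 := contDiff_orthU (g := g) (s := s) h.contP h.contW
  have h5 := contDiff_perp (contDiff_const (c := s))
  fin_cases j
  · exact h.contDiff_covector h1 h2 h3
  · exact h.contDiff_covector contDiff_const contDiff_const h3
  · exact h.contDiff_covector h1 h2 h.contW
  · exact h.contDiff_covector h1 h2 h4
  · exact h.contDiff_covector contDiff_const contDiff_const h4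
  · exact h.contDiff_covector h1 h2 h5
  · exact h.contDiff_covector contDiff_const contDiff_const h5

theorem cderiv_covector_dotProduct {α β : Cn 7 → ℂ}
    {Y : Cn 7 → Cn 7} (hd : DifferentiableAt ℝ (covector dP dW α β Y) x) (ξ : CT 7) (l' : Cn 7) :
    cderiv (covector dP dW α β Y) x ξ ⬝ᵥ l' =
      cderiv (fun y => covector dP dW α β Y y ⬝ᵥ l') x ξ := by
  have := ((hasCDeriv_self (ξ := ξ) hd).dotProduct (hasCDeriv_const l')).2
  rw [this, dotProduct_zero, add_zero]

/-- The derivative of the covectors built from `kerV`. -/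
theorem cderiv_covectorV (h : PlaneFrame P W dP dW) {Y : Cn 7 → Cn 7} (hY : ContDiff ℝ ω Y)
    {d : Cn 7} (hd : HasCDeriv Y x (0, star l) d) (l' : Cn 7) :
    cderiv (covector dP dW (hermF g W W) (fun y => -hermF g P W y) Y) x (0, star l) ⬝ᵥ l' =
      bform (dcoefV g P W dP dW x l l') (Y x) + bform (dkerV g P W dP dW x l') d := by
  have h1 := contDiff_hermF (g := g) h.contW h.contW
  have h2 := (contDiff_hermF (g := g) h.contP h.contW).neg
  rw [cderiv_covector_dotProduct ((h.contDiff_covector h1 h2 hY).differentiable (by simp) x)]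
  simp only [h.covectorV_dotProduct]
  have e1 := hasCDeriv_hermF (g := g) h.derivW h.derivW x (0, star l)
  have e2 := hasCDeriv_hermF (g := g) h.derivP h.derivW x (0, star l)
  have e3 := (e1.smul (h.derivdP x l' (0, star l) rfl)).sub
    (e2.smul (h.derivdW x l' (0, star l) rfl))
  have e4 := (e3.bform hd).2
  simp only [dkerV]
  refine e4.trans ?_
  simp only [star_star, h.dW_zero, h.dP_zero, bform_zero_left, zero_add, smul_zero, add_zero]
  rfl

theorem cderiv_covectorW (h : PlaneFrame P W dP dW) {Y : Cn 7 → Cn 7} (hY : ContDiff ℝ ω Y)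
    {d : Cn 7} (hd : HasCDeriv Y x (0, star l) d) (l' : Cn 7) :
    cderiv (covector dP dW (fun _ => 0) (fun _ => 1) Y) x (0, star l) ⬝ᵥ l' =
      bform (dW x l') d := by
  rw [cderiv_covector_dotProduct ((h.contDiff_covector contDiff_const contDiff_const
    hY).differentiable (by simp) x)]
  simp only [h.covectorW_dotProduct]
  rw [((h.derivdW x l' (0, star l) rfl).bform hd).2, bform_zero_left, zero_add]

/-- The derivative of the Gram determinant along `(1,0)`-vectors. -/
theorem cderiv_gram (h : PlaneFrame P W dP dW) (hS : gram g P W x = 0) (l : Cn 7) :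
    hermF g W W x * cderiv (gram g P W) x (l, 0) =
      bform (dkerV g P W dP dW x l) (kerC g P W x) := by
  have e1 := hasCDeriv_hermF (g := g) h.derivP h.derivP x (l, 0)
  have e2 := hasCDeriv_hermF (g := g) h.derivW h.derivW x (l, 0)
  have e3 := hasCDeriv_hermF (g := g) h.derivP h.derivW x (l, 0)
  have e4 := hasCDeriv_hermF (g := g) h.derivW h.derivP x (l, 0)
  have e5 : HasCDeriv (gram g P W) x (l, 0) _ := (e1.mul e2).sub (e3.mul e4)
  rw [e5.2]
  simp only [star_zero, h.dW_zero, h.dP_zero, cj_zero, bform_zero_right, add_zero]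
  rw [kerC_eq, dkerV]
  simp only [bform_sub_left, bform_sub_right, bform_smul_left, bform_smul_right]
  rw [gram] at hS
  -- The two sides differ by a multiple of the Gram determinant, hence agree on the hypersurface.
  linear_combination bform (dW x l) (cj g (W x)) * hS

end PlaneFrame

end SevenDim

/-! ### First, second and third order: which covectors the CR derivatives generate -/

namespace SevenDim

open CR

namespace PlaneFrame

variable {g : SO7C} {P W : Cn 7 → Cn 7} {dP dW : Cn 7 → Cn 7 → Cn 7} {s : Cn 3} {x l l' : Cn 7}
  {M : Set (Cn 7)} {ρ : Cn 7 → ℝ}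

/-- Differentiating the orthogonality of `orthU` to P and W, valid on the whole chart, and to
`kerC`, valid only along M. The last relation therefore needs the direction to be tangent. -/
theorem exists_hasCDeriv_orthU (h : PlaneFrame P W dP dW) (hd : IsDefiningFunction M x ρ)
    (hM : ∀ᶠ y in 𝓝[M] x, gram g P W y = 0) (hL : (0, star l) ∈ ctangent M x) :
    ∃ du, HasCDeriv (orthU g P W s) x (0, star l) du ∧ bform (P x) du = 0 ∧ bform (W x) du = 0 ∧
      bform (kerC g P W x) du = -bform (orthU g P W s x) (dkerC g P W dP dW x l) := by
  have hU : DifferentiableAt ℝ (orthU g P W s) x :=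
    (contDiff_orthU h.contP h.contW).differentiable (by simp) x
  have h0 := hasCDeriv_self (ξ := (0, star l)) hU
  refine ⟨_, h0, ?_, ?_, ?_⟩
  · have h1 := h0.bform (h.derivP x (0, star l))
    have h2 : HasCDeriv (fun y => bform (orthU g P W s y) (P y)) x (0, star l) 0 := by
      simp only [h.bU_P]; exact hasCDeriv_const 0
    have := h1.unique h2
    rwa [h.dP_zero, bform_zero_right, add_zero, bform_comm] at this
  · have h1 := h0.bform (h.derivW x (0, star l))
    have h2 : HasCDeriv (fun y => bform (orthU g P W s y) (W y)) x (0, star l) 0 := by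
      simp only [h.bU_W]; exact hasCDeriv_const 0
    have := h1.unique h2
    rwa [h.dW_zero, bform_zero_right, add_zero, bform_comm] at this
  · have h1 := h0.bform (h.hasCDeriv_kerC (g := g) x l)
    have h2 := hd.cderiv_eq_zero h1.1
      (hM.mono fun y hy => h.bU_kerC hy) hL
    rw [h1.2, bform_comm _ (kerC g P W x)] at h2
    exact eq_neg_of_add_eq_zero_left h2

/-- A CR direction along which `kerC` does not move, modulo itself, and `W` moves transversally. -/
theorem exists_dW_ne_zero (h : PlaneFrame P W dP dW) (hx : RegularAt g P W s x) :
    ∃ l, bform (dkerV g P W dP dW x l) (kerC g P W x) = 0 ∧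
      (∃ c : ℂ, dkerC g P W dP dW x l = c • kerC g P W x) ∧
      bform (kerC g P W x) (dW x l) ≠ 0 := by
  -- The prescribed movements are 0 for `kerV` and `perp x s` for W.
  have e3 : bform (0 : Cn 7) (W x) + bform (perp x s) (kerV g P W x) = 0 := by
    rw [bform_zero_left, kerV, bform_sub_right, bform_smul_right, bform_smul_right, h.bperpP,
      h.bperpW]
    ring
  obtain ⟨l, a, b, c, d, h1, h2⟩ := h.exists_dkerV hx.herm_ne (bform_zero_left _) (h.bperpW x s) e3
  refine ⟨l, ?_, ?_, ?_⟩
  · rw [h1, zero_add, bform_add_left, bform_smul_left, bform_smul_left, bform_comm,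
      bkerC_kerV hx.gram_eq, bform_comm, bkerC_W]
    ring
  · obtain ⟨c, hc⟩ := dkerC_eq (Y := 0) hx.herm_ne (bform_zero_left _) (by rw [cj_zero]; exact h1)
    exact ⟨c, by rw [hc, zero_add]⟩
  · rw [h2, bform_add_right, bform_add_right, bform_smul_right, bform_smul_right, bkerC_P, bkerC_W,
      hx.gram_eq, h.bkerC_perp hx.gram_eq]
    simpa using hx.form_ne

theorem bU_U_ne_zero (h : PlaneFrame P W dP dW) (hx : RegularAt g P W s x) :
    bform (orthU g P W s x) (orthU g P W s x) ≠ 0 := by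
  rw [h.bU_U hx.gram_eq]
  exact pow_ne_zero 2 (mul_ne_zero hx.herm_ne hx.form_ne)

/-- A CR direction along which `kerC` moves in the direction `orthU`. -/
theorem exists_dkerC_orthU (h : PlaneFrame P W dP dW) (hx : RegularAt g P W s x) :
    ∃ l, bform (dkerV g P W dP dW x l) (kerC g P W x) = 0 ∧
      ∃ c : ℂ, dkerC g P W dP dW x l = orthU g P W s x + c • kerC g P W x :=
  h.exists_dkerC_eq hx.gram_eq hx.herm_ne hx.form_ne h.bU_W h.bU_kerV (h.bU_kerC hx.gram_eq)

/-- The ranks of the spans of the derivatives of the gradient. -/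
def spanRank : ℕ → ℕ
  | 0 => 1
  | 1 => 4
  | 2 => 6
  | _ => 7

theorem spanRank_mono : Monotone spanRank := by
  refine monotone_nat_of_le_succ fun k => ?_
  match k with
  | 0 => decide
  | 1 => decide
  | 2 => decide
  | k + 3 => exact le_rfl

theorem spanRank_of_le {k : ℕ} (hk : 3 ≤ k) : spanRank k = 7 := by
  obtain ⟨m, rfl⟩ := Nat.exists_eq_add_of_le hk
  rw [add_comm]
  rfl

variable (g P W dP dW s x l) in
/-- The values of the coframe on `l`. -/
def pairing : Fin 7 → ℂ :=
  ![bform (dkerV g P W dP dW x l) (kerC g P W x), bform (dW x l) (kerC g P W x),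
    bform (dkerV g P W dP dW x l) (W x), bform (dkerV g P W dP dW x l) (orthU g P W s x),
    bform (dW x l) (orthU g P W s x), bform (dkerV g P W dP dW x l) (perp x s),
    bform (dW x l) (perp x s)]

theorem coframe_dotProduct (h : PlaneFrame P W dP dW) (j : Fin 7) :
    coframe g P W dP dW s j x ⬝ᵥ l = pairing g P W dP dW s x l j := by
  fin_cases j
  · exact h.covectorV_dotProduct (g := g) (kerC g P W) x l
  · exact h.covectorW_dotProduct (kerC g P W) x l
  · exact h.covectorV_dotProduct (g := g) W x l
  · exact h.covectorV_dotProduct (g := g) (orthU g P W s) x l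
  · exact h.covectorW_dotProduct (orthU g P W s) x l
  · exact h.covectorV_dotProduct (g := g) (fun y => perp y s) x l
  · exact h.covectorW_dotProduct (fun y => perp y s) x l

theorem mem_coframeKer (h : PlaneFrame P W dP dW) {r : ℕ} :
    l ∈ coframeKer (coframe g P W dP dW s) r x ↔
      ∀ j : Fin 7, j.val < r → pairing g P W dP dW s x l j = 0 := by
  simp only [coframeKer, mem_ofPred_eq, h.coframe_dotProduct]

variable (g P W dP dW s x l l') in
/-- The values on `l'` of the derivatives of the first five covectors along the `(0,1)`-vector
conjugate to `l`, if `du` is the derivative of `orthU`. -/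
def dpairing (du : Cn 7) : Fin 5 → ℂ :=
  ![bform (dcoefV g P W dP dW x l l') (kerC g P W x) +
      bform (dkerV g P W dP dW x l') (dkerC g P W dP dW x l),
    bform (dW x l') (dkerC g P W dP dW x l),
    bform (dcoefV g P W dP dW x l l') (W x),
    bform (dcoefV g P W dP dW x l l') (orthU g P W s x) + bform (dkerV g P W dP dW x l') du,
    bform (dW x l') du]

/-- Five covectors suffice: at level 2 the inclusion is vacuous because the next annihilator is
zero, and generation uses the derivative of the covector with index 4 only. -/
theorem cderiv_coframe (h : PlaneFrame P W dP dW) {du : Cn 7}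
    (hdu : HasCDeriv (orthU g P W s) x (0, star l) du) (j : Fin 5) :
    cderiv (coframe g P W dP dW s (Fin.castAdd 2 j)) x (0, star l) ⬝ᵥ l' =
      dpairing g P W dP dW s x l l' du j := by
  have hC := contDiff_kerC (g := g) h.contP h.contW
  have hU := contDiff_orthU (g := g) (s := s) h.contP h.contW
  fin_cases j
  · exact h.cderiv_covectorV hC (h.hasCDeriv_kerC x l) l'
  · exact h.cderiv_covectorW hC (h.hasCDeriv_kerC x l) l'
  · refine (h.cderiv_covectorV h.contW (h.derivW x (0, star l)) l').trans ?_
    rw [h.dW_zero, bform_zero_right, add_zero]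
    rfl
  · exact h.cderiv_covectorV hU hdu l'
  · exact h.cderiv_covectorW hU hdu l'

theorem bform_eq_zero_of_mem {y Y : Cn 7} {a b c : ℂ} (hy : y = a • P x + b • W x + c • kerC g P W x)
    (hc : c = 0) (hP : bform (P x) Y = 0) (hW : bform (W x) Y = 0) : bform y Y = 0 := by
  rw [hy, hc, bform_add_left, bform_add_left, bform_smul_left, bform_smul_left, hP, hW]
  simp [bform_zero_left]

/-- If the first four covectors vanish on l', then `dkerV` lies in the span of P, W and `kerC`,
which is orthogonal to every CR derivative of `kerC`, while the variation of coefficients only pairs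
movements with `kerC`. Hence no derivative of the gradient covector detects l'. -/
theorem dpairing_zero (h : PlaneFrame P W dP dW) (hx : RegularAt g P W s x)
    (p0 : bform (dkerV g P W dP dW x l') (kerC g P W x) = 0)
    (p1 : bform (dW x l') (kerC g P W x) = 0)
    (p2 : bform (dkerV g P W dP dW x l') (W x) = 0)
    (p3 : bform (dkerV g P W dP dW x l') (orthU g P W s x) = 0)
    (hl : bform (dkerV g P W dP dW x l) (kerC g P W x) = 0) (du : Cn 7) :
    dpairing g P W dP dW s x l l' du 0 = 0 := by
  obtain ⟨a, b, c, e, -⟩ := h.dkerV_mem hx p0 p2 p3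
  change _ + _ = _
  rw [bform_dcoefV_eq_zero hx.herm_ne p0 p1, e, h.bform_dkerC hx hl, add_zero]

/-- The vanishing pairing with `perp x s` removes the `kerC`-component of `dkerV`, the only
component on which the derivative of `orthU` could be nonzero. -/
theorem dpairing_lt_four (h : PlaneFrame P W dP dW) (hx : RegularAt g P W s x)
    (p0 : bform (dkerV g P W dP dW x l') (kerC g P W x) = 0)
    (p1 : bform (dW x l') (kerC g P W x) = 0)
    (p2 : bform (dkerV g P W dP dW x l') (W x) = 0)
    (p3 : bform (dkerV g P W dP dW x l') (orthU g P W s x) = 0)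
    (p4 : bform (dW x l') (orthU g P W s x) = 0)
    (p5 : bform (dkerV g P W dP dW x l') (perp x s) = 0)
    (hl : bform (dkerV g P W dP dW x l) (kerC g P W x) = 0) {du : Cn 7}
    (hP : bform (P x) du = 0) (hW : bform (W x) du = 0) {j : Fin 5} (hj : j.val < 4) :
    dpairing g P W dP dW s x l l' du j = 0 := by
  obtain ⟨a, b, c, e, ec⟩ := h.dkerV_mem hx p0 p2 p3
  obtain ⟨a', b', c', e', -⟩ := h.dW_mem hx p1 p2 p4
  rw [p5] at ec
  have hc := (mul_eq_zero.1 ec).resolve_right hx.form_ne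
  fin_cases j
  · exact h.dpairing_zero hx p0 p1 p2 p3 hl du
  · change bform _ _ = 0
    rw [e', h.bform_dkerC hx hl]
  · exact bform_dcoefV_eq_zero hx.herm_ne p2 (h.dWW x l')
  · change _ + _ = _
    rw [bform_dcoefV_eq_zero hx.herm_ne p3 p4, bform_eq_zero_of_mem e hc hP hW, add_zero]
  · exact absurd hj (lt_irrefl 4)

/-- Three kinds of CR direction generate the first-order covectors: `kerC` fixed up to scale while W
moves gives b(dW, `kerC`), and `kerC` moving towards W and towards `orthU` gives the other two. The
derivative of `orthU` does not enter the entry 0, so the value 0 stands in for it. -/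
theorem pairing_lt_four (h : PlaneFrame P W dP dW) (hx : RegularAt g P W s x)
    (p0 : bform (dkerV g P W dP dW x l') (kerC g P W x) = 0)
    (hl : ∀ l, bform (dkerV g P W dP dW x l) (kerC g P W x) = 0 →
      dpairing g P W dP dW s x l l' 0 0 = 0) :
    bform (dW x l') (kerC g P W x) = 0 ∧ bform (dkerV g P W dP dW x l') (W x) = 0 ∧
      bform (dkerV g P W dP dW x l') (orthU g P W s x) = 0 := by
  have p1 : bform (dW x l') (kerC g P W x) = 0 := by
    obtain ⟨l, e1, ⟨c, e2⟩, e3⟩ := h.exists_dW_ne_zero hx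
    have e4 : _ + _ = _ := hl l e1
    rw [e2, bform_smul_right, p0, mul_zero, add_zero] at e4
    have e5 := bform_dcoefV_kerC (l := l) p0
    rw [e4, mul_zero, eq_comm, neg_eq_zero] at e5
    exact (mul_eq_zero.1 e5).resolve_left fun h0 => e3 (star_eq_zero.1 h0)
  have key : ∀ (Y l : Cn 7) (c : ℂ), bform (dkerV g P W dP dW x l) (kerC g P W x) = 0 →
      dkerC g P W dP dW x l = Y + c • kerC g P W x → bform (dkerV g P W dP dW x l') Y = 0 := by
    intro Y l c e1 e2
    have e3 : _ + _ = _ := hl l e1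
    rwa [bform_dcoefV_eq_zero hx.herm_ne p0 p1, e2, bform_add_right, bform_smul_right, p0, mul_zero,
      add_zero, zero_add] at e3
  refine ⟨p1, ?_, ?_⟩
  · obtain ⟨l, e1, c, e2⟩ := h.exists_dkerC_eq (s := s) (Y := W x) hx.gram_eq hx.herm_ne hx.form_ne
      (h.bWW x) (by rw [bform_comm, h.bkerV_W]) (by rw [bform_comm, bkerC_W])
    exact key _ l c e1 e2
  · obtain ⟨l, e1, c, e2⟩ := h.exists_dkerC_orthU hx
    exact key _ l c e1 e2

/-- When `kerC` moves towards U = `orthU`, the pairing of `kerC` with dU is -b(U,U) ≠ 0, while P and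
W are orthogonal to dU. A vector of their span orthogonal to dU thus has no `kerC`-component. -/
theorem eq_zero_of_bform_kerC {du y : Cn 7} {a b c c' : ℂ} (h : PlaneFrame P W dP dW)
    (hx : RegularAt g P W s x) (hP : bform (P x) du = 0) (hW : bform (W x) du = 0)
    (hl : dkerC g P W dP dW x l = orthU g P W s x + c' • kerC g P W x)
    (hdu : bform (kerC g P W x) du = -bform (orthU g P W s x) (dkerC g P W dP dW x l))
    (hy : y = a • P x + b • W x + c • kerC g P W x) (h0 : bform y du = 0) : c = 0 := by
  rw [hy, bform_add_left, bform_add_left, bform_smul_left, bform_smul_left, bform_smul_left, hP, hW,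
    hdu, hl, bform_add_right, bform_smul_right, h.bU_kerC hx.gram_eq] at h0
  simpa [h.bU_U_ne_zero hx] using h0

/-! ### The adapted coframe -/

theorem star_gram (x : Cn 7) : star (gram g P W x) = gram g P W x := by
  simp only [gram, star_sub, star_mul', star_hermF]
  ring

theorem ofReal_re_gram (x : Cn 7) : (((gram g P W x).re : ℝ) : ℂ) = gram g P W x :=
  Complex.conj_eq_iff_re.1 (star_gram x)

theorem contDiff_re_gram (h : PlaneFrame P W dP dW) :
    ContDiff ℝ ω (fun y => (gram g P W y).re) :=
  Complex.reCLM.contDiff.comp (contDiff_gram h.contP h.contW)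

theorem cgrad_gram (h : PlaneFrame P W dP dW) (hS : gram g P W x = 0) (l : Cn 7) :
    hermF g W W x * (cgrad (fun y => (gram g P W y).re) x ⬝ᵥ l) =
      bform (dkerV g P W dP dW x l) (kerC g P W x) := by
  rw [dotProduct_cgrad]
  simp only [ofReal_re_gram]
  exact h.cderiv_gram hS l

/-- `kerV` can be moved by `perp x s`, up to the plane, and this pairs with `kerC` to the nonzero
number `form3 (kerM g P W x) s`. -/
theorem fderiv_re_gram_ne_zero (h : PlaneFrame P W dP dW) (hx : RegularAt g P W s x) :
    fderiv ℝ (fun y => (gram g P W y).re) x ≠ 0 := by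
  intro h0
  have hz : ∀ l, bform (dkerV g P W dP dW x l) (kerC g P W x) = 0 := by
    intro l
    rw [← h.cgrad_gram hx.gram_eq, dotProduct_cgrad]
    have hρ : DifferentiableAt ℝ (fun y => (gram g P W y).re) x :=
      h.contDiff_re_gram.differentiable (by simp) x
    have : fderiv ℝ (fun y => (((gram g P W y).re : ℝ) : ℂ)) x = 0 := by
      have hh := (Complex.ofRealCLM.hasFDerivAt (x := (gram g P W x).re)).comp x hρ.hasFDerivAt
      rw [h0, ContinuousLinearMap.comp_zero] at hh
      exact hh.fderiv
    simp [cderiv, this]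
  have e3 : bform (perp x s) (W x) + bform (0 : Cn 7) (kerV g P W x) = 0 := by
    rw [bform_zero_left, h.bperpW, add_zero]
  have e1 : bform (perp x s) (kerV g P W x) = 0 := by
    rw [kerV, bform_sub_right, bform_smul_right, bform_smul_right, h.bperpP, h.bperpW]
    ring
  obtain ⟨l, a, b, c, d, h1, -⟩ := h.exists_dkerV hx.herm_ne e1 (bform_zero_left _) e3
  have := hz l
  rw [h1, bform_add_left, bform_add_left, bform_smul_left, bform_smul_left, bform_comm,
    h.bkerC_perp hx.gram_eq, bform_comm (kerV _ _ _ _), bkerC_kerV hx.gram_eq, bform_comm (W x),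
    bkerC_W] at this
  exact hx.form_ne (by simpa using this)

/-- The point-by-point computations hold at all regular points, and regularity is open within the
hypersurface; the same coframe and the Gram determinant therefore serve on a whole neighbourhood. -/
theorem exists_adaptedCoframe (h : PlaneFrame P W dP dW) (hx : RegularAt g P W s x)
    (hM : ∀ᶠ y in 𝓝 x, y ∈ M ↔ gram g P W y = 0) :
    ∃ U ρ a, x ∈ U ∧ AdaptedCoframe M U ρ a spanRank := by
  have hη := (contDiff_hermF (g := g) h.contW h.contW).continuous
  have hm := (contDiff_kerM (g := g) h.contP h.contW).continuous
  have ha : ∀ j y, AnalyticAt ℝ (coframe g P W dP dW s j) y := fun j y =>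
    (h.contDiff_coframe j).contDiffAt.analyticAt
  have hdet : ContinuousAt (fun y => (coframeMatrix (coframe g P W dP dW s) y).det) x := by
    refine (analyticAt_det (M := coframeMatrix (coframe g P W dP dW s)) fun i j => ?_).continuousAt
    exact (ContinuousLinearMap.proj (R := ℝ) (φ := fun _ : Fin 7 => ℂ) j).analyticAt _ |>.comp
      (ha i x)
  have hf : Continuous fun y => form3 (kerM g P W y) s := by
    have hm' := fun i => (continuous_apply i).comp hm
    have h0 := hm' 0
    have h1 := hm' 1
    have h2 := hm' 2
    simp only [form3]
    simp only [Function.comp_def] at h0 h1 h2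
    fun_prop
  have indep : ∀ y, RegularAt g P W s y → ∀ v, (∀ j, coframe g P W dP dW s j y ⬝ᵥ v = 0) → v = 0 := by
    intro y hy v hv
    simp only [h.coframe_dotProduct] at hv
    exact h.eq_zero_of_pairings hy (hv 0) (hv 1) (hv 2) (hv 3) (hv 4) (hv 5) (hv 6)
  -- Independence is required also off the hypersurface, where the pointwise argument is not
  -- available; it is secured there by the determinant, nonzero at x and hence nearby.
  have hdx : (coframeMatrix (coframe g P W dP dW s) x).det ≠ 0 := by
    intro h0
    obtain ⟨v, hv, hv0⟩ := Matrix.exists_mulVec_eq_zero_iff.2 h0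
    exact hv (indep x hx v fun j => congrFun hv0 j)
  obtain ⟨U, hU, hUo, hxU⟩ := eventually_nhds_iff.1 (((hM.and
    (hη.continuousAt.eventually_ne hx.herm_ne)).and (hf.continuousAt.eventually_ne hx.form_ne)).and
    (hdet.eventually_ne hdx))
  have hreg : ∀ y ∈ M ∩ U, RegularAt g P W s y := fun y hy =>
    ⟨(hU y hy.2).1.1.1.1 hy.1, (hU y hy.2).1.1.2, (hU y hy.2).1.2⟩
  have hdef : ∀ y ∈ M ∩ U, IsDefiningFunction M y (fun y => (gram g P W y).re) := by
    intro y hy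
    refine ⟨hy.1, h.contDiff_re_gram.contDiffAt.analyticAt, h.fderiv_re_gram_ne_zero (hreg y hy), ?_⟩
    filter_upwards [hUo.mem_nhds hy.2] with z hz
    rw [(hU z hz).1.1.1]
    conv_lhs => rw [← ofReal_re_gram, Complex.ofReal_eq_zero]
  have hev : ∀ y ∈ M ∩ U, ∀ᶠ z in 𝓝[M] y, gram g P W z = 0 := by
    intro y hy
    filter_upwards [self_mem_nhdsWithin, mem_nhdsWithin_of_mem_nhds (hUo.mem_nhds hy.2)] with z a b
    exact (hU z b).1.1.1.1 a
  have hH : ∀ y ∈ M ∩ U, ∀ L : CT 7, L ∈ H01 M y ↔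
      L.1 = 0 ∧ bform (dkerV g P W dP dW y (star L.2)) (kerC g P W y) = 0 := by
    intro y hy L
    rw [(hdef y hy).mem_H01, ← h.cgrad_gram (hreg y hy).gram_eq, mul_eq_zero,
      or_iff_right (hreg y hy).herm_ne]
  have hder : ∀ y ∈ M ∩ U, ∀ l, bform (dkerV g P W dP dW y l) (kerC g P W y) = 0 →
      (0, star l) ∈ H01 M y ∧ ∃ du, bform (P y) du = 0 ∧ bform (W y) du = 0 ∧
      bform (kerC g P W y) du = -bform (orthU g P W s y) (dkerC g P W dP dW y l) ∧
      ∀ v (j : Fin 5), cderiv (coframe g P W dP dW s (Fin.castAdd 2 j)) y (0, star l) ⬝ᵥ v =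
        dpairing g P W dP dW s y l v du j := by
    intro y hy l hl
    have hL : (0, star l) ∈ H01 M y := (hH y hy _).2 ⟨rfl, by rwa [star_star]⟩
    obtain ⟨du, e1, e2, e3, e4⟩ := h.exists_hasCDeriv_orthU (s := s) (hdef y hy) (hev y hy) hL.1
    exact ⟨hL, du, e2, e3, e4, fun v j => h.cderiv_coframe e1 j⟩
  refine ⟨U, fun y => (gram g P W y).re, coframe g P W dP dW s, hxU, hUo, hdef, fun j y _ => ha j y,
    ?_, spanRank_mono, ?_, ?_, ?_⟩
  · intro y hy v hv
    by_contra h0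
    exact (hU y hy).2 (Matrix.exists_mulVec_eq_zero_iff.1 ⟨v, h0, funext hv⟩)
  · intro y hy v
    rw [h.mem_coframeKer]
    have : (∀ j : Fin 7, j.val < 1 → pairing g P W dP dW s y v j = 0) ↔
        bform (dkerV g P W dP dW y v) (kerC g P W y) = 0 :=
      ⟨fun H => H 0 (by decide), fun H j hj => by
        obtain rfl : j = 0 := by ext; simpa using hj
        exact H⟩
    rw [← (show spanRank 0 = 1 from rfl)] at this
    rw [this, ← h.cgrad_gram (hreg y hy).gram_eq, mul_eq_zero, or_iff_right (hreg y hy).herm_ne]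
  · intro k y hy v hv j hj L hL
    have hr := hreg y hy
    obtain ⟨hL1, hL2⟩ := (hH y hy L).1 hL
    obtain ⟨-, du, dP0, dW0, -, hc⟩ := hder y hy _ hL2
    have hLe : ((0, star (star L.2)) : CT 7) = L := by
      rw [star_star]; exact Prod.ext hL1.symm rfl
    rw [hLe] at hc
    rw [h.mem_coframeKer] at hv
    match k with
    | 0 =>
      obtain rfl : j = Fin.castAdd 2 0 := by ext; simpa [spanRank] using hj
      rw [hc v 0]
      exact h.dpairing_zero hr (hv 0 (by decide)) (hv 1 (by decide)) (hv 2 (by decide))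
        (hv 3 (by decide)) hL2 du
    | 1 =>
      have hj' : j.val < 4 := hj
      obtain ⟨i, rfl⟩ : ∃ i : Fin 5, j = Fin.castAdd 2 i := ⟨⟨j.val, by omega⟩, rfl⟩
      rw [hc v i]
      exact h.dpairing_lt_four hr (hv 0 (by decide)) (hv 1 (by decide)) (hv 2 (by decide))
        (hv 3 (by decide)) (hv 4 (by decide)) (hv 5 (by decide)) hL2 dP0 dW0 hj'
    | k + 2 =>
      rw [spanRank_of_le (by omega)] at hv
      have : v = 0 := indep y hr v fun j => by
        rw [h.coframe_dotProduct]; exact hv j j.2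
      rw [this, dotProduct_zero]
  · intro k y hy v hv H
    have hr := hreg y hy
    rw [h.mem_coframeKer] at hv ⊢
    match k with
    | 0 =>
      have p0 : bform _ _ = 0 := hv 0 (by decide)
      obtain ⟨p1, p2, p3⟩ := h.pairing_lt_four hr p0 fun l hl => by
        obtain ⟨hL, du, -, -, -, hc⟩ := hder y hy l hl
        have := H (Fin.castAdd 2 0) (by decide) _ hL
        rwa [hc] at this
      intro j hj
      have hj' : j.val < 4 := hj
      match j, hj' with
      | 0, _ => exact p0
      | 1, _ => exact p1
      | 2, _ => exact p2
      | 3, _ => exact p3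
    | 1 =>
      have p0 : bform _ _ = 0 := hv 0 (by decide)
      have p1 : bform _ _ = 0 := hv 1 (by decide)
      have p2 : bform _ _ = 0 := hv 2 (by decide)
      have p3 : bform _ _ = 0 := hv 3 (by decide)
      -- One CR direction, moving `kerC` towards `orthU`, yields both new covectors: index 4 from
      -- the derivative of index 1, and index 5 from that of index 3.
      obtain ⟨l, hl, c', hlC⟩ := h.exists_dkerC_orthU hr
      obtain ⟨hL, du, dP0, dW0, dC, hc⟩ := hder y hy l hl
      have p4 : bform (dW y v) (orthU g P W s y) = 0 := by
        have := H (Fin.castAdd 2 1) (by decide) _ hL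
        rw [hc] at this
        have e : bform _ _ = 0 := this
        rwa [hlC, bform_add_right, bform_smul_right, p1, mul_zero, add_zero] at e
      have p5 : bform (dkerV g P W dP dW y v) (perp y s) = 0 := by
        have := H (Fin.castAdd 2 3) (by decide) _ hL
        rw [hc] at this
        have e : _ + _ = _ := this
        rw [bform_dcoefV_eq_zero hr.herm_ne p3 p4, zero_add] at e
        obtain ⟨a, b, c, e1, e2⟩ := h.dkerV_mem hr p0 p2 p3
        rw [← e2, h.eq_zero_of_bform_kerC hr dP0 dW0 hlC dC e1 e, zero_mul]
      intro j hj
      have hj' : j.val < 6 := hj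
      match j, hj' with
      | 0, _ => exact p0
      | 1, _ => exact p1
      | 2, _ => exact p2
      | 3, _ => exact p3
      | 4, _ => exact p4
      | 5, _ => exact p5
    | 2 =>
      have p1 : bform _ _ = 0 := hv 1 (by decide)
      have p2 : bform _ _ = 0 := hv 2 (by decide)
      have p4 : bform _ _ = 0 := hv 4 (by decide)
      obtain ⟨l, hl, c', hlC⟩ := h.exists_dkerC_orthU hr
      obtain ⟨hL, du, dP0, dW0, dC, hc⟩ := hder y hy l hl
      have p6 : bform (dW y v) (perp y s) = 0 := by
        have := H (Fin.castAdd 2 4) (by decide) _ hL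
        rw [hc] at this
        have e : bform _ _ = 0 := this
        obtain ⟨a, b, c, e1, e2⟩ := h.dW_mem hr p1 p2 p4
        rw [← e2, h.eq_zero_of_bform_kerC hr dP0 dW0 hlC dC e1 e, zero_mul]
      intro j _
      by_cases hj6 : j.val < 6
      · exact hv j hj6
      · obtain rfl : j = 6 := by ext; have := j.2; simp; omega
        exact p6
    | k + 3 =>
      rw [spanRank_of_le (by omega)] at hv ⊢
      exact hv

end PlaneFrame

end SevenDim

namespace SevenDim

open CR

/-! ## Degenerate planes -/

/-- The plane contains a non-zero real vector. -/
def HasRealVector (E : IsoGrass) : Prop := ∃ v ∈ E.plane, v ≠ 0 ∧ star v = v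

/-- A non-zero vector of a plane whose conjugate lies in the plane yields a real vector. -/
theorem hasRealVector_of_star_mem {E : IsoGrass} {v : Cn 7} (hv : v ∈ E.plane)
    (hv' : star v ∈ E.plane) (h0 : v ≠ 0) : HasRealVector E := by
  -- If v plus its conjugate is zero, v is purely imaginary and i·v is real.
  by_cases h : v + star v = 0
  · refine ⟨Complex.I • v, Submodule.smul_mem _ _ hv, smul_ne_zero Complex.I_ne_zero h0, ?_⟩
    rw [star_smul, eq_neg_of_add_eq_zero_right h]
    simp
  · exact ⟨v + star v, Submodule.add_mem _ hv hv', h, by rw [star_add, star_star, add_comm]⟩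

theorem mem_smul_param_plane {g : SO7C} {x v : Cn 7} :
    g.val.val.mulVec v ∈ (g • param x).plane ↔ v ∈ (param x).plane := by
  constructor
  · rintro ⟨w, hw, h⟩
    rwa [← mulVecLin_injective g h]
  · exact fun h => ⟨v, h, rfl⟩

theorem hasRealVector_of_cj_mem {g : SO7C} {x v : Cn 7} (hv : v ∈ (param x).plane)
    (hv' : cj g v ∈ (param x).plane) (h0 : v ≠ 0) : HasRealVector (g • param x) := by
  refine hasRealVector_of_star_mem (mem_smul_param_plane.2 hv) ?_ fun h =>
    h0 (mulVecLin_injective g (h.trans (map_zero (Matrix.mulVecLin g.val.val)).symm))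
  rw [← mulVec_cj]
  exact mem_smul_param_plane.2 hv'

/-- A nondegenerate quadratic form in three variables has no isotropic planes. Concretely, the
squares of the 2 × 2 minors lie in the ideal generated by the three vanishing products. -/
theorem form3_dependent {m y : Cn 3} (hm : form3 m m = 0) (hy : form3 y y = 0)
    (hmy : form3 m y = 0) : ∃ a b : ℂ, (a ≠ 0 ∨ b ≠ 0) ∧ a • m + b • y = 0 := by
  simp only [form3] at hm hy hmy
  have e01 : m 0 * y 1 - m 1 * y 0 = 0 := by
    refine pow_eq_zero_iff two_ne_zero |>.1 ?_
    linear_combination m 0 ^ 2 * hy + y 0 ^ 2 * hm - 2 * m 0 * y 0 * hmy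
  have e12 : m 1 * y 2 - m 2 * y 1 = 0 := by
    refine pow_eq_zero_iff two_ne_zero |>.1 ?_
    linear_combination m 2 ^ 2 * hy + y 2 ^ 2 * hm - 2 * m 2 * y 2 * hmy
  have e02 : m 0 * y 2 - m 2 * y 0 = 0 := by
    refine pow_eq_zero_iff two_ne_zero |>.1 ?_
    linear_combination (m 0 * y 2 + m 2 * y 0 - m 1 * y 1) * hmy + m 1 ^ 2 * hy -
      2 * y 0 * y 2 * hm
  by_cases h : y = 0
  · exact ⟨0, 1, Or.inr one_ne_zero, by simp [h]⟩
  obtain ⟨i, hi⟩ := Function.ne_iff.1 h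
  refine ⟨y i, -m i, Or.inl hi, ?_⟩
  ext j
  simp only [Pi.add_apply, Pi.smul_apply, smul_eq_mul, Pi.zero_apply]
  fin_cases i <;> fin_cases j <;> simp <;>
    first | ring1 | linear_combination e01 | linear_combination -e01 | linear_combination e12 |
      linear_combination -e12 | linear_combination e02 | linear_combination -e02

theorem mem_param {x v : Cn 7} : v ∈ (param x).plane ↔ ∃ a b : ℂ, a • vecA x + b • vecB x = v :=
  Submodule.mem_span_pair

theorem smul_add_smul_vec_ne_zero {x : Cn 7} {a b : ℂ} (h : a ≠ 0 ∨ b ≠ 0) :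
    a • vecA x + b • vecB x ≠ 0 := by
  intro h0
  have e0 := congrFun h0 0
  have e1 := congrFun h0 1
  simp [vecA, vecB] at e0 e1
  exact h.elim (fun h => h e0) (fun h => h e1)

/-- On a plane without real vectors, the Hermitian form does not vanish. -/
theorem hasRealVector_of_hermF_eq_zero {g : SO7C} {x : Cn 7} (hAA : hermF g vecA vecA x = 0)
    (hAB : hermF g vecA vecB x = 0) (hBB : hermF g vecB vecB x = 0) :
    HasRealVector (g • param x) := by
  have hBA : hermF g vecB vecA x = 0 := by rw [← star_hermF, hAB, star_zero]
  have h := planeFrame_AB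
  have cA := fun m => h.bform_perpCoord (x := x) (y := cj g (vecA x)) (by rw [bform_comm]; exact hAA)
    (by rw [bform_comm]; exact hBA) m
  have cB := fun m => h.bform_perpCoord (x := x) (y := cj g (vecB x)) (by rw [bform_comm]; exact hAB)
    (by rw [bform_comm]; exact hBB) m
  obtain ⟨a, b, dA⟩ := h.decomp x (cj g (vecA x)) (by rw [bform_comm]; exact hAA)
    (by rw [bform_comm]; exact hBA)
  obtain ⟨a', b', dB⟩ := h.decomp x (cj g (vecB x)) (by rw [bform_comm]; exact hAB)
    (by rw [bform_comm]; exact hBB)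
  have key : ∀ u w : Cn 7, bform u w = 0 → bform w (vecA x) = 0 → bform w (vecB x) = 0 →
      ∀ (a b : ℂ) (m : Cn 3), u = a • vecA x + b • vecB x + perp x m → form3 (perpCoord x w) m = 0 := by
    intro u w huw h1 h2 a b m hu
    rw [← h.bform_perpCoord h1 h2, ← huw, bform_comm u, hu, bform_add_right, bform_add_right,
      bform_smul_right, bform_smul_right, h1, h2]
    ring
  have fAA := key _ _ (by rw [bform_cj_cj, bform_vecA_vecA, star_zero])
    (by rw [bform_comm]; exact hAA) (by rw [bform_comm]; exact hBA) _ _ _ dA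
  have fBB := key _ _ (by rw [bform_cj_cj, bform_vecB_vecB, star_zero])
    (by rw [bform_comm]; exact hAB) (by rw [bform_comm]; exact hBB) _ _ _ dB
  have fAB := key _ _ (by rw [bform_cj_cj, bform_comm, bform_vecA_vecB, star_zero])
    (by rw [bform_comm]; exact hAA) (by rw [bform_comm]; exact hBA) _ _ _ dB
  -- The images in E^⊥/E of the two conjugate basis vectors are isotropic and mutually orthogonal,
  -- hence dependent; the corresponding combination of the conjugates lies in E.
  obtain ⟨c, d, hcd, h0⟩ := form3_dependent fAA fBB fAB
  have hmem : cj g (star c • vecA x + star d • vecB x) ∈ (param x).plane := by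
    rw [cj_add, cj_smul, cj_smul, star_star, star_star, dA, dB]
    have e : c • (a • vecA x + b • vecB x + perp x (perpCoord x (cj g (vecA x)))) +
        d • (a' • vecA x + b' • vecB x + perp x (perpCoord x (cj g (vecB x)))) =
        (c * a + d * a') • vecA x + (c * b + d * b') • vecB x +
          (c • perp x (perpCoord x (cj g (vecA x))) + d • perp x (perpCoord x (cj g (vecB x)))) := by
      module
    have e2 : c • perp x (perpCoord x (cj g (vecA x))) + d • perp x (perpCoord x (cj g (vecB x))) =
        0 := by
      rw [← PlaneFrame.perp_smul, ← PlaneFrame.perp_smul]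
      have h1 := congrFun h0
      simp only [Pi.add_apply, Pi.zero_apply] at h1
      ext i
      fin_cases i <;> simp [perp] <;> simp only [Pi.smul_apply, smul_eq_mul] at h1
      · exact h1 0
      · exact h1 1
      · exact h1 2
      · linear_combination -(x 5 * h1 0) - x 4 * h1 1 - x 3 * h1 2
      · linear_combination -(x 2 * h1 0) - x 1 * h1 1 - x 0 * h1 2
    rw [e, e2, add_zero]
    exact mem_param.2 ⟨_, _, rfl⟩
  refine hasRealVector_of_cj_mem (mem_param.2 ⟨_, _, rfl⟩) hmem (smul_add_smul_vec_ne_zero ?_)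
  simpa using hcd

theorem gram_comm (g : SO7C) (P W : Cn 7 → Cn 7) : gram g P W = gram g W P := by
  ext x; simp only [gram]; ring

theorem mem_degeneratePlanes {g : SO7C} {x : Cn 7} :
    g • param x ∈ degeneratePlanes ↔ gram g vecA vecB x = 0 := by
  have hcoef : ∀ a b : ℂ, (∀ w ∈ (g • param x).plane,
      hform (g.val.val.mulVec (a • vecA x + b • vecB x)) w = 0) ↔
      a * hermF g vecA vecA x + b * hermF g vecB vecA x = 0 ∧
        a * hermF g vecA vecB x + b * hermF g vecB vecB x = 0 := by
    intro a b
    constructor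
    · intro h
      have h1 := h _ (moveA_mem g x)
      have h2 := h _ (moveB_mem g x)
      rw [moveA, hform_mulVec, bform_add_left, bform_smul_left, bform_smul_left] at h1
      rw [moveB, hform_mulVec, bform_add_left, bform_smul_left, bform_smul_left] at h2
      exact ⟨h1, h2⟩
    · rintro ⟨h1, h2⟩ _ ⟨w, hw, rfl⟩
      obtain ⟨c, d, rfl⟩ := mem_param.1 hw
      change hform _ (g.val.val.mulVec _) = 0
      rw [hform_mulVec, cj_add, cj_smul, cj_smul]
      simp only [bform_add_left, bform_smul_left, bform_add_right, bform_smul_right]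
      simp only [hermF] at h1 h2
      linear_combination star c * h1 + star d * h2
  constructor
  · rintro ⟨_, ⟨v, hv, rfl⟩, h0, h⟩
    obtain ⟨a, b, rfl⟩ := mem_param.1 hv
    obtain ⟨h1, h2⟩ := (hcoef a b).1 h
    rw [gram]
    by_contra hne
    have ha : a = 0 := by
      have : a * gram g vecA vecB x = 0 := by
        rw [gram]; linear_combination hermF g vecB vecB x * h1 - hermF g vecB vecA x * h2
      exact (mul_eq_zero.1 this).resolve_right hne
    have hb : b = 0 := by
      have : b * gram g vecA vecB x = 0 := by
        rw [gram]; linear_combination hermF g vecA vecA x * h2 - hermF g vecA vecB x * h1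
      exact (mul_eq_zero.1 this).resolve_right hne
    apply h0
    rw [ha, hb]
    simp
  · intro h
    rw [gram] at h
    have hne : ∀ {a b : ℂ}, (a ≠ 0 ∨ b ≠ 0) →
        g.val.val.mulVec (a • vecA x + b • vecB x) ≠ 0 := fun hab h0 =>
      smul_add_smul_vec_ne_zero hab (mulVecLin_injective g (h0.trans (map_zero (Matrix.mulVecLin g.val.val)).symm))
    -- A kernel vector of a singular Gram matrix is read off from its minors; if the relevant
    -- entries are both zero, the second basis vector itself is in the kernel.
    by_cases hc : hermF g vecB vecB x ≠ 0 ∨ hermF g vecA vecB x ≠ 0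
    · refine ⟨_, mem_smul_param_plane.2 (mem_param.2 ⟨hermF g vecB vecB x, -hermF g vecA vecB x,
        rfl⟩), hne (by simpa using hc), (hcoef _ _).2 ⟨?_, ?_⟩⟩
      · linear_combination h
      · ring
    · push Not at hc
      refine ⟨_, mem_smul_param_plane.2 (mem_param.2 ⟨0, 1, rfl⟩), hne (Or.inr one_ne_zero),
        (hcoef _ _).2 ⟨?_, ?_⟩⟩
      · rw [← star_hermF g vecA vecB, hc.2]; simp
      · rw [hc.1]; simp

/-- The span of the two members of a plane frame is the plane. -/
def IsFrameOf (P W : Cn 7 → Cn 7) : Prop :=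
  ∀ x, (param x).plane = Submodule.span ℂ {P x, W x} ∧ LinearIndependent ℂ ![P x, W x]

theorem isFrameOf_AB : IsFrameOf vecA vecB := fun x =>
  ⟨rfl, linearIndependent_of_minor (minor_vecA_vecB x)⟩

theorem isFrameOf_BA : IsFrameOf vecB vecA := fun x =>
  ⟨by rw [Set.pair_comm]; rfl, by
    have h := linearIndependent_of_minor (minor_vecA_vecB x)
    rw [LinearIndependent.pair_iff] at h ⊢
    exact fun s t hst => (h t s (by rw [add_comm]; exact hst)).symm⟩

theorem kerV_ne_zero {g : SO7C} {P W : Cn 7 → Cn 7} (hf : IsFrameOf P W) {x : Cn 7}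
    (h : hermF g W W x ≠ 0) : kerV g P W x ≠ 0 := by
  intro h0
  rw [kerV, sub_eq_add_neg, ← neg_smul] at h0
  exact h (LinearIndependent.pair_iff.1 (hf x).2 _ _ h0).1

theorem kerV_mem {g : SO7C} {P W : Cn 7 → Cn 7} (hf : IsFrameOf P W) (x : Cn 7) :
    kerV g P W x ∈ (param x).plane := by
  rw [(hf x).1]
  exact Submodule.sub_mem _ (Submodule.smul_mem _ _ (Submodule.subset_span (by simp)))
    (Submodule.smul_mem _ _ (Submodule.subset_span (by simp)))

/-- A degenerate plane without real vectors is regular, in one of the two orders of the basis. -/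
theorem exists_regularAt {g : SO7C} {x : Cn 7} (hE : g • param x ∈ degeneratePlanes)
    (hr : ¬ HasRealVector (g • param x)) : ∃ (P W : Cn 7 → Cn 7) (dP dW : Cn 7 → Cn 7 → Cn 7),
      PlaneFrame P W dP dW ∧ IsFrameOf P W ∧ gram g P W = gram g vecA vecB ∧
      ∃ s, PlaneFrame.RegularAt g P W s x := by
  rw [mem_degeneratePlanes] at hE
  have key : ∀ (P W : Cn 7 → Cn 7) (dP dW : Cn 7 → Cn 7 → Cn 7), PlaneFrame P W dP dW →
      IsFrameOf P W → gram g P W x = 0 → hermF g W W x ≠ 0 →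
      ∃ s, PlaneFrame.RegularAt g P W s x := by
    intro P W dP dW h hf hg hW
    -- If the image of `kerC` in E^⊥/E were zero, the conjugate of the kernel vector would lie in E
    -- and give a real vector.
    have hm : kerM g P W x ≠ 0 := by
      intro hm
      obtain ⟨a, b, hc⟩ := h.kerC_decomp hg
      refine hr (hasRealVector_of_cj_mem (kerV_mem (g := g) hf x) ?_ (kerV_ne_zero hf hW))
      rw [← kerC, hc, hm, (hf x).1]
      have : perp x 0 = 0 := by
        ext i; fin_cases i <;> simp [perp]
      rw [this, add_zero]
      exact Submodule.mem_span_pair.2 ⟨_, _, rfl⟩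
    by_contra! H
    apply hm
    have H' : ∀ s, form3 (kerM g P W x) s = 0 := fun s => by
      by_contra h0
      exact H s ⟨hg, hW, h0⟩
    ext i
    fin_cases i
    · simpa [form3] using H' ![0, 0, 1]
    · simpa [form3] using H' ![0, 1, 0]
    · simpa [form3] using H' ![1, 0, 0]
  by_cases hB : hermF g vecB vecB x = 0
  -- If both diagonal entries vanished, the zero Gram determinant would kill the off-diagonal entry
  -- as well, and h would vanish on the plane.
  · have hA : hermF g vecA vecA x ≠ 0 := by
      intro hA
      refine hr (hasRealVector_of_hermF_eq_zero hA ?_ hB)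
      rw [gram, hB, mul_zero, zero_sub, neg_eq_zero, ← star_hermF g vecA vecB] at hE
      rcases mul_eq_zero.1 hE with h | h
      · exact h
      · exact star_eq_zero.1 h
    exact ⟨vecB, vecA, _, _, planeFrame_BA, isFrameOf_BA, gram_comm _ _ _,
      key _ _ _ _ planeFrame_BA isFrameOf_BA (by rw [gram_comm]; exact hE) hA⟩
  · exact ⟨vecA, vecB, _, _, planeFrame_AB, isFrameOf_AB, rfl,
      key _ _ _ _ planeFrame_AB isFrameOf_AB hE hB⟩

/-- The adapted coframe of a set that agrees, near a degenerate plane without real vectors, with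
the set of degenerate planes. -/
theorem exists_adaptedCoframe {g : SO7C} {x : Cn 7} {M : Set (Cn 7)}
    (hE : g • param x ∈ degeneratePlanes) (hr : ¬ HasRealVector (g • param x))
    (hM : ∀ᶠ y in 𝓝 x, y ∈ M ↔ g • param y ∈ degeneratePlanes) :
    ∃ U ρ a, x ∈ U ∧ AdaptedCoframe M U ρ a PlaneFrame.spanRank := by
  obtain ⟨P, W, dP, dW, h, -, hg, s, hs⟩ := exists_regularAt hE hr
  refine h.exists_adaptedCoframe hs ?_
  filter_upwards [hM] with y hy
  rw [hy, mem_degeneratePlanes, hg]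

end SevenDim

namespace SevenDim

open CR

/-! ## Completion of a system of six vectors -/

theorem eq_zero_of_bform {v : Cn 7} (h : ∀ w, bform v w = 0) : v = 0 := by
  ext i
  have := h (Pi.single (Fin.rev i) 1)
  rwa [bform, Finset.sum_eq_single i, Pi.single_eq_same, mul_one] at this
  · intro j _ hj
    rw [Pi.single_eq_of_ne (fun h => hj (Fin.rev_injective h)), mul_zero]
  · simp

/-- The vector that represents the functional `y ↦ det (f₀, f₁, f₂, y, f₄, f₅, f₆)`. -/
def crossVec (f : Fin 7 → Cn 7) : Cn 7 :=
  fun k => ((Matrix.of f).updateRow 3 (Pi.single (Fin.rev k) 1)).det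

theorem bform_crossVec (f : Fin 7 → Cn 7) (y : Cn 7) :
    bform (crossVec f) y = ((Matrix.of f).updateRow 3 y).det := by
  have h : ∀ y, ((Matrix.of f).updateRow 3 y).det = (Matrix.of f).transpose.cramer y 3 := fun y =>
    (Matrix.cramer_transpose_apply _ _ _).symm
  have hy : y = ∑ k, y (Fin.rev k) • (Pi.single (Fin.rev k) 1 : Cn 7) := by
    have e := pi_eq_sum_univ' y
    rw [← Equiv.sum_comp Fin.revPerm] at e
    simp only [Fin.revPerm_apply] at e
    exact e
  rw [h]
  conv_rhs => rw [hy]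
  rw [map_sum, Finset.sum_apply, bform]
  refine Finset.sum_congr rfl fun k _ => ?_
  rw [map_smul, Pi.smul_apply, smul_eq_mul, mul_comm, crossVec, h]

theorem bform_crossVec_of_ne (f : Fin 7 → Cn 7) {i : Fin 7} (hi : i ≠ 3) :
    bform (crossVec f) (f i) = 0 := by
  rw [bform_crossVec]
  exact Matrix.det_zero_of_row_eq hi (by
    rw [Matrix.updateRow_self, Matrix.updateRow_ne hi]; rfl)

theorem bmatrix_mul_bmatrix : bmatrix * bmatrix = 1 := by
  ext i j
  rw [Matrix.mul_apply, Finset.sum_eq_single (Fin.rev i)]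
  · simp [bmatrix, Matrix.one_apply, eq_comm]
  · intro k _ hk
    simp [bmatrix, hk]
  · simp

theorem det_bmatrix_ne_zero : bmatrix.det ≠ 0 := by
  intro h
  have := congrArg Matrix.det bmatrix_mul_bmatrix
  rw [Matrix.det_mul, h, zero_mul, Matrix.det_one] at this
  exact zero_ne_one this

theorem mul_bmatrix_mul_transpose (F : Matrix (Fin 7) (Fin 7) ℂ) (i j : Fin 7) :
    (F * bmatrix * F.transpose) i j = bform (F i) (F j) := by
  have h : ∀ k, (F * bmatrix) i k = F i (Fin.rev k) := by
    intro k
    rw [Matrix.mul_apply, Finset.sum_eq_single (Fin.rev k)]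
    · simp [bmatrix]
    · intro b _ hb
      rw [bmatrix, Matrix.of_apply, if_neg (by rintro rfl; simp at hb), mul_zero]
    · simp
  rw [Matrix.mul_apply, bform, ← Equiv.sum_comp Fin.revPerm]
  refine Finset.sum_congr rfl fun k _ => ?_
  rw [h, Matrix.transpose_apply, Fin.revPerm_apply, Fin.rev_rev]

/-- The Gram determinant of an almost standard basis. -/
theorem det_sq_of_gram {F : Matrix (Fin 7) (Fin 7) ℂ} {d : ℂ}
    (hF : ∀ i j, bform (F i) (F j) = if j = Fin.rev i then (if i = 3 then d else 1) else 0) :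
    F.det ^ 2 = d := by
  have h1 : F * bmatrix * F.transpose = Matrix.diagonal (fun i => if i = 3 then d else 1) * bmatrix := by
    ext i j
    rw [mul_bmatrix_mul_transpose, hF, Matrix.diagonal_mul, bmatrix, Matrix.of_apply]
    simp
  have h2 := congrArg Matrix.det h1
  rw [Matrix.det_mul, Matrix.det_mul, Matrix.det_mul, Matrix.det_transpose, Matrix.det_diagonal,
    Finset.prod_ite_eq' Finset.univ (3 : Fin 7) (fun _ => d), if_pos (Finset.mem_univ _)] at h2
  refine mul_right_cancel₀ det_bmatrix_ne_zero ?_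
  rw [← h2]; ring

/-- The completion of six of the vectors of a standard basis. -/
def completion (f : Fin 7 → Cn 7) : Fin 7 → Cn 7 := Function.update f 3 (crossVec f)

theorem completion_of_ne (f : Fin 7 → Cn 7) {i : Fin 7} (hi : i ≠ 3) : completion f i = f i :=
  Function.update_of_ne hi _ _

theorem of_update (f : Fin 7 → Cn 7) (u : Cn 7) :
    Matrix.of (Function.update f 3 u) = (Matrix.of f).updateRow 3 u := rfl

theorem bform_update {f : Fin 7 → Cn 7}
    (hf : ∀ i j, i ≠ 3 → j ≠ 3 → bform (f i) (f j) = if j = Fin.rev i then 1 else 0) {u : Cn 7}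
    (hu : ∀ i, i ≠ 3 → bform u (f i) = 0) (i j : Fin 7) :
    bform (Function.update f 3 u i) (Function.update f 3 u j) =
      if j = Fin.rev i then (if i = 3 then bform u u else 1) else 0 := by
  by_cases hi : i = 3
  · subst hi
    by_cases hj : j = 3
    · subst hj
      simp [Fin.rev]
    · have : j ≠ Fin.rev 3 := hj
      rw [Function.update_self, Function.update_of_ne hj, hu j hj, if_neg this]
  · by_cases hj : j = 3
    · subst hj
      have : (3 : Fin 7) ≠ Fin.rev i := by
        intro h
        apply hi
        rw [← Fin.rev_rev i, ← h]; rfl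
      rw [Function.update_self, Function.update_of_ne hi, bform_comm, hu i hi, if_neg this]
    · rw [Function.update_of_ne hi, Function.update_of_ne hj, hf i j hi hj, if_neg hi]

/-- Let u ≠ 0 be orthogonal to the six vectors, and let δ be the determinant with u in the middle
row. The Gram determinant gives δ² = b(u,u). Now `crossVec f` is also orthogonal to the six vectors
and pairs with u to δ, so it equals u/δ and has norm 1. -/
theorem bform_crossVec_self {f : Fin 7 → Cn 7}
    (hf : ∀ i j, i ≠ 3 → j ≠ 3 → bform (f i) (f j) = if j = Fin.rev i then 1 else 0) :
    bform (crossVec f) (crossVec f) = 1 := by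
  classical
  obtain ⟨y, hy⟩ : ∃ y : Cn 7, y ∉ Submodule.span ℂ (f '' {i | i ≠ 3}) := by
    by_contra! H
    have h1 : Submodule.span ℂ (f '' {i | i ≠ 3}) = ⊤ := Submodule.eq_top_iff'.2 H
    have h2 : f '' {i | i ≠ 3} = ((Finset.univ.filter (· ≠ (3 : Fin 7))).image f : Finset (Cn 7)) := by
      ext; simp
    have h3 := finrank_span_finset_le_card (R := ℂ) ((Finset.univ.filter (· ≠ (3 : Fin 7))).image f)
    rw [Set.finrank, ← h2, h1, finrank_top, Module.finrank_fin_fun] at h3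
    have h4 := h3.trans Finset.card_image_le
    revert h4
    decide
  set u : Cn 7 := y - ∑ i ∈ Finset.univ.filter (· ≠ (3 : Fin 7)), bform y (f (Fin.rev i)) • f i with hu
  have hrev : ∀ i : Fin 7, i ≠ 3 → Fin.rev i ≠ 3 := by decide
  have hperp : ∀ i, i ≠ 3 → bform u (f i) = 0 := by
    intro i hi
    rw [hu, bform_sub_left, bform_sum_left, Finset.sum_eq_single (Fin.rev i), bform_smul_left,
      hf _ _ (hrev i hi) hi]
    · simp
    · intro j hj hji
      rw [bform_smul_left, hf _ _ (Finset.mem_filter.1 hj).2 hi, if_neg, mul_zero]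
      rintro rfl
      simp at hji
    · intro h
      exact (h (by rw [Finset.mem_filter]; exact ⟨Finset.mem_univ _, hrev i hi⟩)).elim
  have hu0 : u ≠ 0 := by
    intro h0
    rw [hu, sub_eq_zero] at h0
    apply hy
    rw [h0]
    exact Submodule.sum_mem _ fun i hi => Submodule.smul_mem _ _
      (Submodule.subset_span ⟨i, (Finset.mem_filter.1 hi).2, rfl⟩)
  have hgram := bform_update hf hperp
  have hsq : ((Matrix.of f).updateRow 3 u).det ^ 2 = bform u u := by
    rw [← of_update]
    exact det_sq_of_gram hgram
  have hdet : ((Matrix.of f).updateRow 3 u).det ≠ 0 := by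
    intro h0
    obtain ⟨c, hc, hc0⟩ := Matrix.exists_vecMul_eq_zero_iff.2 h0
    apply hc
    have hsum : ∑ i, c i • Function.update f 3 u i = 0 := by
      rw [← hc0]
      ext k
      simp only [Finset.sum_apply, Pi.smul_apply, smul_eq_mul, Matrix.vecMul, dotProduct]
      rfl
    have hne : ∀ i, i ≠ 3 → c i = 0 := by
      intro i hi
      have := congrArg (fun v => bform v (f (Fin.rev i))) hsum
      simp only [bform_sum_left, bform_smul_left, bform_zero_left] at this
      rw [Finset.sum_eq_single i, Function.update_of_ne hi, hf _ _ hi (hrev i hi)] at this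
      · simpa using this
      · intro j _ hj
        by_cases h3 : j = 3
        · subst h3
          rw [Function.update_self, hperp _ (hrev i hi), mul_zero]
        · rw [Function.update_of_ne h3, hf _ _ h3 (hrev i hi), if_neg, mul_zero]
          exact fun h => hj (Fin.rev_injective h).symm
      · simp
    have h3 : c 3 = 0 := by
      rw [Finset.sum_eq_single 3 (fun j _ hj => by rw [hne j hj, zero_smul]) (by simp),
        Function.update_self] at hsum
      exact (smul_eq_zero.1 hsum).resolve_right hu0
    ext i
    by_cases hi : i = 3
    · rw [hi, h3]; rfl
    · exact hne i hi
  set δ := ((Matrix.of f).updateRow 3 u).det with hδ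
  have hv : crossVec f = δ⁻¹ • u := by
    rw [← sub_eq_zero]
    have hort : ∀ i, bform (crossVec f - δ⁻¹ • u) (Function.update f 3 u i) = 0 := by
      intro i
      by_cases hi : i = 3
      · subst hi
        rw [Function.update_self, bform_sub_left, bform_smul_left, bform_crossVec, ← hδ, ← hsq]
        field_simp
        ring
      · rw [Function.update_of_ne hi, bform_sub_left, bform_smul_left, bform_crossVec_of_ne f hi,
          hperp i hi]
        ring
    have h1 : (Matrix.of (Function.update f 3 u)).mulVec
        (fun k => (crossVec f - δ⁻¹ • u) (Fin.rev k)) = 0 := by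
      ext i
      have := hort i
      rw [bform_comm, bform] at this
      exact this
    have h2 := Matrix.eq_zero_of_mulVec_eq_zero (by rwa [of_update]) h1
    ext k
    have := congrFun h2 (Fin.rev k)
    simpa using this
  rw [hv, bform_smul_left, bform_smul_right, ← hsq]
  field_simp

theorem bform_completion {f : Fin 7 → Cn 7}
    (hf : ∀ i j, i ≠ 3 → j ≠ 3 → bform (f i) (f j) = if j = Fin.rev i then 1 else 0) (i j : Fin 7) :
    bform (completion f i) (completion f j) = if j = Fin.rev i then 1 else 0 := by
  rw [completion, bform_update hf (fun i hi => bform_crossVec_of_ne f hi), bform_crossVec_self hf]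
  simp

/-- The determinant with `crossVec f` in the middle row is the norm of `crossVec f`, so the
normalization to determinant 1 is automatic and leaves no choice of sign. -/
theorem det_completion {f : Fin 7 → Cn 7}
    (hf : ∀ i j, i ≠ 3 → j ≠ 3 → bform (f i) (f j) = if j = Fin.rev i then 1 else 0) :
    (Matrix.of (completion f)).det = 1 := by
  rw [completion, of_update, ← bform_crossVec, bform_crossVec_self hf]

theorem continuousAt_completion {X : Type*} [TopologicalSpace X] {f : X → Fin 7 → Cn 7} {p : X}
    (hf : ∀ i, i ≠ 3 → ContinuousAt (fun x => f x i) p) (i : Fin 7) :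
    ContinuousAt (fun x => completion (f x) i) p := by
  by_cases hi : i = 3
  · subst hi
    simp only [completion, Function.update_self]
    refine continuousAt_pi.2 fun k => ?_
    have hdet : Continuous fun A : Matrix (Fin 7) (Fin 7) ℂ => A.det := continuous_id.matrix_det
    have hrow : ContinuousAt (fun x => (Matrix.of (f x)).updateRow 3
        (Pi.single (Fin.rev k) (1 : ℂ))) p := ?_
    · simp only [crossVec]
      exact hdet.continuousAt.comp' hrow
    refine continuousAt_pi.2 fun i => ?_
    by_cases hi : i = 3
    · subst hi
      simp only [Matrix.updateRow_self]
      exact continuousAt_const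
    · simp only [Matrix.updateRow_ne hi]
      exact hf i hi
  · simp only [completion_of_ne _ hi]
    exact hf i hi

/-! ## Bases adapted to the complex conjugation -/

/-- The permutation by which the complex conjugation acts on the adapted bases. -/
def conjPerm : Equiv.Perm (Fin 7) := Equiv.swap 0 6 * Equiv.swap 1 2 * Equiv.swap 4 5

/-- The signs by which the complex conjugation acts on the adapted bases. -/
def conjSign (i : Fin 7) : ℤ := if i = 3 then -1 else 1

theorem conjPerm_conjPerm (i : Fin 7) : conjPerm (conjPerm i) = i := by revert i; decide

theorem conjSign_conjPerm (i : Fin 7) : conjSign (conjPerm i) = conjSign i := by revert i; decide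

theorem conjSign_mul_self (i : Fin 7) : conjSign i * conjSign i = 1 := by revert i; decide

theorem conjPerm_ne {i : Fin 7} (hi : i ≠ 3) : conjPerm i ≠ 3 := by revert i; decide

/-- A standard basis on which the complex conjugation acts in the standard way. -/
structure IsAdaptedBasis (f : Fin 7 → Cn 7) : Prop where
  gram : ∀ i j, bform (f i) (f j) = if j = Fin.rev i then 1 else 0
  det : (Matrix.of f).det = 1
  star : ∀ i, star (f i) = (conjSign i : ℂ) • f (conjPerm i)

/-- The middle vector is determined by the other six. Conjugation permutes these by an odd
permutation, which changes the sign of the determinant that defines the middle vector; hence the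
sign -1 there. -/
theorem isAdaptedBasis_completion {f : Fin 7 → Cn 7}
    (hf : ∀ i j, i ≠ 3 → j ≠ 3 → bform (f i) (f j) = if j = Fin.rev i then 1 else 0)
    (hs : ∀ i, i ≠ 3 → star (f i) = f (conjPerm i)) : IsAdaptedBasis (completion f) := by
  refine ⟨bform_completion hf, det_completion hf, fun i => ?_⟩
  by_cases hi : i = 3
  · subst hi
    have hsgn : conjSign 3 = -1 := rfl
    have hp : conjPerm 3 = 3 := by decide
    rw [hsgn, hp, completion, Function.update_self]
    push_cast
    rw [neg_one_smul]
    rw [← sub_eq_zero]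
    refine eq_zero_of_bform fun w => ?_
    rw [bform_sub_left, sub_eq_zero, ← star_star w, bform_star, star_star, bform_crossVec]
    rw [← neg_one_smul ℂ (crossVec f), bform_smul_left, bform_crossVec]
    have e : ((Matrix.of f).updateRow 3 w) =
        (((Matrix.of f).updateRow 3 (star w)).map (starRingEnd ℂ)).submatrix conjPerm id := by
      ext i j
      simp only [Matrix.submatrix_apply, Matrix.map_apply, id_eq]
      by_cases hi : i = 3
      · subst hi
        rw [hp, Matrix.updateRow_self, Matrix.updateRow_self]
        simp
      · rw [Matrix.updateRow_ne hi, Matrix.updateRow_ne (conjPerm_ne hi)]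
        have := congrFun (hs _ (conjPerm_ne hi)) j
        rw [conjPerm_conjPerm] at this
        exact this.symm
    have e2 := congrArg Matrix.det e
    have hsg : Equiv.Perm.sign conjPerm = -1 := by decide
    rw [Matrix.det_permute, hsg, ← RingHom.mapMatrix_apply, ← RingHom.map_det] at e2
    rw [e2]
    simp
  · have hsgn : conjSign i = 1 := if_neg hi
    rw [completion_of_ne f hi, completion_of_ne f (conjPerm_ne hi), hs i hi, hsgn]
    simp

end SevenDim

namespace SevenDim

open CR

namespace IsAdaptedBasis

variable {f f' : Fin 7 → Cn 7}

/-- The element of `SO(7, ℂ)` with the columns `f i`. -/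
def toSO (h : IsAdaptedBasis f) : SO7C := ofColumns f h.gram h.det

theorem toSO_mulVec_single (h : IsAdaptedBasis f) (i : Fin 7) :
    h.toSO.val.val.mulVec (Pi.single i 1) = f i := ofColumns_mulVec_single f _ _ i

theorem eq_toSO_smul (h : IsAdaptedBasis f) {E : IsoGrass} (h0 : f 0 ∈ E.plane)
    (h1 : f 1 ∈ E.plane) : E = h.toSO • param 0 := by
  apply IsoGrass.ext
  symm
  apply Submodule.eq_of_le_of_finrank_eq
  · rw [toSO, ofColumns_smul_param_zero, Submodule.span_le]
    rintro v (rfl | rfl)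
    · exact h0
    · exact h1
  · rw [IsoGrass.finrank_eq, IsoGrass.finrank_eq]

end IsAdaptedBasis

theorem map_conj_mulVec (M : Matrix (Fin 7) (Fin 7) ℂ) (v : Cn 7) :
    (M.map (starRingEnd ℂ)).mulVec v = star (M.mulVec (star v)) := by
  ext i
  simp [Matrix.mulVec, dotProduct]

theorem mem_SO34 {g : SO7C} : g ∈ SO34 ↔ g.val.val.map (starRingEnd ℂ) = g.val.val := Iff.rfl

theorem star_mulVec_of_mem_SO34 {g : SO7C} (hg : g ∈ SO34) (v : Cn 7) :
    star (g.val.val.mulVec v) = g.val.val.mulVec (star v) := by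
  conv_rhs => rw [← mem_SO34.1 hg, map_conj_mulVec, star_star]

/-- Two adapted bases differ by an element of `SO(3, 4)`. -/
theorem IsAdaptedBasis.toSO_mul_inv_mem {f f' : Fin 7 → Cn 7} (h : IsAdaptedBasis f)
    (h' : IsAdaptedBasis f') : h'.toSO * h.toSO⁻¹ ∈ SO34 := by
  rw [mem_SO34]
  set k := h'.toSO * h.toSO⁻¹ with hk
  have hkf : ∀ i, k.val.val.mulVec (f i) = f' i := by
    intro i
    rw [← h.toSO_mulVec_single, ← h'.toSO_mulVec_single, hk]
    change (h'.toSO.val.val * (h.toSO⁻¹).val.val).mulVec _ = _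
    rw [← Matrix.mulVec_mulVec, inv_mulVec_mulVec]
  -- Conjugation acts on both bases by the same signed permutation, so the matrix k and its
  -- conjugate agree on every vector of the first basis.
  have key : ∀ i, (k.val.val.map (starRingEnd ℂ)).mulVec (f i) = k.val.val.mulVec (f i) := by
    intro i
    rw [map_conj_mulVec, h.star, Matrix.mulVec_smul, hkf, hkf, star_smul, h'.star, smul_smul,
      conjPerm_conjPerm, conjSign_conjPerm]
    have := conjSign_mul_self i
    have e : (Star.star (conjSign i : ℂ)) * (conjSign i : ℂ) = 1 := by
      have h2 : ((conjSign i * conjSign i : ℤ) : ℂ) = 1 := by rw [this]; simp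
      rw [← h2]; simp
    rw [e, one_smul]
  have hm : k.val.val.map (starRingEnd ℂ) * h.toSO.val.val = k.val.val * h.toSO.val.val := by
    ext i j
    have := congrFun (key j) i
    simp only [← h.toSO_mulVec_single, Matrix.mulVec_mulVec] at this
    simpa using this
  have := congrArg (fun M => M * (h.toSO⁻¹).val.val) hm
  simpa [mul_assoc] using this

/-! ### The construction of adapted bases -/

/-- The last step in the construction of an adapted basis. -/
def seedY (v w y : Cn 7) : Cn 7 :=
  let Δ := bform y v * star (bform y v) - bform y (star v) * star (bform y (star v))
  let y₁ := (star (bform y v) / Δ) • y - (bform y (star v) / Δ) • star y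
  let y₂ := y₁ - (bform y₁ (star w) / hform w w) • w - (bform y₁ w / hform w w) • star w
  y₂ - (bform y₂ y₂ / 2) • v - (bform y₂ (star y₂) / 2) • star v

/-- The properties of the vectors from which an adapted basis is constructed. -/
structure IsSeed (v w y : Cn 7) : Prop where
  bvv : bform v v = 0
  bvw : bform v w = 0
  bww : bform w w = 0
  hvv : bform v (star v) = 0
  hvw : bform v (star w) = 0
  pos : ∃ η : ℝ, 0 < η ∧ hform w w = η
  ne : bform y v * star (bform y v) - bform y (star v) * star (bform y (star v)) ≠ 0

theorem bform_star_left (v w : Cn 7) : bform (star v) w = star (bform v (star w)) := by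
  rw [← bform_star, star_star]

theorem bform_star_right (v w : Cn 7) : bform v (star w) = star (bform (star v) w) := by
  rw [← bform_star, star_star]

namespace IsSeed

variable {v w y : Cn 7}

theorem hform_ne (h : IsSeed v w y) : hform w w ≠ 0 := by
  obtain ⟨η, h1, h2⟩ := h.pos
  rw [h2]
  exact_mod_cast h1.ne'

theorem hwv (h : IsSeed v w y) : bform w (star v) = 0 := by
  rw [bform_star_right, bform_comm, h.hvw, star_zero]

/-- Three corrections of y. First, a combination of y and its conjugate solves the 2 × 2 system, of
determinant Δ, for being dual to v and orthogonal to the conjugate of v. Second, the components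
along w and its conjugate are removed. Third, multiples of v and its conjugate remove both norms.
The third correction keeps the earlier relations, since v and its conjugate are null, orthogonal to
each other, and orthogonal to w and its conjugate. -/
theorem seedY_spec (h : IsSeed v w y) : bform (seedY v w y) v = 1 ∧
    bform (seedY v w y) (star v) = 0 ∧ bform (seedY v w y) w = 0 ∧
    bform (seedY v w y) (star w) = 0 ∧ bform (seedY v w y) (seedY v w y) = 0 ∧
    bform (seedY v w y) (star (seedY v w y)) = 0 := by
  obtain ⟨Δ, hΔ⟩ : ∃ Δ, Δ = bform y v * star (bform y v) - bform y (star v) * star (bform y (star v)) :=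
    ⟨_, rfl⟩
  obtain ⟨y₁, hy₁⟩ : ∃ y₁, y₁ = (star (bform y v) / Δ) • y - (bform y (star v) / Δ) • star y :=
    ⟨_, rfl⟩
  obtain ⟨y₂, hy₂⟩ : ∃ y₂, y₂ = y₁ - (bform y₁ (star w) / hform w w) • w -
    (bform y₁ w / hform w w) • star w := ⟨_, rfl⟩
  have hY : seedY v w y = y₂ - (bform y₂ y₂ / 2) • v - (bform y₂ (star y₂) / 2) • star v := by
    rw [hy₂, hy₁, hΔ]; rfl
  have hΔ0 : Δ ≠ 0 := hΔ ▸ h.ne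
  have hη := h.hform_ne
  have ww : bform w (star w) = hform w w := rfl
  have sww : bform (star w) w = hform w w := by rw [bform_comm]; rfl
  have swsw : bform (star w) (star w) = 0 := by rw [bform_star, h.bww, star_zero]
  have svsv : bform (star v) (star v) = 0 := by rw [bform_star, h.bvv, star_zero]
  have a1 : bform y₁ v = 1 := by
    rw [hy₁, bform_sub_left, bform_smul_left, bform_smul_left, bform_star_left]
    field_simp
    rw [hΔ]; ring
  have a2 : bform y₁ (star v) = 0 := by
    rw [hy₁, bform_sub_left, bform_smul_left, bform_smul_left, bform_star]
    ring
  have b1 : bform y₂ v = 1 := by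
    rw [hy₂, bform_sub_left, bform_sub_left, bform_smul_left, bform_smul_left, a1, bform_comm w,
      h.bvw, bform_comm (star w), h.hvw]
    ring
  have b2 : bform y₂ (star v) = 0 := by
    rw [hy₂, bform_sub_left, bform_sub_left, bform_smul_left, bform_smul_left, a2, h.hwv,
      bform_star w, bform_comm w, h.bvw]
    simp
  have b3 : bform y₂ w = 0 := by
    rw [hy₂, bform_sub_left, bform_sub_left, bform_smul_left, bform_smul_left, h.bww, sww]
    field_simp
    ring
  have b4 : bform y₂ (star w) = 0 := by
    rw [hy₂, bform_sub_left, bform_sub_left, bform_smul_left, bform_smul_left, swsw, ww]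
    field_simp
    ring
  have b5 : star (bform y₂ (star y₂)) = bform y₂ (star y₂) := by
    rw [← bform_star, star_star, bform_comm]
  have b6 : bform v (star y₂) = 0 := by rw [bform_star_right, bform_comm, b2, star_zero]
  have b7 : bform (star v) (star y₂) = 1 := by rw [bform_star, bform_comm, b1, star_one]
  have b8 := (bform_comm v y₂).trans b1
  have b9 := (bform_comm (star v) y₂).trans b2
  rw [hY]
  refine ⟨?_, ?_, ?_, ?_, ?_, ?_⟩
  · rw [bform_sub_left, bform_sub_left, bform_smul_left, bform_smul_left, b1, h.bvv,
      bform_comm (star v), h.hvv]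
    ring
  · rw [bform_sub_left, bform_sub_left, bform_smul_left, bform_smul_left, b2, h.hvv, svsv]
    ring
  · rw [bform_sub_left, bform_sub_left, bform_smul_left, bform_smul_left, b3, h.bvw,
      bform_comm (star v), h.hwv]
    ring
  · rw [bform_sub_left, bform_sub_left, bform_smul_left, bform_smul_left, b4, h.hvw,
      bform_star v, h.bvw]
    simp
  · simp only [bform_sub_left, bform_sub_right, bform_smul_left, bform_smul_right, h.bvv, h.hvv,
      svsv, b1, b2, b8, b9, bform_comm (star v) v]
    ring
  · simp only [star_sub, star_smul, star_star, bform_sub_left, bform_sub_right, bform_smul_left,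
      bform_smul_right, h.bvv, h.hvv, svsv, b1, b2, b6, b7, bform_comm (star v) v, star_div₀, b5]
    simp
    ring

end IsSeed

/-- The vectors of an adapted basis, except for the middle one. -/
def seedBasis (v w y : Cn 7) : Fin 7 → Cn 7 :=
  ![((Real.sqrt (hform w w).re)⁻¹ : ℂ) • w, v, star v, 0, star (seedY v w y), seedY v w y,
    ((Real.sqrt (hform w w).re)⁻¹ : ℂ) • star w]

theorem IsSeed.isAdaptedBasis {v w y : Cn 7} (h : IsSeed v w y) :
    IsAdaptedBasis (completion (seedBasis v w y)) := by
  obtain ⟨η, hη, hw⟩ := h.pos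
  obtain ⟨y1, y2, y3, y4, y5, y6⟩ := h.seedY_spec
  set Y := seedY v w y with hY
  have hre : (hform w w).re = η := by rw [hw]; simp
  -- The factor 1/√η is real because η > 0, so it is compatible with conjugation and normalizes the
  -- pairing of w with its conjugate to 1.
  have hc : ((Real.sqrt η : ℂ)⁻¹) * ((Real.sqrt η : ℂ)⁻¹ * η) = 1 := by
    have h0 : (Real.sqrt η : ℂ) ≠ 0 := by
      exact_mod_cast (Real.sqrt_pos.2 hη).ne'
    have h1 : (η : ℂ) = Real.sqrt η * Real.sqrt η := by
      exact_mod_cast (Real.mul_self_sqrt hη.le).symm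
    rw [h1]; field_simp
  set c : ℂ := (Real.sqrt η : ℂ)⁻¹ with hcdef
  have hcs : star c = c := by simp [hcdef]
  have hS : seedBasis v w y = ![c • w, v, star v, 0, star Y, Y, c • star w] := by
    rw [seedBasis, hre]
  have ww : bform w (star w) = η := hw
  have e1 := h.bvv
  have e2 := h.bvw
  have e3 := h.bww
  have e4 := h.hvv
  have e5 := h.hvw
  have e6 := h.hwv
  rw [hS]
  refine isAdaptedBasis_completion ?_ ?_
  · have sv : ∀ u, bform (star v) u = star (bform v (star u)) := bform_star_left v
    have sw : ∀ u, bform (star w) u = star (bform w (star u)) := bform_star_left w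
    have sY : ∀ u, bform (star Y) u = star (bform Y (star u)) := bform_star_left Y
    have f1 := (bform_comm w v).trans e2
    have f2 : bform v Y = 1 := (bform_comm v Y).trans y1
    have f3 : bform v (star Y) = 0 := by rw [bform_star_right, bform_comm, y2, star_zero]
    have f4 : bform w Y = 0 := (bform_comm w Y).trans y3
    have f5 : bform w (star Y) = 0 := by rw [bform_star_right, bform_comm, y4, star_zero]
    intro i j hi hj
    fin_cases i <;> first | exact absurd rfl hi | skip
    all_goals fin_cases j <;> first | exact absurd rfl hj | skip
    all_goals simp [Fin.rev, bform_smul_left, bform_smul_right, sv, sw, sY, e1, e2, e3, e4, e5, e6,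
      y1, y2, y3, y4, y5, y6, f1, f2, f3, f4, f5, ww]
    all_goals exact hc
  · intro i hi
    fin_cases i <;> first | exact absurd rfl hi | skip
    all_goals simp [conjPerm, Equiv.swap_apply_def, star_smul]
    all_goals rw [show (starRingEnd ℂ) c = c from hcs]

theorem _root_.ContinuousAt.bform {X : Type*} [TopologicalSpace X] {f g : X → Cn 7} {p : X}
    (hf : ContinuousAt f p) (hg : ContinuousAt g p) :
    ContinuousAt (fun x => bform (f x) (g x)) p :=
  tendsto_finsetSum _ fun i _ =>
    (continuousAt_pi.1 hf i).mul (continuousAt_pi.1 hg (Fin.rev i))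

theorem continuousAt_seedY {X : Type*} [TopologicalSpace X] {v w : X → Cn 7} {y : Cn 7} {p : X}
    (hv : ContinuousAt v p) (hw : ContinuousAt w p) (h : IsSeed (v p) (w p) y) :
    ContinuousAt (fun x => seedY (v x) (w x) y) p := by
  have hy : ContinuousAt (fun _ : X => y) p := continuousAt_const
  have hsv : ContinuousAt (fun x => star (v x)) p := hv.star
  have hsw : ContinuousAt (fun x => star (w x)) p := hw.star
  have hη : ContinuousAt (fun x => hform (w x) (w x)) p := hw.bform hsw
  have h1 := hy.bform hv
  have h2 := hy.bform hsv
  have hΔ := (h1.mul h1.star).sub (h2.mul h2.star)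
  have hy₁ := ((h1.star.div hΔ h.ne).smul hy).sub ((h2.div hΔ h.ne).smul hy.star)
  have hy₂ := (hy₁.sub (((hy₁.bform hsw).div hη h.hform_ne).smul hw)).sub
    (((hy₁.bform hw).div hη h.hform_ne).smul hsw)
  exact (hy₂.sub (((hy₂.bform hy₂).div_const 2).smul hv)).sub
    (((hy₂.bform hy₂.star).div_const 2).smul hsv)

theorem continuousAt_completion_seedBasis {X : Type*} [TopologicalSpace X] {v w : X → Cn 7}
    {y : Cn 7} {p : X} (hv : ContinuousAt v p) (hw : ContinuousAt w p) (h : IsSeed (v p) (w p) y)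
    (i : Fin 7) : ContinuousAt (fun x => completion (seedBasis (v x) (w x) y) i) p := by
  have hY := continuousAt_seedY hv hw h
  have hc : ContinuousAt (fun x => ((Real.sqrt (hform (w x) (w x)).re : ℂ))⁻¹) p := by
    have h1 : ContinuousAt (fun x => hform (w x) (w x)) p := hw.bform hw.star
    have h2 : ContinuousAt (fun x => Real.sqrt (hform (w x) (w x)).re) p :=
      Real.continuous_sqrt.continuousAt.comp' (Complex.continuous_re.continuousAt.comp' h1)
    refine ContinuousAt.inv₀ (Complex.continuous_ofReal.continuousAt.comp' h2) ?_
    obtain ⟨η, hη, he⟩ := h.pos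
    rw [he]
    simpa using (Real.sqrt_pos.2 hη).ne'
  refine continuousAt_completion (fun j hj => ?_) i
  fin_cases j
  · exact hc.smul hw
  · exact hv
  · exact hv.star
  · exact absurd rfl hj
  · exact hY.star
  · exact hY
  · exact hc.smul hw.star

end SevenDim

namespace SevenDim

open CR

/-! ### The signature of the Hermitian form -/

/-- The differences of opposite coordinates. -/
def oppositeDiff : Cn 7 →ₗ[ℂ] Cn 3 where
  toFun u := ![u 0 - u 6, u 1 - u 5, u 2 - u 4]
  map_add' u v := by ext i; fin_cases i <;> simp <;> ring
  map_smul' c u := by ext i; fin_cases i <;> simp <;> ring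

/-- On the four-dimensional space of vectors invariant under reversal of coordinates, h is the
standard positive definite Hermitian form. -/
theorem eq_zero_of_hform_nonpos {u : Cn 7} (h : oppositeDiff u = 0) {r : ℝ} (hr : r ≤ 0)
    (hu : hform u u = r) : u = 0 := by
  have h0 : u 0 - u 6 = 0 := congrFun h 0
  have h1 : u 1 - u 5 = 0 := congrFun h 1
  have h2 : u 2 - u 4 = 0 := congrFun h 2
  have hrev : ∀ i, u (Fin.rev i) = u i := by
    intro i
    fin_cases i
    · exact (sub_eq_zero.1 h0).symm
    · exact (sub_eq_zero.1 h1).symm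
    · exact (sub_eq_zero.1 h2).symm
    · rfl
    · exact (sub_eq_zero.1 h2)
    · exact (sub_eq_zero.1 h1)
    · exact (sub_eq_zero.1 h0)
  have hsum : ((∑ i, Complex.normSq (u i) : ℝ) : ℂ) = r := by
    rw [← hu, hform, bform, Complex.ofReal_sum]
    refine Finset.sum_congr rfl fun i _ => ?_
    rw [Pi.star_apply, hrev, ← Complex.mul_conj]
    rfl
  have hsum' : ∑ i, Complex.normSq (u i) = r := by exact_mod_cast hsum
  have hnn : ∀ i ∈ Finset.univ, 0 ≤ Complex.normSq (u i) := fun i _ => Complex.normSq_nonneg _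
  have hz := (Finset.sum_eq_zero_iff_of_nonneg hnn).1
    (le_antisymm (hsum'.le.trans hr) (Finset.sum_nonneg hnn))
  ext i
  exact Complex.normSq_eq_zero.1 (hz i (Finset.mem_univ i))

/-- If η were negative, h would be nonpositive on the combinations of v, w and their conjugates.
Four parameters against the three equations of `oppositeDiff` leave a nontrivial combination in the
positive definite space, so this combination is zero; pairing it with itself kills the coefficients
of w and its conjugate, and independence kills the other two. -/
theorem hform_pos {v w : Cn 7} (bvv : bform v v = 0) (bvw : bform v w = 0) (bww : bform w w = 0)
    (hvv : bform v (star v) = 0) (hvw : bform v (star w) = 0) {η : ℝ} (hη : hform w w = η)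
    (h0 : η ≠ 0) (hind : ∀ a b : ℂ, a • v + b • star v = 0 → a = 0 ∧ b = 0) : 0 < η := by
  by_contra hneg
  have hneg' : η ≤ 0 := not_lt.1 hneg
  have hwv : bform w (star v) = 0 := by rw [bform_star_right, bform_comm, hvw, star_zero]
  have hww : bform w (star w) = η := hη
  have bwv := (bform_comm w v).trans bvw
  let Φ := oppositeDiff ∘ₗ Fintype.linearCombination ℂ ![v, star v, w, star w]
  have hker : LinearMap.ker Φ ≠ ⊥ := LinearMap.ker_ne_bot_of_finrank_lt (by simp)
  obtain ⟨c, hc, hc0⟩ := Submodule.exists_mem_ne_zero_of_ne_bot hker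
  set u : Cn 7 := c 0 • v + c 1 • star v + c 2 • w + c 3 • star w with hu
  have hcu : Fintype.linearCombination ℂ ![v, star v, w, star w] c = u := by
    rw [Fintype.linearCombination_apply, Fin.sum_univ_four, hu]
    rfl
  have hΦ : oppositeDiff u = 0 := by
    rw [← hcu]; exact hc
  have huu : hform u u = ((η * (Complex.normSq (c 2) + Complex.normSq (c 3)) : ℝ) : ℂ) := by
    rw [hform, hu]
    simp only [star_add, star_smul, star_star, bform_add_left, bform_add_right, bform_smul_left,
      bform_smul_right, bform_star_left, bvv, bvw, bww, hvv, hvw, hwv, bwv, hww]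
    push_cast
    rw [Complex.normSq_eq_conj_mul_self, Complex.normSq_eq_conj_mul_self]
    simp
    ring
  have hu0 : u = 0 := eq_zero_of_hform_nonpos hΦ
    (mul_nonpos_of_nonpos_of_nonneg hneg' (add_nonneg (Complex.normSq_nonneg _)
      (Complex.normSq_nonneg _))) huu
  rw [hu0] at huu
  have hz : η * (Complex.normSq (c 2) + Complex.normSq (c 3)) = 0 := by
    have : hform 0 0 = 0 := bform_zero_left _
    rw [this] at huu
    exact_mod_cast huu.symm
  have hz' := (mul_eq_zero.1 hz).resolve_left h0
  have n2 := Complex.normSq_nonneg (c 2)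
  have n3 := Complex.normSq_nonneg (c 3)
  have c2 : c 2 = 0 := Complex.normSq_eq_zero.1 (by linarith)
  have c3 : c 3 = 0 := Complex.normSq_eq_zero.1 (by linarith)
  rw [hu, c2, c3, zero_smul, zero_smul, add_zero, add_zero] at hu0
  obtain ⟨c0, c1⟩ := hind _ _ hu0
  apply hc0
  ext i
  fin_cases i
  · exact c0
  · exact c1
  · exact c2
  · exact c3

/-! ### Local sections -/

/-- Supplies the auxiliary vector of a seed: with these values the determinant in `IsSeed` is 1 at
the base point and remains nonzero nearby while y is kept fixed. -/
theorem exists_bform_eq_one {v : Cn 7} (hind : ∀ a b : ℂ, a • v + b • star v = 0 → a = 0 ∧ b = 0) :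
    ∃ y, bform y v = 1 ∧ bform y (star v) = 0 := by
  have hnot : v ∉ Submodule.span ℂ {star v} := by
    intro h
    obtain ⟨a, ha⟩ := Submodule.mem_span_singleton.1 h
    have := (hind (-1) a (by rw [ha]; simp)).1
    norm_num at this
  obtain ⟨u, hu, hne⟩ := AdaptedCoframe.exists_dotProduct_of_notMem hnot
  have hb : ∀ w, bform (fun i => u (Fin.rev i)) w = w ⬝ᵥ u := by
    intro w
    rw [bform_comm]
    simp [bform, dotProduct]
  refine ⟨(v ⬝ᵥ u)⁻¹ • fun i => u (Fin.rev i), ?_, ?_⟩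
  · rw [bform_smul_left, hb, inv_mul_cancel₀ hne]
  · rw [bform_smul_left, hb, hu _ (Submodule.mem_span_singleton_self _), mul_zero]

/-- Near a degenerate plane without real vectors, the degenerate planes have adapted bases that
depend continuously on the plane. -/
theorem exists_local_section {z : IsoGrass} (hz : z ∈ degeneratePlanes) (hr : ¬ HasRealVector z) :
    ∃ (g : SO7C) (p : Cn 7), g • param p = z ∧ ∃ F : Cn 7 → Fin 7 → Cn 7,
      (∀ i, ContinuousAt (fun x => F x i) p) ∧ ∀ᶠ x in 𝓝 p, g • param x ∈ degeneratePlanes →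
        IsAdaptedBasis (F x) ∧ F x 0 ∈ (g • param x).plane ∧ F x 1 ∈ (g • param x).plane := by
  obtain ⟨g, hg⟩ := exists_mem_chart_source z
  obtain ⟨p, rfl⟩ := mem_chartHomeo_source.1 hg
  refine ⟨g, p, rfl, ?_⟩
  obtain ⟨P, W, dP, dW, h, hf, hgr, s, hs⟩ := exists_regularAt hz hr
  set v : Cn 7 → Cn 7 := fun x => g.val.val.mulVec (kerV g P W x) with hv
  set w : Cn 7 → Cn 7 := fun x => g.val.val.mulVec (W x) with hw
  have hvc : Continuous v :=
    (PlaneFrame.contDiff_mulVec _ (PlaneFrame.contDiff_kerV h.contP h.contW)).continuous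
  have hwc : Continuous w := (PlaneFrame.contDiff_mulVec _ h.contW).continuous
  have hb : ∀ a b, bform (g.val.val.mulVec a) (g.val.val.mulVec b) = bform a b := g.2.1
  have hWmem : ∀ x, W x ∈ (param x).plane := fun x => by
    rw [(hf x).1]; exact Submodule.subset_span (by simp)
  have bvv : ∀ x, bform (v x) (v x) = 0 := fun x => by rw [hv, hb, h.bkerV_kerV]
  have bvw : ∀ x, bform (v x) (w x) = 0 := fun x => by rw [hv, hw, hb, h.bkerV_W]
  have bww : ∀ x, bform (w x) (w x) = 0 := fun x => by rw [hw, hb, h.bWW]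
  have hvv : ∀ x, gram g P W x = 0 → bform (v x) (star (v x)) = 0 := fun x hx => by
    rw [hv, ← mulVec_cj, hb, bform_comm]
    exact PlaneFrame.bkerC_kerV hx
  have hvw : ∀ x, bform (v x) (star (w x)) = 0 := fun x => by
    rw [hv, hw, ← mulVec_cj, hb, PlaneFrame.bkerV_cW]
  have hww : ∀ x, hform (w x) (w x) = ((hform (w x) (w x)).re : ℂ) := by
    intro x
    refine (Complex.conj_eq_iff_re.1 ?_).symm
    change star (bform _ _) = bform _ _
    rw [← bform_star, star_star, bform_comm]
  have hwp : hform (w p) (w p) ≠ 0 := by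
    rw [hw]
    change hform (g.val.val.mulVec _) (g.val.val.mulVec _) ≠ 0
    rw [hform_mulVec]
    exact hs.herm_ne
  -- The absence of real vectors enters here: a conjugate proportional to the kernel vector would
  -- lie in the plane.
  have hind : ∀ a b : ℂ, a • v p + b • star (v p) = 0 → a = 0 ∧ b = 0 := by
    intro a b hab
    have hv0 : v p ≠ 0 := fun h0 => kerV_ne_zero hf hs.herm_ne
      (mulVecLin_injective g (h0.trans (map_zero (Matrix.mulVecLin g.val.val)).symm))
    have hb0 : b = 0 := by
      by_contra hb0
      refine hr (hasRealVector_of_star_mem (mem_smul_param_plane.2 (kerV_mem (g := g) hf p)) ?_ hv0)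
      have : star (v p) = (-(b⁻¹ * a)) • v p := by
        have h1 : b⁻¹ • (a • v p + b • star (v p)) = 0 := by rw [hab, smul_zero]
        rw [smul_add, smul_smul, smul_smul, inv_mul_cancel₀ hb0, one_smul] at h1
        rw [neg_smul]
        exact eq_neg_of_add_eq_zero_right h1
      change star (v p) ∈ _
      rw [this]
      exact Submodule.smul_mem _ _ (mem_smul_param_plane.2 (kerV_mem hf p))
    rw [hb0, zero_smul, add_zero] at hab
    exact ⟨(smul_eq_zero.1 hab).resolve_right hv0, hb0⟩
  obtain ⟨y, hy1, hy2⟩ := exists_bform_eq_one hind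
  have hpos : 0 < (hform (w p) (w p)).re := hform_pos (bvv p) (bvw p) (bww p) (hvv p hs.gram_eq)
    (hvw p) (hww p) (fun h0 => hwp (by rw [hww, h0]; simp)) hind
  have hηc : ContinuousAt (fun x => (hform (w x) (w x)).re) p :=
    Complex.continuous_re.continuousAt.comp' (hwc.continuousAt.bform hwc.continuousAt.star)
  have h1 := (continuousAt_const (y := y)).bform hvc.continuousAt (p := p)
  have h2 := (continuousAt_const (y := y)).bform hvc.continuousAt.star (p := p)
  have hΔ := (h1.mul h1.star).sub (h2.mul h2.star)
  have hΔp : bform y (v p) * star (bform y (v p)) -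
      bform y (star (v p)) * star (bform y (star (v p))) ≠ 0 := by
    rw [hy1, hy2]; simp
  -- The two strict conditions of a seed are open; of the equations, only the nullity of v for h
  -- needs the plane to be degenerate.
  have hseed : ∀ᶠ x in 𝓝 p, g • param x ∈ degeneratePlanes → IsSeed (v x) (w x) y := by
    filter_upwards [hηc.eventually (lt_mem_nhds hpos), hΔ.eventually_ne hΔp] with x hx1 hx2 hx3
    rw [mem_degeneratePlanes, ← hgr] at hx3
    exact ⟨bvv x, bvw x, bww x, hvv x hx3, hvw x, ⟨_, hx1, hww x⟩, hx2⟩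
  refine ⟨fun x => completion (seedBasis (v x) (w x) y), fun i =>
    continuousAt_completion_seedBasis hvc.continuousAt hwc.continuousAt
      (hseed.self_of_nhds hz) i, ?_⟩
  filter_upwards [hseed] with x hx hE
  refine ⟨(hx hE).isAdaptedBasis, ?_, ?_⟩
  · rw [completion_of_ne _ (by decide)]
    exact Submodule.smul_mem _ _ (mem_smul_param_plane.2 (hWmem x))
  · rw [completion_of_ne _ (by decide)]
    exact mem_smul_param_plane.2 (kerV_mem hf x)

/-- A degenerate plane without real vectors has an adapted basis. -/
theorem exists_isAdaptedBasis {z : IsoGrass} (hz : z ∈ degeneratePlanes) (hr : ¬ HasRealVector z) :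
    ∃ f, ∃ h : IsAdaptedBasis f, z = h.toSO • param 0 := by
  obtain ⟨g, p, rfl, F, -, hF⟩ := exists_local_section hz hr
  obtain ⟨h, h0, h1⟩ := hF.self_of_nhds hz
  exact ⟨F p, h, h.eq_toSO_smul h0 h1⟩

/-! ### Invariance under `SO(3, 4)` -/

theorem smul_mem_degeneratePlanes {k : SO7C} (hk : k ∈ SO34) {z : IsoGrass}
    (hz : z ∈ degeneratePlanes) : k • z ∈ degeneratePlanes := by
  obtain ⟨v, hv, h0, h⟩ := hz
  refine ⟨k.val.val.mulVec v, ⟨v, hv, rfl⟩, fun h1 => h0 (mulVecLin_injective k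
    (h1.trans (map_zero (Matrix.mulVecLin k.val.val)).symm)), ?_⟩
  rintro _ ⟨w, hw, rfl⟩
  change bform _ (star (k.val.val.mulVec w)) = 0
  rw [star_mulVec_of_mem_SO34 hk, k.2.1]
  exact h w hw

theorem HasRealVector.smul {k : SO7C} (hk : k ∈ SO34) {z : IsoGrass} (hz : HasRealVector z) :
    HasRealVector (k • z) := by
  obtain ⟨v, hv, h0, h⟩ := hz
  refine ⟨k.val.val.mulVec v, ⟨v, hv, rfl⟩, fun h1 => h0 (mulVecLin_injective k
    (h1.trans (map_zero (Matrix.mulVecLin k.val.val)).symm)), ?_⟩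
  rw [star_mulVec_of_mem_SO34 hk, h]

theorem hasRealVector_smul_iff {k : SO7C} (hk : k ∈ SO34) {z : IsoGrass} :
    HasRealVector (k • z) ↔ HasRealVector z :=
  ⟨fun h => by simpa using h.smul (SO34.inv_mem hk), fun h => h.smul hk⟩

/-- `SO(3, 4)` acts transitively on the degenerate planes without real vectors. -/
theorem exists_SO34_smul_eq {z z' : IsoGrass} (hz : z ∈ degeneratePlanes) (hr : ¬ HasRealVector z)
    (hz' : z' ∈ degeneratePlanes) (hr' : ¬ HasRealVector z') : ∃ k ∈ SO34, k • z = z' := by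
  obtain ⟨f, h, rfl⟩ := exists_isAdaptedBasis hz hr
  obtain ⟨f', h', rfl⟩ := exists_isAdaptedBasis hz' hr'
  exact ⟨_, h.toSO_mul_inv_mem h', by rw [mul_smul, inv_smul_smul]⟩

end SevenDim

namespace SevenDim

open CR

/-! ## The identity component of `SO(3, 4)` -/

theorem transpose_mul_bmatrix_mul (g : SO7C) :
    g.val.val.transpose * bmatrix * g.val.val = bmatrix := by
  ext i j
  have h := mul_bmatrix_mul_transpose g.val.val.transpose i j
  rw [Matrix.transpose_transpose] at h
  rw [h]
  have hcol : ∀ i, g.val.val.transpose i = g.val.val.mulVec (Pi.single i 1) := by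
    intro i
    ext k
    simp
  rw [hcol, hcol, g.2.1, bform, Finset.sum_eq_single i]
  · simp [bmatrix, Pi.single_apply, eq_comm]
  · intro k _ hk
    simp [hk]
  · simp

/-- The denominator of the Cayley path. -/
def cayleyDen (A : Matrix (Fin 7) (Fin 7) ℂ) (t : ℝ) : Matrix (Fin 7) (Fin 7) ℂ :=
  (1 - t : ℂ) • A + (1 + t : ℂ) • 1

/-- The numerator of the Cayley path. -/
def cayleyNum (A : Matrix (Fin 7) (Fin 7) ℂ) (t : ℝ) : Matrix (Fin 7) (Fin 7) ℂ :=
  (1 + t : ℂ) • A + (1 - t : ℂ) • 1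

/-- The path from 1 to g is the quotient of `cayleyNum` by `cayleyDen`. Invariance of b under g
turns the numerator into the transpose of the denominator, up to factors of equal determinant, so
the quotient has determinant 1. -/
theorem det_cayleyNum (g : SO7C) (t : ℝ) :
    (cayleyNum g.val.val t).det = (cayleyDen g.val.val t).det := by
  have h : bmatrix * cayleyNum g.val.val t =
      (cayleyDen g.val.val t).transpose * bmatrix * g.val.val := by
    rw [cayleyNum, cayleyDen, Matrix.transpose_add, Matrix.transpose_smul, Matrix.transpose_smul,
      Matrix.transpose_one, add_mul, add_mul, Matrix.smul_mul, Matrix.smul_mul, Matrix.smul_mul,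
      Matrix.smul_mul, transpose_mul_bmatrix_mul, mul_add, Matrix.mul_smul, Matrix.mul_smul, mul_one,
      one_mul, add_comm]
  have h2 := congrArg Matrix.det h
  rw [Matrix.det_mul, Matrix.det_mul, Matrix.det_mul, Matrix.det_transpose, g.2.2, mul_one,
    mul_comm] at h2
  exact mul_right_cancel₀ det_bmatrix_ne_zero h2

theorem bform_cayley (g : SO7C) (t : ℝ) (v w : Cn 7) :
    bform ((cayleyNum g.val.val t).mulVec v) ((cayleyNum g.val.val t).mulVec w) =
      bform ((cayleyDen g.val.val t).mulVec v) ((cayleyDen g.val.val t).mulVec w) := by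
  simp only [cayleyNum, cayleyDen, Matrix.add_mulVec, Matrix.smul_mulVec, Matrix.one_mulVec,
    bform_add_left, bform_add_right, bform_smul_left, bform_smul_right, g.2.1]
  ring

theorem map_cayleyNum {g : SO7C} (hg : g ∈ SO34) (t : ℝ) :
    (cayleyNum g.val.val t).map (starRingEnd ℂ) = cayleyNum g.val.val t := by
  ext i j
  have h : starRingEnd ℂ (g.val.val i j) = g.val.val i j := congrFun (congrFun (mem_SO34.1 hg) i) j
  simp only [cayleyNum, Matrix.map_apply, Matrix.add_apply, Matrix.smul_apply, Matrix.one_apply,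
    smul_eq_mul, map_add, map_mul, h]
  split_ifs <;> simp

theorem map_cayleyDen {g : SO7C} (hg : g ∈ SO34) (t : ℝ) :
    (cayleyDen g.val.val t).map (starRingEnd ℂ) = cayleyDen g.val.val t := by
  ext i j
  have h : starRingEnd ℂ (g.val.val i j) = g.val.val i j := congrFun (congrFun (mem_SO34.1 hg) i) j
  simp only [cayleyDen, Matrix.map_apply, Matrix.add_apply, Matrix.smul_apply, Matrix.one_apply,
    smul_eq_mul, map_add, map_mul, h]
  split_ifs <;> simp

/-- A point of the Cayley path from `1` to `g`. -/
def cayley (g : SO34) (t : ℝ) (ht : (cayleyDen g.val.val.val t).det ≠ 0) : SO34 :=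
  ⟨⟨Matrix.GeneralLinearGroup.mkOfDetNeZero
      (cayleyNum g.val.val.val t * (cayleyDen g.val.val.val t)⁻¹) (by
        rw [Matrix.det_mul, Matrix.det_nonsing_inv, det_cayleyNum,
          Ring.mul_inverse_cancel _ (isUnit_iff_ne_zero.2 ht)]
        exact one_ne_zero), by
    refine ⟨fun v w => ?_, ?_⟩
    · change bform ((cayleyNum g.val.val.val t * (cayleyDen g.val.val.val t)⁻¹).mulVec v)
        ((cayleyNum g.val.val.val t * (cayleyDen g.val.val.val t)⁻¹).mulVec w) = _
      rw [← Matrix.mulVec_mulVec, ← Matrix.mulVec_mulVec, bform_cayley, Matrix.mulVec_mulVec,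
        Matrix.mulVec_mulVec, Matrix.mul_nonsing_inv _ (isUnit_iff_ne_zero.2 ht),
        Matrix.one_mulVec, Matrix.one_mulVec]
    · change (cayleyNum g.val.val.val t * (cayleyDen g.val.val.val t)⁻¹).det = 1
      rw [Matrix.det_mul, Matrix.det_nonsing_inv, det_cayleyNum,
        Ring.mul_inverse_cancel _ (isUnit_iff_ne_zero.2 ht)]⟩, by
    change (cayleyNum g.val.val.val t * (cayleyDen g.val.val.val t)⁻¹).map (starRingEnd ℂ) =
      cayleyNum g.val.val.val t * (cayleyDen g.val.val.val t)⁻¹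
    have hu : IsUnit (cayleyDen g.val.val.val t).det := isUnit_iff_ne_zero.2 ht
    have h1 : ((cayleyDen g.val.val.val t)⁻¹).map (starRingEnd ℂ) = (cayleyDen g.val.val.val t)⁻¹ := by
      have h2 := congrArg (fun M => M.map (starRingEnd ℂ)) (Matrix.nonsing_inv_mul _ hu)
      simp only [Matrix.map_mul, map_cayleyDen g.2] at h2
      rw [Matrix.map_one _ (map_zero _) (map_one _)] at h2
      exact (Matrix.inv_eq_left_inv h2).symm
    rw [Matrix.map_mul, map_cayleyNum g.2, h1]⟩

theorem continuous_SO34_of_val {X : Type*} [TopologicalSpace X] {γ : X → SO34}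
    (h : Continuous fun x => (γ x).val.val.val) : Continuous γ := by
  refine Continuous.subtype_mk (Continuous.subtype_mk ?_ _) _
  refine Units.continuous_iff.2 ⟨h, ?_⟩
  have : (fun x => (((γ x).val.val)⁻¹).val) = fun x => ((γ x).val.val.val).adjugate := by
    funext x
    rw [Matrix.coe_units_inv, Matrix.inv_def, (γ x).val.2.2, Ring.inverse_one, one_smul]
  rw [this]
  exact h.matrix_adjugate

theorem continuous_cayleyNum (A : Matrix (Fin 7) (Fin 7) ℂ) : Continuous (cayleyNum A) := by
  unfold cayleyNum
  fun_prop

theorem continuous_cayleyDen :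
    Continuous fun q : Matrix (Fin 7) (Fin 7) ℂ × ℝ => cayleyDen q.1 q.2 := by
  unfold cayleyDen
  fun_prop

/-- The identity component of `SO(3, 4)` is a neighbourhood of `1`. -/
theorem eventually_mem_SO34o : ∀ᶠ A in 𝓝 (1 : Matrix (Fin 7) (Fin 7) ℂ),
    ∀ k : SO7C, k ∈ SO34 → k.val.val = A → k ∈ SO34o := by
  -- At A = 1 the denominator is twice the identity for every t, and compactness of the parameter
  -- interval makes its invertibility uniform near 1.
  have h1 : ∀ᶠ A in 𝓝 (1 : Matrix (Fin 7) (Fin 7) ℂ), ∀ t ∈ Icc (0 : ℝ) 1,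
      (cayleyDen A t).det ≠ 0 := by
    refine isCompact_Icc.eventually_forall_of_forall_eventually fun t _ => ?_
    have hc : Continuous fun q : Matrix (Fin 7) (Fin 7) ℂ × ℝ => (cayleyDen q.1 q.2).det :=
      continuous_cayleyDen.matrix_det
    refine hc.continuousAt.eventually_ne ?_
    have : cayleyDen 1 t = (2 : ℂ) • 1 := by
      rw [cayleyDen, ← add_smul]; congr 1; ring
    change (cayleyDen 1 t).det ≠ 0
    rw [this, Matrix.det_smul]
    simp
  filter_upwards [h1] with A hA k hk hkA
  subst hkA
  let γ : Icc (0 : ℝ) 1 → SO34 := fun t => cayley ⟨k, hk⟩ t.1 (hA t.1 t.2)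
  have hγ : Continuous γ := by
    refine continuous_SO34_of_val ?_
    have hD : Continuous fun t : Icc (0 : ℝ) 1 => cayleyDen k.val.val t.1 :=
      continuous_cayleyDen.comp (continuous_const.prodMk continuous_subtype_val)
    have hN : Continuous fun t : Icc (0 : ℝ) 1 => cayleyNum k.val.val t.1 :=
      (continuous_cayleyNum _).comp continuous_subtype_val
    have hI : Continuous fun t : Icc (0 : ℝ) 1 => (cayleyDen k.val.val t.1)⁻¹ := by
      simp only [Matrix.inv_def, Ring.inverse_eq_inv']
      exact (hD.matrix_det.inv₀ fun t => hA t.1 t.2).smul hD.matrix_adjugate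
    exact hN.matrix_mul hI
  have h0 : γ ⟨0, by simp⟩ = 1 := by
    apply Subtype.ext
    apply Subtype.ext
    apply Units.ext
    change cayleyNum k.val.val 0 * (cayleyDen k.val.val 0)⁻¹ = 1
    have : cayleyNum k.val.val 0 = cayleyDen k.val.val 0 := by simp [cayleyNum, cayleyDen]
    rw [this, Matrix.mul_nonsing_inv _ (isUnit_iff_ne_zero.2 (hA 0 (by simp)))]
  have h2 : γ ⟨1, by simp⟩ = ⟨k, hk⟩ := by
    apply Subtype.ext
    apply Subtype.ext
    apply Units.ext
    change cayleyNum k.val.val 1 * (cayleyDen k.val.val 1)⁻¹ = k.val.val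
    have e1 : cayleyNum k.val.val 1 = k.val.val * cayleyDen k.val.val 1 := by
      simp [cayleyNum, cayleyDen]
    rw [e1, mul_assoc, Matrix.mul_nonsing_inv _ (isUnit_iff_ne_zero.2 (hA 1 (by simp))), mul_one]
  have hpre : IsPreconnected (range γ) := isPreconnected_range hγ
  have hmem : (⟨k, hk⟩ : SO34) ∈ connectedComponent (1 : SO34) :=
    hpre.subset_connectedComponent ⟨_, h0⟩ ⟨_, h2⟩
  exact ⟨⟨k, hk⟩, hmem, rfl⟩

theorem SO34o_le : SO34o ≤ SO34 := by
  rintro _ ⟨k, -, rfl⟩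
  exact k.2

/-- Near a degenerate plane without real vectors, the degenerate planes lie in its orbit. -/
theorem exists_isOpen_subset_orbit {z : IsoGrass} (hz : z ∈ degeneratePlanes)
    (hr : ¬ HasRealVector z) : ∃ V : Set IsoGrass, IsOpen V ∧ z ∈ V ∧
      V ∩ degeneratePlanes ⊆ MulAction.orbit SO34o z := by
  obtain ⟨g, p, rfl, F, hc, hF⟩ := exists_local_section hz hr
  obtain ⟨h, h0, h1⟩ := hF.self_of_nhds hz
  -- The matrix that carries the basis at p to the basis at x; it is 1 at x = p, so for x near p it
  -- falls into the neighbourhood of 1 contained in the identity component.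
  have hcont : ContinuousAt (fun x => (Matrix.of (F x)).transpose * (h.toSO⁻¹).val.val) p := by
    have hm : ContinuousAt (fun x => (Matrix.of (F x)).transpose) p :=
      continuousAt_pi.2 fun i => continuousAt_pi.2 fun j => continuousAt_pi.1 (hc j) i
    exact (continuous_id.matrix_mul continuous_const).continuousAt.comp' hm
  have hone : (Matrix.of (F p)).transpose * (h.toSO⁻¹).val.val = 1 := by
    change h.toSO.val.val * (h.toSO⁻¹).val.val = 1
    simp
  have hev := hcont.eventually (hone ▸ eventually_mem_SO34o)
  obtain ⟨U, hU, hUo, hpU⟩ := eventually_nhds_iff.1 (hF.and hev)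
  refine ⟨_, isOpen_image_smul_param g hUo, ⟨p, hpU, rfl⟩, ?_⟩
  rintro _ ⟨⟨x, hx, rfl⟩, hxH⟩
  obtain ⟨hx1, hx2⟩ := hU x hx
  obtain ⟨h', h0', h1'⟩ := hx1 hxH
  have hk := hx2 (h'.toSO * h.toSO⁻¹) (h.toSO_mul_inv_mem h') rfl
  refine ⟨⟨_, hk⟩, ?_⟩
  change (h'.toSO * h.toSO⁻¹) • g • param p = g • param x
  rw [h.eq_toSO_smul h0 h1, mul_smul, inv_smul_smul, ← h'.eq_toSO_smul h0' h1']

end SevenDim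

namespace SevenDim

open CR

/-! ## Planes with real vectors are singular -/

/-- Every isotropic plane lies in a chart given by a real matrix. -/
theorem exists_real_chart (E : IsoGrass) : ∃ k ∈ SO34, ∃ x, k • param x = E := by
  obtain ⟨u, hu, v, hv, i, j, hi, hj, hij, hji, hne⟩ := exists_minor E
  obtain ⟨hπ, h0, h1⟩ := permFor_spec i j hi hj hij hji
  obtain ⟨g, c, hc, hg⟩ := exists_SO7C_perm _ hπ
  -- Evaluating the invariance of b on the constant vector 1 gives 7c² = 7, so c = ±1 and the chart
  -- matrix is real.
  have hcc : c * c = 1 := by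
    have h := g.2.1 1 1
    simp only [bform, hg, Pi.one_apply, mul_one, Finset.sum_const, Finset.card_univ,
      Fintype.card_fin, nsmul_eq_mul] at h
    have h7 : ((7 : ℕ) : ℂ) ≠ 0 := by norm_num
    exact mul_left_cancel₀ h7 (h.trans (mul_one _).symm)
  have hcs : star c = c := by
    rcases mul_self_eq_one_iff.1 hcc with h | h <;> simp [h]
  have hgr : g ∈ SO34 := by
    rw [mem_SO34]
    ext a b
    have e : g.val.val a b = g.val.val.mulVec (Pi.single b 1) a := by simp
    rw [Matrix.map_apply, e, hg]
    rw [map_mul, show starRingEnd ℂ c = c from hcs, Pi.single_apply]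
    split_ifs <;> simp
  set D := u i * v j - u j * v i with hD
  have hgu : g.val.val.mulVec u ∈ (g • E).plane := ⟨u, hu, rfl⟩
  have hgv : g.val.val.mulVec v ∈ (g • E).plane := ⟨v, hv, rfl⟩
  have hcD : c * D ≠ 0 := mul_ne_zero hc hne
  have key : g • E = param (readCoord
      ((c * D)⁻¹ • (v j • g.val.val.mulVec u - u j • g.val.val.mulVec v))
      ((c * D)⁻¹ • (u i • g.val.val.mulVec v - v i • g.val.val.mulVec u))) := by
    apply eq_param
    · exact Submodule.smul_mem _ _ (Submodule.sub_mem _ (Submodule.smul_mem _ _ hgu)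
        (Submodule.smul_mem _ _ hgv))
    · exact Submodule.smul_mem _ _ (Submodule.sub_mem _ (Submodule.smul_mem _ _ hgv)
        (Submodule.smul_mem _ _ hgu))
    all_goals simp only [Pi.smul_apply, Pi.sub_apply, smul_eq_mul, hg, h0, h1]
    · rw [inv_mul_eq_one₀ hcD, hD]; ring
    · ring
    · ring
    · rw [inv_mul_eq_one₀ hcD, hD]; ring
  exact ⟨g⁻¹, SO34.inv_mem hgr, _, by rw [← key, inv_smul_smul]⟩

theorem cj_of_mem_SO34 {k : SO7C} (hk : k ∈ SO34) (v : Cn 7) : cj k v = star v := by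
  rw [cj, star_mulVec_of_mem_SO34 hk, inv_mulVec_mulVec]

/-- The polar form of the quadratic form `2 a₀ a₂ + a₁²` on `ℝ³`. -/
def real3 (a b : Fin 3 → ℝ) : ℝ := a 0 * b 2 + a 1 * b 1 + a 2 * b 0

/-- The Gram determinant of two vectors of `ℝ³`. -/
def discr3 (a b : Fin 3 → ℝ) : ℝ := real3 a a * real3 b b - real3 a b ^ 2

/-- The imaginary parts of the first three coordinates. -/
def imA (y : Cn 7) : Fin 3 → ℝ := ![(y 0).im, (y 1).im, (y 2).im]

/-- The imaginary parts of the second three coordinates. -/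
def imB (y : Cn 7) : Fin 3 → ℝ := ![(y 3).im, (y 4).im, (y 5).im]

/-- Half the imaginary part of `h` on the normalized basis. -/
def twist (y : Cn 7) : ℝ := (y 6).im + (y 0).im * (y 5).re + (y 1).im * (y 4).re + (y 2).im * (y 3).re

theorem hermF_AA {k : SO7C} (hk : k ∈ SO34) (y : Cn 7) :
    hermF k vecA vecA y = ((2 * real3 (imA y) (imA y) : ℝ) : ℂ) := by
  rw [hermF, cj_of_mem_SO34 hk, bform_apply]
  apply Complex.ext <;> simp [vecA, real3, imA, pow_two] <;> ring

theorem hermF_BB {k : SO7C} (hk : k ∈ SO34) (y : Cn 7) :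
    hermF k vecB vecB y = ((2 * real3 (imB y) (imB y) : ℝ) : ℂ) := by
  rw [hermF, cj_of_mem_SO34 hk, bform_apply]
  apply Complex.ext <;> simp [vecB, real3, imB, pow_two] <;> ring

theorem hermF_AB {k : SO7C} (hk : k ∈ SO34) (y : Cn 7) :
    hermF k vecA vecB y = ⟨2 * real3 (imA y) (imB y), 2 * twist y⟩ := by
  rw [hermF, cj_of_mem_SO34 hk, bform_apply]
  apply Complex.ext <;> simp [vecA, vecB, real3, imA, imB, twist, pow_two] <;> ring

/-- In a real chart the entries of the Gram matrix of h depend on the real parts of the coordinates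
only through `twist`, and its determinant is four times the difference of the two sides. -/
theorem mem_degeneratePlanes_real {k : SO7C} (hk : k ∈ SO34) (y : Cn 7) :
    k • param y ∈ degeneratePlanes ↔ discr3 (imA y) (imB y) = twist y ^ 2 := by
  rw [mem_degeneratePlanes, gram, ← star_hermF k vecA vecB, hermF_AA hk, hermF_BB hk, hermF_AB hk]
  have h1 : ((2 * real3 (imA y) (imA y) : ℝ) : ℂ) * ((2 * real3 (imB y) (imB y) : ℝ) : ℂ) -
      (⟨2 * real3 (imA y) (imB y), 2 * twist y⟩ : ℂ) *
        star (⟨2 * real3 (imA y) (imB y), 2 * twist y⟩ : ℂ) =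
      ((4 * (discr3 (imA y) (imB y) - twist y ^ 2) : ℝ) : ℂ) := by
    apply Complex.ext <;> simp [discr3, pow_two] <;> ring
  rw [h1, Complex.ofReal_eq_zero]
  constructor <;> intro h <;> linarith

/-- The first two entries of a vector of the plane are its coefficients, so a real vector has real
coefficients. The imaginary parts of its other entries then give the linear relation and the
vanishing of `twist`. -/
theorem dependent_of_hasRealVector {k : SO7C} (hk : k ∈ SO34) {x : Cn 7}
    (h : HasRealVector (k • param x)) :
    ((∃ c : ℝ, imA x = c • imB x) ∨ ∃ c : ℝ, imB x = c • imA x) ∧ twist x = 0 := by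
  rw [hasRealVector_smul_iff hk] at h
  obtain ⟨v, hv, h0, hs⟩ := h
  obtain ⟨s, t, rfl⟩ := mem_param.1 hv
  have him : ∀ i, ((s • vecA x + t • vecB x) i).im = 0 := fun i =>
    Complex.conj_eq_iff_im.1 (congrFun hs i)
  have hs0 : s.im = 0 := by simpa [vecA, vecB] using him 0
  have ht0 : t.im = 0 := by simpa [vecA, vecB] using him 1
  have h2 := him 2
  have h3 := him 3
  have h4 := him 4
  have h5 := him 5
  have h6 := him 6
  simp [vecA, vecB, hs0, ht0, pow_two] at h2 h3 h4 h5 h6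
  by_cases hsr : s.re = 0
  · have htr : t.re ≠ 0 := by
      intro htr
      apply h0
      rw [show s = 0 from Complex.ext hsr hs0, show t = 0 from Complex.ext htr ht0]
      simp
    simp only [hsr, zero_mul, zero_add, mul_eq_zero, htr, false_or] at h2 h3 h4 h5 h6
    refine ⟨Or.inr ⟨0, ?_⟩, ?_⟩
    · ext i; fin_cases i <;> simp [imB, h2, h3, h4]
    · rw [h2, h3, h4] at h6
      rw [twist]
      refine mul_left_cancel₀ htr ?_
      linear_combination -t.re * h6
  · refine ⟨Or.inl ⟨-(t.re / s.re), ?_⟩, ?_⟩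
    · ext i
      fin_cases i <;> simp [imA, imB] <;> field_simp
      · linear_combination h2
      · linear_combination h3
      · linear_combination h4
    · rw [twist]
      refine mul_left_cancel₀ hsr ?_
      linear_combination h5 + (x 5).re * h2 + (x 4).re * h3 + (x 3).re * h4

theorem exists_null {a : Fin 3 → ℝ} (ha : a ≠ 0) : ∃ c, real3 c c = 0 ∧ real3 a c ≠ 0 := by
  by_contra! H
  apply ha
  have e0 := H ![1, 0, 0] (by simp [real3])
  have e1 := H ![0, 0, 1] (by simp [real3])
  have e2 := H ![1, 2, -2] (by simp [real3]; norm_num)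
  simp [real3] at e0 e1 e2
  ext i
  fin_cases i
  · exact e1
  · simp; linarith
  · exact e0

/-- The Gram determinant takes negative values near a pair of dependent vectors. -/
theorem exists_discr3_neg {α β : Fin 3 → ℝ} (h : (∃ c : ℝ, α = c • β) ∨ ∃ c : ℝ, β = c • α) :
    ∃ a b, ∀ s : ℝ, 0 < s → discr3 (α + s • a) (β + s • b) < 0 := by
  by_cases hα : α = 0
  · by_cases hβ : β = 0
    -- A hyperbolic pair, for which the Gram determinant is -s⁴. In the other cases one vector is
    -- moved along a null vector that pairs nontrivially with the other, and the determinant is a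
    -- negative multiple of s².
    · refine ⟨![1, 0, 0], ![0, 0, 1], fun s hs => ?_⟩
      rw [hα, hβ]
      simp [discr3, real3]
      positivity
    · obtain ⟨c, h1, h2⟩ := exists_null hβ
      refine ⟨c, 0, fun s hs => ?_⟩
      have e : discr3 (α + s • c) (β + s • 0) = s ^ 2 * (real3 c c * real3 β β - real3 β c ^ 2) := by
        rw [hα]; simp [discr3, real3]; ring
      rw [e, h1]
      have : 0 < s ^ 2 * real3 β c ^ 2 := by positivity
      linarith
  · obtain ⟨κ, rfl⟩ : ∃ κ : ℝ, β = κ • α := by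
      rcases h with ⟨c, hc⟩ | h
      · have hc0 : c ≠ 0 := by rintro rfl; exact hα (by rw [hc, zero_smul])
        exact ⟨c⁻¹, by rw [hc, smul_smul, inv_mul_cancel₀ hc0, one_smul]⟩
      · exact h
    obtain ⟨c, h1, h2⟩ := exists_null hα
    refine ⟨0, c, fun s hs => ?_⟩
    have e : discr3 (α + s • 0) (κ • α + s • c) =
        s ^ 2 * (real3 c c * real3 α α - real3 α c ^ 2) := by
      simp [discr3, real3]; ring
    rw [e, h1]
    have : 0 < s ^ 2 * real3 α c ^ 2 := by positivity
    linarith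

/-- The Gram determinant vanishes to second order at a pair of dependent vectors. -/
theorem exists_discr3_le {α β : Fin 3 → ℝ} (h : (∃ c : ℝ, α = c • β) ∨ ∃ c : ℝ, β = c • α)
    (a b : Fin 3 → ℝ) : ∃ K : ℝ, 0 < K ∧ ∀ τ : ℝ, |τ| ≤ 1 →
      discr3 (α + τ • a) (β + τ • b) ≤ K * τ ^ 2 := by
  obtain ⟨c₂, c₃, c₄, hc⟩ : ∃ c₂ c₃ c₄ : ℝ, ∀ τ : ℝ,
      discr3 (α + τ • a) (β + τ • b) = τ ^ 2 * (c₂ + τ * c₃ + τ ^ 2 * c₄) := by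
    refine ⟨real3 α α * real3 b b + 4 * (real3 α a * real3 β b) + real3 a a * real3 β β -
      (real3 a β + real3 α b) ^ 2 - 2 * (real3 α β * real3 a b), 2 * (real3 α a * real3 b b) +
      2 * (real3 a a * real3 β b) - 2 * ((real3 a β + real3 α b) * real3 a b),
      real3 a a * real3 b b - real3 a b ^ 2, fun τ => ?_⟩
    rcases h with ⟨c, rfl⟩ | ⟨c, rfl⟩ <;> simp [discr3, real3] <;> ring
  refine ⟨|c₂| + |c₃| + |c₄| + 1, by positivity, fun τ hτ => ?_⟩
  rw [hc, mul_comm]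
  refine mul_le_mul_of_nonneg_right ?_ (sq_nonneg τ)
  have h1 : τ * c₃ ≤ |c₃| := by
    calc τ * c₃ ≤ |τ * c₃| := le_abs_self _
      _ = |τ| * |c₃| := abs_mul _ _
      _ ≤ 1 * |c₃| := mul_le_mul_of_nonneg_right hτ (abs_nonneg _)
      _ = |c₃| := one_mul _
  have h2 : τ ^ 2 * c₄ ≤ |c₄| := by
    have hτ2 : τ ^ 2 ≤ 1 := by rw [← sq_abs]; exact pow_le_one₀ (abs_nonneg _) hτ
    calc τ ^ 2 * c₄ ≤ τ ^ 2 * |c₄| := mul_le_mul_of_nonneg_left (le_abs_self _) (sq_nonneg _)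
      _ ≤ 1 * |c₄| := mul_le_mul_of_nonneg_right hτ2 (abs_nonneg _)
      _ = |c₄| := one_mul _
  have := le_abs_self c₂
  linarith

theorem _root_.CR.IsDefiningFunction.exists_mem {n : ℕ} {S : Set (Cn n)} {p : Cn n} {ρ : Cn n → ℝ}
    (h : IsDefiningFunction S p ρ) {ξ e : Cn n} (hξ : fderiv ℝ ρ p ξ = 0)
    (he : fderiv ℝ ρ p e ≠ 0) {ε : ℝ} (hε : 0 < ε) :
    ∃ s τ : ℝ, 0 < s ∧ s ≤ 1 ∧ |τ| ≤ ε * s ∧ p + s • ξ + τ • e ∈ S := by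
  have h1 := eventually_exists_zero h.analyticAt h.zero hξ he hε
  obtain ⟨δ, hδ, hball⟩ := Metric.eventually_nhds_iff_ball.1 h.mem_iff
  have hR : 0 < ‖ξ‖ + ε * ‖e‖ + 1 := by positivity
  have h2 : ∀ᶠ s : ℝ in 𝓝[>] 0, s < min 1 (δ / (‖ξ‖ + ε * ‖e‖ + 1)) :=
    mem_nhdsWithin_of_mem_nhds (gt_mem_nhds (by positivity))
  obtain ⟨s, ⟨⟨τ, hτ, hz⟩, hs2⟩, hs⟩ := ((h1.and h2).and self_mem_nhdsWithin).exists
  have hs0 : 0 < s := hs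
  have hs3 : s * (‖ξ‖ + ε * ‖e‖ + 1) < δ := by
    rw [← lt_div_iff₀ hR]; exact hs2.trans_le (min_le_right _ _)
  refine ⟨s, τ, hs0, (hs2.trans_le (min_le_left _ _)).le, hτ, ((hball _ ?_).2 hz)⟩
  rw [mem_ball_iff_norm, add_assoc, add_sub_cancel_left]
  calc ‖s • ξ + τ • e‖ ≤ ‖s • ξ‖ + ‖τ • e‖ := norm_add_le _ _
    _ = s * ‖ξ‖ + |τ| * ‖e‖ := by
      rw [norm_smul, norm_smul, Real.norm_eq_abs, Real.norm_eq_abs, abs_of_pos hs0]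
    _ ≤ s * ‖ξ‖ + ε * s * ‖e‖ := by gcongr
    _ < δ := by nlinarith

/-- The test direction ξ changes only `twist`. If it were tangent, the hypersurface would contain
points with `twist` of order s but a Gram determinant at most a small multiple of s². If it were
transversal, the hypersurface would have points over every direction complementary to ξ, including
one in which the Gram determinant is negative and cannot equal a square. -/
theorem not_hasRealVector_of_mem_smoothPart {z : IsoGrass}
    (hz : z ∈ smoothPart 7 degeneratePlanes) : ¬ HasRealVector z := by
  intro hr
  obtain ⟨k, hk, p, rfl⟩ := exists_real_chart z
  obtain ⟨ρ, hρ⟩ := hz.2 (chartHomeo k) (mem_atlas_iff.2 ⟨k, rfl⟩) (mem_chartHomeo_source.2 ⟨p, rfl⟩)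
  rw [chartHomeo_apply] at hρ
  obtain ⟨hdep, htw⟩ := dependent_of_hasRealVector hk hr
  have hmem : ∀ {y}, y ∈ coordImage (chartHomeo k) degeneratePlanes →
      discr3 (imA y) (imB y) = twist y ^ 2 := fun hy =>
    (mem_degeneratePlanes_real hk _).1 (mem_coordImage.1 hy)
  set ξ : Cn 7 := Pi.single 6 Complex.I with hξ
  by_cases h6 : fderiv ℝ ρ p ξ = 0
  · obtain ⟨e, he⟩ : ∃ e, fderiv ℝ ρ p e ≠ 0 := by
      by_contra! H
      exact hρ.fderiv_ne_zero (by ext v; exact H v)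
    obtain ⟨K, hK, hKb⟩ := exists_discr3_le hdep (imA e) (imB e)
    obtain ⟨t₁, t₂, ht⟩ : ∃ t₁ t₂ : ℝ, ∀ s τ : ℝ,
        twist (p + s • ξ + τ • e) = s + τ * t₁ + τ ^ 2 * t₂ := by
      refine ⟨(e 6).im + (e 0).im * (p 5).re + (p 0).im * (e 5).re + (e 1).im * (p 4).re +
        (p 1).im * (e 4).re + (e 2).im * (p 3).re + (p 2).im * (e 3).re,
        (e 0).im * (e 5).re + (e 1).im * (e 4).re + (e 2).im * (e 3).re, fun s τ => ?_⟩
      rw [twist] at htw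
      simp [twist, hξ]
      linear_combination htw
    set T := |t₁| + |t₂| + 1 with hT
    have hTpos : 0 < T := by positivity
    -- Chosen so that the corrections to `twist` stay below s/2 and K·τ² stays below s²/4, which
    -- contradicts the equation of the hypersurface.
    set ε := min 1 (min (1 / (2 * T)) (1 / (4 * (K + 1)))) with hε
    have hεpos : 0 < ε := by positivity
    have hε1 : ε ≤ 1 := min_le_left _ _
    have hε2 : ε * T ≤ 1 / 2 := by
      have : ε ≤ 1 / (2 * T) := (min_le_right _ _).trans (min_le_left _ _)
      rw [le_div_iff₀ (by positivity)] at this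
      linarith
    have hε3 : ε * (K + 1) ≤ 1 / 4 := by
      have : ε ≤ 1 / (4 * (K + 1)) := (min_le_right _ _).trans (min_le_right _ _)
      rw [le_div_iff₀ (by positivity)] at this
      linarith
    obtain ⟨s, τ, hs, hs1, hτ, hy⟩ := hρ.exists_mem h6 he hεpos
    have hτ1 : |τ| ≤ 1 := hτ.trans (by nlinarith)
    have hA : imA (p + s • ξ + τ • e) = imA p + τ • imA e := by
      ext i; fin_cases i <;> simp [imA, hξ]
    have hB : imB (p + s • ξ + τ • e) = imB p + τ • imB e := by
      ext i; fin_cases i <;> simp [imB, hξ]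
    have h1 := hmem hy
    rw [hA, hB, ht] at h1
    have h2 := hKb τ hτ1
    have hτs : τ ^ 2 ≤ ε ^ 2 * s ^ 2 := by
      rw [← sq_abs, ← mul_pow]
      exact pow_le_pow_left₀ (abs_nonneg _) hτ 2
    have h3 : |τ * t₁ + τ ^ 2 * t₂| ≤ s / 2 := by
      calc |τ * t₁ + τ ^ 2 * t₂| ≤ |τ * t₁| + |τ ^ 2 * t₂| := abs_add_le _ _
        _ = |τ| * |t₁| + |τ| * (|τ| * |t₂|) := by rw [abs_mul, abs_mul, abs_pow]; ring
        _ ≤ |τ| * |t₁| + |τ| * (1 * |t₂|) := by gcongr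
        _ ≤ |τ| * T := by rw [hT]; nlinarith [abs_nonneg τ]
        _ ≤ ε * s * T := by gcongr
        _ ≤ s / 2 := by nlinarith
    have h4 : s / 2 ≤ s + τ * t₁ + τ ^ 2 * t₂ := by
      have := (abs_le.1 h3).1
      linarith
    have h5 : (s / 2) ^ 2 ≤ (s + τ * t₁ + τ ^ 2 * t₂) ^ 2 := pow_le_pow_left₀ (by positivity) h4 2
    have h7 : K * τ ^ 2 ≤ K * (ε ^ 2 * s ^ 2) := mul_le_mul_of_nonneg_left hτs hK.le
    have h8 : K * ε ^ 2 < 1 / 4 := by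
      have : K * ε ^ 2 = (ε * K) * ε := by ring
      nlinarith
    have h9 : K * (ε ^ 2 * s ^ 2) < 1 / 4 * s ^ 2 := by
      rw [← mul_assoc]
      exact mul_lt_mul_of_pos_right h8 (by positivity)
    nlinarith
  · obtain ⟨a, b, hab⟩ := exists_discr3_neg hdep
    obtain ⟨ζ, hζA, hζB⟩ : ∃ ζ : Cn 7, imA ζ = a ∧ imB ζ = b := by
      refine ⟨![a 0 * Complex.I, a 1 * Complex.I, a 2 * Complex.I, b 0 * Complex.I,
        b 1 * Complex.I, b 2 * Complex.I, 0], ?_, ?_⟩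
      · ext i; fin_cases i <;> simp [imA]
      · ext i; fin_cases i <;> simp [imB]
    -- Subtracting this multiple of ξ makes ζ tangent without affecting the two 3-vectors; the
    -- transversal correction along ξ does not affect them either.
    set c := fderiv ℝ ρ p ζ / fderiv ℝ ρ p ξ with hc
    have h0 : fderiv ℝ ρ p (ζ - c • ξ) = 0 := by
      rw [map_sub, map_smul, hc, smul_eq_mul, div_mul_cancel₀ _ h6, sub_self]
    obtain ⟨s, τ, hs, -, -, hy⟩ := hρ.exists_mem h0 h6 one_pos
    have hA : imA (p + s • (ζ - c • ξ) + τ • ξ) = imA p + s • a := by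
      rw [← hζA]
      ext i; fin_cases i <;> simp [imA, hξ]
    have hB : imB (p + s • (ζ - c • ξ) + τ • ξ) = imB p + s • b := by
      rw [← hζB]
      ext i; fin_cases i <;> simp [imB, hξ]
    have h1 := hmem hy
    rw [hA, hB] at h1
    exact absurd (hab s hs) (not_lt.2 (h1 ▸ sq_nonneg _))

/-- The smooth part of the hypersurface of degenerate planes. -/
theorem mem_smoothPart_iff {z : IsoGrass} :
    z ∈ smoothPart 7 degeneratePlanes ↔ z ∈ degeneratePlanes ∧ ¬ HasRealVector z := by
  refine ⟨fun h => ⟨h.1, not_hasRealVector_of_mem_smoothPart h⟩, fun ⟨h, hr⟩ => ⟨h, ?_⟩⟩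
  intro e he hze
  obtain ⟨g, rfl⟩ := mem_atlas_iff.1 he
  obtain ⟨x, rfl⟩ := mem_chartHomeo_source.1 hze
  rw [chartHomeo_apply]
  obtain ⟨U, ρ, a, hxU, hU⟩ := exists_adaptedCoframe (M := coordImage (chartHomeo g) degeneratePlanes)
    h hr (Eventually.of_forall fun y => mem_coordImage)
  exact ⟨ρ, hU.defining x ⟨mem_coordImage.2 h, hxU⟩⟩

theorem smoothPart_nonempty : (smoothPart 7 degeneratePlanes).Nonempty := by
  -- Here v spans the kernel of h, and w is isotropic with h(w,w) = 8. A real vector in the span has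
  -- its coefficients killed by the pairs (1, i) and (1, 2i) of entries.
  set v : Cn 7 := ![1, Complex.I, 0, 0, 0, 0, 0] with hv
  set w : Cn 7 := ![0, 0, 1, 2 * Complex.I, 2, 0, 0] with hw
  have hli : LinearIndependent ℂ ![v, w] := by
    rw [LinearIndependent.pair_iff]
    intro s t hst
    have h0 := congrFun hst 0
    have h2 := congrFun hst 2
    simp [hv, hw] at h0 h2
    exact ⟨h0, h2⟩
  have hII := Complex.I_mul_I
  let E : IsoGrass := ⟨Submodule.span ℂ {v, w}, finrank_span_pair hli, isotropic_span_pair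
    (by rw [bform_apply]; simp [hv]) (by rw [bform_apply]; simp [hv, hw])
    (by rw [bform_apply]; simp [hv, hw])
    (by rw [bform_apply]; simp [hw]; linear_combination 4 * hII)⟩
  refine ⟨E, mem_smoothPart_iff.2 ⟨⟨v, Submodule.subset_span (by simp), ?_, ?_⟩, ?_⟩⟩
  · intro h
    have := congrFun h 0
    simp [hv] at this
  · intro u hu
    obtain ⟨s, t, rfl⟩ := Submodule.mem_span_pair.1 hu
    rw [hform, bform_apply]
    simp [hv, hw]
  · rintro ⟨u, hu, h0, hs⟩
    obtain ⟨s, t, rfl⟩ := Submodule.mem_span_pair.1 hu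
    apply h0
    have him : ∀ i, ((s • v + t • w) i).im = 0 := fun i => Complex.conj_eq_iff_im.1 (congrFun hs i)
    have e0 := him 0
    have e1 := him 1
    have e2 := him 2
    have e3 := him 3
    simp [hv, hw] at e0 e1 e2 e3
    have s0 : s = 0 := Complex.ext e1 e0
    have t0 : t = 0 := Complex.ext (by simpa using e3) e2
    rw [s0, t0]
    simp

end SevenDim

namespace SevenDim

open CR

/-! ## The orbits -/

theorem smul_mem_smoothPart {k : SO7C} (hk : k ∈ SO34) {z : IsoGrass}
    (hz : z ∈ smoothPart 7 degeneratePlanes) : k • z ∈ smoothPart 7 degeneratePlanes := by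
  rw [mem_smoothPart_iff] at hz ⊢
  exact ⟨smul_mem_degeneratePlanes hk hz.1, fun h => hz.2 ((hasRealVector_smul_iff hk).1 h)⟩

theorem orbit_SO34_eq {z : IsoGrass} (hz : z ∈ smoothPart 7 degeneratePlanes) :
    MulAction.orbit SO34 z = smoothPart 7 degeneratePlanes := by
  ext z'
  constructor
  · rintro ⟨k, rfl⟩
    exact smul_mem_smoothPart k.2 hz
  · intro hz'
    rw [mem_smoothPart_iff] at hz hz'
    obtain ⟨k, hk, h⟩ := exists_SO34_smul_eq hz.1 hz.2 hz'.1 hz'.2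
    exact ⟨⟨k, hk⟩, h⟩

theorem orbit_SO34o_subset {z : IsoGrass} (hz : z ∈ smoothPart 7 degeneratePlanes) :
    MulAction.orbit SO34o z ⊆ smoothPart 7 degeneratePlanes := by
  rintro _ ⟨k, rfl⟩
  exact smul_mem_smoothPart (SO34o_le k.2) hz

theorem exists_isOpen_orbit_eq {z : IsoGrass} (hz : z ∈ smoothPart 7 degeneratePlanes) :
    ∃ U : Set IsoGrass, IsOpen U ∧ MulAction.orbit SO34o z = U ∩ degeneratePlanes := by
  have h : ∀ z' : MulAction.orbit SO34o z, ∃ V : Set IsoGrass, IsOpen V ∧ z'.1 ∈ V ∧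
      V ∩ degeneratePlanes ⊆ MulAction.orbit SO34o z := by
    rintro ⟨z', hz'⟩
    have h1 := mem_smoothPart_iff.1 (orbit_SO34o_subset hz hz')
    obtain ⟨V, hV, hzV, hsub⟩ := exists_isOpen_subset_orbit h1.1 h1.2
    rw [MulAction.orbit_eq_iff.2 hz'] at hsub
    exact ⟨V, hV, hzV, hsub⟩
  choose V hV hzV hsub using h
  refine ⟨⋃ z', V z', isOpen_iUnion hV, Subset.antisymm (fun z' hz' => ?_) ?_⟩
  · exact ⟨mem_iUnion.2 ⟨⟨z', hz'⟩, hzV _⟩, (orbit_SO34o_subset hz hz').1⟩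
  · rintro z' ⟨h1, h2⟩
    obtain ⟨i, hi⟩ := mem_iUnion.1 h1
    exact hsub i ⟨hi, h2⟩

theorem exists_adaptedCoframe_orbit {z : IsoGrass} (hz : z ∈ smoothPart 7 degeneratePlanes)
    {e : OpenPartialHomeomorph IsoGrass (Cn 7)} (he : e ∈ atlas (Cn 7) IsoGrass) {p : Cn 7}
    (hp : p ∈ coordImage e (MulAction.orbit SO34o z)) :
    ∃ U ρ a, p ∈ coordImage e (MulAction.orbit SO34o z) ∩ U ∧
      AdaptedCoframe (coordImage e (MulAction.orbit SO34o z)) U ρ a PlaneFrame.spanRank := by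
  obtain ⟨g, rfl⟩ := mem_atlas_iff.1 he
  obtain ⟨V, hV, hVeq⟩ := exists_isOpen_orbit_eq hz
  have hp' := mem_coordImage.1 hp
  have h1 := mem_smoothPart_iff.1 (orbit_SO34o_subset hz hp')
  have hpV : g • param p ∈ V := by
    rw [hVeq] at hp'
    exact hp'.1
  obtain ⟨U, ρ, a, hU, h⟩ := exists_adaptedCoframe
    (M := coordImage (chartHomeo g) (MulAction.orbit SO34o z)) h1.1 h1.2 (by
      filter_upwards [(continuous_smul_param g).continuousAt.eventually (hV.mem_nhds hpV)] with y hy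
      rw [mem_coordImage, hVeq]
      exact ⟨fun h => h.2, fun h => ⟨hy, h⟩⟩)
  exact ⟨U, ρ, a, ⟨hp, hU⟩, h⟩

theorem isRealHypersurface_orbit {z : IsoGrass} (hz : z ∈ smoothPart 7 degeneratePlanes) :
    IsRealHypersurface 7 (MulAction.orbit SO34o z) := by
  intro e he p hp
  obtain ⟨U, ρ, a, hpU, h⟩ := exists_adaptedCoframe_orbit hz he hp
  exact ⟨ρ, h.defining p hpU⟩

theorem isUniformlyNondegenerate_orbit {z : IsoGrass} (hz : z ∈ smoothPart 7 degeneratePlanes) :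
    IsUniformlyNondegenerate 7 (MulAction.orbit SO34o z) 3 := by
  intro e he p hp
  obtain ⟨U, ρ, a, hpU, h⟩ := exists_adaptedCoframe_orbit hz he hp
  exact h.isNondegenerateAt hpU rfl (by decide)

theorem leviKernelHasRank_orbit {z : IsoGrass} (hz : z ∈ smoothPart 7 degeneratePlanes) {k m : ℕ}
    (hm : PlaneFrame.spanRank k + m = 7) : LeviKernelHasRank 7 (MulAction.orbit SO34o z) k m := by
  intro e he p hp
  obtain ⟨U, ρ, a, hpU, h⟩ := exists_adaptedCoframe_orbit hz he hp
  exact h.exists_frame hpU hm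

end SevenDim

namespace SevenDim

open CR

/-! ## The Lie algebra in an adapted basis -/

theorem mem_so7_iff {M : Matrix (Fin 7) (Fin 7) ℂ} :
    M ∈ so7 ↔ ∀ i j, M i j = -M (Fin.rev j) (Fin.rev i) := by
  rw [mem_skewAdjointMatricesLieSubalgebra, mem_skewAdjointMatricesSubmodule]
  change M.transpose * bmatrix = bmatrix * -M ↔ _
  have h1 : ∀ i j, (M.transpose * bmatrix) i j = M (Fin.rev j) i := by
    intro i j
    rw [Matrix.mul_apply, Finset.sum_eq_single (Fin.rev j)]
    · simp [bmatrix]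
    · intro k _ hk
      rw [bmatrix, Matrix.of_apply, if_neg (by rintro rfl; simp at hk), mul_zero]
    · simp
  have h2 : ∀ i j, (bmatrix * -M) i j = -M (Fin.rev i) j := by
    intro i j
    rw [Matrix.mul_apply, Finset.sum_eq_single (Fin.rev i)]
    · simp [bmatrix]
    · intro k _ hk
      rw [bmatrix, Matrix.of_apply, if_neg hk, zero_mul]
    · simp
  constructor
  · intro h i j
    have := congrFun (congrFun h j) (Fin.rev i)
    rwa [h1, h2, Fin.rev_rev] at this
  · intro h
    ext i j
    rw [h1, h2, h, Fin.rev_rev]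

theorem inv_mul_val (g : SO7C) : (g⁻¹).val.val * g.val.val = 1 := by simp

theorem mul_inv_val (g : SO7C) : g.val.val * (g⁻¹).val.val = 1 := by simp

theorem conjugate_mem_so7 (g : SO7C) (X : so7) :
    g.val.val * X.val * (g⁻¹).val.val ∈ so7 := by
  have hX₀ := X.2
  rw [mem_skewAdjointMatricesLieSubalgebra, mem_skewAdjointMatricesSubmodule] at hX₀ ⊢
  have hX : X.val.transpose * bmatrix = bmatrix * -X.val := hX₀
  change (g.val.val * X.val * (g⁻¹).val.val).transpose * bmatrix =
    bmatrix * -(g.val.val * X.val * (g⁻¹).val.val)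
  have h1 : g.val.val.transpose * bmatrix = bmatrix * (g⁻¹).val.val := by
    conv_rhs => rw [← transpose_mul_bmatrix_mul g, mul_assoc, mul_inv_val, mul_one]
  have h2 : ((g⁻¹).val.val).transpose * bmatrix = bmatrix * g.val.val := by
    conv_rhs => rw [← transpose_mul_bmatrix_mul g⁻¹, mul_assoc, inv_mul_val, mul_one]
  rw [Matrix.transpose_mul, Matrix.transpose_mul, mul_assoc, mul_assoc, h1,
    ← mul_assoc (X.val.transpose), hX, ← mul_assoc, ← mul_assoc, h2]
  simp [mul_assoc]

/-- The matrix of `X ∈ 𝔩` in the basis given by the columns of `g`. -/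
def coord (g : SO7C) : so7 →ₗ[ℂ] Matrix (Fin 7) (Fin 7) ℂ where
  toFun X := (g⁻¹).val.val * X.val * g.val.val
  map_add' X Y := by
    change _ * (X.val + Y.val) * _ = _
    rw [mul_add, add_mul]
  map_smul' c X := by
    change _ * (c • X.val) * _ = _
    rw [Matrix.mul_smul, Matrix.smul_mul]
    rfl

/-- The element of `𝔩` with a given matrix in the basis given by the columns of `g`. -/
def ofCoord (g : SO7C) (X : so7) : so7 := ⟨_, conjugate_mem_so7 g X⟩

section coord

variable (g : SO7C)

theorem coord_ofCoord (X : so7) : coord g (ofCoord g X) = X.val := by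
  change (g⁻¹).val.val * (g.val.val * X.val * (g⁻¹).val.val) * g.val.val = X.val
  rw [mul_assoc, mul_assoc _ (g⁻¹).val.val, inv_mul_val, mul_one, ← mul_assoc, inv_mul_val, one_mul]

theorem mul_coord_mul (X : so7) : g.val.val * coord g X * (g⁻¹).val.val = X.val := by
  change g.val.val * ((g⁻¹).val.val * X.val * g.val.val) * (g⁻¹).val.val = X.val
  rw [mul_assoc, mul_assoc _ g.val.val, mul_inv_val, mul_one, ← mul_assoc, mul_inv_val, one_mul]

theorem coord_injective : Function.Injective (coord g) := by
  intro X Y h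
  apply Subtype.ext
  rw [← mul_coord_mul g X, h, mul_coord_mul]

theorem exists_coord_eq {M : Matrix (Fin 7) (Fin 7) ℂ}
    (hM : ∀ i j, M i j = -M (Fin.rev j) (Fin.rev i)) : ∃ X, coord g X = M :=
  ⟨ofCoord g ⟨M, mem_so7_iff.2 hM⟩, coord_ofCoord g _⟩

theorem coord_skew (X : so7) (i j : Fin 7) :
    coord g X i j = -coord g X (Fin.rev j) (Fin.rev i) := by
  have h := conjugate_mem_so7 g⁻¹ X
  rw [inv_inv] at h
  exact mem_so7_iff.1 h i j

theorem coord_rev (X : so7) (i : Fin 7) : coord g X i (Fin.rev i) = 0 := by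
  have h := coord_skew g X i (Fin.rev i)
  rw [Fin.rev_rev] at h
  exact self_eq_neg.1 h

theorem coord_lie (X Y : so7) :
    coord g ⁅X, Y⁆ = coord g X * coord g Y - coord g Y * coord g X := by
  change (g⁻¹).val.val * (X.val * Y.val - Y.val * X.val) * g.val.val =
    (g⁻¹).val.val * X.val * g.val.val * ((g⁻¹).val.val * Y.val * g.val.val) -
      (g⁻¹).val.val * Y.val * g.val.val * ((g⁻¹).val.val * X.val * g.val.val)
  have h : ∀ A B : Matrix (Fin 7) (Fin 7) ℂ, (g⁻¹).val.val * A * g.val.val *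
      ((g⁻¹).val.val * B * g.val.val) = (g⁻¹).val.val * (A * B) * g.val.val := by
    intro A B
    rw [← mul_assoc, ← mul_assoc, mul_assoc _ g.val.val, mul_inv_val, mul_one]
    simp only [mul_assoc]
  rw [h, h, mul_sub, sub_mul]

/-- The element of `𝔩` with the matrix `E_{pq} - E_{rev q, rev p}`. -/
theorem exists_coord_single (p q : Fin 7) : ∃ X, coord g X =
    Matrix.single p q 1 - Matrix.single (Fin.rev q) (Fin.rev p) 1 := by
  refine exists_coord_eq g fun i j => ?_
  simp only [Matrix.sub_apply, Matrix.single_apply, Fin.rev_inj, neg_sub]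
  congr 1
  · congr 1
    rw [eq_iff_iff, and_comm]
  · congr 1
    rw [eq_iff_iff, and_comm, Fin.rev_eq_iff, Fin.rev_eq_iff]

/-! ### Weights -/

/-- The weights of the basis vectors, in terms of the simple roots. -/
def basisWt : Fin 7 → ℤ × ℤ × ℤ :=
  ![(-1, -1, -1), (0, -1, -1), (0, 0, -1), (0, 0, 0), (0, 0, 1), (0, 1, 1), (1, 1, 1)]

/-- The weight of the matrix entry `(i, j)`. -/
def wt (i j : Fin 7) : ℤ × ℤ × ℤ := basisWt i - basisWt j

theorem wt_rev (i j : Fin 7) : wt (Fin.rev j) (Fin.rev i) = wt i j := by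
  revert i j; decide

/-- The sum of the weight spaces of the weights in a list. -/
def wtSub (S : List (ℤ × ℤ × ℤ)) : Submodule ℂ so7 where
  carrier := {X | ∀ i j, wt i j ∉ S → coord g X i j = 0}
  zero_mem' i j _ := by simp
  add_mem' hX hY i j h := by
    rw [map_add, Matrix.add_apply, hX i j h, hY i j h, add_zero]
  smul_mem' c X hX i j h := by
    rw [map_smul, Matrix.smul_apply, hX i j h, smul_zero]

variable {g}

/-- Skewness makes the antidiagonal entries zero, so their weights, which need not be roots, can be
left out of all finite checks. -/
theorem mem_wtSub' {S : List (ℤ × ℤ × ℤ)} {X : so7} :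
    X ∈ wtSub g S ↔ ∀ i j, j ≠ Fin.rev i → wt i j ∉ S → coord g X i j = 0 := by
  refine ⟨fun h i j _ => h i j, fun h i j hS => ?_⟩
  by_cases hj : j = Fin.rev i
  · rw [hj, coord_rev]
  · exact h i j hj hS

theorem wtSub_le {S T : List (ℤ × ℤ × ℤ)}
    (h : ∀ i j, j ≠ Fin.rev i → wt i j ∈ S → wt i j ∈ T) : wtSub g S ≤ wtSub g T := by
  intro X hX
  rw [mem_wtSub']
  exact fun i j hj hT => hX i j fun hS => hT (h i j hj hS)

theorem wtSub_congr {S T : List (ℤ × ℤ × ℤ)}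
    (h : ∀ i j, j ≠ Fin.rev i → (wt i j ∈ S ↔ wt i j ∈ T)) : wtSub g S = wtSub g T :=
  le_antisymm (wtSub_le fun i j hj => (h i j hj).1) (wtSub_le fun i j hj => (h i j hj).2)

theorem wtSub_sup (S T : List (ℤ × ℤ × ℤ)) : wtSub g S ⊔ wtSub g T = wtSub g (S ++ T) := by
  apply le_antisymm
  · exact sup_le (wtSub_le fun i j _ h => List.mem_append_left _ h)
      (wtSub_le fun i j _ h => List.mem_append_right _ h)
  · intro X hX
    obtain ⟨X₁, h₁⟩ := exists_coord_eq g (M := Matrix.of fun i j =>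
      if wt i j ∈ S then coord g X i j else 0) (by
        intro i j
        simp only [Matrix.of_apply, wt_rev]
        split_ifs
        · exact coord_skew g X i j
        · simp)
    have h₂ : X - X₁ ∈ wtSub g T := by
      intro i j hT
      rw [map_sub, h₁, Matrix.sub_apply, Matrix.of_apply]
      split_ifs with hS
      · exact sub_self _
      · rw [sub_zero]
        exact hX i j (by simp [hS, hT])
    have h₃ : X₁ ∈ wtSub g S := by
      intro i j hS
      rw [h₁, Matrix.of_apply, if_neg hS]
    have : X = X₁ + (X - X₁) := by abel
    rw [this]
    exact Submodule.add_mem_sup h₃ h₂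

theorem wtSub_inf (S T : List (ℤ × ℤ × ℤ)) :
    wtSub g S ⊓ wtSub g T = wtSub g (S.filter (· ∈ T)) := by
  ext X
  rw [Submodule.mem_inf]
  constructor
  · rintro ⟨h1, h2⟩ i j h
    by_cases hS : wt i j ∈ S
    · exact h2 i j fun hT => h (List.mem_filter.2 ⟨hS, by simpa using hT⟩)
    · exact h1 i j hS
  · intro h
    exact ⟨fun i j hS => h i j fun h' => hS (List.mem_filter.1 h').1,
      fun i j hT => h i j fun h' => hT (by simpa using (List.mem_filter.1 h').2)⟩

theorem exists_mem_wtSub {S T : List (ℤ × ℤ × ℤ)} {p q : Fin 7} (hS : wt p q ∈ S)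
    (hT : wt p q ∉ T) (hq : q ≠ Fin.rev p) : ∃ X ∈ wtSub g S, X ∉ wtSub g T := by
  obtain ⟨X, hX⟩ := exists_coord_single g p q
  refine ⟨X, fun i j hij => ?_, fun h => ?_⟩
  · rw [hX, Matrix.sub_apply, Matrix.single_apply, Matrix.single_apply, if_neg, if_neg, sub_zero]
    · rintro ⟨rfl, rfl⟩
      exact hij (by rwa [wt_rev])
    · rintro ⟨rfl, rfl⟩
      exact hij hS
  · have := h p q hT
    rw [hX, Matrix.sub_apply, Matrix.single_apply, Matrix.single_apply, if_pos ⟨rfl, rfl⟩,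
      if_neg, sub_zero] at this
    · exact one_ne_zero this
    · rintro ⟨h1, -⟩
      exact hq (by rw [← h1, Fin.rev_rev])

theorem wtSub_lt {S T : List (ℤ × ℤ × ℤ)}
    (h : ∀ i j, j ≠ Fin.rev i → wt i j ∈ S → wt i j ∈ T) {p q : Fin 7} (hT : wt p q ∈ T)
    (hS : wt p q ∉ S) (hq : q ≠ Fin.rev p) : wtSub g S < wtSub g T := by
  refine lt_of_le_not_ge (wtSub_le h) fun hle => ?_
  obtain ⟨X, h1, h2⟩ := exists_mem_wtSub (g := g) hT hS hq
  exact h2 (hle h1)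

end coord

end SevenDim

namespace SevenDim

open CR

/-! ## The conjugation and the filtration of the isotropy algebra -/

theorem conj7_conj7 (X : so7) : conj7 (conj7 X) = X := by
  apply Subtype.ext
  ext i j
  exact Complex.conj_conj _

/-- The matrix of the complex conjugation of `ℂ⁷` in an adapted basis. -/
def conjMatrix : Matrix (Fin 7) (Fin 7) ℂ :=
  Matrix.of fun i j => if i = conjPerm j then (conjSign j : ℂ) else 0

theorem IsAdaptedBasis.map_conj_toSO {f : Fin 7 → Cn 7} (h : IsAdaptedBasis f) :
    h.toSO.val.val.map (starRingEnd ℂ) = h.toSO.val.val * conjMatrix := by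
  have hc : ∀ i j, h.toSO.val.val i j = f j i := fun i j => rfl
  ext i j
  rw [Matrix.map_apply, hc, Matrix.mul_apply, Finset.sum_eq_single (conjPerm j)]
  · have := congrFun (h.star j) i
    rw [Pi.smul_apply, smul_eq_mul] at this
    rw [hc, conjMatrix, Matrix.of_apply, if_pos rfl, mul_comm, ← this]
    rfl
  · intro k _ hk
    rw [conjMatrix, Matrix.of_apply, if_neg hk, mul_zero]
  · simp

/-- Conjugating the matrix of basis columns multiplies it by the signed permutation `conjMatrix`;
hence σ conjugates the entries and permutes their positions, up to sign. -/
theorem IsAdaptedBasis.coord_conj7 {f : Fin 7 → Cn 7} (h : IsAdaptedBasis f) (X : so7)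
    (i j : Fin 7) : coord h.toSO (conj7 X) (conjPerm i) (conjPerm j) * (conjSign j : ℂ) =
      conjSign i * starRingEnd ℂ (coord h.toSO X i j) := by
  set C := h.toSO with hC
  have hK : C.val.val.map (starRingEnd ℂ) = C.val.val * conjMatrix := h.map_conj_toSO
  have h1 : X.val * C.val.val = C.val.val * coord C X := by
    conv_lhs => rw [← mul_coord_mul C X, mul_assoc, inv_mul_val, mul_one]
  have h2 : (conj7 X).val * C.val.val = C.val.val * coord C (conj7 X) := by
    conv_lhs => rw [← mul_coord_mul C (conj7 X), mul_assoc, inv_mul_val, mul_one]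
  have h3 := congrArg (fun A => Matrix.map A (starRingEnd ℂ)) h1
  simp only [Matrix.map_mul, hK] at h3
  have h4 : (conj7 X).val * (C.val.val * conjMatrix) =
      C.val.val * conjMatrix * (coord C X).map (starRingEnd ℂ) := h3
  rw [← mul_assoc, h2] at h4
  have h5 := congrArg (fun A => (C⁻¹).val.val * A) h4
  simp only [← mul_assoc, inv_mul_val, one_mul] at h5
  have h6 := congrFun (congrFun h5 (conjPerm i)) j
  rw [Matrix.mul_apply, Matrix.mul_apply, Finset.sum_eq_single (conjPerm j),
    Finset.sum_eq_single i] at h6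
  · simpa [conjMatrix] using h6
  · intro k _ hk
    rw [conjMatrix, Matrix.of_apply, if_neg (by simpa using hk.symm), zero_mul]
  · simp
  · intro k _ hk
    rw [conjMatrix, Matrix.of_apply, if_neg hk, mul_zero]
  · simp

/-- The action of the conjugation on weights. -/
def conjWt (r : ℤ × ℤ × ℤ) : ℤ × ℤ × ℤ := (-r.1, -r.1 - r.2.1 + r.2.2, -2 * r.1 + r.2.2)

theorem conjWt_conjWt (r : ℤ × ℤ × ℤ) : conjWt (conjWt r) = r := by
  obtain ⟨a, b, c⟩ := r
  simp only [conjWt, Prod.mk.injEq]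
  refine ⟨by ring, by ring, by ring⟩

theorem wt_conjPerm (i j : Fin 7) : wt (conjPerm i) (conjPerm j) = conjWt (wt i j) := by
  revert i j; decide

theorem IsAdaptedBasis.conj7_mem_wtSub {f : Fin 7 → Cn 7} (h : IsAdaptedBasis f)
    {S : List (ℤ × ℤ × ℤ)} {X : so7} (hX : X ∈ wtSub h.toSO S) :
    conj7 X ∈ wtSub h.toSO (S.map conjWt) := by
  intro a b hab
  rw [← conjPerm_conjPerm a, ← conjPerm_conjPerm b] at hab ⊢
  rw [wt_conjPerm] at hab
  have h0 := hX _ _ fun hS => hab (List.mem_map_of_mem hS)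
  have h1 := h.coord_conj7 X (conjPerm a) (conjPerm b)
  rw [h0, map_zero, mul_zero] at h1
  refine (mul_eq_zero.1 h1).resolve_right ?_
  have h2 := conjSign_mul_self (conjPerm b)
  intro h3
  rw [Int.cast_eq_zero.1 h3] at h2
  simp at h2

theorem IsAdaptedBasis.map_conj7_wtSub {f : Fin 7 → Cn 7} (h : IsAdaptedBasis f)
    (S : List (ℤ × ℤ × ℤ)) :
    (wtSub h.toSO S).map conj7 = wtSub h.toSO (S.map conjWt) := by
  ext X
  constructor
  · rintro ⟨Y, hY, rfl⟩
    exact h.conj7_mem_wtSub hY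
  · intro hX
    refine ⟨conj7 X, ?_, conj7_conj7 X⟩
    have := h.conj7_mem_wtSub hX
    rwa [List.map_map, show conjWt ∘ conjWt = id from funext conjWt_conjWt, List.map_id] at this

/-- The weights of `𝔮 ∩ σ𝔮`. -/
def wts3 : List (ℤ × ℤ × ℤ) :=
  [(0, 0, 0), (1, 0, 0), (-1, -1, -2), (0, 0, -1), (0, -1, -1), (0, -1, -2)]

/-- The weights of the second order kernel. -/
def wts2 : List (ℤ × ℤ × ℤ) := wts3 ++ [(-1, -2, -2)]

/-- The weights of the Levi kernel. -/
def wts1 : List (ℤ × ℤ × ℤ) := wts2 ++ [(0, -1, 0)] ++ [(-1, -1, -1)]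

/-- The weights of the isotropy algebra. -/
def wts0 : List (ℤ × ℤ × ℤ) := wts1 ++ [(-1, 0, 0)] ++ [(-1, -1, 0)] ++ [(0, 0, 1)]

/-- An element stabilizes the span of the first two basis vectors when its entries in the first two
columns below the second row vanish. By skewness the reflected positions vanish too, and off the
antidiagonal these are the positions whose weights are missing from `wts0`. -/
theorem isotropyAlg_smul_param_zero (g : SO7C) : isotropyAlg (g • param 0) = wtSub g wts0 := by
  have hplane : ∀ v, v ∈ (param 0).plane ↔ ∀ i : Fin 7, 2 ≤ i → v i = 0 := by
    intro v
    change v ∈ Submodule.span ℂ {vecA 0, vecB 0} ↔ _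
    rw [vecA_zero, vecB_zero, Submodule.mem_span_pair]
    constructor
    · rintro ⟨a, b, rfl⟩ i hi
      have h0 : i ≠ 0 := by rintro rfl; exact absurd hi (by decide)
      have h1 : i ≠ 1 := by rintro rfl; exact absurd hi (by decide)
      simp [h0, h1]
    · intro hv
      refine ⟨v 0, v 1, ?_⟩
      ext i
      by_cases hi : 2 ≤ i
      · have h0 : i ≠ 0 := by rintro rfl; exact absurd hi (by decide)
        have h1 : i ≠ 1 := by rintro rfl; exact absurd hi (by decide)
        simp [h0, h1, hv i hi]
      · have : i = 0 ∨ i = 1 := by revert i; decide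
        rcases this with rfl | rfl <;> simp
  have hmv : ∀ (X : so7) v, X.val.mulVec (g.val.val.mulVec v) =
      g.val.val.mulVec ((coord g X).mulVec v) := by
    intro X v
    rw [Matrix.mulVec_mulVec, Matrix.mulVec_mulVec]
    conv_lhs => rw [← mul_coord_mul g X, mul_assoc, inv_mul_val, mul_one]
  have hmem : ∀ X, X ∈ isotropyAlg (g • param 0) ↔
      ∀ v ∈ (param 0).plane, (coord g X).mulVec v ∈ (param 0).plane := by
    intro X
    constructor
    · intro h v hv
      rw [← mem_smul_param_plane (g := g), ← hmv]
      exact h _ (mem_smul_param_plane.2 hv)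
    · rintro h _ ⟨v, hv, rfl⟩
      change X.val.mulVec (g.val.val.mulVec v) ∈ _
      rw [hmv]
      exact mem_smul_param_plane.2 (h v hv)
  ext X
  rw [hmem]
  constructor
  · intro h
    have key : ∀ i j : Fin 7, 2 ≤ i → j < 2 → coord g X i j = 0 := by
      intro i j hi hj
      have := (hplane _).1 (h (Pi.single j 1) ((hplane _).2 fun k hk => by
        rw [Pi.single_eq_of_ne (lt_of_lt_of_le hj hk).ne'])) i hi
      simpa using this
    rw [mem_wtSub']
    intro i j hr hij
    have : (2 ≤ i ∧ j < 2) ∨ (2 ≤ Fin.rev j ∧ Fin.rev i < 2) := by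
      revert i j; decide +kernel
    rcases this with ⟨hi, hj⟩ | ⟨hi, hj⟩
    · exact key i j hi hj
    · rw [coord_skew, key _ _ hi hj, neg_zero]
  · intro h v hv
    rw [hplane] at hv ⊢
    intro i hi
    change ∑ j, coord g X i j * v j = 0
    refine Finset.sum_eq_zero fun j _ => ?_
    by_cases hj : 2 ≤ j
    · rw [hv j hj, mul_zero]
    · have h0 : wt i j ∉ wts0 ∨ j = Fin.rev i := by revert i j; decide +kernel
      rcases h0 with h0 | rfl
      · rw [h i j h0, zero_mul]
      · rw [coord_rev, zero_mul]

/-- If `w_{ij}` is non-zero, then the bracket of `w` with `E_{jq} - E_{rev q, rev j}` has a non-zero entry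
`(i, q)`, provided that `(i, j, q)` satisfies this condition; and this bracket is not in `𝔮⁽ᵏ⁾ + σ𝔮`,
whose weights are in `B`. -/
def IsObstruction (T B : List (ℤ × ℤ × ℤ)) (i j q : Fin 7) : Prop :=
  i ≠ j ∧ q ≠ Fin.rev j ∧ q ≠ Fin.rev i ∧ wt j q ∈ T ∧ wt i q ∉ B

instance (T B : List (ℤ × ℤ × ℤ)) (i j q : Fin 7) : Decidable (IsObstruction T B i j q) := by
  unfold IsObstruction; infer_instance

theorem IsObstruction.coord_eq_zero {g : SO7C} {T B : List (ℤ × ℤ × ℤ)} {i j q : Fin 7}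
    (h : IsObstruction T B i j q) {w : so7} (hw : ∀ u ∈ wtSub g T, ⁅w, u⁆ ∈ wtSub g B) :
    coord g w i j = 0 := by
  obtain ⟨hij, hqj, hqi, hT, hB⟩ := h
  obtain ⟨u, hu⟩ := exists_coord_single g j q
  have huT : u ∈ wtSub g T := by
    intro a b hab
    rw [hu, Matrix.sub_apply, Matrix.single_apply, Matrix.single_apply, if_neg, if_neg, sub_zero]
    · rintro ⟨rfl, rfl⟩
      exact hab (by rwa [wt_rev])
    · rintro ⟨rfl, rfl⟩
      exact hab hT
  have h1 := hw u huT i q hB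
  rw [coord_lie, hu, Matrix.sub_apply, mul_sub, sub_mul, Matrix.sub_apply, Matrix.sub_apply,
    Matrix.mul_single_apply_same, Matrix.mul_single_apply_of_ne, Matrix.single_mul_apply_of_ne,
    Matrix.single_mul_apply_of_ne] at h1
  · simpa using h1
  · intro h; exact hqi (by rw [h, Fin.rev_rev])
  · exact hij
  · exact hqj

/-- A bracket of elements with weights in `A` and in `T` may have a summand with the indices
`i, m, l` in its entry `(i, l)`. -/
def MayContribute (A T : List (ℤ × ℤ × ℤ)) (i m l : Fin 7) : Prop :=
  (wt i m ∈ A ∧ wt m l ∈ T) ∨ (wt i m ∈ T ∧ wt m l ∈ A)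

instance (A T : List (ℤ × ℤ × ℤ)) (i m l : Fin 7) : Decidable (MayContribute A T i m l) := by
  unfold MayContribute; infer_instance

/-- One step of the filtration reduces to finite conditions on weights. `hclosed` says that brackets
of weights in A' with weights of σ𝔮 stay in the target sum. `hobs` says that every weight of A
outside A' is detected, at the position or its reflection, by a single bracket with an element of
σ𝔮. -/
theorem crFiltration_succ_eq {g : SO7C} {q : Submodule ℂ so7} {k : ℕ}
    {A A' T : List (ℤ × ℤ × ℤ)} (hA : crFiltration q k = wtSub g A)
    (hT : q.map conj7 = wtSub g T)
    (hle : ∀ i j, j ≠ Fin.rev i → wt i j ∈ A' → wt i j ∈ A)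
    (hclosed : ∀ i l, l ≠ Fin.rev i → wt i l ∉ A ++ T → ∀ m,
      ¬MayContribute A' T i m l)
    (hobs : ∀ i j, j ≠ Fin.rev i → wt i j ∈ A → wt i j ∉ A' →
      ∃ m, IsObstruction T (A ++ T) i j m ∨ IsObstruction T (A ++ T) (Fin.rev j) (Fin.rev i) m) :
    crFiltration q (k + 1) = wtSub g A' := by
  have hmem : ∀ w, w ∈ crFiltration q (k + 1) ↔
      w ∈ wtSub g A ∧ ∀ u ∈ wtSub g T, ⁅w, u⁆ ∈ wtSub g (A ++ T) := by
    intro w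
    change (w ∈ crFiltration q k ∧ ∀ v ∈ q, ⁅w, conj7 v⁆ ∈ crFiltration q k ⊔ q.map conj7) ↔ _
    rw [hA, hT, wtSub_sup, ← hT]
    refine and_congr_right fun _ => ?_
    constructor
    · rintro h _ ⟨v, hv, rfl⟩
      exact h v hv
    · exact fun h v hv => h _ ⟨v, hv, rfl⟩
  ext w
  rw [hmem]
  constructor
  · rintro ⟨hwA, hw⟩
    rw [mem_wtSub']
    intro i j hij hA'
    by_cases h : wt i j ∈ A
    · obtain ⟨m, hm | hm⟩ := hobs i j hij h hA'
      · exact hm.coord_eq_zero hw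
      · rw [coord_skew, hm.coord_eq_zero hw, neg_zero]
    · exact hwA i j h
  · intro hw
    refine ⟨wtSub_le hle hw, fun u hu => ?_⟩
    rw [mem_wtSub']
    intro i l hil hB
    have hz : ∀ {S S' : List (ℤ × ℤ × ℤ)} {x y : so7}, x ∈ wtSub g S → y ∈ wtSub g S' →
        (∀ m, ¬(wt i m ∈ S ∧ wt m l ∈ S')) →
        (coord g x * coord g y) i l = 0 := by
      intro S S' x y hx hy h
      rw [Matrix.mul_apply]
      refine Finset.sum_eq_zero fun m _ => ?_
      by_cases h1 : wt i m ∈ S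
      · by_cases h2 : wt m l ∈ S'
        · exact absurd ⟨h1, h2⟩ (h m)
        · rw [hy m l h2, mul_zero]
      · rw [hx i m h1, zero_mul]
    rw [coord_lie, Matrix.sub_apply, hz hw hu fun m hm => hclosed i l hil hB m (.inl hm),
      hz hu hw fun m hm => hclosed i l hil hB m (.inr hm), sub_zero]

section filtration

variable {f : Fin 7 → Cn 7} (h : IsAdaptedBasis f)

theorem IsAdaptedBasis.crFiltration_one :
    crFiltration (wtSub h.toSO wts0) 1 = wtSub h.toSO wts1 :=
  crFiltration_succ_eq rfl (h.map_conj7_wtSub _) (by decide +kernel) (by decide +kernel)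
    (by decide +kernel)

theorem IsAdaptedBasis.crFiltration_two :
    crFiltration (wtSub h.toSO wts0) 2 = wtSub h.toSO wts2 :=
  crFiltration_succ_eq h.crFiltration_one (h.map_conj7_wtSub _) (by decide +kernel)
    (by decide +kernel) (by decide +kernel)

theorem IsAdaptedBasis.crFiltration_three :
    crFiltration (wtSub h.toSO wts0) 3 = wtSub h.toSO wts3 :=
  crFiltration_succ_eq h.crFiltration_two (h.map_conj7_wtSub _) (by decide +kernel)
    (by decide +kernel) (by decide +kernel)

theorem IsAdaptedBasis.inf_map_conj7 :
    wtSub h.toSO wts0 ⊓ (wtSub h.toSO wts0).map conj7 = wtSub h.toSO wts3 := by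
  rw [h.map_conj7_wtSub, wtSub_inf]
  exact wtSub_congr (by decide +kernel)

end filtration

end SevenDim

namespace SevenDim

open CR

/-! ## The Cartan subalgebra and its root spaces -/

section cartan

variable (g : SO7C)

theorem wt_eq_zero_iff {i j : Fin 7} : wt i j ∈ [((0, 0, 0) : ℤ × ℤ × ℤ)] ↔ i = j := by
  revert i j; decide

variable {g} in
theorem coord_eq_zero_of_ne {d : so7} (hd : d ∈ wtSub g [(0, 0, 0)]) {i j : Fin 7} (h : i ≠ j) :
    coord g d i j = 0 :=
  hd i j fun h' => h (wt_eq_zero_iff.1 h')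

variable {g} in
theorem coord_lie_of_diagonal {d : so7} (hd : d ∈ wtSub g [(0, 0, 0)]) (v : so7) (i j : Fin 7) :
    coord g ⁅d, v⁆ i j = (coord g d i i - coord g d j j) * coord g v i j := by
  rw [coord_lie, Matrix.sub_apply, Matrix.mul_apply, Matrix.mul_apply, Finset.sum_eq_single i,
    Finset.sum_eq_single j]
  · ring
  · intro k _ hk
    rw [coord_eq_zero_of_ne hd hk, mul_zero]
  · simp
  · intro k _ hk
    rw [coord_eq_zero_of_ne hd hk.symm, zero_mul]
  · simp

variable {g} in
theorem lie_eq_zero_of_diagonal {d e : so7} (hd : d ∈ wtSub g [(0, 0, 0)])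
    (he : e ∈ wtSub g [(0, 0, 0)]) : ⁅d, e⁆ = 0 := by
  apply coord_injective g
  ext i j
  rw [coord_lie_of_diagonal hd, map_zero, Matrix.zero_apply]
  by_cases h : i = j
  · rw [h, sub_self, zero_mul]
  · rw [coord_eq_zero_of_ne he h, mul_zero]

/-- The Cartan subalgebra of the matrices that are diagonal in the basis given by the columns
of `g`. -/
def diagonalAlg : LieSubalgebra ℂ so7 :=
  { wtSub g [(0, 0, 0)] with
    lie_mem' := fun {d e} hd he => by
      rw [lie_eq_zero_of_diagonal (g := g) hd he]
      exact (wtSub g [(0, 0, 0)]).zero_mem }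

theorem toSubmodule_diagonalAlg : (diagonalAlg g).toSubmodule = wtSub g [(0, 0, 0)] := rfl

theorem mem_diagonalAlg {d : so7} : d ∈ diagonalAlg g ↔ d ∈ wtSub g [(0, 0, 0)] := Iff.rfl

theorem exists_diagonal {x : Fin 7 → ℂ} (hx : ∀ i, x (Fin.rev i) = -x i) :
    ∃ d : diagonalAlg g, ∀ i, coord g d i i = x i := by
  obtain ⟨d, hd⟩ := exists_coord_eq g (M := Matrix.diagonal x) (by
    intro i j
    by_cases h : i = j
    · rw [h, Matrix.diagonal_apply_eq, Matrix.diagonal_apply_eq, hx, neg_neg]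
    · rw [Matrix.diagonal_apply_ne _ h, Matrix.diagonal_apply_ne, neg_zero]
      exact fun h' => h (Fin.rev_injective h').symm)
  refine ⟨⟨d, fun i j h => ?_⟩, fun i => ?_⟩
  · rw [hd, Matrix.diagonal_apply_ne]
    exact fun h' => h (wt_eq_zero_iff.2 h')
  · rw [hd, Matrix.diagonal_apply_eq]

theorem isCartanSubalgebra_diagonalAlg : (diagonalAlg g).IsCartanSubalgebra where
  nilpotent := by
    have : IsLieAbelian (diagonalAlg g) := ⟨fun d e => Subtype.ext
      (lie_eq_zero_of_diagonal d.2 e.2)⟩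
    infer_instance
  self_normalizing := by
    refine le_antisymm (fun x hx => ?_) (LieSubalgebra.le_normalizer _)
    -- A diagonal element with distinct eigenvalues: an element that normalizes the diagonal algebra
    -- has a diagonal bracket with it, so its off-diagonal entries vanish.
    let r : Fin 7 → ℤ := ![1, 2, 3, 0, -3, -2, -1]
    obtain ⟨d, hd⟩ := exists_diagonal g (x := fun i => (r i : ℂ)) (by
      intro i
      have : ∀ i, r (Fin.rev i) = -r i := by decide
      rw [this, Int.cast_neg])
    have hr : Function.Injective r := by decide
    have h1 : ⁅(d : so7), x⁆ ∈ diagonalAlg g :=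
      (LieSubalgebra.mem_normalizer_iff' _ x).1 hx d d.2
    rw [mem_diagonalAlg]
    intro i j hij
    have hne : i ≠ j := fun h => hij (wt_eq_zero_iff.2 h)
    have h2 := coord_eq_zero_of_ne h1 hne
    rw [coord_lie_of_diagonal d.2, hd, hd] at h2
    refine (mul_eq_zero.1 h2).resolve_left fun h3 => hne (hr ?_)
    exact_mod_cast sub_eq_zero.1 h3

/-- The linear form that maps a diagonal matrix to its `i`-th entry. -/
def diagEntry (i : Fin 7) : Module.Dual ℂ (diagonalAlg g) where
  toFun d := coord g d i i
  map_add' d e := by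
    change coord g ((d : so7) + e) i i = _
    rw [map_add, Matrix.add_apply]
  map_smul' c d := by
    change coord g (c • (d : so7)) i i = _
    rw [map_smul, Matrix.smul_apply]
    rfl

/-- The simple roots. -/
def simpleRoots : Fin 3 → Module.Dual ℂ (diagonalAlg g) :=
  ![diagEntry g 1 - diagEntry g 0, diagEntry g 2 - diagEntry g 1, -diagEntry g 2]

theorem comb_apply {t : LieSubalgebra ℂ so7} (α : Fin 3 → Module.Dual ℂ t) (a b c : ℤ) (d : t) :
    comb α a b c d = a * α 0 d + b * α 1 d + c * α 2 d := by
  simp [comb]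

theorem diagEntry_eq_comb (i : Fin 7) (d : diagonalAlg g) : coord g d i i =
    comb (simpleRoots g) (basisWt i).1 (basisWt i).2.1 (basisWt i).2.2 d := by
  have h0 : simpleRoots g 0 d = coord g d 1 1 - coord g d 0 0 := rfl
  have h1 : simpleRoots g 1 d = coord g d 2 2 - coord g d 1 1 := rfl
  have h2 : simpleRoots g 2 d = -coord g d 2 2 := rfl
  have h3 : coord g d 3 3 = 0 := coord_rev g d 3
  have h4 : coord g d 4 4 = -coord g d 2 2 := coord_skew g d 4 4
  have h5 : coord g d 5 5 = -coord g d 1 1 := coord_skew g d 5 5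
  have h6 : coord g d 6 6 = -coord g d 0 0 := coord_skew g d 6 6
  rw [comb_apply, h0, h1, h2]
  fin_cases i <;> simp [basisWt, h3, h4, h5, h6] <;> ring

theorem coord_sub_coord (i j : Fin 7) (d : diagonalAlg g) : coord g d i i - coord g d j j =
    comb (simpleRoots g) (wt i j).1 (wt i j).2.1 (wt i j).2.2 d := by
  rw [diagEntry_eq_comb, diagEntry_eq_comb, comb_apply, comb_apply, comb_apply, wt]
  simp only [Prod.fst_sub, Prod.snd_sub, Int.cast_sub]
  ring

theorem exists_simpleRoots_eq (x y z : ℂ) : ∃ d : diagonalAlg g,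
    simpleRoots g 0 d = x ∧ simpleRoots g 1 d = y ∧ simpleRoots g 2 d = z := by
  obtain ⟨d, hd⟩ := exists_diagonal g (x := ![-z - y - x, -z - y, -z, 0, z, z + y, z + y + x]) (by
    intro i
    fin_cases i <;> simp [Fin.rev] <;> ring)
  refine ⟨d, ?_, ?_, ?_⟩
  · change coord g d 1 1 - coord g d 0 0 = x
    rw [hd, hd]; simp
  · change coord g d 2 2 - coord g d 1 1 = y
    rw [hd, hd]; simp
  · change -coord g d 2 2 = z
    rw [hd]; simp

theorem linearIndependent_simpleRoots : LinearIndependent ℂ (simpleRoots g) := by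
  rw [Fintype.linearIndependent_iff]
  intro c hc
  have key : ∀ d, c 0 * simpleRoots g 0 d + c 1 * simpleRoots g 1 d + c 2 * simpleRoots g 2 d = 0 := by
    intro d
    have := LinearMap.congr_fun hc d
    simpa [Fin.sum_univ_three] using this
  intro i
  obtain ⟨d, h0, h1, h2⟩ := exists_simpleRoots_eq g (if i = 0 then 1 else 0)
    (if i = 1 then 1 else 0) (if i = 2 then 1 else 0)
  have := key d
  rw [h0, h1, h2] at this
  fin_cases i <;> simpa using this

theorem comb_simpleRoots_injective {r s : ℤ × ℤ × ℤ}
    (h : comb (simpleRoots g) r.1 r.2.1 r.2.2 = comb (simpleRoots g) s.1 s.2.1 s.2.2) : r = s := by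
  have key : ∀ x y z : ℂ, r.1 * x + r.2.1 * y + r.2.2 * z = s.1 * x + s.2.1 * y + s.2.2 * z := by
    intro x y z
    obtain ⟨d, rfl, rfl, rfl⟩ := exists_simpleRoots_eq g x y z
    rw [← comb_apply, ← comb_apply, h]
  have h0 := key 1 0 0
  have h1 := key 0 1 0
  have h2 := key 0 0 1
  simp only [mul_one, mul_zero, add_zero, zero_add, Int.cast_inj] at h0 h1 h2
  exact Prod.ext h0 (Prod.ext h1 h2)

/-- A non-zero matrix entry of a root vector determines the root. -/
theorem eq_comb_wt {β : Module.Dual ℂ (diagonalAlg g)} {v : so7} (hv : v ∈ rootSp (diagonalAlg g) β)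
    {i j : Fin 7} (hij : coord g v i j ≠ 0) :
    β = comb (simpleRoots g) (wt i j).1 (wt i j).2.1 (wt i j).2.2 := by
  ext d
  have h1 := congrArg (fun X => coord g X i j) (hv d)
  simp only [coord_lie_of_diagonal d.2, map_smul, Matrix.smul_apply, smul_eq_mul] at h1
  rw [← coord_sub_coord]
  exact (mul_right_cancel₀ hij h1).symm

theorem rootSp_comb (r : ℤ × ℤ × ℤ) :
    rootSp (diagonalAlg g) (comb (simpleRoots g) r.1 r.2.1 r.2.2) = wtSub g [r] := by
  ext v
  constructor
  · intro hv i j hij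
    by_contra h
    exact hij (by rw [comb_simpleRoots_injective g (eq_comb_wt g hv h)]; simp)
  · intro hv d
    apply coord_injective g
    ext i j
    rw [coord_lie_of_diagonal d.2, coord_sub_coord, map_smul, Matrix.smul_apply, smul_eq_mul]
    by_cases h : wt i j ∈ [r]
    · rw [List.mem_singleton.1 h]
    · rw [hv i j h, mul_zero, mul_zero]

theorem neg_comb {t : LieSubalgebra ℂ so7} (α : Fin 3 → Module.Dual ℂ t) (r : ℤ × ℤ × ℤ) :
    -comb α r.1 r.2.1 r.2.2 = comb α (-r).1 (-r).2.1 (-r).2.2 := by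
  simp only [comb, Prod.fst_neg, Prod.snd_neg, neg_smul]
  abel

theorem mem_posB3_iff {r : ℤ × ℤ × ℤ} : r ∈ posB3 ↔
    r ∈ [(1, 0, 0), (0, 1, 0), (0, 0, 1), (1, 1, 0), (0, 1, 1), (1, 1, 1), (0, 1, 2), (1, 1, 2),
      ((1, 2, 2) : ℤ × ℤ × ℤ)] := by
  simp [posB3]

theorem comb_ne_zero_and_rootSp_ne_bot {r : ℤ × ℤ × ℤ} (h0 : r ≠ 0)
    (h : ∃ i j, j ≠ Fin.rev i ∧ wt i j = r) : comb (simpleRoots g) r.1 r.2.1 r.2.2 ≠ 0 ∧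
      rootSp (diagonalAlg g) (comb (simpleRoots g) r.1 r.2.1 r.2.2) ≠ ⊥ := by
  refine ⟨fun hr => h0 (comb_simpleRoots_injective g ?_), fun hr => ?_⟩
  · rw [hr]
    simp [comb]
  · obtain ⟨i, j, hj, rfl⟩ := h
    rw [rootSp_comb] at hr
    obtain ⟨X, h1, h2⟩ := exists_mem_wtSub (g := g) (S := [wt i j]) (T := []) (by simp) (by simp) hj
    rw [hr, Submodule.mem_bot] at h1
    rw [h1] at h2
    exact h2 (Submodule.zero_mem _)

theorem isCartanWithSimpleRoots_diagonalAlg :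
    IsCartanWithSimpleRoots (diagonalAlg g) (simpleRoots g) where
  cartan := isCartanSubalgebra_diagonalAlg g
  linearIndependent := linearIndependent_simpleRoots g
  roots β := by
    constructor
    · rintro ⟨hβ, hne⟩
      obtain ⟨v, hv, hv0⟩ := Submodule.exists_mem_ne_zero_of_ne_bot hne
      obtain ⟨i, j, hij⟩ : ∃ i j, coord g v i j ≠ 0 := by
        by_contra! h
        refine hv0 (coord_injective g ?_)
        ext i j
        rw [h, map_zero, Matrix.zero_apply]
      have hβ' := eq_comb_wt g hv hij
      have h1 : j ≠ Fin.rev i := fun h => hij (by rw [h, coord_rev])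
      have h2 : i ≠ j := by
        rintro rfl
        apply hβ
        rw [hβ', wt, sub_self]
        simp [comb]
      -- Every position off the diagonal and off the antidiagonal carries a positive or a negative
      -- root of type B₃.
      have h3 : wt i j ∈ posB3 ∨ -wt i j ∈ posB3 := by
        rw [mem_posB3_iff, mem_posB3_iff]
        clear hij hβ'
        revert i j
        decide +kernel
      rcases h3 with h3 | h3
      · exact ⟨_, h3, .inl hβ'⟩
      · refine ⟨_, h3, .inr ?_⟩
        rw [neg_comb, neg_neg, hβ']
    · have key : ∀ r ∈ [(1, 0, 0), (0, 1, 0), (0, 0, 1), (1, 1, 0), (0, 1, 1), (1, 1, 1), (0, 1, 2),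
          (1, 1, 2), ((1, 2, 2) : ℤ × ℤ × ℤ)], (r ≠ 0 ∧ ∃ i j, j ≠ Fin.rev i ∧ wt i j = r) ∧
          (-r ≠ 0 ∧ ∃ i j, j ≠ Fin.rev i ∧ wt i j = -r) := by
        decide +kernel
      rintro ⟨r, hr, rfl | rfl⟩
      · have := (key r (mem_posB3_iff.1 hr)).1
        exact comb_ne_zero_and_rootSp_ne_bot g this.1 this.2
      · have := (key r (mem_posB3_iff.1 hr)).2
        rw [neg_comb]
        exact comb_ne_zero_and_rootSp_ne_bot g this.1 this.2

theorem simpleRoots_eq_comb (k : Fin 3) : simpleRoots g k = comb (simpleRoots g)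
    (if k = 0 then 1 else 0) (if k = 1 then 1 else 0) (if k = 2 then 1 else 0) := by
  fin_cases k <;> simp [comb]

theorem isParabolicOneThree_wtSub :
    IsParabolicOneThree (diagonalAlg g) (simpleRoots g) (wtSub g wts0) where
  cartan_le := by
    rw [toSubmodule_diagonalAlg]
    exact wtSub_le (by decide +kernel)
  neg_le r hr := by
    rw [neg_comb, rootSp_comb]
    refine wtSub_le fun i j _ h => ?_
    rw [List.mem_singleton.1 h]
    rw [mem_posB3_iff] at hr
    have : ∀ r ∈ [(1, 0, 0), (0, 1, 0), (0, 0, 1), (1, 1, 0), (0, 1, 1), (1, 1, 1), (0, 1, 2),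
      (1, 1, 2), ((1, 2, 2) : ℤ × ℤ × ℤ)], -r ∈ wts0 := by decide +kernel
    exact this r hr
  one_le := by
    rw [simpleRoots_eq_comb]
    exact (rootSp_comb g (1, 0, 0)).trans_le (wtSub_le (by decide +kernel))
  three_le := by
    rw [simpleRoots_eq_comb]
    exact (rootSp_comb g (0, 0, 1)).trans_le (wtSub_le (by decide +kernel))
  two_not_le h := by
    rw [simpleRoots_eq_comb] at h
    obtain ⟨X, h1, h2⟩ := exists_mem_wtSub (g := g) (S := [(0, 1, 0)]) (T := wts0) (p := 2) (q := 1)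
      (by decide) (by decide) (by decide)
    exact h2 (h ((rootSp_comb g (0, 1, 0)).ge h1))

end cartan

/-- The structure of the isotropy algebra at a degenerate plane without real vectors. -/
theorem exists_cartan_filtration {z : IsoGrass} (hz : z ∈ smoothPart 7 degeneratePlanes) :
    ∃ (t : LieSubalgebra ℂ so7) (α : Fin 3 → Module.Dual ℂ t),
        IsCartanWithSimpleRoots t α ∧
        (∀ d ∈ t, conj7 d ∈ t) ∧
        (∀ a b c : ℤ, (rootSp t (comb α a b c)).map conj7 =
          rootSp t (comb α (-a) (-a - b + c) (-2 * a + c))) ∧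
        IsParabolicOneThree t α (isotropyAlg z) ∧
        isotropyAlg z ⊓ (isotropyAlg z).map conj7 = crFiltration (isotropyAlg z) 3 ∧
        crFiltration (isotropyAlg z) 3 =
          t.toSubmodule ⊔ rootSp t (comb α 1 0 0) ⊔ rootSp t (comb α (-1) (-1) (-2)) ⊔
            rootSp t (comb α 0 0 (-1)) ⊔ rootSp t (comb α 0 (-1) (-1)) ⊔
            rootSp t (comb α 0 (-1) (-2)) ∧
        crFiltration (isotropyAlg z) 2 =
          crFiltration (isotropyAlg z) 3 ⊔ rootSp t (comb α (-1) (-2) (-2)) ∧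
        crFiltration (isotropyAlg z) 1 =
          crFiltration (isotropyAlg z) 2 ⊔ rootSp t (comb α 0 (-1) 0) ⊔
            rootSp t (comb α (-1) (-1) (-1)) ∧
        isotropyAlg z =
          crFiltration (isotropyAlg z) 1 ⊔ rootSp t (comb α (-1) 0 0) ⊔
            rootSp t (comb α (-1) (-1) 0) ⊔ rootSp t (comb α 0 0 1) ∧
        crFiltration (isotropyAlg z) 3 < crFiltration (isotropyAlg z) 2 ∧
        crFiltration (isotropyAlg z) 2 < crFiltration (isotropyAlg z) 1 ∧
        crFiltration (isotropyAlg z) 1 < isotropyAlg z := by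
  obtain ⟨hd, hr⟩ := mem_smoothPart_iff.1 hz
  obtain ⟨f, h, rfl⟩ := exists_isAdaptedBasis hd hr
  have hroot : ∀ a b c : ℤ, rootSp (diagonalAlg h.toSO) (comb (simpleRoots h.toSO) a b c) =
      wtSub h.toSO [(a, b, c)] := fun a b c => rootSp_comb h.toSO (a, b, c)
  refine ⟨diagonalAlg h.toSO, simpleRoots h.toSO, isCartanWithSimpleRoots_diagonalAlg _, ?_, ?_, ?_⟩
  · exact fun d hd => h.conj7_mem_wtSub hd
  · intro a b c
    rw [hroot, hroot, h.map_conj7_wtSub]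
    rfl
  · rw [isotropyAlg_smul_param_zero, h.inf_map_conj7, h.crFiltration_one, h.crFiltration_two,
      h.crFiltration_three, toSubmodule_diagonalAlg]
    simp only [hroot, wtSub_sup, true_and]
    -- The positions (0,5), (1,2) and (0,1) carry the weights -(1,2,2), -(0,1,0) and -(1,0,0), one
    -- for each space removed by the filtration.
    exact ⟨isParabolicOneThree_wtSub _, rfl, rfl, rfl, rfl,
      wtSub_lt (p := 0) (q := 5) (by decide +kernel) (by decide +kernel) (by decide +kernel)
        (by decide),
      wtSub_lt (p := 1) (q := 2) (by decide +kernel) (by decide +kernel) (by decide +kernel)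
        (by decide),
      wtSub_lt (p := 0) (q := 1) (by decide +kernel) (by decide +kernel) (by decide +kernel)
        (by decide)⟩

end SevenDim

end

/-! ### The theorem -/

open CR SevenDim in
theorem mainTheorem6 :
    -- `Z` is a complex manifold, on which `SO(7, ℂ)` acts holomorphically and transitively
    IsManifold 𝓘(ℂ, Cn 7) ω IsoGrass ∧
    (∀ g : SO7C, ContMDiff 𝓘(ℂ, Cn 7) 𝓘(ℂ, Cn 7) ω (fun z : IsoGrass => g • z)) ∧
    MulAction.IsPretransitive SO7C IsoGrass ∧
    -- the smooth part of the hypersurface of degenerate planes is an orbit of `SO(3, 4)`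
    (smoothPart 7 degeneratePlanes).Nonempty ∧
    (∀ z ∈ smoothPart 7 degeneratePlanes,
      MulAction.orbit SO34 z = smoothPart 7 degeneratePlanes) ∧
    -- the orbits of `SO(3, 4)°` in it
    ∀ z ∈ smoothPart 7 degeneratePlanes,
      MulAction.orbit SO34o z ⊆ smoothPart 7 degeneratePlanes ∧
      (∃ U : Set IsoGrass, IsOpen U ∧ MulAction.orbit SO34o z = U ∩ degeneratePlanes) ∧
      IsRealHypersurface 7 (MulAction.orbit SO34o z) ∧
      IsUniformlyNondegenerate 7 (MulAction.orbit SO34o z) 3 ∧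
      LeviKernelHasRank 7 (MulAction.orbit SO34o z) 0 6 ∧
      LeviKernelHasRank 7 (MulAction.orbit SO34o z) 1 3 ∧
      LeviKernelHasRank 7 (MulAction.orbit SO34o z) 2 1 ∧
      (∀ k, 3 ≤ k → LeviKernelHasRank 7 (MulAction.orbit SO34o z) k 0) ∧
      -- the filtration of the isotropy algebra
      ∃ (t : LieSubalgebra ℂ so7) (α : Fin 3 → Module.Dual ℂ t),
        IsCartanWithSimpleRoots t α ∧
        (∀ d ∈ t, conj7 d ∈ t) ∧
        (∀ a b c : ℤ, (rootSp t (comb α a b c)).map conj7 =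
          rootSp t (comb α (-a) (-a - b + c) (-2 * a + c))) ∧
        IsParabolicOneThree t α (isotropyAlg z) ∧
        isotropyAlg z ⊓ (isotropyAlg z).map conj7 = crFiltration (isotropyAlg z) 3 ∧
        crFiltration (isotropyAlg z) 3 =
          t.toSubmodule ⊔ rootSp t (comb α 1 0 0) ⊔ rootSp t (comb α (-1) (-1) (-2)) ⊔
            rootSp t (comb α 0 0 (-1)) ⊔ rootSp t (comb α 0 (-1) (-1)) ⊔
            rootSp t (comb α 0 (-1) (-2)) ∧
        crFiltration (isotropyAlg z) 2 =
          crFiltration (isotropyAlg z) 3 ⊔ rootSp t (comb α (-1) (-2) (-2)) ∧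
        crFiltration (isotropyAlg z) 1 =
          crFiltration (isotropyAlg z) 2 ⊔ rootSp t (comb α 0 (-1) 0) ⊔
            rootSp t (comb α (-1) (-1) (-1)) ∧
        isotropyAlg z =
          crFiltration (isotropyAlg z) 1 ⊔ rootSp t (comb α (-1) 0 0) ⊔
            rootSp t (comb α (-1) (-1) 0) ⊔ rootSp t (comb α 0 0 1) ∧
        crFiltration (isotropyAlg z) 3 < crFiltration (isotropyAlg z) 2 ∧
        crFiltration (isotropyAlg z) 2 < crFiltration (isotropyAlg z) 1 ∧
        crFiltration (isotropyAlg z) 1 < isotropyAlg z := by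
  refine ⟨isManifold_isoGrass, contMDiff_smul, isPretransitive_isoGrass, smoothPart_nonempty,
    fun z hz => orbit_SO34_eq hz, fun z hz => ⟨orbit_SO34o_subset hz, exists_isOpen_orbit_eq hz,
      isRealHypersurface_orbit hz, isUniformlyNondegenerate_orbit hz,
      leviKernelHasRank_orbit hz rfl, leviKernelHasRank_orbit hz rfl,
      leviKernelHasRank_orbit hz rfl, fun k hk => leviKernelHasRank_orbit hz ?_,
      exists_cartan_filtration hz⟩⟩
  rw [PlaneFrame.spanRank_of_le hk]
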